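/- **Setting.** Let $\hat\Omega\subset\mathbb R^2$ be a bounded polygonal domain and $k,l,m$ integers with $k\ge1$, $1\le l\le m$. Let $F$ be bi-Lipschitz on $\hat\Omega$, $F\in[W^{m+1}_\infty(\hat\Omega)]^2$, with Jacobian $J=\nabla F$, $j=\det J\ge j_0>0$ a.e. and $|J_{cd}|\le\Lambda$ a.e. Let $\hat a,\hat\mu\in L^\infty(\hat\Omega)$, $\hat b\in L^\infty(\hat\Omega)^2$ with $0<a_0\le \hat a\le a_1$, $|\hat b_d|\le b_1$, $0\le\mu_0\le\hat\mu\le\mu_1$ a.e. For an open $E\subseteq\hat\Omega$ put $$\hat{\mathcal A}^E(u,v)=\int_E \hat a\,J^{-T}\nabla u\cdot J^{-T}\nabla v\;j+\tfrac12\int_E\hat b\cdot\big(v\,J^{-T}\nabla u-u\,J^{-T}\nabla v\big)j+\int_E\hat\mu\,u\,v\,j .$$ **Mesh and spaces.** $\mathcal T_h$ is a finite partition of $\hat\Omega$ into simple polygons $E$ (aligned consecutive edges allowed) with diameters $h_E$, $h=\max h_E$. It is $\alpha$-shape regular: each $E$ is a finite union of domains each star-shaped with respect to a ball of radius $>\alpha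 h_E$, and each edge of $E$ is longer than $\alpha h_E$. $\Pi^0_k$ is the $L^2(E)$-projection onto $\mathbb P_k$ and $\Pi^1_{k-1}v=\Pi^0_{k-1}\nabla v$ (elementwise). The degrees of freedom on $E$ are vertex values, edge moments of degree $\le k-2$ and interior moments of degree $\le k-2$. $W_k(E)$ is the set of $v\in H^1(E)\cap C^0(\bar E)$ with $\Delta v\in\mathbb P_k$ and $v|_e\in\mathbb P_k(e)$ on every edge $e$; $\Pi^*_k:W_k(E)\to\mathbb P_k$ is any linear, $L^2$-stable map that reproduces $\mathbb P_k$ and depends only on the degrees of freedom. $V_k(E)$ is the set of $v\in W_k(E)$ with $\int_E(\Pi^*_kv-v)q=0$ for all scaled monomials $q$ (centred at the barycentre) of degree $k-1$ or $k$. Finally $\hat V_h^k=\{v\in H^1(\hat\Omega):v|_E\in V_k(E)\ \forall E\}$ and $\hat V^k_{h,0}=\hat V^k_h\cap H^1_0(\hat\Omega)$. **Mapping accuracy** (constant $C_F$). $F_h\in[\hat V_h^l]^2$ and, for all $E\in\mathcal T_h$ and $s=0,\dots,l$, $$\|F-F_h\|_{0,E}+h_E|F-F_h|_{1,E}\le C_F\,h_E^{s+1}|F|_{s+1,E}.$$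 On each $E$ put $J_h=\Pi^1_{l-1}F_h$ and $j_h=\det J_h$. **Stabilisation** (constants $c_S>0$, $C_S$). For each $E$, $S^E$ is a bilinear form on $V_k(E)$, computable from the degrees of freedom, with $c_S\hat{\mathcal A}^E(v,v)\le S^E(v,v)\le C_S\hat{\mathcal A}^E(v,v)$ for all $v\in V_k(E)$ with $\Pi^0_kv=0$. **Discrete forms.** For $f\in L^2(\hat\Omega)$, $$\hat{\mathcal A}_h(u,v)=\sum_E\Big[\int_E \hat a\,J_h^{-T}\Pi^1_{k-1}u\cdot J_h^{-T}\Pi^1_{k-1}v\;j_h+\tfrac12\int_E\hat b\cdot\big(\Pi^0_kv\,J_h^{-T}\Pi^1_{k-1}u-\Pi^0_ku\,J_h^{-T}\Pi^1_{k-1}v\big)j_h+\int_E\hat\mu\,\Pi^0_ku\,\Pi^0_kv\,j_h+S^E(u-\Pi^0_ku,v-\Pi^0_kv)\Big],$$ $$\hat l_h(v)=\sum_E\int_E f\,\Pi^0_kv\,j_h .$$ **Theorem (Reference IsoVEM well-posedness).** There are constants $M,c>0$, depending only on $\hat\Omega,k,l,m,\alpha,C_F,c_S,C_S,a_0,a_1,b_1,\mu_0,\mu_1,j_0,\Lambda$,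 such that for every $F$ as above there is $h_0>0$ (independent of the coefficients, the mesh, $F_h$, the $\Pi^*$, the $S^E$ and $f$) with the following property. For all coefficients as above, all $\alpha$-shape-regular meshes with $h\le h_0$, all auxiliary projections, all $F_h$ satisfying the accuracy condition and all stabilisations as above: 1. $\hat{\mathcal A}_h$ is continuous on $\hat V^k_{h,0}$ in the $H^1(\hat\Omega)$-norm; if the forms $S^E$ are symmetric, then $|\hat{\mathcal A}_h(u,v)|\le M\|u\|_{1,\hat\Omega}\|v\|_{1,\hat\Omega}$ for all $u,v\in\hat V^k_{h,0}$; 2. $\hat{\mathcal A}_h(v,v)\ge c\|v\|_{1,\hat\Omega}^2$ for all $v\in\hat V^k_{h,0}$; 3. for every $f\in L^2(\hat\Omega)$, $|\hat l_h(v)|\le M\|f\|_{0,\hat\Omega}\|v\|_{1,\hat\Omega}$ for all $v\in\hat V^k_{h,0}$, and there is exactly one $u_h\in\hat V^k_{h,0}$ with $\hat{\mathcal A}_h(u_h,v)=\hat l_h(v)$ for all $v\in\hat V^k_{h,0}$. -/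

import Mathlib

open MeasureTheory Set
open scoped Matrix ContDiff ENNReal

noncomputable section

namespace IsoVEM

/-- The Euclidean plane. -/
abbrev R2 : Type := EuclideanSpace ℝ (Fin 2)

/-! ### Sobolev spaces through weak derivatives -/

/-- Classical partial derivative in the coordinate direction `d`. -/
def pderiv (d : Fin 2) (φ : R2 → ℝ) : R2 → ℝ :=
  fun x => fderiv ℝ φ x (EuclideanSpace.single d 1)

/-- The classical derivative `∂₀^{α.1} ∂₁^{α.2} φ` for a multi-index `α`. -/
def multiDeriv (α : ℕ × ℕ) (φ : R2 → ℝ) : R2 → ℝ :=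
  (pderiv 0)^[α.1] ((pderiv 1)^[α.2] φ)

/-- `φ ∈ C_c^∞(U)`. -/
def IsTestFunction (U : Set R2) (φ : R2 → ℝ) : Prop :=
  ContDiff ℝ ∞ φ ∧ HasCompactSupport φ ∧ tsupport φ ⊆ U

/-- `g` is the weak derivative `D^α f` on the open set `U`. -/
def HasWeakDeriv (U : Set R2) (α : ℕ × ℕ) (f g : R2 → ℝ) : Prop :=
  LocallyIntegrableOn f U ∧ LocallyIntegrableOn g U ∧
    ∀ φ, IsTestFunction U φ →
      ∫ x in U, f x * multiDeriv α φ x = (-1) ^ (α.1 + α.2) * ∫ x in U, g x * φ x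

open Classical in
/-- A representative of the weak derivative `D^α f` on `U` (unique a.e. on `U`), when it exists. -/
def weakDeriv (U : Set R2) (α : ℕ × ℕ) (f : R2 → ℝ) : R2 → ℝ :=
  if h : ∃ g, HasWeakDeriv U α f g then h.choose else 0

/-- Membership in the Sobolev space of functions on `U` all of whose weak derivatives
up to order `s` are in `L^p(U)`. -/
def MemSobolev (U : Set R2) (s : ℕ) (p : ℝ≥0∞) (f : R2 → ℝ) : Prop :=
  ∀ α : ℕ × ℕ, α.1 + α.2 ≤ s →
    ∃ g, HasWeakDeriv U α f g ∧ MemLp g p (volume.restrict U)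

/-- The weak gradient on `U`. -/
def weakGrad (U : Set R2) (v : R2 → ℝ) (x : R2) : Fin 2 → ℝ :=
  ![weakDeriv U (1, 0) v x, weakDeriv U (0, 1) v x]

/-- The `L²(U)` norm. -/
def l2norm (U : Set R2) (v : R2 → ℝ) : ℝ :=
  √(∫ x in U, v x ^ 2)

/-- The `H^s(U)` semi-norm. -/
def sobolevSemi (U : Set R2) (s : ℕ) (v : R2 → ℝ) : ℝ :=
  √(∑ α ∈ Finset.HasAntidiagonal.antidiagonal s, ∫ x in U, weakDeriv U α v x ^ 2)

/-- The `H^1(U)` norm. -/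
def h1norm (U : Set R2) (v : R2 → ℝ) : ℝ :=
  √(l2norm U v ^ 2 + sobolevSemi U 1 v ^ 2)

/-- Membership in `H^1_0(U)`, the closure of `C_c^∞(U)` in `H^1(U)`. -/
def MemH10 (U : Set R2) (v : R2 → ℝ) : Prop :=
  MemSobolev U 1 2 v ∧
    ∀ ε > 0, ∃ φ, IsTestFunction U φ ∧ h1norm U (fun x => v x - φ x) < ε

/-- The component `c` of a vector field. -/
def comp (F : R2 → R2) (c : Fin 2) : R2 → ℝ := fun x => F x c

/-! ### Polynomials and `L²`-projections -/

/-- Polynomial functions of total degree at most `k` on the plane. -/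
def polySpace (k : ℕ) : Set (R2 → ℝ) :=
  {p | ∃ q : MvPolynomial (Fin 2) ℝ, q.totalDegree ≤ k ∧
    ∀ x, p x = MvPolynomial.eval (fun d => x d) q}

open Classical in
/-- The `L²(E)`-orthogonal projection `Π⁰_k v` onto polynomials of degree at most `k`. -/
def l2proj (E : Set R2) (k : ℕ) (v : R2 → ℝ) : R2 → ℝ :=
  if h : ∃ p ∈ polySpace k, ∀ q ∈ polySpace k, ∫ x in E, (v x - p x) * q x = 0
  then h.choose else 0

/-- The projected gradient `Π¹_{k-1} v = Π⁰_{k-1} ∇v`, componentwise (used for `k ≥ 1`). -/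
def projGrad (E : Set R2) (k : ℕ) (v : R2 → ℝ) (x : R2) : Fin 2 → ℝ :=
  fun d => l2proj E (k - 1) (fun y => weakGrad E v y d) x

/-! ### Polygons and meshes -/

/-- An open polygonal element: the domain enclosed by a simple closed polygonal curve.
Consecutive edges may be aligned (hanging nodes). -/
structure Element where
  n : ℕ
  poly : Polygon R2 (n + 3)
  carrier : Set R2
  vertices_injective : Function.Injective poly.vertices
  /-- Two different edges meet at most in common endpoints. -/
  simple : ∀ i j, i ≠ j → poly.edgeSet ℝ i ∩ poly.edgeSet ℝ j ⊆
    {poly i, poly (finRotate _ i)} ∩ {poly j, poly (finRotate _ j)}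
  isOpen : IsOpen carrier
  isConnected : IsConnected carrier
  isBounded : Bornology.IsBounded carrier
  frontier_eq : frontier carrier = poly.boundary ℝ

/-- The diameter of an element. -/
def Element.diam (E : Element) : ℝ := Metric.diam E.carrier

/-- A bounded domain whose boundary lies in finitely many line segments. -/
structure IsPolygonalDomain (Ω : Set R2) : Prop where
  isOpen : IsOpen Ω
  isConnected : IsConnected Ω
  isBounded : Bornology.IsBounded Ω
  polygonal : ∃ (N : ℕ) (a b : Fin N → R2), frontier Ω ⊆ ⋃ i, segment ℝ (a i) (b i)

/-- A finite partition of `Ω` into non-overlapping polygons. -/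
structure Mesh (Ω : Set R2) where
  card : ℕ
  elem : Fin card → Element
  subset : ∀ i, (elem i).carrier ⊆ Ω
  disjoint : ∀ i j, i ≠ j → Disjoint (elem i).carrier (elem j).carrier
  cover : closure Ω = ⋃ i, closure (elem i).carrier

/-- The mesh size `h = max_E h_E`. -/
def Mesh.size {Ω : Set R2} (T : Mesh Ω) : ℝ := ⨆ i, (T.elem i).diam

/-- Shape regularity with parameter `α`: every element is a finite union of domains, each of
them star-shaped with respect to a ball of radius greater than `α h_E`, and each of its edges is
longer than `α h_E`. -/
def Mesh.ShapeRegular {Ω : Set R2} (T : Mesh Ω) (α : ℝ) : Prop :=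
  ∀ i,
    (∃ (N : ℕ) (D : Fin N → Set R2), (T.elem i).carrier = ⋃ j, D j ∧
      ∀ j, IsOpen (D j) ∧ ∃ (x : R2) (r : ℝ), α * (T.elem i).diam < r ∧
        Metric.ball x r ⊆ D j ∧ ∀ y ∈ Metric.ball x r, StarConvex ℝ y (D j)) ∧
    ∀ j, α * (T.elem i).diam <
      dist ((T.elem i).poly j) ((T.elem i).poly (finRotate _ j))

/-! ### Local and global virtual element spaces -/

/-- The enlarged local space `W_k(E)`: functions in `H¹(E) ∩ C⁰(Ē)` with (distributional)
Laplacian in `P_k` and with polynomial trace of degree at most `k` on every edge. -/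
def enlargedSpace (E : Element) (k : ℕ) : Set (R2 → ℝ) :=
  {v | MemSobolev E.carrier 1 2 v ∧ ContinuousOn v (closure E.carrier) ∧
    (∃ p ∈ polySpace k, ∀ φ, IsTestFunction E.carrier φ →
      ∫ x in E.carrier, v x * (pderiv 0 (pderiv 0 φ) x + pderiv 1 (pderiv 1 φ) x) =
        ∫ x in E.carrier, p x * φ x) ∧
    ∀ j, ∃ q : Polynomial ℝ, q.natDegree ≤ k ∧
      ∀ t ∈ Icc (0 : ℝ) 1, v (E.poly.edgePath ℝ j t) = q.eval t}

/-- All the degrees of freedom of `v` are zero: vertex values, edge moments of degree at most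
`k - 2`, internal moments of degree at most `k - 2` (no moments if `k = 1`). -/
def DofsVanish (E : Element) (k : ℕ) (v : R2 → ℝ) : Prop :=
  (∀ j, v (E.poly j) = 0) ∧
  (∀ j, ∀ q : Polynomial ℝ, q.natDegree + 2 ≤ k →
    ∫ t in (0 : ℝ)..1, v (E.poly.edgePath ℝ j t) * q.eval t = 0) ∧
  (∀ q : MvPolynomial (Fin 2) ℝ, q.totalDegree + 2 ≤ k →
    ∫ x in E.carrier, v x * MvPolynomial.eval (fun d => x d) q = 0)

/-- An auxiliary projection `Π*_k : W_k(E) → P_k(E)`: linear, reproducing polynomials,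
`L²`-stable and computable from the degrees of freedom only. The linear map is extended
to all functions for convenience; only its values on `W_k(E)` matter. -/
structure IsAuxProj (E : Element) (k : ℕ) (P : (R2 → ℝ) →ₗ[ℝ] (R2 → ℝ)) : Prop where
  range : ∀ v ∈ enlargedSpace E k, P v ∈ polySpace k
  reproduces : ∀ p ∈ polySpace k, P p = p
  computable : ∀ v ∈ enlargedSpace E k, DofsVanish E k v → P v = 0
  stable : ∃ C : ℝ, ∀ v ∈ enlargedSpace E k, l2norm E.carrier (P v) ≤ C * l2norm E.carrier v

/-- The scaled monomial of exponent `β` on `E`, centred at the barycentre of `E`. -/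
def scaledMonomial (E : Element) (β : ℕ × ℕ) (x : R2) : ℝ :=
  ((x 0 - ⨍ y in E.carrier, y 0) / E.diam) ^ β.1 *
    ((x 1 - ⨍ y in E.carrier, y 1) / E.diam) ^ β.2

/-- The enhanced local virtual element space `V_k(E)` attached to the auxiliary projection `P`:
`v` and `P v` have the same moments against the scaled monomials of degree `k - 1` and `k`. -/
def localSpace (E : Element) (k : ℕ) (P : (R2 → ℝ) →ₗ[ℝ] (R2 → ℝ)) : Set (R2 → ℝ) :=
  {v | v ∈ enlargedSpace E k ∧ ∀ β : ℕ × ℕ, β.1 + β.2 ≤ k → k ≤ β.1 + β.2 + 1 →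
    ∫ x in E.carrier, (P v x - v x) * scaledMonomial E β x = 0}

/-- The global space `V_h^k`. Its elements are represented by functions on the plane that are
continuous on the closure of the domain; values outside of it are irrelevant. -/
def vemSpace {Ω : Set R2} (T : Mesh Ω) (k : ℕ)
    (P : Fin T.card → (R2 → ℝ) →ₗ[ℝ] (R2 → ℝ)) : Set (R2 → ℝ) :=
  {v | MemSobolev Ω 1 2 v ∧ ∀ i, v ∈ localSpace (T.elem i) k (P i)}

/-- The space `V_{h,0}^k = V_h^k ∩ H^1_0(Ω)`. -/
def vemSpaceZero {Ω : Set R2} (T : Mesh Ω) (k : ℕ)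
    (P : Fin T.card → (R2 → ℝ) →ₗ[ℝ] (R2 → ℝ)) : Set (R2 → ℝ) :=
  {v | v ∈ vemSpace T k P ∧ MemH10 Ω v}

/-! ### The reference-to-physical map and its virtual approximation -/

/-- `F` is bi-Lipschitz on `Ω`. -/
def IsBiLipschitzOn (Ω : Set R2) (F : R2 → R2) : Prop :=
  ∃ L > 0, ∀ x ∈ Ω, ∀ y ∈ Ω, L⁻¹ * dist x y ≤ dist (F x) (F y) ∧ dist (F x) (F y) ≤ L * dist x y

/-- The Jacobian matrix `J_F`, with entries `∂_d F_c`. -/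
def jac (Ω : Set R2) (F : R2 → R2) (x : R2) : Matrix (Fin 2) (Fin 2) ℝ :=
  Matrix.of fun c => weakGrad Ω (comp F c) x

/-- The projected Jacobian `J_{F,h} = Π¹_{l-1} F_h` on an element. -/
def jacProj (E : Set R2) (l : ℕ) (Fh : R2 → R2) (x : R2) : Matrix (Fin 2) (Fin 2) ℝ :=
  Matrix.of fun c => projGrad E l (comp Fh c) x

/-- Accuracy of order `l` of the approximation `Fh` of `F`, with constant `C`: on every element,
for all `s = 0, …, l`,
`‖F - F_h‖_{0,E} + h_E |F - F_h|_{1,E} ≤ C h_E^{s+1} |F|_{s+1,E}`. -/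
def MapAccurate {Ω : Set R2} (T : Mesh Ω) (l : ℕ) (C : ℝ) (F Fh : R2 → R2) : Prop :=
  ∀ i, ∀ s ≤ l,
    √(∑ c, l2norm (T.elem i).carrier (fun x => comp F c x - comp Fh c x) ^ 2) +
      (T.elem i).diam *
        √(∑ c, sobolevSemi (T.elem i).carrier 1 (fun x => comp F c x - comp Fh c x) ^ 2) ≤
    C * (T.elem i).diam ^ (s + 1) *
      √(∑ c, sobolevSemi (T.elem i).carrier (s + 1) (comp F c) ^ 2)

/-! ### Bilinear and linear forms -/

/-- Diffusion, convection and (skew-symmetrised) reaction coefficients on the reference domain. -/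
structure Coeffs where
  a : R2 → ℝ
  b : R2 → Fin 2 → ℝ
  μ : R2 → ℝ

/-- Bounded measurable coefficients with `a₀ ≤ a ≤ a₁`, `|b_d| ≤ b₁` and `μ₀ ≤ μ ≤ μ₁`
a.e. on `Ω`. -/
structure Coeffs.Admissible (D : Coeffs) (Ω : Set R2) (a₀ a₁ b₁ μ₀ μ₁ : ℝ) : Prop where
  measurable_a : AEStronglyMeasurable D.a (volume.restrict Ω)
  measurable_b : ∀ d, AEStronglyMeasurable (fun x => D.b x d) (volume.restrict Ω)
  measurable_μ : AEStronglyMeasurable D.μ (volume.restrict Ω)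
  bound_a : ∀ᵐ x ∂volume.restrict Ω, a₀ ≤ D.a x ∧ D.a x ≤ a₁
  bound_b : ∀ᵐ x ∂volume.restrict Ω, ∀ d, |D.b x d| ≤ b₁
  bound_μ : ∀ᵐ x ∂volume.restrict Ω, μ₀ ≤ D.μ x ∧ D.μ x ≤ μ₁

/-- The form
`∫_E a J⁻ᵀgu · J⁻ᵀgv det J + ½ ∫_E b · (v J⁻ᵀgu - u J⁻ᵀgv) det J + ∫_E μ u v det J`
for a matrix field `J`, functions `u`, `v` and vector fields `gu`, `gv` in the role of their
gradients. -/
def transformedForm (E : Set R2) (D : Coeffs) (J : R2 → Matrix (Fin 2) (Fin 2) ℝ)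
    (u v : R2 → ℝ) (gu gv : R2 → Fin 2 → ℝ) : ℝ :=
  (∫ x in E, D.a x * (((J x)⁻¹ᵀ *ᵥ gu x) ⬝ᵥ ((J x)⁻¹ᵀ *ᵥ gv x)) * (J x).det) +
  (1 / 2) * (∫ x in E, (D.b x ⬝ᵥ (v x • ((J x)⁻¹ᵀ *ᵥ gu x) - u x • ((J x)⁻¹ᵀ *ᵥ gv x))) *
    (J x).det) +
  ∫ x in E, D.μ x * u x * v x * (J x).det

/-- The restriction to `E` of the exact bilinear form transformed to the reference domain. -/
def exactLocal (Ω : Set R2) (F : R2 → R2) (D : Coeffs) (E : Set R2) (u v : R2 → ℝ) : ℝ :=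
  transformedForm E D (jac Ω F) u v (weakGrad E u) (weakGrad E v)

/-- The discrete local form `A_h^E + B_h^E + C_h^E`. -/
def discreteLocal (k l : ℕ) (Fh : R2 → R2) (D : Coeffs) (E : Set R2) (u v : R2 → ℝ) : ℝ :=
  transformedForm E D (jacProj E l Fh) (l2proj E k u) (l2proj E k v)
    (projGrad E k u) (projGrad E k v)

/-- `S` is a stabilisation form on `V_k(E)`: it is computable from the degrees of freedom, and on
the functions of `V_k(E)` with `Π⁰_k v = 0` it is equivalent to the exact local form `aE`, with
constants `cS` and `CS`. The bilinear form is extended to all functions for convenience; only its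
values on `V_k(E)` matter. -/
structure IsStabilisation (E : Element) (k : ℕ) (P : (R2 → ℝ) →ₗ[ℝ] (R2 → ℝ))
    (aE : (R2 → ℝ) → (R2 → ℝ) → ℝ) (cS CS : ℝ) (S : LinearMap.BilinForm ℝ (R2 → ℝ)) :
    Prop where
  computable : ∀ u ∈ localSpace E k P, ∀ v ∈ localSpace E k P, DofsVanish E k u →
    S u v = 0 ∧ S v u = 0
  lower : ∀ v ∈ localSpace E k P, l2proj E.carrier k v = 0 → cS * aE v v ≤ S v v
  upper : ∀ v ∈ localSpace E k P, l2proj E.carrier k v = 0 → S v v ≤ CS * aE v v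

/-- The global discrete bilinear form of the reference IsoVEM. -/
def discreteForm {Ω : Set R2} (T : Mesh Ω) (k l : ℕ) (Fh : R2 → R2) (D : Coeffs)
    (S : Fin T.card → LinearMap.BilinForm ℝ (R2 → ℝ)) (u v : R2 → ℝ) : ℝ :=
  ∑ i, (discreteLocal k l Fh D (T.elem i).carrier u v +
    S i (u - l2proj (T.elem i).carrier k u) (v - l2proj (T.elem i).carrier k v))

/-- The global discrete right-hand side `∑_E ∫_E f Π⁰_k v j_h`. -/
def discreteLoad {Ω : Set R2} (T : Mesh Ω) (k l : ℕ) (Fh : R2 → R2) (f : R2 → ℝ)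
    (v : R2 → ℝ) : ℝ :=
  ∑ i, ∫ x in (T.elem i).carrier,
    f x * l2proj (T.elem i).carrier k v x * (jacProj (T.elem i).carrier l Fh x).det

end IsoVEM

end

/-! Everything is reduced to estimates on single elements whose constants see an element only
through `α`. Two facts carry this reduction: the discrete Jacobian inherits the bounds of the exact
one, and `Π⁰_k` is stable in the `H¹` semi-norm on `W_k(E)`.

Jacobian. Since `m + 1 ≥ 2`, the entries of `J` have bounded weak gradients, so `J` stays within
`O(h_E)` of one of its values `J(x₀)` on an element (`exists_jac_near`). The accuracy condition with
`s = 1` puts `∇F_h` within `O(h_E²)` of `∇F` in `L²(E)`. Hence `J_h - J(x₀)` is a polynomial whose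
`L²` norm is `O(h_E²)`, and an inverse inequality makes it `O(h_E)` at every point of `E`
(`exists_jacProj_near`). For `h ≤ h₀` this gives `det J_h ≥ j₀ / 2` and `|J_h| ≤ Λ + 1`; `h₀`
depends on `F` only through a bound for its second derivatives.

Coercivity. On the diagonal the skew-symmetrised convection cancels and the reaction is nonnegative,
so the form controls `‖Π¹_{k-1} v‖²`. The stabilisation controls `|v - Π⁰_k v|₁²`. Since `∇Π⁰_k v`
is a competitor of degree `k - 1` in the best approximation of `∇v`, the two together dominate
`|v|₁²` (`sobolevSemi_sq_le_projGrad`). Summation over the mesh and Friedrichs' inequality on `H¹₀`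
finish.

Continuity. The projected part is bounded by Cauchy-Schwarz. The stabilisation is bounded by the
exact form at `v - Π⁰_k v`, so the `H¹` stability of `Π⁰_k` is needed (`exists_l2proj_stable`); it
follows from an inverse estimate and a Poincaré inequality on `E`. The latter is the delicate point:
the star-shaped pieces of `E` may overlap in arbitrarily small sets, so chaining local inequalities
through the overlaps gives no uniform constant. The polynomial traces of `W_k(E)` replace that
chain. On each edge, a trace inequality from one piece holds on a fixed fraction of the edge, and a
Remez inequality extends it to the whole edge. Neighbouring edges share a vertex, so the boundary
values oscillate by at most `C |u|₁` (`exists_frontier_osc_le`), and Friedrichs' inequality for `u -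
c` gives Poincaré.

If the forms `S^E` are symmetric, they satisfy Cauchy-Schwarz and the bound is uniform. Otherwise
finite dimension is used: modulo functions vanishing on the closed domain, a virtual element
function is determined by its edge traces and its element Laplacians, by a weak maximum principle
(`eq_zero_of_weaklyHarmonic`). A positive definite form on a finite-dimensional space is bounded by
its diagonal (`exists_bound_of_posDef`) and maps onto the dual, which also yields the discrete
solution. -/

noncomputable section

namespace IsoVEM

/-! ### Weak derivatives -/

/-- The multi-index of the first partial derivative in direction `d`. -/
def unitIdx : Fin 2 → ℕ × ℕ := ![(1, 0), (0, 1)]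

theorem multiDeriv_unitIdx (d : Fin 2) (φ : R2 → ℝ) : multiDeriv (unitIdx d) φ = pderiv d φ := by
  fin_cases d <;> rfl

theorem unitIdx_order (d : Fin 2) : (unitIdx d).1 + (unitIdx d).2 = 1 := by
  fin_cases d <;> rfl

theorem weakGrad_apply (U : Set R2) (v : R2 → ℝ) (x : R2) (d : Fin 2) :
    weakGrad U v x d = weakDeriv U (unitIdx d) v x := by
  fin_cases d <;> rfl

theorem contDiff_pderiv {φ : R2 → ℝ} (h : ContDiff ℝ ∞ φ) (d : Fin 2) :
    ContDiff ℝ ∞ (pderiv d φ) := by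
  unfold pderiv
  exact (h.fderiv_right (m := ∞) (by simp)).clm_apply contDiff_const

theorem tsupport_pderiv_subset (φ : R2 → ℝ) (d : Fin 2) : tsupport (pderiv d φ) ⊆ tsupport φ :=
  closure_minimal (fun x hx => by
    by_contra hn
    apply hx
    simp [pderiv, fderiv_of_notMem_tsupport (𝕜 := ℝ) hn]) (isClosed_tsupport _)

theorem IsTestFunction.pderiv {U : Set R2} {φ : R2 → ℝ} (h : IsTestFunction U φ) (d : Fin 2) :
    IsTestFunction U (pderiv d φ) :=
  ⟨contDiff_pderiv h.1 d, h.2.1.of_isClosed_subset (isClosed_tsupport _)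
    (tsupport_pderiv_subset φ d), (tsupport_pderiv_subset φ d).trans h.2.2⟩

theorem IsTestFunction.multiDeriv {U : Set R2} {φ : R2 → ℝ} (h : IsTestFunction U φ)
    (α : ℕ × ℕ) : IsTestFunction U (multiDeriv α φ) := by
  have key : ∀ (d : Fin 2) (n : ℕ) (ψ : R2 → ℝ), IsTestFunction U ψ →
      IsTestFunction U ((IsoVEM.pderiv d)^[n] ψ) := by
    intro d n
    induction n with
    | zero => intro ψ hψ; simpa using hψ
    | succ n ih => intro ψ hψ; rw [Function.iterate_succ_apply]; exact ih _ (hψ.pderiv d)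
  exact key _ _ _ (key _ _ _ h)

theorem IsTestFunction.mono {U V : Set R2} {φ : R2 → ℝ} (h : IsTestFunction V φ) (hVU : V ⊆ U) :
    IsTestFunction U φ := ⟨h.1, h.2.1, h.2.2.trans hVU⟩

theorem IsTestFunction.continuous {U : Set R2} {φ : R2 → ℝ} (h : IsTestFunction U φ) :
    Continuous φ := h.1.continuous

theorem IsTestFunction.eq_zero {U : Set R2} {φ : R2 → ℝ} (h : IsTestFunction U φ) {x : R2}
    (hx : x ∉ U) : φ x = 0 := image_eq_zero_of_notMem_tsupport fun hx' => hx (h.2.2 hx')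

theorem IsTestFunction.integrableOn_mul {U : Set R2} {φ f : R2 → ℝ} (h : IsTestFunction U φ)
    (hf : LocallyIntegrableOn f U) : IntegrableOn (fun x => f x * φ x) U := by
  have hK : IntegrableOn f (tsupport φ) := hf.integrableOn_compact_subset h.2.2 h.2.1
  have h1 : IntegrableOn (fun x => f x * φ x) (tsupport φ) :=
    hK.mul_continuousOn h.continuous.continuousOn h.2.1
  refine Integrable.integrableOn ?_
  refine (integrableOn_iff_integrable_of_support_subset ?_).1 h1
  intro x hx
  exact subset_tsupport φ (fun h0 => hx (by simp [h0]))

theorem IsTestFunction.setIntegral_mul_eq {U : Set R2} {φ : R2 → ℝ} (h : IsTestFunction U φ)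
    (f : R2 → ℝ) : ∫ x in U, f x * φ x = ∫ x, f x * φ x :=
  setIntegral_eq_integral_of_forall_compl_eq_zero fun x hx => by simp [h.eq_zero hx]

/-- The fundamental lemma of the calculus of variations, applied to the difference of the two
candidates. -/
theorem HasWeakDeriv.ae_unique {U : Set R2} (hU : IsOpen U) {α : ℕ × ℕ} {f g g' : R2 → ℝ}
    (h : HasWeakDeriv U α f g) (h' : HasWeakDeriv U α f g') :
    g =ᵐ[volume.restrict U] g' := by
  have h0 : ∀ᵐ x, x ∈ U → (g - g') x = 0 := by
    refine hU.ae_eq_zero_of_integral_contDiff_smul_eq_zero (h.2.1.sub h'.2.1) ?_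
    intro φ h1 h2 h3
    have hφ : IsTestFunction U φ := ⟨h1, h2, h3⟩
    have e := (h.2.2 φ hφ).symm.trans (h'.2.2 φ hφ)
    have e' := mul_left_cancel₀ (pow_ne_zero _ (by norm_num)) e
    have : ∫ x in U, (g - g') x * φ x = 0 := by
      simp only [Pi.sub_apply, sub_mul]
      rw [integral_sub (hφ.integrableOn_mul h.2.1) (hφ.integrableOn_mul h'.2.1), e', sub_self]
    rw [hφ.setIntegral_mul_eq] at this
    simpa [mul_comm] using this
  rw [Filter.EventuallyEq, ae_restrict_iff' hU.measurableSet]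
  filter_upwards [h0] with x hx hxU
  simpa [sub_eq_zero] using hx hxU

theorem HasWeakDeriv.weakDeriv {U : Set R2} {α : ℕ × ℕ} {f g : R2 → ℝ}
    (h : HasWeakDeriv U α f g) : HasWeakDeriv U α f (weakDeriv U α f) := by
  have h' : ∃ g, HasWeakDeriv U α f g := ⟨g, h⟩
  rw [IsoVEM.weakDeriv, dif_pos h']
  exact h'.choose_spec

theorem HasWeakDeriv.weakDeriv_ae {U : Set R2} (hU : IsOpen U) {α : ℕ × ℕ} {f g : R2 → ℝ}
    (h : HasWeakDeriv U α f g) : IsoVEM.weakDeriv U α f =ᵐ[volume.restrict U] g :=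
  h.weakDeriv.ae_unique hU h

theorem HasWeakDeriv.add {U : Set R2} {α : ℕ × ℕ} {f f' g g' : R2 → ℝ}
    (h : HasWeakDeriv U α f g) (h' : HasWeakDeriv U α f' g') :
    HasWeakDeriv U α (f + f') (g + g') := by
  refine ⟨h.1.add h'.1, h.2.1.add h'.2.1, fun φ hφ => ?_⟩
  simp only [Pi.add_apply, add_mul]
  rw [integral_add ((hφ.multiDeriv α).integrableOn_mul h.1)
    ((hφ.multiDeriv α).integrableOn_mul h'.1),
    integral_add (hφ.integrableOn_mul h.2.1) (hφ.integrableOn_mul h'.2.1), h.2.2 φ hφ,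
    h'.2.2 φ hφ]
  ring

theorem HasWeakDeriv.smul {U : Set R2} {α : ℕ × ℕ} {f g : R2 → ℝ}
    (h : HasWeakDeriv U α f g) (c : ℝ) : HasWeakDeriv U α (c • f) (c • g) := by
  refine ⟨h.1.smul c, h.2.1.smul c, fun φ hφ => ?_⟩
  simp only [Pi.smul_apply, smul_eq_mul, mul_assoc, integral_const_mul]
  rw [h.2.2 φ hφ]
  ring

theorem HasWeakDeriv.sub {U : Set R2} {α : ℕ × ℕ} {f f' g g' : R2 → ℝ}
    (h : HasWeakDeriv U α f g) (h' : HasWeakDeriv U α f' g') :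
    HasWeakDeriv U α (f - f') (g - g') := by
  have := h.add (h'.smul (-1))
  simpa [sub_eq_add_neg] using this

/-- A test function on the smaller set is one on the larger set, and all the integrals may be taken
over the whole plane. -/
theorem HasWeakDeriv.mono {U V : Set R2} {α : ℕ × ℕ} {f g : R2 → ℝ}
    (h : HasWeakDeriv U α f g) (hVU : V ⊆ U) : HasWeakDeriv V α f g := by
  refine ⟨h.1.mono_set hVU, h.2.1.mono_set hVU, fun φ hφ => ?_⟩
  have e := h.2.2 φ (hφ.mono hVU)
  rw [((hφ.mono hVU).multiDeriv α).setIntegral_mul_eq, (hφ.mono hVU).setIntegral_mul_eq] at e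
  rw [(hφ.multiDeriv α).setIntegral_mul_eq, hφ.setIntegral_mul_eq, e]

theorem integral_mul_pderiv {U : Set R2} {f φ : R2 → ℝ} (hf : ContDiff ℝ ∞ f)
    (hφ : IsTestFunction U φ) (d : Fin 2) :
    ∫ x in U, f x * pderiv d φ x = -∫ x in U, pderiv d f x * φ x := by
  rw [(hφ.pderiv d).setIntegral_mul_eq, hφ.setIntegral_mul_eq]
  have hl : ∀ {a : R2 → ℝ}, Continuous a → LocallyIntegrableOn a univ := fun ha =>
    (ha.locallyIntegrable).locallyIntegrableOn _
  have hφ' : IsTestFunction univ φ := hφ.mono (subset_univ _)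
  unfold pderiv
  refine integral_mul_fderiv_eq_neg_fderiv_mul_of_integrable ?_ ?_ ?_
    (fun x _ => (hf.differentiable (by simp)).differentiableAt)
    (fun x _ => (hφ.1.differentiable (by simp)).differentiableAt)
  · simpa [pderiv] using hφ'.integrableOn_mul (hl (contDiff_pderiv hf d).continuous)
  · simpa [pderiv] using (hφ'.pderiv d).integrableOn_mul (hl hf.continuous)
  · simpa using hφ'.integrableOn_mul (hl hf.continuous)

theorem hasWeakDeriv_of_contDiff (U : Set R2) {f : R2 → ℝ} (hf : ContDiff ℝ ∞ f) (d : Fin 2) :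
    HasWeakDeriv U (unitIdx d) f (pderiv d f) := by
  refine ⟨hf.continuous.locallyIntegrable.locallyIntegrableOn _,
    (contDiff_pderiv hf d).continuous.locallyIntegrable.locallyIntegrableOn _, fun φ hφ => ?_⟩
  rw [multiDeriv_unitIdx, integral_mul_pderiv hf hφ d, unitIdx_order]
  ring

/-- `multiDeriv` differentiates in a fixed order; iterating first-order weak derivatives produces
the other order as well. -/
theorem pderiv_comm {φ : R2 → ℝ} (hφ : ContDiff ℝ ∞ φ) (d e : Fin 2) :
    pderiv d (pderiv e φ) = pderiv e (pderiv d φ) := by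
  ext x
  have h2 : ContDiffAt ℝ 2 φ x := (contDiff_infty.1 hφ 2).contDiffAt
  have hd : DifferentiableAt ℝ (fderiv ℝ φ) x :=
    ((hφ.fderiv_right (m := ∞) (by simp)).differentiable (by simp)).differentiableAt
  have key : ∀ a b : R2, fderiv ℝ (fun y => fderiv ℝ φ y a) x b = fderiv ℝ (fderiv ℝ φ) x b a := by
    intro a b
    rw [fderiv_clm_apply hd (differentiableAt_const _)]
    simp
  have hs : IsSymmSndFDerivAt ℝ φ x := h2.isSymmSndFDerivAt (by simp)
  unfold pderiv
  rw [key, key]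
  exact hs _ _

/-! ### First order Sobolev functions -/

theorem hasWeakDeriv_zero_iff {U : Set R2} {f : R2 → ℝ} (hf : LocallyIntegrableOn f U) :
    HasWeakDeriv U (0, 0) f f := ⟨hf, hf, fun φ _ => by simp [multiDeriv]⟩

theorem MemLp.locallyIntegrableOn_two {U : Set R2} {f : R2 → ℝ} (hf : MemLp f 2 (volume.restrict U)) :
    LocallyIntegrableOn f U := by
  intro x hx
  refine ⟨Metric.closedBall x 1 ∩ U, Filter.inter_mem
    (mem_nhdsWithin_of_mem_nhds (Metric.closedBall_mem_nhds x one_pos)) self_mem_nhdsWithin, ?_⟩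
  have h1 : MemLp f 2 (volume.restrict (Metric.closedBall x 1 ∩ U)) :=
    hf.mono_measure (Measure.restrict_mono inter_subset_right le_rfl)
  have : IsFiniteMeasure (volume.restrict (Metric.closedBall x 1 ∩ U)) :=
    ⟨by
      rw [Measure.restrict_apply_univ]
      exact (measure_mono inter_subset_left).trans_lt measure_closedBall_lt_top⟩
  exact h1.integrable (by norm_num)

/-- `MemSobolev` only provides some weak derivative of order zero in `L²`; by uniqueness it is `f`
almost everywhere. -/
theorem MemSobolev.memLp {U : Set R2} (hU : IsOpen U) {s : ℕ} {f : R2 → ℝ}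
    (h : MemSobolev U s 2 f) : MemLp f 2 (volume.restrict U) := by
  obtain ⟨g, hg, hgp⟩ := h (0, 0) (by simp)
  exact hgp.ae_eq (hg.ae_unique hU (hasWeakDeriv_zero_iff hg.1))

theorem MemSobolev.hasWeakDeriv {U : Set R2} {s : ℕ} {p : ℝ≥0∞} {f : R2 → ℝ}
    (h : MemSobolev U s p f) {α : ℕ × ℕ} (hα : α.1 + α.2 ≤ s) :
    HasWeakDeriv U α f (weakDeriv U α f) := by
  obtain ⟨g, hg, -⟩ := h α hα
  exact hg.weakDeriv

theorem MemSobolev.memLp_weakDeriv {U : Set R2} (hU : IsOpen U) {s : ℕ} {p : ℝ≥0∞} {f : R2 → ℝ}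
    (h : MemSobolev U s p f) {α : ℕ × ℕ} (hα : α.1 + α.2 ≤ s) :
    MemLp (weakDeriv U α f) p (volume.restrict U) := by
  obtain ⟨g, hg, hgp⟩ := h α hα
  exact hgp.ae_eq (hg.weakDeriv_ae hU).symm

theorem MemSobolev.mono {U V : Set R2} {s : ℕ} {p : ℝ≥0∞} {f : R2 → ℝ}
    (h : MemSobolev U s p f) (hVU : V ⊆ U) : MemSobolev V s p f := by
  intro α hα
  obtain ⟨g, hg, hgp⟩ := h α hα
  exact ⟨g, hg.mono hVU, hgp.mono_measure (Measure.restrict_mono hVU le_rfl)⟩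

theorem MemSobolev.add {U : Set R2} {s : ℕ} {p : ℝ≥0∞} {f f' : R2 → ℝ}
    (h : MemSobolev U s p f) (h' : MemSobolev U s p f') : MemSobolev U s p (f + f') := by
  intro α hα
  obtain ⟨g, hg, hgp⟩ := h α hα
  obtain ⟨g', hg', hgp'⟩ := h' α hα
  exact ⟨g + g', hg.add hg', hgp.add hgp'⟩

theorem MemSobolev.smul {U : Set R2} {s : ℕ} {p : ℝ≥0∞} {f : R2 → ℝ}
    (h : MemSobolev U s p f) (c : ℝ) : MemSobolev U s p (c • f) := by
  intro α hα
  obtain ⟨g, hg, hgp⟩ := h α hα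
  exact ⟨c • g, hg.smul c, hgp.const_smul c⟩

theorem memLp_of_continuous {U : Set R2} (hb : Bornology.IsBounded U) {f : R2 → ℝ}
    (hf : Continuous f) (p : ℝ≥0∞) : MemLp f p (volume.restrict U) := by
  have hc : IsCompact (closure U) := hb.isCompact_closure
  obtain ⟨C, hC⟩ := hc.exists_bound_of_continuousOn hf.continuousOn
  have : IsFiniteMeasure (volume.restrict U) := ⟨by
    rw [Measure.restrict_apply_univ]; exact hb.measure_lt_top⟩
  have : IsFiniteMeasure (volume.restrict (closure U)) := ⟨by
    rw [Measure.restrict_apply_univ]; exact hc.measure_lt_top⟩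
  have h1 : MemLp f p (volume.restrict (closure U)) := by
    refine MemLp.of_bound hf.aestronglyMeasurable C ?_
    exact (ae_restrict_iff' isClosed_closure.measurableSet).2 (Filter.Eventually.of_forall hC)
  exact h1.mono_measure (Measure.restrict_mono subset_closure le_rfl)

theorem memSobolev_one_iff {U : Set R2} (hU : IsOpen U) {f : R2 → ℝ} :
    MemSobolev U 1 2 f ↔ MemLp f 2 (volume.restrict U) ∧
      ∀ d, ∃ g, HasWeakDeriv U (unitIdx d) f g ∧ MemLp g 2 (volume.restrict U) := by
  constructor
  · intro h
    exact ⟨h.memLp hU, fun d => h _ (unitIdx_order d).le⟩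
  · rintro ⟨h0, h1⟩ ⟨a, b⟩ hα
    have : (a, b) = (0, 0) ∨ (a, b) = (1, 0) ∨ (a, b) = (0, 1) := by
      simp only [Prod.mk.injEq]; simp only at hα; omega
    rcases this with h | h | h
    · rw [h]; exact ⟨f, hasWeakDeriv_zero_iff (MemLp.locallyIntegrableOn_two h0), h0⟩
    · rw [h]; exact h1 0
    · rw [h]; exact h1 1

theorem memSobolev_of_contDiff {U : Set R2} (hU : IsOpen U) (hb : Bornology.IsBounded U)
    {f : R2 → ℝ} (hf : ContDiff ℝ ∞ f) : MemSobolev U 1 2 f :=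
  (memSobolev_one_iff hU).2 ⟨memLp_of_continuous hb hf.continuous 2, fun d =>
    ⟨_, hasWeakDeriv_of_contDiff U hf d,
      memLp_of_continuous hb (contDiff_pderiv hf d).continuous 2⟩⟩

theorem sobolevSemi_one_sq (U : Set R2) (v : R2 → ℝ) :
    sobolevSemi U 1 v ^ 2 = ∑ d, ∫ x in U, weakDeriv U (unitIdx d) v x ^ 2 := by
  have : Finset.HasAntidiagonal.antidiagonal 1 = {((0 : ℕ), 1), (1, 0)} := by decide
  rw [sobolevSemi, Real.sq_sqrt (Finset.sum_nonneg fun _ _ => integral_nonneg fun _ => sq_nonneg _),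
    this, Fin.sum_univ_two, Finset.sum_pair (by decide), add_comm]
  rfl

theorem l2norm_sq (U : Set R2) (v : R2 → ℝ) : l2norm U v ^ 2 = ∫ x in U, v x ^ 2 :=
  Real.sq_sqrt (integral_nonneg fun _ => sq_nonneg _)

theorem h1norm_sq (U : Set R2) (v : R2 → ℝ) :
    h1norm U v ^ 2 = l2norm U v ^ 2 + sobolevSemi U 1 v ^ 2 :=
  Real.sq_sqrt (by positivity)

/-! ### Mollification -/

/-- The convolution of `u` with a kernel `η`. -/
def conv (η u : R2 → ℝ) (x : R2) : ℝ := ∫ y, u y * η (x - y)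

theorem conv_eq_convolution (η u : R2 → ℝ) :
    conv η u = convolution u η (ContinuousLinearMap.lsmul ℝ ℝ) volume := by
  ext x; simp [conv, convolution]

theorem contDiff_conv {η u : R2 → ℝ} (hη : IsTestFunction univ η) (hu : LocallyIntegrable u) :
    ContDiff ℝ ∞ (conv η u) := by
  rw [conv_eq_convolution]
  exact hη.2.1.contDiff_convolution_right _ hu hη.1

theorem pderiv_conv {η u : R2 → ℝ} (hη : IsTestFunction univ η) (hu : LocallyIntegrable u)
    (d : Fin 2) : pderiv d (conv η u) = conv (pderiv d η) u := by
  ext x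
  have h1 : ContDiff ℝ 1 η := hη.1.of_le (by exact_mod_cast le_top)
  have h := hη.2.1.hasFDerivAt_convolution_right (ContinuousLinearMap.lsmul ℝ ℝ) hu h1 x
  rw [conv_eq_convolution, conv_eq_convolution, pderiv, h.fderiv,
    convolution_precompR_apply _ hu (hη.2.1.fderiv ℝ) (h1.continuous_fderiv one_ne_zero)]
  rfl

theorem isTestFunction_reflect {η : R2 → ℝ} (hη : IsTestFunction univ η) {ε : ℝ}
    (hs : tsupport η ⊆ Metric.closedBall 0 ε) {E : Set R2} {x : R2}
    (hx : Metric.closedBall x ε ⊆ E) : IsTestFunction E (fun y => η (x - y)) := by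
  have hsub : tsupport (fun y => η (x - y)) ⊆ Metric.closedBall x ε := by
    refine closure_minimal (fun y hy => ?_) Metric.isClosed_closedBall
    have := hs (subset_tsupport η hy)
    rw [mem_closedBall_zero_iff] at this
    rwa [Metric.mem_closedBall, dist_comm, dist_eq_norm]
  exact ⟨hη.1.comp (contDiff_const.sub contDiff_id),
    (isCompact_closedBall x ε).of_isClosed_subset (isClosed_tsupport _) hsub, hsub.trans hx⟩

theorem pderiv_reflect {η : R2 → ℝ} (hη : ContDiff ℝ ∞ η) (x : R2) (d : Fin 2) (y : R2) :
    pderiv d (fun y => η (x - y)) y = -pderiv d η (x - y) := by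
  have h1 : HasFDerivAt η (fderiv ℝ η (x - y)) (x - y) :=
    (hη.differentiable (by simp)).differentiableAt.hasFDerivAt
  have h2 : HasFDerivAt (fun y : R2 => x - y) (-ContinuousLinearMap.id ℝ R2) y := by
    simpa using (hasFDerivAt_id (𝕜 := ℝ) y).const_sub x
  have h3 := h1.comp y h2
  rw [pderiv, show (fun y => η (x - y)) = η ∘ (fun y => x - y) from rfl, h3.fderiv]
  simp [pderiv]

theorem conv_indicator {E : Set R2} (hE : MeasurableSet E) (η f : R2 → ℝ) (x : R2) :
    conv η (E.indicator f) x = ∫ y in E, f y * η (x - y) := by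
  rw [conv, ← integral_indicator hE]
  congr 1
  ext y
  by_cases hy : y ∈ E <;> simp [hy]

/-- As a function of `y`, `η (x - y)` is a test function on `E` as soon as the closed `ε`-ball
around `x` lies in `E`. The weak derivative is then moved from the kernel to `f`; the signs from the
reflection and from the integration by parts cancel. Nearer to the boundary the extension by zero
would interfere. -/
theorem HasWeakDeriv.pderiv_conv {E : Set R2} (hE : MeasurableSet E) {f g : R2 → ℝ} {d : Fin 2}
    (h : HasWeakDeriv E (unitIdx d) f g) (hf : IntegrableOn f E) {η : R2 → ℝ}
    (hη : IsTestFunction univ η) {ε : ℝ} (hs : tsupport η ⊆ Metric.closedBall 0 ε) {x : R2}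
    (hx : Metric.closedBall x ε ⊆ E) :
    pderiv d (conv η (E.indicator f)) x = conv η (E.indicator g) x := by
  have hf' : LocallyIntegrable (E.indicator f) :=
    ((integrable_indicator_iff hE).2 hf).locallyIntegrable
  rw [IsoVEM.pderiv_conv hη hf', conv_indicator hE, conv_indicator hE]
  have h1 := h.2.2 _ (isTestFunction_reflect hη hs hx)
  rw [multiDeriv_unitIdx, unitIdx_order] at h1
  simp only [pderiv_reflect hη.1, mul_neg, integral_neg, pow_one, neg_mul, one_mul] at h1
  exact neg_injective h1

/-- The reflected kernel is the test function in the distributional equation; two derivatives of the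
reflection leave no sign. -/
theorem laplacian_conv {E : Set R2} (hE : MeasurableSet E) {v : R2 → ℝ} (hf : IntegrableOn v E)
    (hv : ∀ φ, IsTestFunction E φ →
      ∫ x in E, v x * (pderiv 0 (pderiv 0 φ) x + pderiv 1 (pderiv 1 φ) x) = 0) {η : R2 → ℝ}
    (hη : IsTestFunction univ η) {ε : ℝ} (hs : tsupport η ⊆ Metric.closedBall 0 ε) {x : R2}
    (hx : Metric.closedBall x ε ⊆ E) :
    pderiv 0 (pderiv 0 (conv η (E.indicator v))) x +
      pderiv 1 (pderiv 1 (conv η (E.indicator v))) x = 0 := by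
  have hf' : LocallyIntegrable (E.indicator v) :=
    ((integrable_indicator_iff hE).2 hf).locallyIntegrable
  have htest := isTestFunction_reflect hη hs hx
  have hr : ∀ d y, pderiv d (pderiv d (fun y => η (x - y))) y = pderiv d (pderiv d η) (x - y) := by
    intro d y
    have : pderiv d (fun y => η (x - y)) = fun y => (-pderiv d η) (x - y) := by
      ext y; rw [pderiv_reflect hη.1]; rfl
    rw [this, pderiv_reflect (η := -pderiv d η) (contDiff_pderiv hη.1 d).neg]
    simp [pderiv, fderiv_neg]
  have h1 := hv _ htest
  simp only [hr, mul_add] at h1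
  have hlE : LocallyIntegrableOn v E := hf.locallyIntegrableOn
  have hi : ∀ d, IntegrableOn (fun y => v y * pderiv d (pderiv d η) (x - y)) E := by
    intro d
    have := ((htest.pderiv d).pderiv d).integrableOn_mul hlE
    simpa only [hr] using this
  rw [integral_add (hi 0) (hi 1)] at h1
  rw [IsoVEM.pderiv_conv hη hf', IsoVEM.pderiv_conv hη hf', IsoVEM.pderiv_conv (hη.pderiv 0) hf',
    IsoVEM.pderiv_conv (hη.pderiv 1) hf', conv_indicator hE, conv_indicator hE]
  exact h1

/-- A smooth nonnegative kernel of integral one supported in the ball of radius `ε`. -/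
structure IsMollifier (η : R2 → ℝ) (ε : ℝ) : Prop where
  test : IsTestFunction univ η
  tsupport_subset : tsupport η ⊆ Metric.closedBall 0 ε
  support_subset : Function.support η ⊆ Metric.ball 0 ε
  nonneg : ∀ x, 0 ≤ η x
  integral_eq : ∫ x, η x = 1

theorem _root_.ContDiffBump.isMollifier (φ : ContDiffBump (0 : R2)) :
    IsMollifier (φ.normed volume) φ.rOut :=
  ⟨⟨φ.contDiff_normed, φ.hasCompactSupport_normed, subset_univ _⟩, φ.tsupport_normed_eq.subset,
    φ.support_normed_eq.subset, φ.nonneg_normed, φ.integral_normed⟩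

/-- The standard bump function at scale `ε`. -/
def stdBump (ε : ℝ) (hε : 0 < ε) : ContDiffBump (0 : R2) := ⟨ε / 2, ε, by linarith, by linarith⟩

theorem exists_isMollifier {ε : ℝ} (hε : 0 < ε) : ∃ η, IsMollifier η ε :=
  ⟨_, (stdBump ε hε).isMollifier⟩

theorem conv_comm (η u : R2 → ℝ) :
    conv η u = convolution η u (ContinuousLinearMap.lsmul ℝ ℝ) volume := by
  ext x
  rw [convolution_eq_swap]
  simp [conv, mul_comm]

/-- The convolution is an average of the values of `u` on the `ε`-ball. -/
theorem IsMollifier.abs_conv_sub_le {η : R2 → ℝ} {ε : ℝ} (hη : IsMollifier η ε) {u : R2 → ℝ}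
    (hu : AEStronglyMeasurable u volume) {x : R2} {a δ : ℝ} (hδ : 0 ≤ δ)
    (h : ∀ y ∈ Metric.ball x ε, |u y - a| ≤ δ) : |conv η u x - a| ≤ δ := by
  rw [conv_comm, ← Real.dist_eq]
  exact dist_convolution_le hδ hη.support_subset hη.nonneg hη.integral_eq hu
    (fun y hy => by rw [Real.dist_eq]; exact h y hy)

theorem lintegral_mul_sq_le {X : Type*} [MeasurableSpace X] (μ : Measure X) {f g : X → ℝ≥0∞}
    (hf : AEMeasurable f μ) (hg : AEMeasurable g μ) :
    (∫⁻ x, f x * g x ∂μ) ^ 2 ≤ (∫⁻ x, f x ^ 2 ∂μ) * ∫⁻ x, g x ^ 2 ∂μ := by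
  have h := ENNReal.lintegral_mul_le_Lp_mul_Lq μ (p := 2) (q := 2)
    (Real.HolderConjugate.two_two) hf hg
  have h2 := pow_le_pow_left' h 2
  simp only [ENNReal.rpow_ofNat, Pi.mul_apply] at h2
  refine h2.trans_eq ?_
  rw [mul_pow, ← ENNReal.rpow_natCast, ← ENNReal.rpow_natCast, ← ENNReal.rpow_mul,
    ← ENNReal.rpow_mul]
  norm_num

theorem IsMollifier.integrable {η : R2 → ℝ} {ε : ℝ} (hη : IsMollifier η ε) : Integrable η :=
  integrable_of_integral_eq_one hη.integral_eq

theorem IsMollifier.lintegral_eq {η : R2 → ℝ} {ε : ℝ} (hη : IsMollifier η ε) (x : R2) :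
    ∫⁻ y, ENNReal.ofReal (η (x - y)) = 1 := by
  rw [lintegral_sub_left_eq_self (μ := volume) (fun y => ENNReal.ofReal (η y)) x,
    ← ofReal_integral_eq_lintegral_ofReal hη.integrable (Filter.Eventually.of_forall hη.nonneg),
    hη.integral_eq, ENNReal.ofReal_one]

/-- Jensen's inequality for the probability density `η (x - ·)`: Cauchy-Schwarz with the kernel
split as `√η * √η`. -/
theorem IsMollifier.conv_sq_le {η : R2 → ℝ} {ε : ℝ} (hη : IsMollifier η ε) {g : R2 → ℝ}
    (hg : AEStronglyMeasurable g volume) (x : R2) :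
    ENNReal.ofReal (conv η g x ^ 2) ≤
      ∫⁻ y, ENNReal.ofReal (η (x - y)) * ENNReal.ofReal (g y ^ 2) := by
  have hc : Continuous fun y => η (x - y) := hη.test.continuous.comp (by fun_prop)
  have e : ∀ t : ℝ, ENNReal.ofReal (t ^ 2) = ‖t‖ₑ ^ 2 := by
    intro t
    rw [← sq_abs, ENNReal.ofReal_pow (abs_nonneg _), ← Real.norm_eq_abs, ofReal_norm]
  have hs : ∀ y, ENNReal.ofReal (√(η (x - y))) ^ 2 = ENNReal.ofReal (η (x - y)) := by
    intro y
    rw [← ENNReal.ofReal_pow (Real.sqrt_nonneg _), Real.sq_sqrt (hη.nonneg _)]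
  calc ENNReal.ofReal (conv η g x ^ 2) = ‖conv η g x‖ₑ ^ 2 := e _
    _ ≤ (∫⁻ y, ‖g y * η (x - y)‖ₑ) ^ 2 := by
        gcongr; exact enorm_integral_le_lintegral_enorm _
    _ = (∫⁻ y, ENNReal.ofReal (√(η (x - y))) *
          (ENNReal.ofReal (√(η (x - y))) * ‖g y‖ₑ)) ^ 2 := by
        congr 2; ext y
        rw [enorm_mul, ← mul_assoc, ← pow_two, hs, mul_comm, Real.enorm_of_nonneg (hη.nonneg _)]
    _ ≤ (∫⁻ y, ENNReal.ofReal (√(η (x - y))) ^ 2) *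
          ∫⁻ y, (ENNReal.ofReal (√(η (x - y))) * ‖g y‖ₑ) ^ 2 := by
        have hm : AEMeasurable (fun y => ENNReal.ofReal (√(η (x - y)))) volume :=
          (Real.continuous_sqrt.comp hc).measurable.ennreal_ofReal.aemeasurable
        exact lintegral_mul_sq_le _ hm (hm.mul hg.enorm)
    _ = _ := by
        simp only [hs, mul_pow, hη.lintegral_eq, one_mul, e]

/-- Integrate the Jensen bound in `x` and exchange the integrals; the kernel has mass one in either
variable. No constant is lost, so smoothing does not increase the energy. -/
theorem IsMollifier.lintegral_conv_sq_le {η : R2 → ℝ} {ε : ℝ} (hη : IsMollifier η ε) {g : R2 → ℝ}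
    (hg : AEStronglyMeasurable g volume) :
    ∫⁻ x, ENNReal.ofReal (conv η g x ^ 2) ≤ ∫⁻ y, ENNReal.ofReal (g y ^ 2) := by
  calc ∫⁻ x, ENNReal.ofReal (conv η g x ^ 2)
      ≤ ∫⁻ x, ∫⁻ y, ENNReal.ofReal (η (x - y)) * ENNReal.ofReal (g y ^ 2) :=
        lintegral_mono fun x => hη.conv_sq_le hg x
    _ = ∫⁻ y, ∫⁻ x, ENNReal.ofReal (η (x - y)) * ENNReal.ofReal (g y ^ 2) := by
        refine lintegral_lintegral_swap ?_
        refine AEMeasurable.mul (M := ℝ≥0∞) (f := fun p : R2 × R2 => ENNReal.ofReal (η (p.1 - p.2)))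
          (g := fun p : R2 × R2 => ENNReal.ofReal (g p.2 ^ 2)) ?_ ?_
        · have : Continuous fun p : R2 × R2 => η (p.1 - p.2) := hη.test.continuous.comp (by fun_prop)
          exact this.measurable.ennreal_ofReal.aemeasurable
        · have h1 : AEMeasurable (fun y => ENNReal.ofReal (g y ^ 2)) volume :=
            (hg.aemeasurable.pow_const 2).ennreal_ofReal
          exact h1.comp_quasiMeasurePreserving Measure.quasiMeasurePreserving_snd
    _ = ∫⁻ y, ENNReal.ofReal (g y ^ 2) := by
        congr 1; ext y
        have hm : Measurable fun x => ENNReal.ofReal (η (x - y)) :=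
          (hη.test.continuous.comp (by fun_prop : Continuous fun x => x - y)).measurable.ennreal_ofReal
        rw [lintegral_mul_const _ hm, lintegral_sub_right_eq_self
          (μ := volume) (fun x => ENNReal.ofReal (η x)) y]
        have := hη.lintegral_eq 0
        simp only [zero_sub] at this
        rw [← lintegral_neg_eq_self (μ := volume) (fun x => ENNReal.ofReal (η x)), this, one_mul]

/-- The squared length of the classical gradient. -/
def gradSq (v : R2 → ℝ) (x : R2) : ℝ := ∑ d, pderiv d v x ^ 2

theorem gradSq_nonneg (v : R2 → ℝ) (x : R2) : 0 ≤ gradSq v x :=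
  Finset.sum_nonneg fun _ _ => sq_nonneg _

theorem continuous_gradSq {v : R2 → ℝ} (h : ContDiff ℝ ∞ v) : Continuous (gradSq v) := by
  unfold gradSq
  exact continuous_finsetSum _ fun d _ => (contDiff_pderiv h d).continuous.pow 2

theorem measurable_gradSq {v : R2 → ℝ} (h : ContDiff ℝ ∞ v) :
    Measurable fun x => ENNReal.ofReal (gradSq v x) :=
  (continuous_gradSq h).measurable.ennreal_ofReal

/-- Smoothing of a Sobolev function at scale `ε`. -/
theorem exists_smoothing {E : Set R2} (hE : IsOpen E) {u : R2 → ℝ} {g : Fin 2 → R2 → ℝ}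
    (hu : IntegrableOn u E) (hg : ∀ d, HasWeakDeriv E (unitIdx d) u (g d))
    (hg2 : ∀ d, AEStronglyMeasurable (g d) (volume.restrict E)) {ε : ℝ} (hε : 0 < ε) :
    ∃ w : R2 → ℝ, ContDiff ℝ ∞ w ∧
      (∀ x a δ, 0 ≤ δ → (∀ y ∈ Metric.ball x ε, |E.indicator u y - a| ≤ δ) → |w x - a| ≤ δ) ∧
      ∀ S, MeasurableSet S → (∀ x ∈ S, Metric.closedBall x ε ⊆ E) →
        ∫⁻ x in S, ENNReal.ofReal (gradSq w x) ≤ ∫⁻ x in E, ENNReal.ofReal (∑ d, g d x ^ 2) := by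
  obtain ⟨η, hη⟩ := exists_isMollifier hε
  have hi : Integrable (E.indicator u) := (integrable_indicator_iff hE.measurableSet).2 hu
  refine ⟨conv η (E.indicator u), contDiff_conv hη.test hi.locallyIntegrable, ?_, ?_⟩
  · intro x a δ hδ h
    exact hη.abs_conv_sub_le hi.1 hδ h
  · intro S hS hSE
    have hgm : ∀ d, AEStronglyMeasurable (E.indicator (g d)) volume := fun d =>
      (aestronglyMeasurable_indicator_iff hE.measurableSet).2 (hg2 d)
    have hcm : ∀ d, AEMeasurable (fun x => ENNReal.ofReal (conv η (E.indicator (g d)) x ^ 2))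
        (volume.restrict S) := fun d => by
      have h1 : AEStronglyMeasurable (pderiv d (conv η (E.indicator u))) (volume.restrict S) :=
        (contDiff_pderiv (contDiff_conv hη.test hi.locallyIntegrable) d).continuous.aestronglyMeasurable
      have h2 : AEStronglyMeasurable (conv η (E.indicator (g d))) (volume.restrict S) := by
        refine h1.congr ?_
        filter_upwards [ae_restrict_mem hS] with x hx
        exact (hg d).pderiv_conv hE.measurableSet hu hη.test hη.tsupport_subset (hSE x hx)
      exact (h2.aemeasurable.pow_const 2).ennreal_ofReal
    calc ∫⁻ x in S, ENNReal.ofReal (gradSq (conv η (E.indicator u)) x)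
        = ∫⁻ x in S, ∑ d, ENNReal.ofReal (conv η (E.indicator (g d)) x ^ 2) := by
          refine setLIntegral_congr_fun hS fun x hx => ?_
          rw [gradSq, ENNReal.ofReal_sum_of_nonneg fun _ _ => sq_nonneg _]
          refine Finset.sum_congr rfl fun d _ => ?_
          rw [(hg d).pderiv_conv hE.measurableSet hu hη.test hη.tsupport_subset (hSE x hx)]
      _ = ∑ d, ∫⁻ x in S, ENNReal.ofReal (conv η (E.indicator (g d)) x ^ 2) :=
          lintegral_finsetSum' _ fun d _ => hcm d
      _ ≤ ∑ d, ∫⁻ x in E, ENNReal.ofReal (g d x ^ 2) := by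
          refine Finset.sum_le_sum fun d _ => ?_
          refine (setLIntegral_le_lintegral _ _).trans ((hη.lintegral_conv_sq_le (hgm d)).trans_eq ?_)
          rw [← lintegral_indicator hE.measurableSet]
          congr 1; ext x
          by_cases hx : x ∈ E <;> simp [hx]
      _ = ∫⁻ x in E, ∑ d, ENNReal.ofReal (g d x ^ 2) :=
          (lintegral_finsetSum' _ fun d _ =>
            ((hg2 d).aemeasurable.pow_const 2).ennreal_ofReal).symm
      _ = _ := by
          congr 1; ext x
          rw [ENNReal.ofReal_sum_of_nonneg fun _ _ => sq_nonneg _]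

theorem fderiv_apply_eq_sum (w : R2 → ℝ) (x v : R2) :
    fderiv ℝ w x v = ∑ d, v d * pderiv d w x := by
  have hv : v = ∑ d, v d • EuclideanSpace.single d (1 : ℝ) := by
    ext i
    fin_cases i <;> simp
  conv_lhs => rw [hv]
  rw [map_sum]
  simp [pderiv]

theorem sq_fderiv_apply_le (w : R2 → ℝ) (x v : R2) :
    (fderiv ℝ w x v) ^ 2 ≤ ‖v‖ ^ 2 * gradSq w x := by
  rw [fderiv_apply_eq_sum, EuclideanSpace.norm_sq_eq, gradSq]
  simp only [Real.norm_eq_abs, sq_abs]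
  exact Finset.sum_mul_sq_le_sq_mul_sq _ _ _

/-! ### Slicing -/

theorem measurePreserving_pair :
    MeasurePreserving (fun x : R2 => (x 0, x 1)) volume (volume.prod volume) := by
  have h1 := PiLp.volume_preserving_ofLp (Fin 2)
  have h2 := volume_preserving_finTwoArrow ℝ
  exact h2.comp h1

theorem lintegral_eq_iterated {f : R2 → ℝ≥0∞} (hf : Measurable f) :
    ∫⁻ x, f x = ∫⁻ t, ∫⁻ s, f !₂[s, t] := by
  have hm : Measurable fun p : ℝ × ℝ => f !₂[p.1, p.2] := by
    refine hf.comp ?_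
    have : Continuous fun p : ℝ × ℝ => (!₂[p.1, p.2] : R2) := by
      fun_prop
    exact this.measurable
  have h1 := measurePreserving_pair.lintegral_comp hm
  have h2 : ∀ x : R2, !₂[x 0, x 1] = x := fun x => by ext i; fin_cases i <;> rfl
  simp only [h2] at h1
  rw [h1, lintegral_prod_symm' _ hm]

theorem pow_two_add_le (a b : ℝ≥0∞) : (a + b) ^ 2 ≤ 2 * a ^ 2 + 2 * b ^ 2 := by
  have := ENNReal.rpow_add_le_mul_rpow_add_rpow a b (p := 2) (by norm_num)
  norm_num at this
  rwa [mul_add] at this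

/-- The fundamental theorem of calculus, started at the last point to the left of `s` that is
outside `O`. This point exists because `O` is open and bounded below, and everything between it and
`s` belongs to `O`. -/
theorem ofReal_abs_le_of_section {O : Set ℝ} (hO : IsOpen O) (hb : BddBelow O) {f f' : ℝ → ℝ}
    (hf : ∀ s, HasDerivAt f (f' s) s) (hf' : Continuous f') {δ : ℝ}
    (h : ∀ s, s ∉ O → |f s| ≤ δ) (s : ℝ) (hs : s ∈ O) :
    ENNReal.ofReal |f s| ≤ ENNReal.ofReal δ + ∫⁻ r in O, ENNReal.ofReal |f' r| := by
  obtain ⟨m, hm⟩ := hb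
  set A : Set ℝ := {r | r ≤ s ∧ r ∉ O}
  have hAc : IsClosed A := isClosed_Iic.inter hO.isClosed_compl
  have hAn : A.Nonempty := ⟨m - 1, by
    refine ⟨by linarith [hm hs], fun h' => by linarith [hm h']⟩⟩
  have hAb : BddAbove A := ⟨s, fun r hr => hr.1⟩
  have h0 := hAc.csSup_mem hAn hAb
  set s₀ := sSup A
  have hsub : Ioc s₀ s ⊆ O := by
    intro r hr
    by_contra hrO
    exact absurd (le_csSup hAb (show r ∈ A from ⟨hr.2, hrO⟩)) (not_le.2 hr.1)
  have hint : ∫ r in s₀..s, f' r = f s - f s₀ :=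
    intervalIntegral.integral_eq_sub_of_hasDerivAt (fun r _ => hf r) (hf'.intervalIntegrable _ _)
  rw [intervalIntegral.integral_of_le h0.1] at hint
  have e : f s = f s₀ + ∫ r in Ioc s₀ s, f' r := by rw [hint]; ring
  have hen : ∀ t : ℝ, ENNReal.ofReal |t| = ‖t‖ₑ := fun t => by
    rw [← Real.norm_eq_abs, ofReal_norm]
  calc ENNReal.ofReal |f s| ≤ ENNReal.ofReal |f s₀| + ENNReal.ofReal |∫ r in Ioc s₀ s, f' r| := by
        rw [← ENNReal.ofReal_add (abs_nonneg _) (abs_nonneg _), e]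
        exact ENNReal.ofReal_le_ofReal (abs_add_le _ _)
    _ ≤ ENNReal.ofReal δ + ∫⁻ r in O, ENNReal.ofReal |f' r| := by
        gcongr
        · exact h s₀ h0.2
        · simp only [hen]
          exact (enorm_integral_le_lintegral_enorm _).trans (lintegral_mono_set hsub)

/-- Slicing by horizontal lines. On each section, `v` is at most `δ` plus the integral of `|∂₀v|`
over the section. Each section has measure at most `h`: Cauchy-Schwarz costs one factor `h`, the
integration of the resulting constant over the section another. Only the diameter of `O` matters,
not its shape. -/
theorem friedrichs_smooth {O : Set R2} (hO : IsOpen O) {h : ℝ}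
    (hd : ∀ x ∈ O, ∀ y ∈ O, dist x y ≤ h) {v : R2 → ℝ} (hv : ContDiff ℝ ∞ v) {δ : ℝ}
    (hδ0 : 0 ≤ δ) (hδ : ∀ x, x ∉ O → |v x| ≤ δ) :
    ∫⁻ x in O, ENNReal.ofReal (v x ^ 2) ≤
      ENNReal.ofReal (2 * δ ^ 2) * volume O +
        ENNReal.ofReal (2 * h ^ 2) * ∫⁻ x in O, ENNReal.ofReal (gradSq v x) := by
  rcases O.eq_empty_or_nonempty with rfl | ⟨x₀, hx₀⟩
  · simp
  have hh : 0 ≤ h := dist_nonneg.trans (hd x₀ hx₀ x₀ hx₀)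
  have hline : ∀ t, Continuous fun s : ℝ => (!₂[s, t] : R2) := fun t => by fun_prop
  have hdist : ∀ s s' t, dist (!₂[s, t] : R2) !₂[s', t] = |s - s'| := by
    intro s s' t
    rw [EuclideanSpace.dist_eq, Fin.sum_univ_two]
    simp [Real.dist_eq, Real.sqrt_sq_eq_abs]
  set W : ℝ → Set ℝ := fun t => {s | !₂[s, t] ∈ O}
  have hWo : ∀ t, IsOpen (W t) := fun t => hO.preimage (hline t)
  have hWd : ∀ t, ∀ s ∈ W t, ∀ s' ∈ W t, |s - s'| ≤ h := fun t s hs s' hs' => by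
    rw [← hdist s s' t]; exact hd _ hs _ hs'
  have hWb : ∀ t, BddBelow (W t) := by
    intro t
    rcases (W t).eq_empty_or_nonempty with h' | ⟨s, hs⟩
    · rw [h']; exact bddBelow_empty
    · exact ⟨s - h, fun s' hs' => by linarith [(abs_le.1 (hWd t s hs s' hs')).2]⟩
  have hWv : ∀ t, volume (W t) ≤ ENNReal.ofReal h := by
    intro t
    refine (Real.volume_le_diam _).trans ?_
    refine Metric.ediam_le fun s hs s' hs' => ?_
    rw [edist_dist, Real.dist_eq]
    exact ENNReal.ofReal_le_ofReal (hWd t s hs s' hs')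
  have hderiv : ∀ t s, HasDerivAt (fun s : ℝ => v !₂[s, t]) (pderiv 0 v !₂[s, t]) s := by
    intro t s
    have h1 : HasFDerivAt v (fderiv ℝ v !₂[s, t]) !₂[s, t] :=
      (hv.differentiable (by simp)).differentiableAt.hasFDerivAt
    have h2 : HasDerivAt (fun s : ℝ => (!₂[s, t] : R2)) (EuclideanSpace.single 0 1) s := by
      have : (fun s : ℝ => (!₂[s, t] : R2)) =
          fun s => !₂[0, t] + s • EuclideanSpace.single 0 (1 : ℝ) := by
        ext s i; fin_cases i <;> simp
      rw [this]
      simpa using ((hasDerivAt_id s).smul_const (EuclideanSpace.single 0 (1 : ℝ))).const_add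
        (!₂[0, t] : R2)
    exact h1.comp_hasDerivAt s h2
  have hp : Continuous (pderiv 0 v) := (contDiff_pderiv hv 0).continuous
  have key : ∀ t, ∫⁻ s in W t, ENNReal.ofReal (v !₂[s, t] ^ 2) ≤
      ENNReal.ofReal (2 * δ ^ 2) * volume (W t) + ENNReal.ofReal (2 * h ^ 2) *
        ∫⁻ s in W t, ENNReal.ofReal (gradSq v !₂[s, t]) := by
    intro t
    set I := ∫⁻ r in W t, ENNReal.ofReal |pderiv 0 v !₂[r, t]| with hI
    have hm1 : Measurable fun r => ENNReal.ofReal |pderiv 0 v !₂[r, t]| :=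
      ((hp.comp (hline t)).abs).measurable.ennreal_ofReal
    have hI2 : I ^ 2 ≤ ENNReal.ofReal h * ∫⁻ s in W t, ENNReal.ofReal (gradSq v !₂[s, t]) := by
      have := lintegral_mul_sq_le (volume.restrict (W t)) (f := fun _ => 1) aemeasurable_const
        hm1.aemeasurable
      simp only [one_mul, one_pow, lintegral_const, Measure.restrict_apply_univ] at this
      refine this.trans ?_
      gcongr with s
      · exact hWv t
      · rw [← ENNReal.ofReal_pow (abs_nonneg _), sq_abs]
        refine ENNReal.ofReal_le_ofReal ?_
        exact Finset.single_le_sum (f := fun d => pderiv d v !₂[s, t] ^ 2)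
          (fun _ _ => sq_nonneg _) (Finset.mem_univ (0 : Fin 2))
    have hpt : ∀ s ∈ W t, ENNReal.ofReal (v !₂[s, t] ^ 2) ≤
        2 * ENNReal.ofReal δ ^ 2 + 2 * I ^ 2 := by
      intro s hs
      have := ofReal_abs_le_of_section (hWo t) (hWb t) (hderiv t) (hp.comp (hline t))
        (fun s hs => hδ _ hs) s hs
      calc ENNReal.ofReal (v !₂[s, t] ^ 2) = ENNReal.ofReal |v !₂[s, t]| ^ 2 := by
            rw [← ENNReal.ofReal_pow (abs_nonneg _), sq_abs]
        _ ≤ (ENNReal.ofReal δ + I) ^ 2 := by gcongr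
        _ ≤ _ := pow_two_add_le _ _
    calc ∫⁻ s in W t, ENNReal.ofReal (v !₂[s, t] ^ 2)
        ≤ ∫⁻ s in W t, (2 * ENNReal.ofReal δ ^ 2 + 2 * I ^ 2) :=
          setLIntegral_mono' (hWo t).measurableSet hpt
      _ = 2 * ENNReal.ofReal δ ^ 2 * volume (W t) + 2 * I ^ 2 * volume (W t) := by
          rw [lintegral_const, Measure.restrict_apply_univ, add_mul]
      _ ≤ 2 * ENNReal.ofReal δ ^ 2 * volume (W t) + 2 * (ENNReal.ofReal h *
            ∫⁻ s in W t, ENNReal.ofReal (gradSq v !₂[s, t])) * ENNReal.ofReal h := by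
          gcongr; exact hWv t
      _ = _ := by
          rw [ENNReal.ofReal_mul (by norm_num), ENNReal.ofReal_mul (by norm_num),
            ENNReal.ofReal_pow hδ0, ENNReal.ofReal_pow hh, ENNReal.ofReal_ofNat]
          ring
  have hconv : ∀ f : R2 → ℝ≥0∞, Measurable f →
      ∫⁻ x in O, f x = ∫⁻ t, ∫⁻ s in W t, f !₂[s, t] := by
    intro f hf
    rw [← lintegral_indicator hO.measurableSet,
      lintegral_eq_iterated (hf.indicator hO.measurableSet)]
    congr 1; ext t
    rw [← lintegral_indicator (hWo t).measurableSet]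
    rfl
  have hmeas : ∀ f : R2 → ℝ≥0∞, Measurable f →
      Measurable fun t => ∫⁻ s in W t, f !₂[s, t] := by
    intro f hf
    have h0 : ∀ t, ∫⁻ s in W t, f !₂[s, t] = ∫⁻ s, O.indicator f !₂[s, t] := by
      intro t
      rw [← lintegral_indicator (hWo t).measurableSet]
      rfl
    simp only [h0]
    have : Continuous fun p : ℝ × ℝ => (!₂[p.2, p.1] : R2) := by fun_prop
    exact Measurable.lintegral_prod_right' (f := fun p : ℝ × ℝ => O.indicator f !₂[p.2, p.1])
      ((hf.indicator hO.measurableSet).comp this.measurable)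
  have hvol : volume O = ∫⁻ t, volume (W t) := by
    have := hconv (fun _ => 1) measurable_const
    simpa using this
  have hvm : Measurable fun x => ENNReal.ofReal (v x ^ 2) :=
    (hv.continuous.pow 2).measurable.ennreal_ofReal
  have hm1 : Measurable fun t => volume (W t) := by
    have := hmeas (fun _ => 1) measurable_const
    simpa using this
  rw [hconv _ hvm, hconv _ (measurable_gradSq hv), hvol]
  refine (lintegral_mono key).trans_eq ?_
  rw [lintegral_add_left (hm1.const_mul _), lintegral_const_mul _ hm1,
    lintegral_const_mul _ (hmeas _ (measurable_gradSq hv))]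

/-! ### Near the boundary -/

/-- The segment from `y` to `z` is connected, so it cannot pass from the interior to the exterior
without meeting the frontier. -/
theorem exists_frontier_dist_le {E : Set R2} {y z : R2} (hy : y ∈ E) (hz : z ∉ E) :
    ∃ p ∈ frontier E, dist y p ≤ dist y z := by
  have hs : IsPreconnected (segment ℝ y z) := (convex_segment y z).isPreconnected
  obtain ⟨p, hp, hpf⟩ : ∃ p ∈ segment ℝ y z, p ∈ frontier E := by
    by_contra! hcon
    have hy' : y ∈ interior E := by
      by_contra h
      exact hcon y (left_mem_segment ℝ y z) ⟨subset_closure hy, h⟩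
    have hz' : z ∈ (closure E)ᶜ := fun h =>
      hcon z (right_mem_segment ℝ y z) ⟨h, fun h' => hz (interior_subset h')⟩
    obtain ⟨p, -, hp1, hp2⟩ := hs _ _ isOpen_interior isClosed_closure.isOpen_compl
      (fun p hp => by
        by_contra h
        rw [mem_union, not_or, mem_compl_iff, not_not] at h
        exact hcon p hp ⟨h.2, h.1⟩)
      ⟨y, left_mem_segment ℝ y z, hy'⟩ ⟨z, right_mem_segment ℝ y z, hz'⟩
    exact hp2 (subset_closure (interior_subset hp1))
  refine ⟨p, hpf, ?_⟩
  have := dist_add_dist_of_mem_segment hp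
  linarith [dist_nonneg (x := p) (y := z)]

/-- The points of `E` at distance greater than `ε` from the complement of `E`. -/
def innerPart (E : Set R2) (ε : ℝ) : Set R2 := {x | ε < Metric.infDist x Eᶜ}

theorem isOpen_innerPart (E : Set R2) (ε : ℝ) : IsOpen (innerPart E ε) :=
  isOpen_lt continuous_const (Metric.continuous_infDist_pt _)

theorem closedBall_subset_of_mem_innerPart {E : Set R2} {ε : ℝ} {x : R2}
    (hx : x ∈ innerPart E ε) : Metric.closedBall x ε ⊆ E := by
  intro y hy
  by_contra hyE
  have h1 : Metric.infDist x Eᶜ ≤ dist x y := Metric.infDist_le_dist_of_mem hyE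
  rw [Metric.mem_closedBall, dist_comm] at hy
  exact absurd (h1.trans hy) (not_le.2 hx)

theorem innerPart_subset {E : Set R2} {ε : ℝ} (hε : 0 ≤ ε) : innerPart E ε ⊆ E := fun _ hx =>
  closedBall_subset_of_mem_innerPart hx (Metric.mem_closedBall_self hε)

/-- Some `z` outside `E` is within `2 * ε` of `x`, hence within `3 * ε` of `y`, and the segment from
`y` to `z` meets the frontier. This is the source of the `3 * ε` in `exists_scale`. -/
theorem exists_frontier_near {E : Set R2} (hb : Bornology.IsBounded E) {ε : ℝ} (hε : 0 < ε)
    {x y : R2} (hx : x ∉ innerPart E ε) (hy : y ∈ E) (hxy : dist y x < ε) :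
    ∃ p ∈ frontier E, dist y p < 3 * ε := by
  have hne : (Eᶜ).Nonempty := by
    by_contra h
    rw [not_nonempty_iff_eq_empty, compl_empty_iff] at h
    rw [h] at hb
    exact NormedSpace.unbounded_univ ℝ R2 hb
  have h1 : Metric.infDist x Eᶜ < 2 * ε := by
    have : ¬ ε < Metric.infDist x Eᶜ := hx
    linarith
  obtain ⟨z, hz, hxz⟩ := (Metric.infDist_lt_iff hne).1 h1
  obtain ⟨p, hp, hpy⟩ := exists_frontier_dist_le hy hz
  exact ⟨p, hp, by linarith [dist_triangle y x z]⟩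

/-- Uniform continuity up to the boundary, in the form needed for mollification. -/
theorem exists_scale {E : Set R2} (hb : Bornology.IsBounded E) {u : R2 → ℝ}
    (hu : ContinuousOn u (closure E)) {κ : ℝ} (hκ : 0 < κ) :
    ∃ ε > 0, ∀ x ∈ closure E, ∀ y ∈ closure E, dist x y < 3 * ε → |u x - u y| ≤ κ := by
  have hc : IsCompact (closure E) := hb.isCompact_closure
  have := Metric.uniformContinuousOn_iff.1 (hc.uniformContinuousOn_of_continuous hu) κ hκ
  obtain ⟨ρ, hρ, h⟩ := this
  refine ⟨ρ / 3, by positivity, fun x hx y hy hxy => ?_⟩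
  have := h x hx y hy (by linarith)
  rw [Real.dist_eq] at this
  exact this.le

theorem abs_le_near_frontier {E : Set R2} (hb : Bornology.IsBounded E) {u : R2 → ℝ} {δ κ ε : ℝ}
    (hε : 0 < ε) (hδ : ∀ x ∈ frontier E, |u x| ≤ δ)
    (hscale : ∀ x ∈ closure E, ∀ y ∈ closure E, dist x y < 3 * ε → |u x - u y| ≤ κ) {x y : R2}
    (hx : x ∉ innerPart E ε) (hy : y ∈ E) (hxy : dist y x < ε) : |u y| ≤ δ + κ := by
  obtain ⟨p, hp, hpy⟩ := exists_frontier_near hb hε hx hy hxy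
  have h1 := hscale y (subset_closure hy) p (frontier_subset_closure hp) hpy
  have h2 := hδ p hp
  have : |u y| ≤ |u y - u p| + |u p| := by
    calc |u y| = |(u y - u p) + u p| := by ring_nf
      _ ≤ _ := abs_add_le _ _
  linarith

theorem integrableOn_of_continuousOn_closure {E : Set R2} (hb : Bornology.IsBounded E) {u : R2 → ℝ}
    (hu : ContinuousOn u (closure E)) : IntegrableOn u E :=
  (hu.integrableOn_compact hb.isCompact_closure).mono_set subset_closure

/-- Friedrichs' inequality for a Sobolev function, continuous up to the boundary and small there. -/
theorem friedrichs_sobolev {E : Set R2} (hE : IsOpen E) (hb : Bornology.IsBounded E) {u : R2 → ℝ}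
    (hu : ContinuousOn u (closure E)) {g : Fin 2 → R2 → ℝ}
    (hg : ∀ d, HasWeakDeriv E (unitIdx d) u (g d))
    (hg2 : ∀ d, AEStronglyMeasurable (g d) (volume.restrict E)) {δ : ℝ} (hδ0 : 0 ≤ δ)
    (hδ : ∀ x ∈ frontier E, |u x| ≤ δ) :
    ∫⁻ x in E, ENNReal.ofReal (u x ^ 2) ≤ ENNReal.ofReal (7 * δ ^ 2) * volume E +
      ENNReal.ofReal (4 * Metric.diam E ^ 2) * ∫⁻ x in E, ENNReal.ofReal (∑ d, g d x ^ 2) := by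
  have hvol : volume E ≠ ⊤ := hb.measure_lt_top.ne
  -- The margin `δ' - δ` absorbs the modulus of continuity of `u` at the mollification scale; it is
  -- sent to zero afterwards.
  suffices H : ∀ δ' > δ, ∫⁻ x in E, ENNReal.ofReal (u x ^ 2) ≤
      ENNReal.ofReal (7 * δ' ^ 2) * volume E +
      ENNReal.ofReal (4 * Metric.diam E ^ 2) * ∫⁻ x in E, ENNReal.ofReal (∑ d, g d x ^ 2) by
    have ht : Filter.Tendsto (fun δ' : ℝ => ENNReal.ofReal (7 * δ' ^ 2) * volume E +
        ENNReal.ofReal (4 * Metric.diam E ^ 2) * ∫⁻ x in E, ENNReal.ofReal (∑ d, g d x ^ 2))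
        (nhdsWithin δ (Ioi δ)) (nhds (ENNReal.ofReal (7 * δ ^ 2) * volume E +
        ENNReal.ofReal (4 * Metric.diam E ^ 2) *
          ∫⁻ x in E, ENNReal.ofReal (∑ d, g d x ^ 2))) := by
      refine Filter.Tendsto.mono_left ?_ nhdsWithin_le_nhds
      refine Filter.Tendsto.add ?_ tendsto_const_nhds
      refine ENNReal.Tendsto.mul_const ?_ (Or.inr hvol)
      refine ENNReal.tendsto_ofReal ?_
      exact (continuous_const.mul (continuous_pow 2)).tendsto _
    refine ge_of_tendsto ht ?_
    filter_upwards [self_mem_nhdsWithin] with δ' hδ' using H δ' hδ'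
  intro δ' hδ'
  obtain ⟨ε, hε, hscale⟩ := exists_scale hb hu (sub_pos.2 hδ')
  obtain ⟨w, hw, hw1, hw2⟩ := exists_smoothing hE
    (integrableOn_of_continuousOn_closure hb hu) hg hg2 hε
  have hδ'0 : 0 ≤ δ' := hδ0.trans hδ'.le
  have hnear : ∀ x y, x ∉ innerPart E ε → y ∈ E → dist y x < ε → |u y| ≤ δ' := by
    intro x y hx hy hxy
    have := abs_le_near_frontier hb hε hδ hscale hx hy hxy
    linarith
  have hoff : ∀ x, x ∉ innerPart E ε → |w x| ≤ δ' := by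
    intro x hx
    have := hw1 x 0 δ' hδ'0 (fun y hy => by
      by_cases hyE : y ∈ E
      · simpa [hyE] using hnear x y hx hyE (Metric.mem_ball.1 hy)
      · simpa [hyE] using hδ'0)
    simpa using this
  have hsubE := innerPart_subset (E := E) hε.le
  have hon : ∀ x ∈ innerPart E ε, |w x - u x| ≤ δ' := by
    intro x hx
    refine hw1 x (u x) δ' hδ'0 fun y hy => ?_
    have hyE : y ∈ E := closedBall_subset_of_mem_innerPart hx (Metric.ball_subset_closedBall hy)
    have hxE := hsubE hx
    rw [indicator_of_mem hyE]
    have := hscale y (subset_closure hyE) x (subset_closure hxE)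
      (by have := Metric.mem_ball.1 hy; linarith)
    linarith
  set O := innerPart E ε
  have hOo : IsOpen O := isOpen_innerPart E ε
  have hfr := friedrichs_smooth hOo (h := Metric.diam E)
    (fun x hx y hy => Metric.dist_le_diam_of_mem hb (hsubE hx) (hsubE hy)) hw hδ'0 hoff
  have hen := hw2 O hOo.measurableSet fun x hx => closedBall_subset_of_mem_innerPart hx
  -- On the inner part `w` is within `δ'` of `u`, whence `u² ≤ 2w² + 2δ'²`; elsewhere in `E` the
  -- frontier is near and `|u| ≤ δ'`. Friedrichs' inequality is applied to `w` on the inner part: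
  -- there the energy of `w` is controlled, and off it `|w| ≤ δ'`.
  have hpt : ∀ x ∈ E, ENNReal.ofReal (u x ^ 2) ≤
      O.indicator (fun x => 2 * ENNReal.ofReal (w x ^ 2)) x + ENNReal.ofReal (2 * δ' ^ 2) := by
    intro x hx
    by_cases hxO : x ∈ O
    · rw [indicator_of_mem hxO, ← ENNReal.ofReal_ofNat, ← ENNReal.ofReal_mul (by norm_num),
        ← ENNReal.ofReal_add (by positivity) (by positivity)]
      refine ENNReal.ofReal_le_ofReal ?_
      have h1 : (w x - u x) ^ 2 ≤ δ' ^ 2 := sq_le_sq' (by linarith [(abs_le.1 (hon x hxO)).1])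
        (abs_le.1 (hon x hxO)).2
      nlinarith [sq_nonneg (2 * w x - u x)]
    · rw [indicator_of_notMem hxO, zero_add]
      refine ENNReal.ofReal_le_ofReal ?_
      have h1 := abs_le.1 (hnear x x hxO hx (by simpa using hε))
      nlinarith [sq_le_sq' h1.1 h1.2]
  have hwm : Measurable fun x => ENNReal.ofReal (w x ^ 2) :=
    (hw.continuous.pow 2).measurable.ennreal_ofReal
  calc ∫⁻ x in E, ENNReal.ofReal (u x ^ 2)
      ≤ ∫⁻ x in E, (O.indicator (fun x => 2 * ENNReal.ofReal (w x ^ 2)) x +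
          ENNReal.ofReal (2 * δ' ^ 2)) := setLIntegral_mono' hE.measurableSet hpt
    _ ≤ 2 * (∫⁻ x in O, ENNReal.ofReal (w x ^ 2)) + ENNReal.ofReal (2 * δ' ^ 2) * volume E := by
        rw [lintegral_add_right _ measurable_const, lintegral_const, Measure.restrict_apply_univ]
        gcongr
        refine (setLIntegral_le_lintegral _ _).trans_eq ?_
        rw [lintegral_indicator hOo.measurableSet, lintegral_const_mul _ hwm]
    _ ≤ 2 * (ENNReal.ofReal (2 * δ' ^ 2) * volume E + ENNReal.ofReal (2 * Metric.diam E ^ 2) *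
          ∫⁻ x in E, ENNReal.ofReal (∑ d, g d x ^ 2)) + ENNReal.ofReal (2 * δ' ^ 2) * volume E := by
        gcongr
        refine hfr.trans ?_
        gcongr
    _ = ENNReal.ofReal (6 * δ' ^ 2) * volume E + ENNReal.ofReal (4 * Metric.diam E ^ 2) *
          ∫⁻ x in E, ENNReal.ofReal (∑ d, g d x ^ 2) := by
        rw [ENNReal.ofReal_mul (by norm_num), ENNReal.ofReal_mul (by norm_num),
          ENNReal.ofReal_mul (by norm_num), ENNReal.ofReal_mul (by norm_num)]
        simp only [ENNReal.ofReal_ofNat]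
        ring
    _ ≤ _ := by gcongr; norm_num

/-! ### A weak maximum principle -/

theorem hasDerivAt_line {w : R2 → ℝ} (hw : ContDiff ℝ ∞ w) (x : R2) (d : Fin 2) (t : ℝ) :
    HasDerivAt (fun t : ℝ => w (x + t • EuclideanSpace.single d (1 : ℝ)))
      (pderiv d w (x + t • EuclideanSpace.single d (1 : ℝ))) t := by
  have h1 : HasFDerivAt w (fderiv ℝ w (x + t • EuclideanSpace.single d (1 : ℝ)))
      (x + t • EuclideanSpace.single d (1 : ℝ)) :=
    (hw.differentiable (by simp)).differentiableAt.hasFDerivAt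
  have h2 : HasDerivAt (fun t : ℝ => x + t • EuclideanSpace.single d (1 : ℝ))
      (EuclideanSpace.single d 1) t := by
    simpa using ((hasDerivAt_id t).smul_const (EuclideanSpace.single d (1 : ℝ))).const_add x
  exact h1.comp_hasDerivAt t h2

/-- A positive second derivative at the critical point would make it a local minimum too; then `g`
would be locally constant and the second derivative zero. -/
theorem nonpos_of_isLocalMax {g g' : ℝ → ℝ} {c t : ℝ} (hg : ∀ s, HasDerivAt g (g' s) s)
    (hg' : HasDerivAt g' c t) (hmax : IsLocalMax g t) : c ≤ 0 := by
  by_contra! hc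
  have hd : deriv g = g' := funext fun s => (hg s).deriv
  have h0 : deriv g t = 0 := hmax.deriv_eq_zero
  have hmin : IsLocalMin g t := isLocalMin_of_deriv_deriv_pos (by rw [hd, hg'.deriv]; exact hc) h0
    (hg t).continuousAt
  have heq : g =ᶠ[nhds t] fun _ => g t := by
    filter_upwards [hmax, hmin] with s h1 h2 using le_antisymm h1 h2
  have h1 : deriv g =ᶠ[nhds t] fun _ => 0 := by
    have := heq.deriv
    simpa using this
  have h2 := h1.deriv_eq
  rw [hd, hg'.deriv] at h2
  simp at h2
  exact hc.ne' h2

/-- Adding `κ |x|²` makes the Laplacian strictly positive on `O`, so the perturbed function,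
maximised over a closed ball containing `O`, has no maximum point in `O`. At a maximum point outside
`O` the bound `δ` holds and `|x|² ≤ R²`; finally `κ` tends to zero. -/
theorem le_of_laplacian_eq_zero {w : R2 → ℝ} (hw : ContDiff ℝ ∞ w) {O : Set R2} (hO : IsOpen O)
    (hb : Bornology.IsBounded O) (hl : ∀ x ∈ O, pderiv 0 (pderiv 0 w) x + pderiv 1 (pderiv 1 w) x = 0)
    {δ : ℝ} (hδ : ∀ x, x ∉ O → w x ≤ δ) (x : R2) : w x ≤ δ := by
  by_cases hxO : x ∈ O
  swap
  · exact hδ x hxO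
  obtain ⟨R, hR⟩ := hb.subset_closedBall (0 : R2)
  have hcont : Continuous w := hw.continuous
  suffices H : ∀ κ > 0, w x ≤ δ + κ * R ^ 2 by
    have ht : Filter.Tendsto (fun κ : ℝ => δ + κ * R ^ 2) (nhdsWithin 0 (Ioi 0))
        (nhds (δ + 0 * R ^ 2)) :=
      (Continuous.tendsto (by fun_prop) _).mono_left nhdsWithin_le_nhds
    rw [zero_mul, add_zero] at ht
    refine ge_of_tendsto ht ?_
    filter_upwards [self_mem_nhdsWithin] with κ hκ using H κ hκ
  intro κ hκ
  set f : R2 → ℝ := fun x => w x + κ * (x 0 ^ 2 + x 1 ^ 2) with hf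
  have hfc : Continuous f := by
    have h0 : Continuous fun x : R2 => x 0 := by fun_prop
    have h1 : Continuous fun x : R2 => x 1 := by fun_prop
    exact hcont.add (continuous_const.mul ((h0.pow 2).add (h1.pow 2)))
  obtain ⟨z, hz, hmax⟩ := (isCompact_closedBall (0 : R2) R).exists_isMaxOn ⟨x, hR hxO⟩
    hfc.continuousOn
  have hle : w x ≤ f z := by
    refine le_trans ?_ (hmax (hR hxO))
    simp only [hf]
    nlinarith [sq_nonneg (x 0), sq_nonneg (x 1)]
  have hzn : z 0 ^ 2 + z 1 ^ 2 ≤ R ^ 2 := by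
    have h1 := mem_closedBall_zero_iff.1 hz
    have h2 := EuclideanSpace.norm_sq_eq z
    rw [Fin.sum_univ_two] at h2
    simp only [Real.norm_eq_abs, sq_abs] at h2
    rw [← h2]
    exact pow_le_pow_left₀ (norm_nonneg _) h1 2
  by_cases hzO : z ∈ O
  · exfalso
    have hloc : IsLocalMax f z := by
      filter_upwards [hO.mem_nhds hzO] with y hy using hmax (hR hy)
    have hsec : ∀ d : Fin 2, pderiv d (pderiv d w) z + 2 * κ ≤ 0 := by
      intro d
      have hline : Continuous fun t : ℝ => z + t • EuclideanSpace.single d (1 : ℝ) := by fun_prop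
      have e : ∀ t : ℝ, (z + t • EuclideanSpace.single d (1 : ℝ)) 0 ^ 2 +
          (z + t • EuclideanSpace.single d (1 : ℝ)) 1 ^ 2 =
          z 0 ^ 2 + z 1 ^ 2 + 2 * z d * t + t ^ 2 := by
        intro t
        fin_cases d <;> simp <;> ring
      refine nonpos_of_isLocalMax (g := fun t => f (z + t • EuclideanSpace.single d (1 : ℝ)))
        (g' := fun t => pderiv d w (z + t • EuclideanSpace.single d (1 : ℝ)) +
          κ * (2 * z d + 2 * t)) (t := 0) ?_ ?_ ?_
      · intro s
        simp only [hf, e]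
        refine (hasDerivAt_line hw z d s).add (HasDerivAt.const_mul κ ?_)
        have h1 := ((hasDerivAt_id s).const_mul (2 * z d)).const_add (z 0 ^ 2 + z 1 ^ 2)
        exact (h1.add (hasDerivAt_pow 2 s)).congr_deriv (by simp)
      · have h1 := hasDerivAt_line (contDiff_pderiv hw d) z d 0
        have h2 := (((hasDerivAt_id (0 : ℝ)).const_mul 2).const_add (2 * z d)).const_mul κ
        have := h1.add h2
        simp only [zero_smul, add_zero, mul_one, mul_comm κ 2] at this
        exact this
      · have : Filter.Tendsto (fun t : ℝ => z + t • EuclideanSpace.single d (1 : ℝ)) (nhds 0)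
            (nhds z) := by simpa using hline.tendsto 0
        have hl' := this.eventually hloc
        simpa [IsLocalMax, IsMaxFilter] using hl'
    have h0 := hsec 0
    have h1 := hsec 1
    linarith [hl z hzO]
  · have := hδ z hzO
    simp only [hf] at hle
    nlinarith

/-- A function that is continuous up to the boundary, vanishes there and is harmonic in the sense of
distributions vanishes identically. -/
theorem eq_zero_of_weaklyHarmonic {E : Set R2} (hE : IsOpen E) (hb : Bornology.IsBounded E)
    {v : R2 → ℝ} (hv : ContinuousOn v (closure E)) (h0 : ∀ x ∈ frontier E, v x = 0)
    (hl : ∀ φ, IsTestFunction E φ →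
      ∫ x in E, v x * (pderiv 0 (pderiv 0 φ) x + pderiv 1 (pderiv 1 φ) x) = 0) :
    ∀ x ∈ E, v x = 0 := by
  have key : ∀ v : R2 → ℝ, ContinuousOn v (closure E) → (∀ x ∈ frontier E, v x = 0) →
      (∀ φ, IsTestFunction E φ →
        ∫ x in E, v x * (pderiv 0 (pderiv 0 φ) x + pderiv 1 (pderiv 1 φ) x) = 0) →
      ∀ x ∈ E, v x ≤ 0 := by
    intro v hv h0 hl x hx
    refine le_of_forall_pos_le_add fun κ hκ => ?_
    rw [zero_add]
    obtain ⟨ε, hε, hscale⟩ := exists_scale hb hv (half_pos hκ)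
    obtain ⟨η, hη⟩ := exists_isMollifier hε
    have hi := integrableOn_of_continuousOn_closure hb hv
    have hi' : Integrable (E.indicator v) := (integrable_indicator_iff hE.measurableSet).2 hi
    have hnear : ∀ x y, x ∉ innerPart E ε → y ∈ E → dist y x < ε → |v y| ≤ κ / 2 := by
      intro x y hx hy hxy
      have := abs_le_near_frontier hb hε (δ := 0) (fun x hx => by simp [h0 x hx]) hscale hx hy hxy
      linarith
    have hoff : ∀ x, x ∉ innerPart E ε → conv η (E.indicator v) x ≤ κ / 2 := by
      intro x hx
      have := hη.abs_conv_sub_le hi'.1 (x := x) (a := 0) (δ := κ / 2) (by positivity) fun y hy => by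
        by_cases hyE : y ∈ E
        · simpa [hyE] using hnear x y hx hyE (Metric.mem_ball.1 hy)
        · simp [hyE]; positivity
      rw [sub_zero] at this
      exact (abs_le.1 this).2
    -- The mollified extension is classically harmonic on the inner part and at most `κ / 2` off it,
    -- hence at most `κ / 2` everywhere. On the inner part it is within `κ / 2` of `v`; off the
    -- inner part `v` itself is small.
    have hle := le_of_laplacian_eq_zero (contDiff_conv hη.test hi'.locallyIntegrable)
      (isOpen_innerPart E ε) (hb.subset (innerPart_subset hε.le))
      (fun x hx => laplacian_conv hE.measurableSet hi hl hη.test hη.tsupport_subset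
        (closedBall_subset_of_mem_innerPart hx)) hoff x
    by_cases hxO : x ∈ innerPart E ε
    · have := hη.abs_conv_sub_le hi'.1 (x := x) (a := v x) (δ := κ / 2) (by positivity)
        fun y hy => by
          have hyE : y ∈ E :=
            closedBall_subset_of_mem_innerPart hxO (Metric.ball_subset_closedBall hy)
          rw [indicator_of_mem hyE]
          exact hscale y (subset_closure hyE) x (subset_closure hx)
            (by have := Metric.mem_ball.1 hy; linarith)
      linarith [(abs_le.1 this).1]
    · linarith [(abs_le.1 (hnear x x hxO hx (by simpa using hε))).2]
  intro x hx
  refine le_antisymm (key v hv h0 hl x hx) ?_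
  have := key (fun x => -v x) hv.neg (fun x hx => by simp [h0 x hx]) (fun φ hφ => by
    simp only [neg_mul, integral_neg, hl φ hφ, neg_zero]) x hx
  linarith

/-! ### Functions with bounded weak gradient -/

theorem IsMollifier.abs_conv_le {η : R2 → ℝ} {ε : ℝ} (hη : IsMollifier η ε) {g : R2 → ℝ} {K : ℝ}
    (hg : ∀ᵐ y, |g y| ≤ K) (x : R2) : |conv η g x| ≤ K := by
  have hi : Integrable fun y => η (x - y) := hη.integrable.comp_sub_left x
  have h := norm_integral_le_of_norm_le (f := fun y => g y * η (x - y)) (hi.const_mul K) (by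
    filter_upwards [hg] with y hy
    rw [norm_mul, Real.norm_of_nonneg (hη.nonneg _), Real.norm_eq_abs]
    exact mul_le_mul_of_nonneg_right hy (hη.nonneg _))
  rw [integral_const_mul, integral_sub_left_eq_self, hη.integral_eq, mul_one] at h
  exact h

theorem norm_fderiv_le (w : R2 → ℝ) (x : R2) {K : ℝ} (hK : ∀ d, |pderiv d w x| ≤ K) :
    ‖fderiv ℝ w x‖ ≤ 2 * K := by
  have hK0 : 0 ≤ K := (abs_nonneg _).trans (hK 0)
  refine ContinuousLinearMap.opNorm_le_bound _ (by positivity) fun v => ?_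
  rw [fderiv_apply_eq_sum, Fin.sum_univ_two]
  have h0 : ∀ d, |v d * pderiv d w x| ≤ ‖v‖ * K := fun d => by
    rw [abs_mul]
    exact mul_le_mul (by simpa using PiLp.norm_apply_le v d) (hK d) (abs_nonneg _) (norm_nonneg _)
  calc ‖v 0 * pderiv 0 w x + v 1 * pderiv 1 w x‖ ≤ _ := abs_add_le _ _
    _ ≤ 2 * K * ‖v‖ := by linarith [h0 0, h0 1]

/-- A function with bounded weak gradient is Lipschitz along the segments of its domain, outside of
a null set of end points. -/
theorem exists_lipschitz_on_segments {U : Set R2} (hU : IsOpen U) {f : R2 → ℝ}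
    (hf : IntegrableOn f U) {g : Fin 2 → R2 → ℝ} (hg : ∀ d, HasWeakDeriv U (unitIdx d) f (g d))
    {K : ℝ} (hK0 : 0 ≤ K) (hK : ∀ d, ∀ᵐ x ∂volume.restrict U, |g d x| ≤ K) :
    ∃ S : Set R2, (∀ᵐ x, x ∈ U → x ∈ S) ∧ ∀ x ∈ S, ∀ y ∈ S, segment ℝ x y ⊆ U →
      |f x - f y| ≤ 2 * K * dist x y := by
  have hi : Integrable (U.indicator f) := (integrable_indicator_iff hU.measurableSet).2 hf
  set φ : ℕ → ContDiffBump (0 : R2) := fun n => stdBump (1 / ((n : ℝ) + 1)) (by positivity)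
  have hφ : Filter.Tendsto (fun n => (φ n).rOut) Filter.atTop (nhds 0) :=
    tendsto_one_div_add_atTop_nhds_zero_nat
  have hae := ContDiffBump.ae_convolution_tendsto_right_of_locallyIntegrable (K := 2)
    (μ := volume) hφ
    (Filter.Eventually.of_forall fun n => by
      change (1 / ((n : ℝ) + 1)) ≤ 2 * ((1 / ((n : ℝ) + 1)) / 2); linarith) hi.locallyIntegrable
  -- The exceptional set consists of the points where the mollifications fail to converge to `f`; it
  -- is null by Lebesgue differentiation.
  refine ⟨{x | x ∈ U ∧ Filter.Tendsto (fun n => conv ((φ n).normed volume) (U.indicator f) x)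
    Filter.atTop (nhds (f x))}, ?_, ?_⟩
  · filter_upwards [hae] with x hx hxU
    refine ⟨hxU, ?_⟩
    rw [indicator_of_mem hxU] at hx
    simpa only [conv_comm] using hx
  · rintro x ⟨hxU, hx⟩ y ⟨hyU, hy⟩ hseg
    have hgK : ∀ d, ∀ᵐ z, |U.indicator (g d) z| ≤ K := by
      intro d
      have := (ae_restrict_iff' hU.measurableSet).1 (hK d)
      filter_upwards [this] with z hz
      by_cases hzU : z ∈ U
      · rw [indicator_of_mem hzU]; exact hz hzU
      · rw [indicator_of_notMem hzU, abs_zero]; exact hK0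
    -- A compact segment in `U` has a closed neighbourhood in `U`. For small kernels the
    -- mollification therefore has gradient at most `2 * K` along the whole segment, and the mean
    -- value inequality passes to the limit at the two end points.
    have hcomp : IsCompact (segment ℝ x y) := by
      rw [segment_eq_image_lineMap]
      exact isCompact_Icc.image (AffineMap.lineMap_continuous)
    obtain ⟨ρ, hρ, hthick⟩ := hcomp.exists_cthickening_subset_open hU hseg
    have hlim : Filter.Tendsto (fun n => |conv ((φ n).normed volume) (U.indicator f) x -
        conv ((φ n).normed volume) (U.indicator f) y|) Filter.atTop (nhds |f x - f y|) :=
      (hx.sub hy).abs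
    refine le_of_tendsto hlim ?_
    filter_upwards [hφ.eventually (gt_mem_nhds hρ)] with n hn
    have hη := (φ n).isMollifier
    have hsm := contDiff_conv hη.test hi.locallyIntegrable
    have hconv : Convex ℝ (segment ℝ x y) := convex_segment x y
    have hbound : ∀ z ∈ segment ℝ x y,
        ‖fderiv ℝ (conv ((φ n).normed volume) (U.indicator f)) z‖ ≤ 2 * K := by
      intro z hz
      refine norm_fderiv_le _ _ fun d => ?_
      have hball : Metric.closedBall z (φ n).rOut ⊆ U :=
        ((Metric.closedBall_subset_cthickening hz _).trans
          (Metric.cthickening_mono hn.le _)).trans hthick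
      rw [(hg d).pderiv_conv hU.measurableSet hf hη.test hη.tsupport_subset hball]
      exact hη.abs_conv_le (hgK d) z
    have := hconv.norm_image_sub_le_of_norm_fderiv_le (𝕜 := ℝ)
      (fun z _ => (hsm.differentiable (by simp)).differentiableAt) hbound
      (right_mem_segment ℝ x y) (left_mem_segment ℝ x y)
    rwa [Real.norm_eq_abs, ← dist_eq_norm] at this

/-! ### Changes of variables -/

theorem lintegral_comp_smul_add {f : R2 → ℝ≥0∞} (hf : Measurable f) {c : ℝ} (hc : c ≠ 0) (w : R2) :
    ∫⁻ x, f (c • x + w) = ENNReal.ofReal ((c ^ 2)⁻¹) * ∫⁻ x, f x := by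
  have h1 : ∫⁻ x, f (c • x + w) = ∫⁻ y, f (y + w) ∂(Measure.map (fun x : R2 => c • x) volume) := by
    have hm : Measurable fun y => f (y + w) := hf.comp (measurable_id.add_const w)
    rw [lintegral_map hm (measurable_const_smul c)]
  rw [h1, Measure.map_addHaar_smul volume hc, lintegral_smul_measure,
    lintegral_add_right_eq_self (μ := volume) f w]
  simp [abs_of_nonneg (sq_nonneg c)]

/-- The oriented area spanned by two vectors. -/
def cross (τ w : R2) : ℝ := τ 0 * w 1 - τ 1 * w 0

/-- The parametrisation `(s, t) ↦ z + t • w + s • τ` is affine, with determinant `cross τ w`. -/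
theorem lintegral_affine_plane {f : R2 → ℝ≥0∞} (hf : Measurable f) {τ w : R2}
    (hd : cross τ w ≠ 0) (z : R2) :
    ∫⁻ t : ℝ, ∫⁻ s : ℝ, f (z + t • w + s • τ) =
      ENNReal.ofReal |(cross τ w)⁻¹| * ∫⁻ x, f x := by
  let L : R2 →ₗ[ℝ] R2 :=
    { toFun := fun x => x 1 • w + x 0 • τ
      map_add' := fun x y => by simp only [PiLp.add_apply, add_smul]; abel
      map_smul' := fun c x => by
        simp only [PiLp.smul_apply, smul_eq_mul, mul_smul, smul_add, RingHom.id_apply] }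
  have hL : ∀ x, L x = x 1 • w + x 0 • τ := fun _ => rfl
  have hdet : LinearMap.det L = cross τ w := by
    rw [← LinearMap.det_toMatrix (EuclideanSpace.basisFun (Fin 2) ℝ).toBasis,
      Matrix.det_fin_two]
    simp [LinearMap.toMatrix_apply, hL, cross]
    ring
  have hLm : Measurable L := (LinearMap.continuous_of_finiteDimensional L).measurable
  have h1 : ∫⁻ x, f (z + L x) = ENNReal.ofReal |(cross τ w)⁻¹| * ∫⁻ x, f x := by
    have e : ∫⁻ x, f (z + L x) = ∫⁻ y, f (z + y) ∂(Measure.map L volume) := by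
      have hm : Measurable fun y => f (z + y) := hf.comp (measurable_const_add z)
      rw [lintegral_map hm hLm]
    rw [e, Measure.map_linearMap_addHaar_eq_smul_addHaar volume (by rw [hdet]; exact hd),
      lintegral_smul_measure, lintegral_add_left_eq_self (μ := volume) f z, hdet, smul_eq_mul]
  have hm : Measurable fun x => f (z + L x) := hf.comp (hLm.const_add z)
  rw [← h1, lintegral_eq_iterated hm]
  simp only [hL]
  congr 1; ext t; congr 1; ext s
  simp [add_assoc]

theorem lintegral_comp_mul_left {f : ℝ → ℝ≥0∞} (hf : Measurable f) {c : ℝ} (hc : 0 < c) :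
    ∫⁻ s, f (c * s) = ENNReal.ofReal c⁻¹ * ∫⁻ s, f s := by
  have h1 : ∫⁻ x, f (c * x) = ∫⁻ y, f y ∂(Measure.map (fun x : ℝ => c * x) volume) := by
    rw [lintegral_map hf (measurable_const_mul c)]
  rw [h1, Real.map_volume_mul_left hc.ne', lintegral_smul_measure, abs_of_pos (inv_pos.2 hc),
    smul_eq_mul]

/-! ### Domains that are star-shaped with respect to a ball -/

/-- `D` is open and star-shaped with respect to every point of the ball. -/
def StarBall (D : Set R2) (z : R2) (r : ℝ) : Prop :=
  IsOpen D ∧ ∀ y ∈ Metric.ball z r, StarConvex ℝ y D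

/-- `StarBall` alone does not place the ball inside `D`: the empty set qualifies, and such empty
pieces do occur in `exists_uniform_cover`. -/
theorem StarBall.ball_subset {D : Set R2} {z : R2} {r : ℝ} (h : StarBall D z r)
    (hne : D.Nonempty) : Metric.ball z r ⊆ D := fun y hy => (h.2 y hy).mem hne

/-- Replace `y` by a nearby point `w` of `D` and move the pole from `z'` to `z' + (t / (1 - t)) • (y
- w)`, which is still in the open ball. The point on the new segment with parameter `t` is the same
as before. -/
theorem StarBall.mem_of_mem_closure {D : Set R2} {z : R2} {r : ℝ} (h : StarBall D z r) {y z' : R2}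
    (hy : y ∈ closure D) (hz' : z' ∈ Metric.ball z r) {t : ℝ} (ht0 : 0 ≤ t) (ht1 : t < 1) :
    z' + t • (y - z') ∈ D := by
  have h1t : 0 < 1 - t := by linarith
  have hop : ∀ᶠ w in nhds y, z' + (t / (1 - t)) • (y - w) ∈ Metric.ball z r := by
    have hc : Continuous fun w : R2 => z' + (t / (1 - t)) • (y - w) := by fun_prop
    have : Filter.Tendsto (fun w : R2 => z' + (t / (1 - t)) • (y - w)) (nhds y) (nhds z') := by
      simpa using hc.tendsto y
    exact this.eventually (Metric.isOpen_ball.mem_nhds hz')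
  obtain ⟨w, hw, hwD⟩ := mem_closure_iff_nhds.1 hy _ hop
  have := h.2 _ hw hwD h1t.le ht0 (by ring)
  convert this using 1
  rw [smul_add, smul_smul, mul_div_cancel₀ _ h1t.ne']
  module

/-- Smooth approximation on a star-shaped subdomain, without increase of the energy. -/
theorem StarBall.exists_smooth_approx {E : Set R2} (hE : IsOpen E) (hb : Bornology.IsBounded E)
    {u : R2 → ℝ} (hu : ContinuousOn u (closure E)) {g : Fin 2 → R2 → ℝ}
    (hg : ∀ d, HasWeakDeriv E (unitIdx d) u (g d))
    (hg2 : ∀ d, AEStronglyMeasurable (g d) (volume.restrict E)) {D : Set R2} {z : R2} {r : ℝ}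
    (hD : StarBall D z r) (hr : 0 < r) (hne : D.Nonempty) (hDE : D ⊆ E) {κ : ℝ} (hκ : 0 < κ) :
    ∃ v : R2 → ℝ, ContDiff ℝ ∞ v ∧ (∀ y ∈ closure D, |v y - u y| ≤ κ) ∧
      ∫⁻ x in D, ENNReal.ofReal (gradSq v x) ≤ ∫⁻ x in E, ENNReal.ofReal (∑ d, g d x ^ 2) := by
  obtain ⟨ε₁, hε₁, hscale⟩ := exists_scale hb hu (half_pos hκ)
  have hzr : z ∈ Metric.ball z r := Metric.mem_ball_self hr
  have hzE : z ∈ E := hDE (hD.ball_subset hne hzr)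
  set h := Metric.diam (closure E)
  have hh0 : 0 ≤ h := Metric.diam_nonneg
  have hdist : ∀ y ∈ closure D, dist y z ≤ h := fun y hy =>
    Metric.dist_le_diam_of_mem hb.closure (closure_mono hDE hy) (subset_closure hzE)
  set m : ℝ := min (1 / 2) (ε₁ / (h + 1)) with hm
  have hm0 : 0 < m := lt_min (by norm_num) (by positivity)
  have hm1 : m ≤ 1 / 2 := min_le_left _ _
  have hm2 : m * (h + 1) ≤ ε₁ := by
    have := min_le_right (1 / 2) (ε₁ / (h + 1))
    rwa [← hm, le_div_iff₀ (by positivity)] at this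
  set lam : ℝ := 1 - m with hlam
  have hlam0 : 0 < lam := by linarith
  set Φ : R2 → R2 := fun y => z + lam • (y - z) with hΦ
  have hΦc : Continuous Φ := by fun_prop
  have hΦD : ∀ y ∈ closure D, Φ y ∈ D := fun y hy =>
    hD.mem_of_mem_closure hy hzr hlam0.le (by linarith)
  have hΦu : ∀ y ∈ closure D, |u (Φ y) - u y| ≤ κ / 2 := by
    intro y hy
    refine hscale _ (subset_closure (hDE (hΦD y hy))) _ (closure_mono hDE hy) ?_
    have e : Φ y - y = -(m • (y - z)) := by simp only [hΦ, hlam]; module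
    rw [dist_eq_norm, e, norm_neg, norm_smul, Real.norm_of_nonneg hm0.le, ← dist_eq_norm]
    calc m * dist y z ≤ m * (h + 1) := by gcongr; linarith [hdist y hy]
      _ < 3 * ε₁ := by linarith
  have hK : IsCompact (Φ '' closure D) := (hb.subset hDE).isCompact_closure.image hΦc
  have hKE : Φ '' closure D ⊆ E := by
    rintro _ ⟨y, hy, rfl⟩; exact hDE (hΦD y hy)
  obtain ⟨ρ, hρ, hthick⟩ := hK.exists_cthickening_subset_open hE hKE
  have hε : 0 < min ρ ε₁ := lt_min hρ hε₁
  obtain ⟨w, hw, hw1, hw2⟩ := exists_smoothing hE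
    (integrableOn_of_continuousOn_closure hb hu) hg hg2 hε
  have hball : ∀ y ∈ closure D, Metric.closedBall (Φ y) (min ρ ε₁) ⊆ E := fun y hy =>
    ((Metric.closedBall_subset_cthickening (mem_image_of_mem Φ hy) _).trans
      (Metric.cthickening_mono (min_le_left _ _) _)).trans hthick
  have hwu : ∀ y ∈ closure D, |w (Φ y) - u (Φ y)| ≤ κ / 2 := by
    intro y hy
    refine hw1 _ _ _ (by positivity) fun x hx => ?_
    have hxE : x ∈ E := hball y hy (Metric.ball_subset_closedBall hx)
    rw [indicator_of_mem hxE]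
    refine hscale _ (subset_closure hxE) _ (subset_closure (hDE (hΦD y hy))) ?_
    have := Metric.mem_ball.1 hx
    linarith [min_le_right ρ ε₁]
  have hv : ContDiff ℝ ∞ fun y => w (Φ y) := hw.comp (by fun_prop)
  refine ⟨fun y => w (Φ y), hv, fun y hy => ?_, ?_⟩
  · calc |w (Φ y) - u y| = |(w (Φ y) - u (Φ y)) + (u (Φ y) - u y)| := by ring_nf
      _ ≤ _ := abs_add_le _ _
      _ ≤ κ := by linarith [hwu y hy, hΦu y hy]
  -- The Dirichlet energy in the plane is invariant under dilations: the factor `lam ^ 2` from the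
  -- gradient cancels against the change of area.
  · have hgr : ∀ y, gradSq (fun y => w (Φ y)) y = lam ^ 2 * gradSq w (Φ y) := by
      intro y
      have h1 : HasFDerivAt w (fderiv ℝ w (Φ y)) (Φ y) :=
        (hw.differentiable (by simp)).differentiableAt.hasFDerivAt
      have h2 : HasFDerivAt Φ (lam • ContinuousLinearMap.id ℝ R2) y := by
        have := (((hasFDerivAt_id (𝕜 := ℝ) y).sub_const z).const_smul lam).const_add z
        exact this
      have h3 : fderiv ℝ (fun y => w (Φ y)) y = _ := (h1.comp y h2).fderiv
      simp only [gradSq, pderiv, h3, Finset.mul_sum]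
      refine Finset.sum_congr rfl fun d _ => ?_
      simp [mul_pow]
    set S : Set R2 := {x | z + lam⁻¹ • (x - z) ∈ D}
    have hSo : IsOpen S := hD.1.preimage (by fun_prop : Continuous fun x : R2 => z + lam⁻¹ • (x - z))
    have hΦS : ∀ y, Φ y ∈ S ↔ y ∈ D := by
      intro y
      have : z + lam⁻¹ • (Φ y - z) = y := by
        simp only [hΦ, add_sub_cancel_left, smul_smul, inv_mul_cancel₀ hlam0.ne', one_smul,
          add_sub_cancel]
      simp only [S, mem_ofPred_eq, this]
    have hSE : ∀ x ∈ S, Metric.closedBall x (min ρ ε₁) ⊆ E := by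
      intro x hx
      have e : Φ (z + lam⁻¹ • (x - z)) = x := by
        simp only [hΦ, add_sub_cancel_left, smul_smul, mul_inv_cancel₀ hlam0.ne', one_smul,
          add_sub_cancel]
      rw [← e]
      exact hball _ (subset_closure hx)
    refine le_trans (le_of_eq ?_) (hw2 S hSo.measurableSet hSE)
    have hm' : Measurable (S.indicator fun x => ENNReal.ofReal (gradSq w x)) :=
      (measurable_gradSq hw).indicator hSo.measurableSet
    have h1 := lintegral_comp_smul_add hm' hlam0.ne' (z - lam • z)
    rw [lintegral_indicator hSo.measurableSet] at h1
    rw [← lintegral_indicator hD.1.measurableSet]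
    have h2 : ∀ y, D.indicator (fun x => ENNReal.ofReal (gradSq (fun y => w (Φ y)) x)) y =
        ENNReal.ofReal (lam ^ 2) *
          S.indicator (fun x => ENNReal.ofReal (gradSq w x)) (lam • y + (z - lam • z)) := by
      intro y
      have e : lam • y + (z - lam • z) = Φ y := by simp only [hΦ]; module
      rw [e]
      by_cases hy : y ∈ D
      · rw [indicator_of_mem hy, indicator_of_mem ((hΦS y).2 hy), hgr,
          ENNReal.ofReal_mul (sq_nonneg _)]
      · rw [indicator_of_notMem hy, indicator_of_notMem (fun h => hy ((hΦS y).1 h)), mul_zero]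
    simp only [h2]
    rw [lintegral_const_mul' _ _ ENNReal.ofReal_ne_top, h1, ← mul_assoc,
      ← ENNReal.ofReal_mul (sq_nonneg _), mul_inv_cancel₀ (by positivity), ENNReal.ofReal_one,
      one_mul]

/-! ### A trace inequality -/

/-- `|cross τ q|` is `‖τ‖` times the distance from the origin to the line `q + s • τ`; the
hypothesis is used at the foot of the perpendicular. -/
theorem cross_sq_ge {τ q : R2} {ρ : ℝ} (hρ : 0 ≤ ρ) (hτ : τ ≠ 0) (h : ∀ s : ℝ, ρ ≤ ‖q + s • τ‖) :
    ρ * ‖τ‖ ≤ |cross τ q| := by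
  have hn : ∀ v : R2, ‖v‖ ^ 2 = v 0 ^ 2 + v 1 ^ 2 := fun v => by
    rw [EuclideanSpace.norm_sq_eq, Fin.sum_univ_two]; simp
  have hN : 0 < ‖τ‖ ^ 2 := by positivity
  set N := ‖τ‖ ^ 2 with hNdef
  set dd := q 0 * τ 0 + q 1 * τ 1
  have h1 := pow_le_pow_left₀ hρ (h (-(dd / N))) 2
  rw [hn] at h1
  simp only [PiLp.add_apply, PiLp.smul_apply, smul_eq_mul] at h1
  have h2 : ρ ^ 2 * N ≤ cross τ q ^ 2 := by
    calc ρ ^ 2 * N ≤ ((q 0 + -(dd / N) * τ 0) ^ 2 + (q 1 + -(dd / N) * τ 1) ^ 2) * N := by gcongr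
      _ = (q 0 ^ 2 + q 1 ^ 2) * N - 2 * dd ^ 2 + dd ^ 2 / N * (τ 0 ^ 2 + τ 1 ^ 2) := by
          field_simp; ring
      _ = (q 0 ^ 2 + q 1 ^ 2) * N - dd ^ 2 := by
          rw [← hn τ, ← hNdef, div_mul_cancel₀ _ hN.ne']; ring
      _ = cross τ q ^ 2 := by rw [hNdef, hn τ]; simp only [cross, dd]; ring
  refine abs_le_of_sq_le_sq' ?_ (abs_nonneg _) |>.2
  rw [sq_abs, mul_pow]
  exact h2

/-- The fundamental theorem of calculus along the segment, then Cauchy-Schwarz. Only the open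
segment has to lie in `D`, which is what star-shapedness gives when `p` is merely in the closure. -/
theorem ofReal_sq_sub_le {v : R2 → ℝ} (hv : ContDiff ℝ ∞ v) {D : Set R2} (p q : R2)
    (hD : ∀ t ∈ Ioo (0 : ℝ) 1, q + t • (p - q) ∈ D) {h : ℝ} (hh : dist p q ≤ h) :
    ENNReal.ofReal ((v p - v q) ^ 2) ≤ ENNReal.ofReal (h ^ 2) *
      ∫⁻ t in Ioo (0 : ℝ) 1,
        D.indicator (fun x => ENNReal.ofReal (gradSq v x)) (q + t • (p - q)) := by
  have e : ∀ t : ℝ, ENNReal.ofReal (t ^ 2) = ‖t‖ₑ ^ 2 := by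
    intro t
    rw [← sq_abs, ENNReal.ofReal_pow (abs_nonneg _), ← Real.norm_eq_abs, ofReal_norm]
  set f' : ℝ → ℝ := fun t => fderiv ℝ v (q + t • (p - q)) (p - q) with hf'
  have hline : Continuous fun t : ℝ => q + t • (p - q) := by fun_prop
  have hc : Continuous f' :=
    ((hv.continuous_fderiv (by simp)).comp hline).clm_apply continuous_const
  have hd : ∀ t : ℝ, HasDerivAt (fun t : ℝ => v (q + t • (p - q))) (f' t) t := by
    intro t
    have h1 : HasFDerivAt v (fderiv ℝ v (q + t • (p - q))) (q + t • (p - q)) :=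
      (hv.differentiable (by simp)).differentiableAt.hasFDerivAt
    have h2 : HasDerivAt (fun t : ℝ => q + t • (p - q)) (p - q) t := by
      simpa using ((hasDerivAt_id t).smul_const (p - q)).const_add q
    exact h1.comp_hasDerivAt t h2
  have hint : ∫ t in (0 : ℝ)..1, f' t = v p - v q := by
    rw [intervalIntegral.integral_eq_sub_of_hasDerivAt (fun t _ => hd t)
      (hc.intervalIntegrable _ _)]
    simp
  rw [intervalIntegral.integral_of_le zero_le_one, integral_Ioc_eq_integral_Ioo] at hint
  have hme : AEMeasurable (fun t => ‖f' t‖ₑ) (volume.restrict (Ioo (0 : ℝ) 1)) :=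
    hc.measurable.enorm.aemeasurable
  calc ENNReal.ofReal ((v p - v q) ^ 2) = ‖∫ t in Ioo (0 : ℝ) 1, f' t‖ₑ ^ 2 := by rw [e, hint]
    _ ≤ (∫⁻ t in Ioo (0 : ℝ) 1, ‖f' t‖ₑ) ^ 2 := by
        gcongr; exact enorm_integral_le_lintegral_enorm _
    _ ≤ ∫⁻ t in Ioo (0 : ℝ) 1, ‖f' t‖ₑ ^ 2 := by
        have := lintegral_mul_sq_le (volume.restrict (Ioo (0 : ℝ) 1)) (f := fun _ => 1)
          aemeasurable_const hme
        simpa using this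
    _ ≤ ∫⁻ t in Ioo (0 : ℝ) 1, ENNReal.ofReal (h ^ 2) *
          D.indicator (fun x => ENNReal.ofReal (gradSq v x)) (q + t • (p - q)) := by
        refine setLIntegral_mono' measurableSet_Ioo fun t ht => ?_
        rw [indicator_of_mem (hD t ht), ← e, ← ENNReal.ofReal_mul (sq_nonneg _)]
        refine ENNReal.ofReal_le_ofReal ((sq_fderiv_apply_le v _ _).trans ?_)
        have h1 : ‖p - q‖ ≤ h := by rwa [← dist_eq_norm]
        exact mul_le_mul_of_nonneg_right (pow_le_pow_left₀ (norm_nonneg _) h1 2) (gradSq_nonneg _ _)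
    _ = _ := lintegral_const_mul' _ _ ENNReal.ofReal_ne_top

theorem two_mul_ofReal (x : ℝ) : 2 * ENNReal.ofReal x = ENNReal.ofReal (2 * x) := by
  rw [ENNReal.ofReal_mul two_pos.le, ENNReal.ofReal_ofNat]

/-- For fixed `q`, the map `(s, t) ↦ q + t • (a + s • τ - q)` has Jacobian `t * |cross τ (a - q)|`.
Restricting to `t > 1 / 2` keeps it above `ρ / 2`. -/
theorem lintegral_line_le {f : R2 → ℝ≥0∞} (hf : Measurable f) {a τ q : R2} {ρ : ℝ} (hρ : 0 < ρ)
    (hc : ρ ≤ |cross τ (a - q)|) :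
    ∫⁻ t in Ioo (1 / 2 : ℝ) 1, ∫⁻ s : ℝ, f (q + t • ((a + s • τ) - q)) ≤
      ENNReal.ofReal (2 / ρ) * ∫⁻ x, f x := by
  have hcr : cross τ (a - q) ≠ 0 := fun h => by rw [h, abs_zero] at hc; linarith
  calc ∫⁻ t in Ioo (1 / 2 : ℝ) 1, ∫⁻ s : ℝ, f (q + t • ((a + s • τ) - q))
      ≤ ∫⁻ t in Ioo (1 / 2 : ℝ) 1, 2 * ∫⁻ s : ℝ, f (q + t • (a - q) + s • τ) := by
        refine setLIntegral_mono' measurableSet_Ioo fun t ht => ?_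
        have ht0 : 0 < t := by linarith [ht.1]
        have hm : Measurable fun s : ℝ => f (q + t • (a - q) + s • τ) :=
          hf.comp (by fun_prop : Continuous fun s : ℝ => q + t • (a - q) + s • τ).measurable
        have h1 := lintegral_comp_mul_left hm ht0
        have e : ∀ s : ℝ, f (q + t • ((a + s • τ) - q)) = f (q + t • (a - q) + (t * s) • τ) := by
          intro s; congr 1; module
        simp only [e]
        rw [h1]
        gcongr
        rw [← ENNReal.ofReal_ofNat 2]
        refine ENNReal.ofReal_le_ofReal ?_
        rw [inv_le_comm₀ ht0 two_pos]
        linarith [ht.1]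
    _ ≤ ∫⁻ t : ℝ, 2 * ∫⁻ s : ℝ, f (q + t • (a - q) + s • τ) := setLIntegral_le_lintegral _ _
    _ = 2 * (ENNReal.ofReal |(cross τ (a - q))⁻¹| * ∫⁻ x, f x) := by
        rw [lintegral_const_mul' _ _ (by norm_num), lintegral_affine_plane hf hcr]
    _ ≤ _ := by
        rw [← mul_assoc, div_eq_mul_inv, ENNReal.ofReal_mul two_pos.le, ENNReal.ofReal_ofNat]
        gcongr
        rw [abs_inv]
        exact inv_anti₀ hρ hc

/-- Trace inequality for smooth functions: comparison of the values on an edge and in the ball. -/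
theorem StarBall.trace_smooth {D : Set R2} {z : R2} {r : ℝ} (hD : StarBall D z r) (hr : 0 < r)
    {a τ : R2} (hτ : r ≤ ‖τ‖) (hline : ∀ s : ℝ, r ≤ dist (a + s • τ) z) {T : Set ℝ}
    (hT : MeasurableSet T) (hTI : T ⊆ Icc 0 1) (hTD : ∀ s ∈ T, a + s • τ ∈ closure D) {h : ℝ}
    (hh : ∀ s ∈ T, ∀ q ∈ Metric.ball z r, dist (a + s • τ) q ≤ h) {v : R2 → ℝ}
    (hv : ContDiff ℝ ∞ v) :
    ∫⁻ s in T, ∫⁻ q in Metric.ball z (r / 2), ENNReal.ofReal ((v (a + s • τ) - v q) ^ 2) ≤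
      ENNReal.ofReal (6 * h ^ 2) * ∫⁻ x in D, ENNReal.ofReal (gradSq v x) := by
  set I := ∫⁻ x in D, ENNReal.ofReal (gradSq v x) with hI
  set f : R2 → ℝ≥0∞ := D.indicator fun x => ENNReal.ofReal (gradSq v x) with hf
  have hfm : Measurable f := (measurable_gradSq hv).indicator hD.1.measurableSet
  have hfI : ∫⁻ x, f x = I := lintegral_indicator hD.1.measurableSet _
  set B := Metric.ball z (r / 2) with hB
  have hBr : B ⊆ Metric.ball z r := Metric.ball_subset_ball (by linarith)
  have hTv : volume T ≤ 1 := (measure_mono hTI).trans_eq (by simp)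
  have hpt : ∀ s ∈ T, ∀ q ∈ B, ENNReal.ofReal ((v (a + s • τ) - v q) ^ 2) ≤
      ENNReal.ofReal (h ^ 2) * ∫⁻ t in Ioo (0 : ℝ) 1, f (q + t • ((a + s • τ) - q)) :=
    fun s hs q hq => ofReal_sq_sub_le hv _ _
      (fun t ht => hD.mem_of_mem_closure (hTD s hs) (hBr hq) ht.1.le ht.2) (hh s hs q (hBr hq))
  have hcont : Continuous fun p : ℝ × R2 × ℝ => p.2.1 + p.2.2 • ((a + p.1 • τ) - p.2.1) := by
    fun_prop
  have hm3 : Measurable fun p : ℝ × R2 × ℝ => f (p.2.1 + p.2.2 • ((a + p.1 • τ) - p.2.1)) :=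
    hfm.comp hcont.measurable
  have hm2 : ∀ s, Measurable fun p : R2 × ℝ => f (p.1 + p.2 • ((a + s • τ) - p.1)) := fun s =>
    hm3.comp (by fun_prop : Measurable fun p : R2 × ℝ => (s, p))
  -- The half of the segment next to `q`: for fixed `s` and `t` the map is affine in `q`, with
  -- Jacobian `(1 - t) ^ 2 ≥ 1 / 4`.
  have hnear : ∀ s ∈ T, ∫⁻ q in B, ∫⁻ t in Ioc (0 : ℝ) (1 / 2), f (q + t • ((a + s • τ) - q)) ≤
      2 * I := by
    intro s _
    calc ∫⁻ q in B, ∫⁻ t in Ioc (0 : ℝ) (1 / 2), f (q + t • ((a + s • τ) - q))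
        ≤ ∫⁻ q, ∫⁻ t in Ioc (0 : ℝ) (1 / 2), f (q + t • ((a + s • τ) - q)) :=
          setLIntegral_le_lintegral _ _
      _ = ∫⁻ t in Ioc (0 : ℝ) (1 / 2), ∫⁻ q, f (q + t • ((a + s • τ) - q)) :=
          lintegral_lintegral_swap (f := fun q t => f (q + t • ((a + s • τ) - q)))
            (hm2 s).aemeasurable
      _ ≤ ∫⁻ t in Ioc (0 : ℝ) (1 / 2), 4 * I := by
          refine setLIntegral_mono' measurableSet_Ioc fun t ht => ?_
          have h1t : (0 : ℝ) < 1 - t := by linarith [ht.2]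
          have e : ∀ q : R2, f (q + t • ((a + s • τ) - q)) =
              f ((1 - t) • q + t • (a + s • τ)) := by
            intro q; congr 1; module
          simp only [e]
          rw [lintegral_comp_smul_add hfm h1t.ne', hfI]
          gcongr
          rw [← ENNReal.ofReal_ofNat 4]
          refine ENNReal.ofReal_le_ofReal ?_
          rw [inv_le_comm₀ (by positivity) (by norm_num)]
          nlinarith [ht.2]
      _ = 2 * I := by
          rw [lintegral_const, Measure.restrict_apply_univ, Real.volume_Ioc, mul_comm, ← mul_assoc]
          congr 1
          rw [← ENNReal.ofReal_ofNat 4, ← ENNReal.ofReal_mul (by norm_num)]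
          norm_num
  have hτ0 : τ ≠ 0 := fun h0 => by rw [h0, norm_zero] at hτ; linarith
  -- The line keeps distance `r` from `z`, hence `r / 2` from `q`, and `‖τ‖ ≥ r`.
  have hcross : ∀ q ∈ B, r ^ 2 / 2 ≤ |cross τ (a - q)| := by
    intro q hq
    refine le_trans ?_ (cross_sq_ge (half_pos hr).le hτ0 (q := a - q) fun s => ?_)
    · nlinarith
    · have h1 := hline s
      have h2 := Metric.mem_ball.1 hq
      have h3 := dist_triangle (a + s • τ) q z
      have : a - q + s • τ = (a + s • τ) - q := by abel
      rw [this, ← dist_eq_norm]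
      linarith
  -- The half next to the edge: for fixed `q`, the pair `(s, t)` is the new variable. The factor `4
  -- / r ^ 2` from the Jacobian is compensated by the area `π r ^ 2 / 4` of `B`.
  have hfar : ∫⁻ s in T, ∫⁻ q in B, ∫⁻ t in Ioo (1 / 2 : ℝ) 1, f (q + t • ((a + s • τ) - q)) ≤
      4 * I := by
    have hm' : Measurable fun p : ℝ × R2 =>
        ∫⁻ t in Ioo (1 / 2 : ℝ) 1, f (p.2 + t • ((a + p.1 • τ) - p.2)) :=
      Measurable.lintegral_prod_right' (ν := volume.restrict (Ioo (1 / 2 : ℝ) 1))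
        (f := fun p : (ℝ × R2) × ℝ => f (p.1.2 + p.2 • ((a + p.1.1 • τ) - p.1.2)))
        (hm3.comp (by fun_prop : Measurable fun p : (ℝ × R2) × ℝ => (p.1.1, p.1.2, p.2)))
    rw [lintegral_lintegral_swap (f := fun s q =>
      ∫⁻ t in Ioo (1 / 2 : ℝ) 1, f (q + t • ((a + s • τ) - q))) hm'.aemeasurable]
    calc ∫⁻ q in B, ∫⁻ s in T, ∫⁻ t in Ioo (1 / 2 : ℝ) 1, f (q + t • ((a + s • τ) - q))
        ≤ ∫⁻ q in B, ENNReal.ofReal (2 / (r ^ 2 / 2)) * I := by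
          refine setLIntegral_mono' Metric.isOpen_ball.measurableSet fun q hq => ?_
          refine (setLIntegral_le_lintegral _ _).trans ?_
          have hmq : Measurable fun p : ℝ × ℝ => f (q + p.2 • ((a + p.1 • τ) - q)) :=
            hm3.comp (by fun_prop : Measurable fun p : ℝ × ℝ => (p.1, q, p.2))
          rw [lintegral_lintegral_swap (f := fun s t => f (q + t • ((a + s • τ) - q)))
            hmq.aemeasurable, ← hfI]
          exact lintegral_line_le hfm (by positivity) (hcross q hq)
      _ = ENNReal.ofReal (2 / (r ^ 2 / 2)) * I * volume B := by
          rw [lintegral_const, Measure.restrict_apply_univ]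
      _ ≤ 4 * I := by
          rw [hB, EuclideanSpace.volume_ball_fin_two, mul_right_comm]
          gcongr
          rw [← ENNReal.ofReal_pow (by positivity), ← ENNReal.ofReal_mul (by positivity),
            ← ENNReal.ofReal_mul (by positivity), ← ENNReal.ofReal_ofNat 4]
          refine ENNReal.ofReal_le_ofReal ?_
          have e : 2 / (r ^ 2 / 2) * ((r / 2) ^ 2 * Real.pi) = Real.pi := by
            field_simp
          rw [e]
          exact Real.pi_le_four
  have hsplit : ∀ g : ℝ → ℝ≥0∞, ∫⁻ t in Ioo (0 : ℝ) 1, g t ≤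
      (∫⁻ t in Ioc (0 : ℝ) (1 / 2), g t) + ∫⁻ t in Ioo (1 / 2 : ℝ) 1, g t := by
    intro g
    refine (lintegral_mono_set fun t ht => ?_).trans (lintegral_union_le _ _ _)
    rcases le_or_gt t (1 / 2) with h' | h'
    · exact Or.inl ⟨ht.1, h'⟩
    · exact Or.inr ⟨h', ht.2⟩
  have hBm : MeasurableSet B := Metric.isOpen_ball.measurableSet
  have hmn : ∀ s, Measurable fun q => ∫⁻ t in Ioc (0 : ℝ) (1 / 2), f (q + t • ((a + s • τ) - q)) :=
    fun s => Measurable.lintegral_prod_right' (ν := volume.restrict (Ioc (0 : ℝ) (1 / 2))) (hm2 s)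
  have hmn' : Measurable fun s : ℝ => ∫⁻ q in B, ∫⁻ t in Ioc (0 : ℝ) (1 / 2),
      f (q + t • ((a + s • τ) - q)) := by
    refine Measurable.lintegral_prod_right' (ν := volume.restrict B) (f := fun p : ℝ × R2 =>
      ∫⁻ t in Ioc (0 : ℝ) (1 / 2), f (p.2 + t • ((a + p.1 • τ) - p.2))) ?_
    exact Measurable.lintegral_prod_right' (ν := volume.restrict (Ioc (0 : ℝ) (1 / 2)))
        (f := fun p : (ℝ × R2) × ℝ => f (p.1.2 + p.2 • ((a + p.1.1 • τ) - p.1.2)))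
        (hm3.comp (by fun_prop : Measurable fun p : (ℝ × R2) × ℝ => (p.1.1, p.1.2, p.2)))
  calc ∫⁻ s in T, ∫⁻ q in B, ENNReal.ofReal ((v (a + s • τ) - v q) ^ 2)
      ≤ ∫⁻ s in T, ∫⁻ q in B, ENNReal.ofReal (h ^ 2) *
          ((∫⁻ t in Ioc (0 : ℝ) (1 / 2), f (q + t • ((a + s • τ) - q))) +
            ∫⁻ t in Ioo (1 / 2 : ℝ) 1, f (q + t • ((a + s • τ) - q))) := by
        refine setLIntegral_mono' hT fun s hs => setLIntegral_mono' hBm fun q hq => ?_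
        refine (hpt s hs q hq).trans ?_
        gcongr
        exact hsplit _
    _ = ENNReal.ofReal (h ^ 2) * ((∫⁻ s in T, ∫⁻ q in B,
          ∫⁻ t in Ioc (0 : ℝ) (1 / 2), f (q + t • ((a + s • τ) - q))) + ∫⁻ s in T, ∫⁻ q in B,
            ∫⁻ t in Ioo (1 / 2 : ℝ) 1, f (q + t • ((a + s • τ) - q))) := by
        rw [← lintegral_add_left hmn', ← lintegral_const_mul' _ _ ENNReal.ofReal_ne_top]
        congr 1; ext s
        rw [lintegral_const_mul' _ _ ENNReal.ofReal_ne_top, lintegral_add_left (hmn s)]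
    _ ≤ ENNReal.ofReal (h ^ 2) * (2 * I + 4 * I) := by
        gcongr
        calc _ ≤ ∫⁻ _ in T, 2 * I := setLIntegral_mono' hT hnear
          _ = 2 * I * volume T := by rw [lintegral_const, Measure.restrict_apply_univ]
          _ ≤ 2 * I * 1 := by gcongr
          _ = 2 * I := mul_one _
    _ = _ := by
        rw [ENNReal.ofReal_mul (by norm_num), ENNReal.ofReal_ofNat]
        ring

/-- Trace inequality for Sobolev functions continuous up to the boundary. -/
theorem StarBall.trace_sobolev {E : Set R2} (hE : IsOpen E) (hb : Bornology.IsBounded E)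
    {u : R2 → ℝ} (hu : ContinuousOn u (closure E)) {g : Fin 2 → R2 → ℝ}
    (hg : ∀ d, HasWeakDeriv E (unitIdx d) u (g d))
    (hg2 : ∀ d, AEStronglyMeasurable (g d) (volume.restrict E)) {D : Set R2} {z : R2} {r : ℝ}
    (hD : StarBall D z r) (hr : 0 < r) (hne : D.Nonempty) (hDE : D ⊆ E)
    {a τ : R2} (hτ : r ≤ ‖τ‖) (hline : ∀ s : ℝ, r ≤ dist (a + s • τ) z) {T : Set ℝ}
    (hT : MeasurableSet T) (hTI : T ⊆ Icc 0 1) (hTD : ∀ s ∈ T, a + s • τ ∈ closure D) :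
    ∫⁻ s in T, ENNReal.ofReal ((u (a + s • τ) - ⨍ q in Metric.ball z (r / 2), u q) ^ 2) ≤
      ENNReal.ofReal (96 * Metric.diam E ^ 2 / r ^ 2) *
        ∫⁻ x in E, ENNReal.ofReal (∑ d, g d x ^ 2) := by
  set G := ∫⁻ x in E, ENNReal.ofReal (∑ d, g d x ^ 2) with hG
  set h := Metric.diam E with hh
  set B := Metric.ball z (r / 2) with hB
  have hBr : B ⊆ Metric.ball z r := Metric.ball_subset_ball (by linarith)
  have hrD : Metric.ball z r ⊆ D := hD.ball_subset hne
  have hBD : B ⊆ D := hBr.trans hrD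
  have hTv : volume T ≤ 1 := (measure_mono hTI).trans_eq (by simp)
  have hBm : MeasurableSet B := Metric.isOpen_ball.measurableSet
  have hBfin : volume B ≠ ⊤ := measure_ball_lt_top.ne
  have hBvol : volume B = ENNReal.ofReal ((r / 2) ^ 2 * Real.pi) := by
    rw [hB, EuclideanSpace.volume_ball_fin_two, ENNReal.ofReal_mul (by positivity),
      ENNReal.ofReal_pow (by positivity)]
  have hhd : ∀ s ∈ T, ∀ q ∈ Metric.ball z r, dist (a + s • τ) q ≤ h := by
    intro s hs q hq
    rw [hh, ← Metric.diam_closure]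
    exact Metric.dist_le_diam_of_mem hb.closure (closure_mono hDE (hTD s hs))
      (subset_closure (hDE (hrD hq)))
  have key : ∫⁻ s in T, ∫⁻ q in B, ENNReal.ofReal ((u (a + s • τ) - u q) ^ 2) ≤
      ENNReal.ofReal (12 * h ^ 2) * G := by
    suffices H : ∀ κ : ℝ, 0 < κ → ∫⁻ s in T, ∫⁻ q in B,
        ENNReal.ofReal ((u (a + s • τ) - u q) ^ 2) ≤
          ENNReal.ofReal (12 * h ^ 2) * G + ENNReal.ofReal (8 * κ ^ 2) * volume B by
      have ht : Filter.Tendsto (fun κ : ℝ =>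
          ENNReal.ofReal (12 * h ^ 2) * G + ENNReal.ofReal (8 * κ ^ 2) * volume B)
          (nhdsWithin 0 (Ioi 0)) (nhds (ENNReal.ofReal (12 * h ^ 2) * G +
            ENNReal.ofReal (8 * (0 : ℝ) ^ 2) * volume B)) := by
        refine Filter.Tendsto.mono_left ?_ nhdsWithin_le_nhds
        refine Filter.Tendsto.add tendsto_const_nhds ?_
        refine ENNReal.Tendsto.mul_const ?_ (Or.inr hBfin)
        exact ENNReal.tendsto_ofReal ((continuous_const.mul (continuous_pow 2)).tendsto _)
      have := ge_of_tendsto ht (by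
        filter_upwards [self_mem_nhdsWithin] with κ hκ using H κ hκ)
      simpa using this
    intro κ hκ
    obtain ⟨v, hv, hvu, hvG⟩ := hD.exists_smooth_approx hE hb hu hg hg2 hr hne hDE hκ
    have htr := hD.trace_smooth hr hτ hline hT hTI hTD hhd hv
    calc ∫⁻ s in T, ∫⁻ q in B, ENNReal.ofReal ((u (a + s • τ) - u q) ^ 2)
        ≤ ∫⁻ s in T, ∫⁻ q in B, (2 * ENNReal.ofReal ((v (a + s • τ) - v q) ^ 2) +
            ENNReal.ofReal (8 * κ ^ 2)) := by
          refine setLIntegral_mono' hT fun s hs => setLIntegral_mono' hBm fun q hq => ?_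
          rw [two_mul_ofReal, ← ENNReal.ofReal_add (by positivity) (by positivity)]
          refine ENNReal.ofReal_le_ofReal ?_
          have h1 := abs_le.1 (hvu _ (hTD s hs))
          have h2 := abs_le.1 (hvu _ (subset_closure (hBD hq)))
          have h3 : |(u (a + s • τ) - u q) - (v (a + s • τ) - v q)| ≤ 2 * κ := by
            rw [abs_le]; constructor <;> linarith
          have h4 : ((u (a + s • τ) - u q) - (v (a + s • τ) - v q)) ^ 2 ≤ (2 * κ) ^ 2 :=
            sq_le_sq' (abs_le.1 h3).1 (abs_le.1 h3).2
          nlinarith [sq_nonneg ((u (a + s • τ) - u q) - 2 * (v (a + s • τ) - v q))]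
      _ = 2 * (∫⁻ s in T, ∫⁻ q in B, ENNReal.ofReal ((v (a + s • τ) - v q) ^ 2)) +
            ENNReal.ofReal (8 * κ ^ 2) * volume B * volume T := by
          have e : ∀ s : ℝ, ∫⁻ q in B, (2 * ENNReal.ofReal ((v (a + s • τ) - v q) ^ 2) +
              ENNReal.ofReal (8 * κ ^ 2)) =
              2 * (∫⁻ q in B, ENNReal.ofReal ((v (a + s • τ) - v q) ^ 2)) +
                ENNReal.ofReal (8 * κ ^ 2) * volume B := by
            intro s
            rw [lintegral_add_right _ measurable_const, lintegral_const,
              Measure.restrict_apply_univ, lintegral_const_mul' _ _ (by norm_num)]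
          simp only [e]
          rw [lintegral_add_right _ measurable_const, lintegral_const, Measure.restrict_apply_univ,
            lintegral_const_mul' _ _ (by norm_num)]
      _ ≤ 2 * (ENNReal.ofReal (6 * h ^ 2) * G) + ENNReal.ofReal (8 * κ ^ 2) * volume B * 1 := by
          gcongr
          exact htr.trans (by gcongr)
      _ = _ := by
          rw [mul_one, ← mul_assoc, two_mul_ofReal, ← mul_assoc]
          norm_num
  have hui : IntegrableOn u B :=
    (integrableOn_of_continuousOn_closure hb hu).mono_set (hBD.trans hDE)
  -- Jensen's inequality replaces the average of the squared differences over the ball by the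
  -- squared difference to the mean.
  have hjen : ∀ x : ℝ, ENNReal.ofReal ((x - ⨍ q in B, u q) ^ 2) * volume B ≤
      ∫⁻ q in B, ENNReal.ofReal ((x - u q) ^ 2) := by
    intro x
    have e : ∀ t : ℝ, ENNReal.ofReal (t ^ 2) = ‖t‖ₑ ^ 2 := by
      intro t
      rw [← sq_abs, ENNReal.ofReal_pow (abs_nonneg _), ← Real.norm_eq_abs, ofReal_norm]
    have hBpos : 0 < volume.real B := by
      rw [measureReal_def, hBvol, ENNReal.toReal_ofReal (by positivity)]; positivity
    have : IsFiniteMeasure (volume.restrict B) := ⟨by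
      rw [Measure.restrict_apply_univ]; exact hBfin.lt_top⟩
    have h1 : (x - ⨍ q in B, u q) * volume.real B = ∫ q in B, (x - u q) := by
      rw [integral_sub (integrable_const x) hui, setAverage_eq, setIntegral_const,
        smul_eq_mul, smul_eq_mul]
      field_simp
    have h2 : ‖∫ q in B, (x - u q)‖ₑ ^ 2 ≤ volume B * ∫⁻ q in B, ENNReal.ofReal ((x - u q) ^ 2) := by
      have hme : AEMeasurable (fun q => ‖x - u q‖ₑ) (volume.restrict B) :=
        (aestronglyMeasurable_const.sub hui.1).enorm
      have := lintegral_mul_sq_le (volume.restrict B) (f := fun _ => 1) aemeasurable_const hme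
      simp only [one_mul, one_pow, lintegral_const, Measure.restrict_apply_univ] at this
      simp only [e]
      refine le_trans ?_ this
      gcongr
      exact enorm_integral_le_lintegral_enorm _
    rw [← h1, ← e, mul_pow, ENNReal.ofReal_mul (sq_nonneg _)] at h2
    have hBe : volume B = ENNReal.ofReal (volume.real B) := (ENNReal.ofReal_toReal hBfin).symm
    rw [ENNReal.ofReal_pow hBpos.le, ← hBe, pow_two (volume B), ← mul_assoc, mul_comm (volume B)] at h2
    have hB0 : volume B ≠ 0 := by
      rw [hBe]; simpa using hBpos
    exact (ENNReal.mul_le_mul_iff_left hB0 hBfin).1 h2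
  have hfin : (∫⁻ s in T, ENNReal.ofReal ((u (a + s • τ) - ⨍ q in B, u q) ^ 2)) * volume B ≤
      ENNReal.ofReal (12 * h ^ 2) * G := by
    rw [← lintegral_mul_const' _ _ hBfin]
    exact (lintegral_mono fun s => hjen _).trans key
  have hB0 : 0 < (r / 2) ^ 2 * Real.pi := by positivity
  rw [hBvol] at hfin
  have hne0 : ENNReal.ofReal ((r / 2) ^ 2 * Real.pi) ≠ 0 := by simpa using hB0
  refine (ENNReal.mul_le_mul_iff_left hne0 ENNReal.ofReal_ne_top).1 (hfin.trans ?_)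
  rw [mul_right_comm, ← ENNReal.ofReal_mul (by positivity)]
  refine mul_le_mul' (ENNReal.ofReal_le_ofReal ?_) le_rfl
  -- Dividing `12 * h ^ 2` by the area `π r ^ 2 / 4` leaves less than `96 * h ^ 2 / r ^ 2`.
  have e : 96 * h ^ 2 / r ^ 2 * ((r / 2) ^ 2 * Real.pi) = 24 * Real.pi * h ^ 2 := by
    field_simp; ring
  rw [e]
  nlinarith [Real.pi_gt_three, sq_nonneg h]

/-! ### A Remez type inequality -/

/-- Greedy choice: pick a point of `T`, remove the ball of radius `δ` around it, which costs measure
at most `2 * δ`, and continue in the remainder. -/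
theorem exists_separated {δ : ℝ} (hδ : 0 < δ) (m : ℕ) : ∀ T : Set ℝ,
    ENNReal.ofReal (2 * δ * m) < volume T →
      ∃ s : Finset ℝ, s.card = m + 1 ∧ (s : Set ℝ) ⊆ T ∧ ∀ x ∈ s, ∀ y ∈ s, x ≠ y → δ ≤ |x - y| := by
  induction m with
  | zero =>
    intro T hT
    obtain ⟨t, ht⟩ : T.Nonempty := by
      by_contra h
      rw [not_nonempty_iff_eq_empty] at h
      simp [h] at hT
    exact ⟨{t}, by simp, by simpa using ht, fun x hx y hy hxy => by simp_all⟩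
  | succ m ih =>
    intro T hT
    obtain ⟨t, ht⟩ : T.Nonempty := by
      by_contra h
      rw [not_nonempty_iff_eq_empty] at h
      simp [h] at hT
    have h1 : volume T ≤ volume (T \ Metric.ball t δ) + ENNReal.ofReal (2 * δ) := by
      rw [← Real.volume_ball t δ]
      exact (measure_mono (fun x hx => by
        by_cases h : x ∈ Metric.ball t δ
        · exact Or.inr h
        · exact Or.inl ⟨hx, h⟩)).trans (measure_union_le _ _)
    have h2 : ENNReal.ofReal (2 * δ * m) < volume (T \ Metric.ball t δ) := by
      by_contra! h
      have h3 : volume T ≤ ENNReal.ofReal (2 * δ * m) + ENNReal.ofReal (2 * δ) :=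
        h1.trans (by gcongr)
      rw [← ENNReal.ofReal_add (by positivity) (by positivity)] at h3
      refine absurd hT (not_lt.2 (h3.trans_eq ?_))
      push_cast
      ring_nf
    obtain ⟨s, hs1, hs2, hs3⟩ := ih _ h2
    have hsep : ∀ x ∈ s, δ ≤ |x - t| := fun x hx => by
      have := (hs2 hx).2
      rwa [Metric.mem_ball, not_lt, Real.dist_eq] at this
    have hts : t ∉ s := fun h => by
      have := hsep t h
      simp at this
      linarith
    refine ⟨insert t s, by rw [Finset.card_insert_of_notMem hts, hs1], ?_, ?_⟩
    · intro x hx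
      rcases Finset.mem_insert.1 hx with rfl | hx
      · exact ht
      · exact (hs2 hx).1
    · intro x hx y hy hxy
      rcases Finset.mem_insert.1 hx with rfl | hx'
      · rcases Finset.mem_insert.1 hy with rfl | hy'
        · exact absurd rfl hxy
        · rw [abs_sub_comm]; exact hsep y hy'
      · rcases Finset.mem_insert.1 hy with rfl | hy'
        · exact hsep x hx'
        · exact hs3 x hx' y hy' hxy

/-- Lagrange interpolation at `k + 1` nodes: each of the `k` factors of a basis polynomial is at
most `δ⁻¹` on the unit interval. -/
theorem abs_eval_le_of_separated {k : ℕ} {q : Polynomial ℝ} (hq : q.natDegree ≤ k) {s : Finset ℝ}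
    (hs : s.card = k + 1) (hsI : (s : Set ℝ) ⊆ Icc 0 1) {δ : ℝ} (hδ : 0 < δ)
    (hsep : ∀ x ∈ s, ∀ y ∈ s, x ≠ y → δ ≤ |x - y|) {A : ℝ}
    (hA : ∀ x ∈ s, |q.eval x| ≤ A) {x : ℝ} (hx : x ∈ Icc (0 : ℝ) 1) :
    |q.eval x| ≤ (k + 1) * ((δ⁻¹) ^ k * A) := by
  have hdeg : q.degree < s.card := by
    rw [hs]
    exact lt_of_le_of_lt Polynomial.degree_le_natDegree (by exact_mod_cast Nat.lt_succ_of_le hq)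
  have h := Lagrange.eq_interpolate (s := s) (v := id) (injOn_id _) hdeg
  rw [h, Lagrange.interpolate_apply, Polynomial.eval_finsetSum]
  refine (Finset.abs_sum_le_sum_abs _ _).trans ?_
  have hterm : ∀ y ∈ s, |Polynomial.eval x (Polynomial.C (q.eval (id y)) * Lagrange.basis s id y)| ≤
      (δ⁻¹) ^ k * A := by
    intro y hy
    rw [Polynomial.eval_mul, Polynomial.eval_C, abs_mul, mul_comm]
    refine mul_le_mul ?_ (hA y hy) (abs_nonneg _) (by positivity)
    rw [Lagrange.basis, Polynomial.eval_prod, Finset.abs_prod]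
    have hc : (s.erase y).card = k := by rw [Finset.card_erase_of_mem hy, hs]; rfl
    rw [← hc]
    rw [← Finset.prod_const]
    refine Finset.prod_le_prod (fun w _ => abs_nonneg _) fun w hw => ?_
    rw [Lagrange.basisDivisor]
    simp only [id, Polynomial.eval_mul, Polynomial.eval_C, Polynomial.eval_sub, Polynomial.eval_X,
      abs_mul, abs_inv]
    have hw' := Finset.mem_erase.1 hw
    have h1 : δ ≤ |y - w| := hsep y hy w hw'.2 (Ne.symm hw'.1)
    have h2 : |x - w| ≤ 1 := by
      have := hsI hw'.2
      rw [abs_le]; constructor <;> linarith [hx.1, hx.2, this.1, this.2]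
    calc |y - w|⁻¹ * |x - w| ≤ δ⁻¹ * 1 :=
          mul_le_mul (inv_anti₀ hδ h1) h2 (abs_nonneg _) (by positivity)
      _ = δ⁻¹ := mul_one _
  refine (Finset.sum_le_sum hterm).trans_eq ?_
  rw [Finset.sum_const, hs, nsmul_eq_mul]
  push_cast
  ring

/-- By Markov's inequality `q² < 2Y / τ` on a part of `T` of measure at least `τ / 2`. That part
contains `k + 1` separated points, and interpolation from them bounds `q` on the whole interval. The
structure of `T` plays no role, only its measure. -/
theorem exists_remez (k : ℕ) {τ : ℝ} (hτ : 0 < τ) : ∃ C > 0, ∀ q : Polynomial ℝ, q.natDegree ≤ k →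
    ∀ T : Set ℝ, MeasurableSet T → T ⊆ Icc 0 1 → ENNReal.ofReal τ ≤ volume T → ∀ Y : ℝ, 0 ≤ Y →
      ∫⁻ s in T, ENNReal.ofReal (q.eval s ^ 2) ≤ ENNReal.ofReal Y →
        ∀ x ∈ Icc (0 : ℝ) 1, q.eval x ^ 2 ≤ C * Y := by
  -- Small enough for `2 * δ * k < τ / 2`.
  set δ : ℝ := τ / (8 * (k + 1)) with hδdef
  have hδ : 0 < δ := by positivity
  refine ⟨((k + 1) * (δ⁻¹) ^ k) ^ 2 * (2 / τ), by positivity, ?_⟩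
  intro q hq T hT hTI hτT Y hY hint x hx
  set C := ((k + 1) * (δ⁻¹) ^ k) ^ 2 * (2 / τ) with hC
  have hC0 : 0 < C := by positivity
  have key : ∀ Y : ℝ, 0 < Y → ∫⁻ s in T, ENNReal.ofReal (q.eval s ^ 2) ≤ ENNReal.ofReal Y →
      q.eval x ^ 2 ≤ C * Y := by
    intro Y hY hint
    have hqm : Measurable fun s => ENNReal.ofReal (q.eval s ^ 2) :=
      (q.continuous.pow 2).measurable.ennreal_ofReal
    set bad : Set ℝ := {s | ENNReal.ofReal (2 * Y / τ) ≤ ENNReal.ofReal (q.eval s ^ 2)} with hbad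
    have hbm : MeasurableSet bad := measurableSet_le measurable_const hqm
    have hmark := mul_meas_ge_le_lintegral (μ := volume.restrict T) hqm (ENNReal.ofReal (2 * Y / τ))
    have hbadv : volume (T ∩ bad) ≤ ENNReal.ofReal (τ / 2) := by
      have h1 : ENNReal.ofReal (2 * Y / τ) * volume (T ∩ bad) ≤ ENNReal.ofReal Y := by
        have e : volume (T ∩ bad) = (volume.restrict T) bad := by
          rw [Measure.restrict_apply hbm, inter_comm]
        rw [e]
        exact hmark.trans hint
      have h2 : ENNReal.ofReal Y = ENNReal.ofReal (2 * Y / τ) * ENNReal.ofReal (τ / 2) := by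
        rw [← ENNReal.ofReal_mul (by positivity)]
        congr 1
        field_simp
      rw [h2] at h1
      exact (ENNReal.mul_le_mul_iff_right (by simp; positivity) ENNReal.ofReal_ne_top).1 h1
    have hgood : ENNReal.ofReal (2 * δ * k) < volume (T \ bad) := by
      have h1 : ENNReal.ofReal τ ≤ volume (T \ bad) + ENNReal.ofReal (τ / 2) := by
        refine hτT.trans ?_
        calc volume T = volume ((T \ bad) ∪ (T ∩ bad)) := by rw [sdiff_union_inter]
          _ ≤ volume (T \ bad) + volume (T ∩ bad) := measure_union_le _ _
          _ ≤ _ := by gcongr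
      have h2 : ENNReal.ofReal (τ / 2) ≤ volume (T \ bad) := by
        have e : ENNReal.ofReal τ = ENNReal.ofReal (τ / 2) + ENNReal.ofReal (τ / 2) := by
          rw [← ENNReal.ofReal_add (by positivity) (by positivity)]
          congr 1
          ring
        rw [e] at h1
        exact (ENNReal.add_le_add_iff_right ENNReal.ofReal_ne_top).1 h1
      refine lt_of_lt_of_le ((ENNReal.ofReal_lt_ofReal_iff (by positivity)).2 ?_) h2
      rw [hδdef]
      have hk : (0 : ℝ) ≤ k := Nat.cast_nonneg k
      have : 2 * (τ / (8 * ((k : ℝ) + 1))) * k = (τ / 2) * (k / (2 * (k + 1))) := by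
        field_simp; ring
      rw [this]
      have h3 : (k : ℝ) / (2 * (k + 1)) < 1 := by
        rw [div_lt_one (by positivity)]; linarith
      nlinarith
    obtain ⟨s, hs1, hs2, hs3⟩ := exists_separated hδ k _ hgood
    have hA : ∀ y ∈ s, |q.eval y| ≤ √(2 * Y / τ) := by
      intro y hy
      have h1 : ¬ ENNReal.ofReal (2 * Y / τ) ≤ ENNReal.ofReal (q.eval y ^ 2) := (hs2 hy).2
      rw [not_le] at h1
      have h2 := (ENNReal.ofReal_lt_ofReal_iff_of_nonneg (sq_nonneg _)).1 h1
      exact Real.abs_le_sqrt h2.le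
    have h1 := abs_eval_le_of_separated hq hs1 (fun y hy => hTI (hs2 hy).1) hδ hs3
      hA hx
    have h2 := pow_le_pow_left₀ (abs_nonneg _) h1 2
    rw [sq_abs] at h2
    refine h2.trans_eq ?_
    rw [← mul_assoc, mul_pow _ (√(2 * Y / τ)), Real.sq_sqrt (by positivity), hC]
    ring
  -- Markov's inequality needs `Y > 0`; the case `Y = 0` is reached by applying the result to `Y +
  -- κ`.
  by_contra! hcon
  set κ := (q.eval x ^ 2 - C * Y) / (2 * C)
  have hκ : 0 < κ := by
    apply div_pos <;> linarith
  have h1 := key (Y + κ) (by linarith) (hint.trans (ENNReal.ofReal_le_ofReal (by linarith)))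
  have h2 : C * κ = (q.eval x ^ 2 - C * Y) / 2 := by
    simp only [κ]; field_simp
  nlinarith

/-! ### Covering arguments -/

theorem sub_le_of_Ioo_subset_iUnion {ι : Type} [Fintype ι] {c : ι → ℝ} {δ a b : ℝ} (hδ : 0 ≤ δ)
    (h : Ioo a b ⊆ ⋃ i, Icc (c i - δ) (c i + δ)) : b - a ≤ Fintype.card ι * (2 * δ) := by
  have h1 : ENNReal.ofReal (b - a) ≤ ENNReal.ofReal (Fintype.card ι * (2 * δ)) := by
    calc ENNReal.ofReal (b - a) = volume (Ioo a b) := Real.volume_Ioo.symm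
      _ ≤ volume (⋃ i, Icc (c i - δ) (c i + δ)) := measure_mono h
      _ ≤ ∑ i, volume (Icc (c i - δ) (c i + δ)) := measure_iUnion_fintype_le _ _
      _ = ∑ _i : ι, ENNReal.ofReal (2 * δ) := by
          refine Finset.sum_congr rfl fun i _ => ?_
          rw [Real.volume_Icc]; congr 1; ring
      _ = _ := by
          rw [Finset.sum_const, Finset.card_univ, nsmul_eq_mul,
            ENNReal.ofReal_mul (p := (Fintype.card ι : ℝ)) (Nat.cast_nonneg _),
            ENNReal.ofReal_natCast]
  exact (ENNReal.ofReal_le_ofReal_iff (by positivity)).1 h1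

/-- If two values were further apart, some level between them would have distance more than `δ` from
every `c i`, and a walk with steps at most `δ` cannot cross such a level. The bound counts the
elements of `ι` and not the steps, so it does not depend on the number of edges. -/
theorem abs_sub_le_of_cyclic {ι : Type} [Fintype ι] {n : ℕ} (j : Fin (n + 3) → ι) (c : ι → ℝ)
    {δ : ℝ} (hδ : ∀ e, |c (j e) - c (j (finRotate _ e))| ≤ δ) (e e' : Fin (n + 3)) :
    |c (j e) - c (j e')| ≤ Fintype.card ι * (2 * δ) := by
  have hδ0 : 0 ≤ δ := (abs_nonneg _).trans (hδ e)
  have key : ∀ e e', c (j e') - c (j e) ≤ Fintype.card ι * (2 * δ) := by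
    intro e e'
    refine sub_le_of_Ioo_subset_iUnion (c := c) hδ0 fun a ha => ?_
    by_contra hcon
    rw [mem_iUnion, not_exists] at hcon
    have hstep : ∀ i, c (j i) ≤ a → c (j (finRotate _ i)) ≤ a := by
      intro i hi
      by_contra! h'
      refine hcon (j i) ⟨by linarith, ?_⟩
      have := (abs_le.1 (hδ i)).1
      linarith
    -- Induction along the cyclic order starting at `e`; every index is `e + i` for some `i`.
    have hall : ∀ m : ℕ, ∀ i : Fin (n + 3), i.val = m → c (j (e + i)) ≤ a := by
      intro m
      induction m with
      | zero =>
        intro i hi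
        rw [show i = 0 from Fin.ext hi, add_zero]
        exact ha.1.le
      | succ m ih =>
        intro i hi
        have hm : m < n + 3 := by have := i.isLt; omega
        have := hstep _ (ih ⟨m, hm⟩ rfl)
        rw [finRotate_apply, add_assoc] at this
        have e1 : (⟨m, hm⟩ : Fin (n + 3)) + 1 = i := by
          apply Fin.ext
          rw [Fin.val_add_one_of_lt' (by simp; have := i.isLt; omega), hi]
        rwa [e1] at this
    have := hall _ (e' - e) rfl
    rw [add_sub_cancel] at this
    exact absurd ha.2 (not_lt.2 this)
  rw [abs_le]
  constructor
  · linarith [key e e']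
  · exact key e' e

/-- The same gap argument with connectedness in place of the walk: a level that no piece crosses
would split the pieces into two families whose open unions cover `E`. These unions intersect, and
the intersection contains a point of `S`, on which the two families contradict each other. -/
theorem abs_sub_le_of_connected {ι : Type} [Fintype ι] {E : Set R2} (hE : IsPreconnected E)
    {D : ι → Set R2} (hD : ∀ i, IsOpen (D i)) (hED : E = ⋃ i, D i) {f : R2 → ℝ} {S : Set R2}
    (hS : ∀ O ⊆ E, IsOpen O → O.Nonempty → (O ∩ S).Nonempty) {δ : ℝ} (hδ0 : 0 ≤ δ)
    (hδ : ∀ i, ∀ x ∈ S ∩ D i, ∀ y ∈ S ∩ D i, |f x - f y| ≤ δ) {x y : R2} (hx : x ∈ S ∩ E)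
    (hy : y ∈ S ∩ E) : |f x - f y| ≤ Fintype.card ι * (2 * δ) := by
  classical
  have key : ∀ x ∈ S ∩ E, ∀ y ∈ S ∩ E, f y - f x ≤ Fintype.card ι * (2 * δ) := by
    intro x hx y hy
    set c : ι → ℝ := fun i => if h : (S ∩ D i).Nonempty then f h.choose else 0
    refine sub_le_of_Ioo_subset_iUnion (c := c) hδ0 fun a ha => ?_
    by_contra hcon
    rw [mem_iUnion, not_exists] at hcon
    have hdich : ∀ i, (∀ s ∈ S ∩ D i, f s ≤ a) ∨ ∀ s ∈ S ∩ D i, a < f s := by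
      intro i
      by_contra! h
      obtain ⟨⟨s, hs, hsa⟩, s', hs', hsa'⟩ := h
      have hne : (S ∩ D i).Nonempty := ⟨s, hs⟩
      refine hcon i ?_
      have hc : c i = f hne.choose := dif_pos hne
      have h1 := abs_le.1 (hδ i s hs _ hne.choose_spec)
      have h2 := abs_le.1 (hδ i s' hs' _ hne.choose_spec)
      rw [hc]
      constructor <;> linarith
    set U₁ := ⋃ i ∈ {i | ∀ s ∈ S ∩ D i, f s ≤ a}, D i
    set U₂ := ⋃ i ∈ {i | ∀ s ∈ S ∩ D i, a < f s}, D i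
    have hU₁ : IsOpen U₁ := isOpen_biUnion fun i _ => hD i
    have hU₂ : IsOpen U₂ := isOpen_biUnion fun i _ => hD i
    have hcov : E ⊆ U₁ ∪ U₂ := by
      rw [hED]
      refine iUnion_subset fun i => ?_
      rcases hdich i with h | h
      · exact fun w hw => Or.inl (mem_iUnion₂.2 ⟨i, h, hw⟩)
      · exact fun w hw => Or.inr (mem_iUnion₂.2 ⟨i, h, hw⟩)
    have hx1 : x ∈ U₁ := by
      rcases hcov hx.2 with h | h
      · exact h
      · obtain ⟨i, hi, hxi⟩ := mem_iUnion₂.1 h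
        exact absurd (hi x ⟨hx.1, hxi⟩) (not_lt.2 ha.1.le)
    have hy2 : y ∈ U₂ := by
      rcases hcov hy.2 with h | h
      · obtain ⟨i, hi, hyi⟩ := mem_iUnion₂.1 h
        exact absurd (hi y ⟨hy.1, hyi⟩) (not_le.2 ha.2)
      · exact h
    obtain ⟨w, -, hw1, hw2⟩ := hE U₁ U₂ hU₁ hU₂ hcov ⟨x, hx.2, hx1⟩ ⟨y, hy.2, hy2⟩
    obtain ⟨i, hi, hwi⟩ := mem_iUnion₂.1 hw1
    obtain ⟨i', hi', hwi'⟩ := mem_iUnion₂.1 hw2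
    have hsub : D i ∩ D i' ⊆ E := by
      rw [hED]; exact inter_subset_left.trans (subset_iUnion D i)
    obtain ⟨s, hs, hsS⟩ := hS _ hsub ((hD i).inter (hD i')) ⟨w, hwi, hwi'⟩
    exact absurd (hi s ⟨hsS, hs.1⟩) (not_le.2 (hi' s ⟨hsS, hs.2⟩))
  rw [abs_le]
  constructor
  · linarith [key x hx y hy]
  · exact key y hy x hx

/-! ### Shape regularity -/

/-- Shape regularity of a single element. -/
def Element.Regular (E : Element) (α : ℝ) : Prop :=
  (∃ (N : ℕ) (D : Fin N → Set R2), E.carrier = ⋃ j, D j ∧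
    ∀ j, IsOpen (D j) ∧ ∃ (x : R2) (r : ℝ), α * E.diam < r ∧
      Metric.ball x r ⊆ D j ∧ ∀ y ∈ Metric.ball x r, StarConvex ℝ y (D j)) ∧
  ∀ j, α * E.diam < dist (E.poly j) (E.poly (finRotate _ j))

theorem Element.diam_pos (E : Element) : 0 < E.diam := by
  obtain ⟨x, hx⟩ := E.isConnected.nonempty
  obtain ⟨ε, hε, hb⟩ := Metric.isOpen_iff.1 E.isOpen x hx
  have hy : x + (ε / 2) • EuclideanSpace.single 0 (1 : ℝ) ∈ E.carrier := by
    refine hb ?_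
    rw [Metric.mem_ball, dist_eq_norm, add_sub_cancel_left, norm_smul]
    simp [abs_of_pos hε]
    linarith
  have h := Metric.dist_le_diam_of_mem E.isBounded hy hx
  rw [dist_eq_norm, add_sub_cancel_left, norm_smul] at h
  simp [abs_of_pos hε] at h
  exact lt_of_lt_of_le (by linarith) h

/-- A shape-regular element is covered by a uniformly bounded number of star-shaped domains. -/
theorem exists_uniform_cover {α : ℝ} (hα : 0 < α) : ∃ (ι : Type) (_ : Fintype ι), ∀ E : Element,
    E.Regular α → ∃ (D : ι → Set R2) (z : ι → R2), E.carrier = ⋃ i, D i ∧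
      ∀ i, StarBall (D i) (z i) (α * E.diam / 2) := by
  -- The centres of the given balls are sorted into a square grid of side `s = α h / 4` around a
  -- point `p` of the element. They lie within `h = (4 / α) * s` of `p`, so their cell indices range
  -- from `-m - 1` to `m`, whatever the number of given domains.
  set m : ℤ := ⌈4 / α⌉
  refine ⟨Finset.Icc (-m - 1) m × Finset.Icc (-m - 1) m, inferInstance, fun E hE => ?_⟩
  obtain ⟨⟨N, D, hED, hD⟩, -⟩ := hE
  choose hDo x r hr hball hstar using hD
  set h := E.diam
  have hh : 0 < h := E.diam_pos
  obtain ⟨p, hp⟩ := E.isConnected.nonempty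
  set s : ℝ := α * h / 4 with hs
  have hs0 : 0 < s := by positivity
  have hr0 : ∀ j, 0 < r j := fun j => lt_trans (by positivity) (hr j)
  have hxE : ∀ j, x j ∈ E.carrier := fun j => by
    rw [hED]; exact mem_iUnion.2 ⟨j, hball j (Metric.mem_ball_self (hr0 j))⟩
  set cell : Fin N → Fin 2 → ℤ := fun j d => ⌊(x j d - p d) / s⌋ with hcell
  have hcellm : ∀ j d, cell j d ∈ Finset.Icc (-m - 1) m := by
    intro j d
    have h1 : |x j d - p d| ≤ h := by
      have := PiLp.norm_apply_le (x j - p) d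
      rw [PiLp.sub_apply, Real.norm_eq_abs] at this
      refine this.trans ?_
      rw [← dist_eq_norm]
      exact Metric.dist_le_diam_of_mem E.isBounded (hxE j) hp
    have h2 : |(x j d - p d) / s| ≤ m := by
      rw [abs_div, abs_of_pos hs0, div_le_iff₀ hs0]
      have h4 : 4 / α ≤ m := Int.le_ceil _
      calc |x j d - p d| ≤ h := h1
        _ = 4 / α * s := by rw [hs]; field_simp
        _ ≤ m * s := by gcongr
    rw [abs_le] at h2
    rw [Finset.mem_Icc]
    constructor
    · rw [Int.le_floor]; push_cast; linarith
    · have := (Int.floor_le ((x j d - p d) / s)).trans h2.2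
      exact Int.cast_le.1 this
  set idx : Fin N → Finset.Icc (-m - 1) m × Finset.Icc (-m - 1) m := fun j =>
    (⟨cell j 0, hcellm j 0⟩, ⟨cell j 1, hcellm j 1⟩) with hidx
  set z : Finset.Icc (-m - 1) m × Finset.Icc (-m - 1) m → R2 := fun i =>
    p + s • !₂[((i.1 : ℤ) : ℝ), ((i.2 : ℤ) : ℝ)] with hz
  have hclose : ∀ j, dist (z (idx j)) (x j) ≤ 2 * s := by
    intro j
    have hc : ∀ d, |z (idx j) d - x j d| ≤ s := by
      intro d
      have e : z (idx j) d = p d + s * cell j d := by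
        fin_cases d <;> simp [hz, hidx]
      rw [e]
      have h1 := Int.floor_le ((x j d - p d) / s)
      have h2 := Int.lt_floor_add_one ((x j d - p d) / s)
      rw [le_div_iff₀ hs0] at h1
      rw [div_lt_iff₀ hs0] at h2
      have h3 : (⌊(x j d - p d) / s⌋ : ℝ) = cell j d := rfl
      rw [h3] at h1 h2
      rw [abs_le]; constructor <;> nlinarith
    rw [EuclideanSpace.dist_eq, Fin.sum_univ_two]
    apply Real.sqrt_le_iff.2
    refine ⟨by positivity, ?_⟩
    rw [Real.dist_eq, Real.dist_eq, sq_abs, sq_abs]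
    have h0 := sq_le_sq' (abs_le.1 (hc 0)).1 (abs_le.1 (hc 0)).2
    have h1 := sq_le_sq' (abs_le.1 (hc 1)).1 (abs_le.1 (hc 1)).2
    nlinarith
  -- All domains whose centre falls into the same cell are merged. The grid point is within `2 * s =
  -- α h / 2` of these centres, so the ball of radius `α h / 2` around it lies in each of their
  -- balls, and a union of sets star-shaped with respect to a common ball is star-shaped with
  -- respect to it. Unoccupied cells give empty pieces.
  refine ⟨fun i => ⋃ j ∈ {j | idx j = i}, D j, z, ?_, fun i => ⟨?_, ?_⟩⟩
  · rw [hED]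
    ext y
    simp only [mem_iUnion]
    constructor
    · rintro ⟨j, hj⟩; exact ⟨idx j, j, rfl, hj⟩
    · rintro ⟨-, j, -, hj⟩; exact ⟨j, hj⟩
  · exact isOpen_biUnion fun j _ => hDo j
  · intro y hy w hw a b ha hb hab
    obtain ⟨j, hj, hwj⟩ := mem_iUnion₂.1 hw
    have hj' : idx j = i := hj
    refine mem_iUnion₂.2 ⟨j, hj, hstar j y ?_ hwj ha hb hab⟩
    rw [Metric.mem_ball] at hy ⊢
    have h1 := hclose j
    rw [hj'] at h1
    calc dist y (x j) ≤ dist y (z i) + dist (z i) (x j) := dist_triangle _ _ _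
      _ < α * h / 2 + 2 * s := by linarith
      _ = α * h := by rw [hs]; ring
      _ < r j := hr j

/-! ### The Poincaré inequality for virtual element functions -/

theorem MemSobolev.lintegral_gradSq {U : Set R2} (hU : IsOpen U) {u : R2 → ℝ}
    (h : MemSobolev U 1 2 u) :
    ∫⁻ x in U, ENNReal.ofReal (∑ d, weakDeriv U (unitIdx d) u x ^ 2) =
      ENNReal.ofReal (sobolevSemi U 1 u ^ 2) := by
  have hi : ∀ d, Integrable (fun x => weakDeriv U (unitIdx d) u x ^ 2) (volume.restrict U) :=
    fun d => (h.memLp_weakDeriv hU (unitIdx_order d).le).integrable_sq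
  rw [sobolevSemi_one_sq, ← integral_finsetSum _ fun d _ => hi d,
    ofReal_integral_eq_lintegral_ofReal (integrable_finsetSum _ fun d _ => hi d)
      (Filter.Eventually.of_forall fun x => Finset.sum_nonneg fun d _ => sq_nonneg _)]

theorem volume_le_sq_diam {E : Set R2} (hb : Bornology.IsBounded E) :
    volume E ≤ ENNReal.ofReal (4 * Metric.diam E ^ 2) := by
  rcases E.eq_empty_or_nonempty with rfl | ⟨x, hx⟩
  · simp
  refine (measure_mono (t := Metric.closedBall x (Metric.diam E)) fun y hy =>
    Metric.dist_le_diam_of_mem hb hy hx).trans ?_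
  rw [EuclideanSpace.volume_closedBall_fin_two, ← ENNReal.ofReal_pow Metric.diam_nonneg,
    ← ENNReal.ofReal_mul (by positivity)]
  refine ENNReal.ofReal_le_ofReal ?_
  have := Real.pi_le_four
  nlinarith [sq_nonneg (Metric.diam E)]

theorem Element.volume_lt_top (E : Element) : volume E.carrier < ⊤ :=
  E.isBounded.measure_lt_top

theorem edgePath_eq {n : ℕ} (p : Polygon R2 (n + 3)) (i : Fin (n + 3)) (t : ℝ) :
    p.edgePath ℝ i t = p i + t • (p (finRotate _ i) - p i) := by
  rw [Polygon.edgePath, AffineMap.lineMap_apply, vsub_eq_sub, vadd_eq_add, add_comm]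

theorem Element.edgePath_mem_frontier (E : Element) (i : Fin (E.n + 3)) {t : ℝ}
    (ht : t ∈ Icc (0 : ℝ) 1) : E.poly.edgePath ℝ i t ∈ frontier E.carrier := by
  rw [E.frontier_eq]
  exact mem_iUnion.2 ⟨i, mem_image_of_mem _ ht⟩

theorem Element.exists_edgePath (E : Element) {x : R2} (hx : x ∈ frontier E.carrier) :
    ∃ i, ∃ t ∈ Icc (0 : ℝ) 1, E.poly.edgePath ℝ i t = x := by
  rw [E.frontier_eq] at hx
  obtain ⟨i, t, ht, rfl⟩ := mem_iUnion.1 hx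
  exact ⟨i, t, ht, rfl⟩

/-- The line through an edge stays away from the centre of each star-shaped subdomain whose
closure contains an interior point of the edge. -/
theorem Element.le_dist_line (E : Element) (i : Fin (E.n + 3)) {D : Set R2} {z : R2} {r : ℝ}
    (hD : StarBall D z r) (hDE : D ⊆ E.carrier) {s : ℝ} (hs : s ∈ Ioo (0 : ℝ) 1)
    (hsD : E.poly.edgePath ℝ i s ∈ closure D) (t : ℝ) :
    r ≤ dist (E.poly.edgePath ℝ i t) z := by
  -- If the line came closer than `r` to `z` at the parameter `t`, the segment from that point to
  -- the edge point `s` would lie in `D`, except perhaps for its end `s`. Near `s` it consists of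
  -- points of the edge, which are on the frontier and not in the open set.
  by_contra! hlt
  have hcont : ContinuousAt (fun w : ℝ => t + w * (s - t)) 1 := by fun_prop
  have hev : ∀ᶠ w in nhds (1 : ℝ), t + w * (s - t) ∈ Ioo (0 : ℝ) 1 :=
    hcont (Ioo_mem_nhds (by simpa using hs.1) (by simpa using hs.2))
  obtain ⟨ε, hε, hball⟩ := Metric.eventually_nhds_iff.1 hev
  set w := 1 - min (ε / 2) 1
  have hw1 : w < 1 := by simp only [w]; linarith [lt_min (half_pos hε) one_pos]
  have hw0 : 0 ≤ w := by simp only [w]; linarith [min_le_right (ε / 2) 1]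
  have hwd : dist w 1 < ε := by
    rw [Real.dist_eq, abs_sub_comm, abs_of_pos (by linarith)]
    simp only [w]
    linarith [min_le_left (ε / 2) 1]
  have hmem := hD.mem_of_mem_closure hsD (z' := E.poly.edgePath ℝ i t) hlt hw0 hw1
  have e : E.poly.edgePath ℝ i t + w • (E.poly.edgePath ℝ i s - E.poly.edgePath ℝ i t) =
      E.poly.edgePath ℝ i (t + w * (s - t)) := by
    simp only [edgePath_eq]
    module
  rw [e] at hmem
  have hfr := E.edgePath_mem_frontier i (Ioo_subset_Icc_self (hball hwd))
  rw [frontier, E.isOpen.interior_eq] at hfr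
  exact hfr.2 (hDE hmem)

/-- Pigeonhole: this selects the piece that sees a fixed fraction of an edge. -/
theorem exists_volume_ge {ι : Type} [Fintype ι] [Nonempty ι] {T : ι → Set ℝ}
    (h : Icc 0 1 ⊆ ⋃ j, T j) : ∃ j, ENNReal.ofReal (1 / Fintype.card ι) ≤ volume (T j) := by
  by_contra! hcon
  have h1 : (1 : ℝ≥0∞) ≤ ∑ j, volume (T j) := by
    calc (1 : ℝ≥0∞) = volume (Icc (0 : ℝ) 1) := by simp
      _ ≤ _ := (measure_mono h).trans (measure_iUnion_fintype_le _ _)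
  have h2 : ∑ j, volume (T j) < ∑ _j : ι, ENNReal.ofReal (1 / Fintype.card ι) :=
    ENNReal.sum_lt_sum_of_nonempty Finset.univ_nonempty fun j _ => hcon j
  rw [Finset.sum_const, Finset.card_univ, nsmul_eq_mul, ← ENNReal.ofReal_natCast,
    ← ENNReal.ofReal_mul (Nat.cast_nonneg _), mul_one_div_cancel (by positivity),
    ENNReal.ofReal_one] at h2
  exact absurd h1 (not_le.2 h2)

/-- Each edge is covered by the closures of boundedly many star-shaped pieces, so one of them
touches a fixed fraction of the edge. The trace inequality compares `u` there with its mean over a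
ball in that piece, and the Remez inequality extends this to the whole edge because `u` is a
polynomial on it. Neighbouring edges meet in a vertex, so their means are close, and the cyclic gap
argument compares all of them. Nothing is assumed on how the pieces overlap. -/
theorem exists_frontier_osc_le {α : ℝ} (hα : 0 < α) (k : ℕ) : ∃ C > 0, ∀ E : Element,
    E.Regular α → ∀ u ∈ enlargedSpace E k, ∃ c : ℝ, ∀ x ∈ frontier E.carrier,
      |u x - c| ≤ C * sobolevSemi E.carrier 1 u := by
  obtain ⟨ι, hι, hcov⟩ := exists_uniform_cover hα
  rcases isEmpty_or_nonempty ι with he | hne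
  · refine ⟨1, one_pos, fun E hE => ?_⟩
    obtain ⟨D, z, hED, -⟩ := hcov E hE
    have := E.isConnected.nonempty
    rw [hED] at this
    simp at this
  obtain ⟨CR, hCR, hremez⟩ := exists_remez k (τ := 1 / Fintype.card ι) (by positivity)
  -- `384 / α ^ 2` is the constant `96 * h ^ 2 / r ^ 2` of the trace inequality for `r = α h / 2`.
  set C₁ := √(CR * (384 / α ^ 2)) with hC₁
  have hC₁0 : 0 < C₁ := Real.sqrt_pos.2 (by positivity)
  refine ⟨C₁ + Fintype.card ι * (2 * (2 * C₁)), by positivity, fun E hE u hu => ?_⟩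
  obtain ⟨D, z, hED, hD⟩ := hcov E hE
  obtain ⟨huS, huc, -, hedge⟩ := hu
  choose q hq hqe using hedge
  set h := E.diam
  set r := α * h / 2 with hr
  have hh : 0 < h := E.diam_pos
  have hr0 : 0 < r := by positivity
  set G := sobolevSemi E.carrier 1 u
  have hG : 0 ≤ G := Real.sqrt_nonneg _
  set c : ι → ℝ := fun j => ⨍ y in Metric.ball (z j) (r / 2), u y
  have hDE : ∀ j, D j ⊆ E.carrier := fun j => by rw [hED]; exact subset_iUnion D j
  have hstep : ∀ i, ∃ j, ∀ t ∈ Icc (0 : ℝ) 1, |(q i).eval t - c j| ≤ C₁ * G := by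
    intro i
    set T : ι → Set ℝ := fun j => {s ∈ Icc (0 : ℝ) 1 | E.poly.edgePath ℝ i s ∈ closure (D j)}
    have hpath : Continuous fun s : ℝ => E.poly.edgePath ℝ i s := by
      simp only [edgePath_eq]; fun_prop
    have hTm : ∀ j, MeasurableSet (T j) := fun j =>
      measurableSet_Icc.inter (hpath.measurable isClosed_closure.measurableSet)
    have hTcov : Icc 0 1 ⊆ ⋃ j, T j := by
      intro s hs
      have h1 := frontier_subset_closure (E.edgePath_mem_frontier i hs)
      rw [hED, closure_iUnion_of_finite] at h1
      obtain ⟨j, hj⟩ := mem_iUnion.1 h1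
      exact mem_iUnion.2 ⟨j, hs, hj⟩
    obtain ⟨j, hj⟩ := exists_volume_ge hTcov
    refine ⟨j, ?_⟩
    -- Positive measure provides a point of `T j` in the interior of the edge, which
    -- `Element.le_dist_line` requires.
    obtain ⟨s, hs, hs01⟩ : ∃ s ∈ T j, s ∈ Ioo (0 : ℝ) 1 := by
      by_contra! hcon
      have hsub : T j ⊆ {0, 1} := by
        intro s hs
        have h2 := hcon s hs
        rw [mem_Ioo, not_and_or, not_lt, not_lt] at h2
        rcases h2 with h2 | h2
        · exact Or.inl (le_antisymm h2 hs.1.1)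
        · exact Or.inr (le_antisymm hs.1.2 h2)
      have h0 : volume (T j) = 0 := measure_mono_null hsub ((Set.toFinite _).measure_zero _)
      rw [h0, nonpos_iff_eq_zero, ENNReal.ofReal_eq_zero] at hj
      have : (0 : ℝ) < 1 / Fintype.card ι := by positivity
      linarith
    have hline := E.le_dist_line i (hD j) (hDE j) hs01 hs.2
    have hDne : (D j).Nonempty := closure_nonempty_iff.1 ⟨_, hs.2⟩
    have htr := (hD j).trace_sobolev E.isOpen E.isBounded huc
      (fun d => huS.hasWeakDeriv (unitIdx_order d).le)
      (fun d => (huS.memLp_weakDeriv E.isOpen (unitIdx_order d).le).1) hr0 hDne (hDE j)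
      (a := E.poly i) (τ := E.poly (finRotate _ i) - E.poly i)
      (by
        rw [← dist_eq_norm, dist_comm, hr]
        have := hE.2 i
        have : 0 < α * h := by positivity
        linarith)
      (fun s => by rw [← edgePath_eq]; exact hline s) (hTm j) (fun s hs => hs.1)
      (fun s hs => by rw [← edgePath_eq]; exact hs.2)
    rw [huS.lintegral_gradSq E.isOpen, ← ENNReal.ofReal_mul (by positivity)] at htr
    have hpoly : ∫⁻ s in T j, ENNReal.ofReal ((q i - Polynomial.C (c j)).eval s ^ 2) ≤
        ENNReal.ofReal (384 / α ^ 2 * G ^ 2) := by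
      refine le_trans (le_of_eq ?_) (htr.trans_eq ?_)
      · refine setLIntegral_congr_fun (hTm j) fun s hs => ?_
        rw [Polynomial.eval_sub, Polynomial.eval_C, ← hqe i s hs.1, edgePath_eq]
      · congr 2
        change 96 * h ^ 2 / r ^ 2 = _
        rw [hr]
        field_simp
        norm_num
    have hdeg : (q i - Polynomial.C (c j)).natDegree ≤ k := by
      refine (Polynomial.natDegree_sub_le _ _).trans ?_
      simpa using hq i
    intro t ht
    have h1 := hremez _ hdeg (T j) (hTm j) (fun s hs => hs.1) hj _ (by positivity) hpoly t ht
    rw [Polynomial.eval_sub, Polynomial.eval_C] at h1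
    refine (Real.abs_le_sqrt h1).trans_eq ?_
    rw [hC₁, ← mul_assoc, Real.sqrt_mul (by positivity), Real.sqrt_sq hG]
  choose j hj using hstep
  -- The end of an edge is the start of the next one, and both polynomial traces equal `u` there.
  have hadj : ∀ e, |c (j e) - c (j (finRotate _ e))| ≤ 2 * (C₁ * G) := by
    intro e
    have h1 := hj e 1 (by simp)
    have h0 := hj (finRotate _ e) 0 (by simp)
    have e1 : (q e).eval 1 = (q (finRotate _ e)).eval 0 := by
      rw [← hqe e 1 (by simp), ← hqe (finRotate _ e) 0 (by simp), edgePath_eq, edgePath_eq]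
      congr 1
      module
    rw [e1, abs_sub_comm] at h1
    calc |c (j e) - c (j (finRotate _ e))|
        ≤ |c (j e) - (q (finRotate _ e)).eval 0| +
          |(q (finRotate _ e)).eval 0 - c (j (finRotate _ e))| := abs_sub_le _ _ _
      _ ≤ _ := by linarith
  refine ⟨c (j 0), fun x hx => ?_⟩
  obtain ⟨i, t, ht, rfl⟩ := E.exists_edgePath hx
  have h1 := hj i t ht
  have h2 := abs_sub_le_of_cyclic j c hadj i 0
  rw [hqe i t ht]
  calc |(q i).eval t - c (j 0)| ≤ |(q i).eval t - c (j i)| + |c (j i) - c (j 0)| :=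
        abs_sub_le _ _ _
    _ ≤ C₁ * G + Fintype.card ι * (2 * (2 * (C₁ * G))) := add_le_add h1 h2
    _ = _ := by ring

theorem hasWeakDeriv_const (U : Set R2) (c : ℝ) (d : Fin 2) :
    HasWeakDeriv U (unitIdx d) (fun _ => c) (fun _ => 0) := by
  have := hasWeakDeriv_of_contDiff U (f := fun _ => c) contDiff_const d
  have e : pderiv d (fun _ : R2 => c) = fun _ => 0 := by
    funext x
    simp [pderiv]
  rwa [e] at this

/-- `u - c` is bounded by `C |u|₁` on the frontier, so Friedrichs' inequality applies with that
bound as `δ`. The area is at most `4 h_E²`, hence `28 = 7 * 4`, and both terms scale like `h_E²`. -/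
theorem exists_poincare {α : ℝ} (hα : 0 < α) (k : ℕ) : ∃ C > 0, ∀ E : Element,
    E.Regular α → ∀ u ∈ enlargedSpace E k, ∃ c : ℝ,
      ∫ x in E.carrier, (u x - c) ^ 2 ≤ C * E.diam ^ 2 * sobolevSemi E.carrier 1 u ^ 2 := by
  obtain ⟨C, hC, hosc⟩ := exists_frontier_osc_le hα k
  refine ⟨28 * C ^ 2 + 4, by positivity, fun E hE u hu => ?_⟩
  obtain ⟨c, hc⟩ := hosc E hE u hu
  refine ⟨c, ?_⟩
  set G := sobolevSemi E.carrier 1 u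
  have hG : 0 ≤ G := Real.sqrt_nonneg _
  have hw : ∀ d, HasWeakDeriv E.carrier (unitIdx d) (fun x => u x - c)
      (weakDeriv E.carrier (unitIdx d) u) := fun d => by
    have := (hu.1.hasWeakDeriv (unitIdx_order d).le).sub (hasWeakDeriv_const E.carrier c d)
    rw [show (fun _ => (0 : ℝ)) = (0 : R2 → ℝ) from rfl, sub_zero] at this
    exact this
  have hF := friedrichs_sobolev E.isOpen E.isBounded (u := fun x => u x - c)
    (hu.2.1.sub continuousOn_const) hw
    (fun d => (hu.1.memLp_weakDeriv E.isOpen (unitIdx_order d).le).1) (δ := C * G) (by positivity) hc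
  have hint : Integrable (fun x => (u x - c) ^ 2) (volume.restrict E.carrier) :=
    integrableOn_of_continuousOn_closure E.isBounded ((hu.2.1.sub continuousOn_const).pow 2)
  rw [hu.1.lintegral_gradSq E.isOpen, ← ofReal_integral_eq_lintegral_ofReal hint
    (Filter.Eventually.of_forall fun _ => sq_nonneg _)] at hF
  have hvol := volume_le_sq_diam E.isBounded
  have h2 : ENNReal.ofReal (∫ x in E.carrier, (u x - c) ^ 2) ≤
      ENNReal.ofReal ((28 * C ^ 2 + 4) * E.diam ^ 2 * G ^ 2) := by
    refine hF.trans ((add_le_add (mul_le_mul_right hvol _) le_rfl).trans_eq ?_)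
    rw [← ENNReal.ofReal_mul (by positivity), ← ENNReal.ofReal_mul (by positivity),
      ← ENNReal.ofReal_add (by positivity) (by positivity)]
    congr 1
    rw [Element.diam]
    ring
  exact (ENNReal.ofReal_le_ofReal_iff (by positivity)).1 h2

/-! ### Polynomial functions on the plane -/

/-- Evaluation of a polynomial as a function on the plane. -/
def evalPoly : MvPolynomial (Fin 2) ℝ →ₗ[ℝ] (R2 → ℝ) where
  toFun q x := MvPolynomial.eval (fun d => x d) q
  map_add' p q := by funext x; simp
  map_smul' c q := by funext x; simp [MvPolynomial.smul_eval]

theorem evalPoly_apply (q : MvPolynomial (Fin 2) ℝ) (x : R2) :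
    evalPoly q x = MvPolynomial.eval (fun d => x d) q := rfl

/-- `polySpace k` as a subspace. -/
def polySub (k : ℕ) : Submodule ℝ (R2 → ℝ) :=
  (MvPolynomial.restrictTotalDegree (Fin 2) ℝ k).map evalPoly

theorem mem_polySub {k : ℕ} {p : R2 → ℝ} : p ∈ polySub k ↔ p ∈ polySpace k := by
  constructor
  · rintro ⟨q, hq, rfl⟩
    exact ⟨q, (MvPolynomial.mem_restrictTotalDegree _ _ _).1 hq, fun x => rfl⟩
  · rintro ⟨q, hq, h⟩
    exact ⟨q, (MvPolynomial.mem_restrictTotalDegree _ _ _).2 hq, (funext h).symm⟩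

instance (k : ℕ) : Module.Finite ℝ (polySub k) := by
  unfold polySub
  infer_instance

theorem evalPoly_mem {q : MvPolynomial (Fin 2) ℝ} {k : ℕ} (hq : q.totalDegree ≤ k) :
    evalPoly q ∈ polySpace k := ⟨q, hq, fun _ => rfl⟩

theorem exists_evalPoly {k : ℕ} {p : R2 → ℝ} (hp : p ∈ polySpace k) :
    ∃ q : MvPolynomial (Fin 2) ℝ, q.totalDegree ≤ k ∧ p = evalPoly q := by
  obtain ⟨q, hq, h⟩ := hp
  exact ⟨q, hq, funext h⟩

theorem polySpace_mono {k l : ℕ} (h : k ≤ l) : polySpace k ⊆ polySpace l := by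
  rintro p ⟨q, hq, h'⟩
  exact ⟨q, hq.trans h, h'⟩

theorem const_mem_polySpace (k : ℕ) (c : ℝ) : (fun _ => c) ∈ polySpace k :=
  ⟨MvPolynomial.C c, by simp, fun x => by simp⟩

theorem contDiff_evalPoly (q : MvPolynomial (Fin 2) ℝ) : ContDiff ℝ ∞ (evalPoly q) := by
  induction q using MvPolynomial.induction_on with
  | C a =>
    have : evalPoly (MvPolynomial.C a) = fun _ => a := by funext x; simp [evalPoly_apply]
    rw [this]
    exact contDiff_const
  | add p q hp hq => rw [map_add]; exact hp.add hq
  | mul_X p d hp =>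
    have : evalPoly (p * MvPolynomial.X d) = fun x => evalPoly p x * x d := by
      funext x; simp [evalPoly_apply]
    rw [this]
    exact hp.mul (by fun_prop)

theorem contDiff_of_mem_polySpace {k : ℕ} {p : R2 → ℝ} (hp : p ∈ polySpace k) :
    ContDiff ℝ ∞ p := by
  obtain ⟨q, -, rfl⟩ := exists_evalPoly hp
  exact contDiff_evalPoly q

theorem pderiv_evalPoly (q : MvPolynomial (Fin 2) ℝ) (d : Fin 2) :
    pderiv d (evalPoly q) = evalPoly (MvPolynomial.pderiv d q) := by
  have hdiff : ∀ q x, DifferentiableAt ℝ (evalPoly q) x := fun q x =>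
    (contDiff_evalPoly q).differentiable (by simp) x
  induction q using MvPolynomial.induction_on with
  | C a =>
    have : evalPoly (MvPolynomial.C a) = fun _ => a := by funext x; simp [evalPoly_apply]
    rw [this]
    funext x
    simp [pderiv]
  | add p q hp hq =>
    rw [map_add, map_add, map_add, ← hp, ← hq]
    funext x
    simp only [pderiv, Pi.add_apply]
    rw [fderiv_add (hdiff p x) (hdiff q x)]
    rfl
  | mul_X p e hp =>
    have h1 : evalPoly (p * MvPolynomial.X e) = evalPoly p * fun x => x e := by
      funext x; simp [evalPoly_apply]
    funext x
    rw [h1]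
    have hx : HasFDerivAt (fun x : R2 => x e) (EuclideanSpace.proj (𝕜 := ℝ) e) x :=
      (EuclideanSpace.proj (𝕜 := ℝ) (ι := Fin 2) e).hasFDerivAt
    have hp' := congrFun hp x
    simp only [pderiv] at hp' ⊢
    rw [fderiv_mul (hdiff p x) hx.differentiableAt, hx.fderiv]
    simp only [_root_.add_apply, _root_.smul_apply, smul_eq_mul, hp']
    rw [evalPoly_apply, evalPoly_apply, evalPoly_apply]
    by_cases h : e = d
    · subst h; simp
    · simp [h]

theorem totalDegree_pderiv_le (q : MvPolynomial (Fin 2) ℝ) (d : Fin 2) :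
    (MvPolynomial.pderiv d q).totalDegree ≤ q.totalDegree - 1 := by
  conv_lhs => rw [← MvPolynomial.support_sum_monomial_coeff q, map_sum]
  refine MvPolynomial.totalDegree_finsetSum_le fun s hs => ?_
  rw [MvPolynomial.pderiv_monomial]
  by_cases h0 : s d = 0
  · simp [h0]
  refine (MvPolynomial.totalDegree_monomial_le _ _).trans ?_
  have h1 := MvPolynomial.le_totalDegree hs
  have h2 : (s - Finsupp.single d 1) + Finsupp.single d 1 = s := by
    refine tsub_add_cancel_of_le ?_
    rw [Finsupp.single_le_iff]
    omega
  have h3 : s.sum (fun _ e => e) = (s - Finsupp.single d 1).sum (fun _ e => e) + 1 := by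
    conv_lhs => rw [← h2]
    rw [Finsupp.sum_add_index' (by simp) (by simp)]
    simp
  change (s - Finsupp.single d 1).sum (fun _ e => e) ≤ _
  omega

theorem pderiv_mem_polySpace {k : ℕ} {p : R2 → ℝ} (hp : p ∈ polySpace k) (d : Fin 2) :
    pderiv d p ∈ polySpace (k - 1) := by
  obtain ⟨q, hq, rfl⟩ := exists_evalPoly hp
  rw [pderiv_evalPoly]
  exact evalPoly_mem ((totalDegree_pderiv_le q d).trans (by omega))

theorem totalDegree_aeval_le (q : MvPolynomial (Fin 2) ℝ) (L : Fin 2 → MvPolynomial (Fin 2) ℝ)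
    (hL : ∀ d, (L d).totalDegree ≤ 1) : (MvPolynomial.aeval L q).totalDegree ≤ q.totalDegree := by
  rw [MvPolynomial.aeval_def, MvPolynomial.eval₂_eq]
  refine MvPolynomial.totalDegree_finsetSum_le fun s hs => ?_
  refine (MvPolynomial.totalDegree_mul _ _).trans ?_
  have h1 := MvPolynomial.le_totalDegree hs
  refine le_trans ?_ h1
  rw [MvPolynomial.algebraMap_eq, MvPolynomial.totalDegree_C, zero_add]
  refine (MvPolynomial.totalDegree_finsetProd _ _).trans ?_
  refine Finset.sum_le_sum fun d _ => (MvPolynomial.totalDegree_pow _ _).trans ?_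
  calc s d * (L d).totalDegree ≤ s d * 1 := Nat.mul_le_mul_left _ (hL d)
    _ = s d := mul_one _

theorem comp_affine_mem_polySpace {k : ℕ} {p : R2 → ℝ} (hp : p ∈ polySpace k) (x : R2) (r : ℝ) :
    (fun y => p (x + r • y)) ∈ polySpace k := by
  obtain ⟨q, hq, rfl⟩ := exists_evalPoly hp
  refine ⟨MvPolynomial.aeval
    (fun d => MvPolynomial.C (x d) + MvPolynomial.C r * MvPolynomial.X d) q, ?_, fun y => ?_⟩
  · refine (totalDegree_aeval_le q _ fun d => ?_).trans hq
    refine (MvPolynomial.totalDegree_add _ _).trans (max_le (by simp) ?_)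
    refine (MvPolynomial.totalDegree_mul _ _).trans ?_
    simp
  · beta_reduce
    rw [evalPoly_apply, MvPolynomial.aeval_def, MvPolynomial.eval₂_eq', MvPolynomial.eval_eq',
      map_sum]
    refine Finset.sum_congr rfl fun s _ => ?_
    simp [MvPolynomial.algebraMap_eq]

/-- An open set contains a box, and a polynomial that vanishes on a product of infinite sets is
zero. -/
theorem eq_zero_of_eqOn_isOpen {k : ℕ} {p : R2 → ℝ} (hp : p ∈ polySpace k) {U : Set R2}
    (hU : IsOpen U) (hne : U.Nonempty) (h : ∀ x ∈ U, p x = 0) : p = 0 := by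
  obtain ⟨q, -, rfl⟩ := exists_evalPoly hp
  obtain ⟨x, hx⟩ := hne
  have hO : IsOpen (WithLp.toLp 2 ⁻¹' U : Set (Fin 2 → ℝ)) :=
    hU.preimage (PiLp.continuous_toLp 2 _)
  obtain ⟨ε, hε, hb⟩ := Metric.isOpen_iff.1 hO (fun d => x d) hx
  have hq : q = 0 := by
    refine MvPolynomial.funext_set (s := fun d => Metric.ball (x d) ε) (fun d => ?_) fun y hy => ?_
    · rw [Real.ball_eq_Ioo]
      exact Ioo_infinite (by linarith)
    · rw [map_zero]
      refine h (WithLp.toLp 2 y) (hb ?_)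
      rw [ball_pi _ hε]
      exact hy
  rw [hq, map_zero]

section

/-! ### Positive definite forms on finite-dimensional spaces -/

/-- The quadratic form is positive and continuous on the compact unit sphere of the coordinates, and
both sides are homogeneous of degree two. Symmetry of `B` is not needed, which matters for the
discrete form. -/
theorem exists_coord_sq_le {V : Type*} [AddCommGroup V] [Module ℝ V] {ι : Type*} [Fintype ι]
    (b : Module.Basis ι ℝ V) (B : LinearMap.BilinForm ℝ V) (hB : ∀ v, v ≠ 0 → 0 < B v v) :
    ∃ C > 0, ∀ v i, b.repr v i ^ 2 ≤ C * B v v := by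
  set Q : (ι → ℝ) → ℝ := fun c => B (∑ i, c i • b i) (∑ i, c i • b i) with hQ
  have hQc : Continuous Q := by
    simp only [hQ, map_sum, LinearMap.sum_apply, map_smul, LinearMap.smul_apply, smul_eq_mul]
    fun_prop
  have hQpos : ∀ c, c ≠ 0 → 0 < Q c := by
    intro c hc
    refine hB _ fun h => hc ?_
    funext i
    exact Fintype.linearIndependent_iff.1 b.linearIndependent c h i
  have hQs : ∀ (t : ℝ) (c : ι → ℝ), Q (t • c) = t ^ 2 * Q c := by
    intro t c
    have : ∑ i, (t • c) i • b i = t • ∑ i, c i • b i := by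
      rw [Finset.smul_sum]
      exact Finset.sum_congr rfl fun i _ => by rw [Pi.smul_apply, smul_eq_mul, mul_smul]
    simp only [hQ]
    rw [this, LinearMap.map_smul₂, map_smul, smul_eq_mul, smul_eq_mul]
    ring
  have hne : ∀ c ∈ Metric.sphere (0 : ι → ℝ) 1, c ≠ 0 := fun c hc h => by
    simp [h] at hc
  obtain ⟨C, hC⟩ := (isCompact_sphere (0 : ι → ℝ) 1).exists_bound_of_continuousOn
    (f := fun c => (Q c)⁻¹) (hQc.continuousOn.inv₀ fun c hc => (hQpos c (hne c hc)).ne')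
  refine ⟨max C 1, by positivity, fun v i => ?_⟩
  have hv : B v v = Q (b.repr v) := by
    simp only [hQ]
    rw [b.sum_repr]
  set c : ι → ℝ := ⇑(b.repr v)
  rw [hv]
  by_cases hc : c = 0
  · have h0 : Q 0 = 0 := by simp [hQ]
    rw [hc, h0]
    simp
  have hn : 0 < ‖c‖ := norm_pos_iff.2 hc
  have h1 := hC (‖c‖⁻¹ • c) (by
    rw [mem_sphere_zero_iff_norm, norm_smul, norm_inv, norm_norm, inv_mul_cancel₀ hn.ne'])
  have hQp := hQpos c hc
  rw [hQs, norm_inv, Real.norm_of_nonneg (by positivity), mul_inv, inv_pow, inv_inv,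
    ← div_eq_mul_inv, div_le_iff₀ hQp] at h1
  calc c i ^ 2 = ‖c i‖ ^ 2 := by rw [Real.norm_eq_abs, sq_abs]
    _ ≤ ‖c‖ ^ 2 := pow_le_pow_left₀ (norm_nonneg _) (norm_le_pi_norm c i) 2
    _ ≤ C * Q c := h1
    _ ≤ _ := mul_le_mul_of_nonneg_right (le_max_left _ _) hQp.le

/-! ### `L²`-projection onto polynomials -/

theorem _root_.MeasureTheory.MemLp.integrable_mul_fun {X : Type*} [MeasurableSpace X]
    {μ : Measure X} {f g : X → ℝ} (hf : MemLp f 2 μ) (hg : MemLp g 2 μ) :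
    Integrable (fun x => f x * g x) μ :=
  hf.integrable_mul hg

theorem _root_.MeasureTheory.MemLp.sub_fun {X : Type*} [MeasurableSpace X]
    {μ : Measure X} {f g : X → ℝ} (hf : MemLp f 2 μ) (hg : MemLp g 2 μ) :
    MemLp (fun x => f x - g x) 2 μ :=
  hf.sub hg

theorem setIntegral_sq_nonneg (E : Set R2) (f : R2 → ℝ) : 0 ≤ ∫ x in E, f x ^ 2 :=
  integral_nonneg fun _ => sq_nonneg _

/-- A bounded nonempty open set. -/
structure IsCell (E : Set R2) : Prop where
  isOpen : IsOpen E
  isBounded : Bornology.IsBounded E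
  nonempty : E.Nonempty

theorem Element.isCell (E : Element) : IsCell E.carrier :=
  ⟨E.isOpen, E.isBounded, E.isConnected.nonempty⟩

theorem isCell_ball (x : R2) {r : ℝ} (hr : 0 < r) : IsCell (Metric.ball x r) :=
  ⟨Metric.isOpen_ball, Metric.isBounded_ball, Metric.nonempty_ball.2 hr⟩

variable {E : Set R2} {k : ℕ} {u v p q : R2 → ℝ}

theorem IsCell.memLp_poly (hE : IsCell E) (hp : p ∈ polySpace k) :
    MemLp p 2 (volume.restrict E) :=
  memLp_of_continuous hE.isBounded (contDiff_of_mem_polySpace hp).continuous 2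

theorem eq_zero_of_integral_sq (hE : IsCell E) (hp : p ∈ polySpace k)
    (h : ∫ x in E, p x ^ 2 = 0) : p = 0 := by
  have hc := (contDiff_of_mem_polySpace hp).continuous
  have h1 := (integral_eq_zero_iff_of_nonneg (fun x => sq_nonneg (p x))
    (hE.memLp_poly hp).integrable_sq).1 h
  have h2 := Measure.eqOn_open_of_ae_eq (g := fun _ => (0 : ℝ)) h1 hE.isOpen
    (hc.pow 2).continuousOn continuousOn_const
  exact eq_zero_of_eqOn_isOpen hp hE.isOpen hE.nonempty fun x hx => by simpa using h2 hx

/-- The `L²(E)` inner product on polynomials. -/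
def polyForm (hE : IsCell E) (k : ℕ) : LinearMap.BilinForm ℝ (polySub k) :=
  LinearMap.mk₂ ℝ (fun p q => ∫ x in E, p.1 x * q.1 x)
    (fun p p' q => by
      simp only [Submodule.coe_add, Pi.add_apply, add_mul]
      exact integral_add ((hE.memLp_poly (mem_polySub.1 p.2)).integrable_mul_fun
        (hE.memLp_poly (mem_polySub.1 q.2))) ((hE.memLp_poly (mem_polySub.1 p'.2)).integrable_mul_fun
        (hE.memLp_poly (mem_polySub.1 q.2))))
    (fun c p q => by
      simp only [Submodule.coe_smul, Pi.smul_apply, smul_eq_mul, mul_assoc]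
      exact integral_const_mul _ _)
    (fun p q q' => by
      simp only [Submodule.coe_add, Pi.add_apply, mul_add]
      exact integral_add ((hE.memLp_poly (mem_polySub.1 p.2)).integrable_mul_fun
        (hE.memLp_poly (mem_polySub.1 q.2))) ((hE.memLp_poly (mem_polySub.1 p.2)).integrable_mul_fun
        (hE.memLp_poly (mem_polySub.1 q'.2))))
    (fun c p q => by
      simp only [Submodule.coe_smul, Pi.smul_apply, smul_eq_mul, mul_left_comm _ c]
      exact integral_const_mul _ _)

theorem polyForm_apply (hE : IsCell E) (p q : polySub k) :
    polyForm hE k p q = ∫ x in E, p.1 x * q.1 x := rfl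

theorem polyForm_self (hE : IsCell E) (p : polySub k) :
    polyForm hE k p p = ∫ x in E, p.1 x ^ 2 := by
  rw [polyForm_apply]
  simp only [sq]

theorem polyForm_pos (hE : IsCell E) (p : polySub k) (hp : p ≠ 0) : 0 < polyForm hE k p p := by
  rw [polyForm_self]
  refine lt_of_le_of_ne (integral_nonneg fun x => sq_nonneg _) fun h => hp ?_
  exact Subtype.ext (eq_zero_of_integral_sq hE (mem_polySub.1 p.2) h.symm)

/-- The polynomial inner product is positive definite, so it maps the finite-dimensional space
injectively, hence onto, its dual. -/
theorem exists_l2proj (hE : IsCell E) (k : ℕ) (hv : MemLp v 2 (volume.restrict E)) :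
    ∃ p ∈ polySpace k, ∀ q ∈ polySpace k, ∫ x in E, (v x - p x) * q x = 0 := by
  have hinj : Function.Injective (polyForm hE k) := by
    rw [← LinearMap.ker_eq_bot, LinearMap.ker_eq_bot']
    intro p hp
    by_contra hne
    have := polyForm_pos hE p hne
    rw [hp] at this
    simp at this
  have hsurj : Function.Surjective (polyForm hE k) :=
    (LinearMap.injective_iff_surjective_of_finrank_eq_finrank
      (Subspace.dual_finrank_eq (K := ℝ) (V := polySub k)).symm).1 hinj
  obtain ⟨p, hp⟩ := hsurj
    { toFun := fun q => ∫ x in E, v x * q.1 x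
      map_add' := fun q q' => by
        simp only [Submodule.coe_add, Pi.add_apply, mul_add]
        exact integral_add (hv.integrable_mul_fun (hE.memLp_poly (mem_polySub.1 q.2)))
          (hv.integrable_mul_fun (hE.memLp_poly (mem_polySub.1 q'.2)))
      map_smul' := fun c q => by
        simp only [Submodule.coe_smul, Pi.smul_apply, smul_eq_mul, mul_left_comm _ c]
        exact integral_const_mul _ _ }
  refine ⟨p.1, mem_polySub.1 p.2, fun q hq => ?_⟩
  have h1 := LinearMap.congr_fun hp ⟨q, mem_polySub.2 hq⟩
  rw [polyForm_apply] at h1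
  simp only [sub_mul]
  rw [integral_sub (hv.integrable_mul_fun (hE.memLp_poly hq))
    ((hE.memLp_poly (mem_polySub.1 p.2)).integrable_mul_fun (hE.memLp_poly hq)), h1]
  exact sub_self _

theorem l2proj_mem (hE : IsCell E) (k : ℕ) (hv : MemLp v 2 (volume.restrict E)) :
    l2proj E k v ∈ polySpace k := by
  rw [l2proj, dif_pos (exists_l2proj hE k hv)]
  exact (exists_l2proj hE k hv).choose_spec.1

theorem integral_sub_l2proj_mul (hE : IsCell E) (hv : MemLp v 2 (volume.restrict E))
    (hq : q ∈ polySpace k) : ∫ x in E, (v x - l2proj E k v x) * q x = 0 := by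
  rw [l2proj, dif_pos (exists_l2proj hE k hv)]
  exact (exists_l2proj hE k hv).choose_spec.2 q hq

theorem sub_mem_polySpace (hp : p ∈ polySpace k) (hq : q ∈ polySpace k) : p - q ∈ polySpace k :=
  mem_polySub.1 ((polySub k).sub_mem (mem_polySub.2 hp) (mem_polySub.2 hq))

theorem add_mem_polySpace (hp : p ∈ polySpace k) (hq : q ∈ polySpace k) : p + q ∈ polySpace k :=
  mem_polySub.1 ((polySub k).add_mem (mem_polySub.2 hp) (mem_polySub.2 hq))

theorem smul_mem_polySpace (c : ℝ) (hp : p ∈ polySpace k) : c • p ∈ polySpace k :=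
  mem_polySub.1 ((polySub k).smul_mem c (mem_polySub.2 hp))

theorem l2proj_eq (hE : IsCell E) (hv : MemLp v 2 (volume.restrict E)) (hp : p ∈ polySpace k)
    (h : ∀ q ∈ polySpace k, ∫ x in E, (v x - p x) * q x = 0) : l2proj E k v = p := by
  have hm := l2proj_mem hE k hv
  have hd := sub_mem_polySpace hm hp
  have hd2 := hE.memLp_poly hd
  have h1 := h _ hd
  have h2 := integral_sub_l2proj_mul hE hv hd
  have h3 : ∫ x in E, (l2proj E k v - p) x ^ 2 = 0 := by
    have e : ∀ x, (l2proj E k v - p) x ^ 2 = (v x - p x) * (l2proj E k v - p) x -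
        (v x - l2proj E k v x) * (l2proj E k v - p) x := fun x => by
      simp only [Pi.sub_apply]; ring
    simp only [e]
    rw [integral_sub ((hv.sub_fun (hE.memLp_poly hp)).integrable_mul_fun hd2)
      ((hv.sub_fun (hE.memLp_poly hm)).integrable_mul_fun hd2), h1, h2, sub_zero]
  exact sub_eq_zero.1 (eq_zero_of_integral_sq hE hd h3)

theorem l2proj_add (hE : IsCell E) (k : ℕ) (hu : MemLp u 2 (volume.restrict E))
    (hv : MemLp v 2 (volume.restrict E)) :
    l2proj E k (u + v) = l2proj E k u + l2proj E k v := by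
  have hmu := l2proj_mem hE k hu
  have hmv := l2proj_mem hE k hv
  refine l2proj_eq hE (hu.add hv) (add_mem_polySpace hmu hmv) fun q hq => ?_
  have e : ∀ x, ((u + v) x - (l2proj E k u + l2proj E k v) x) * q x =
      (u x - l2proj E k u x) * q x + (v x - l2proj E k v x) * q x := fun x => by
    simp only [Pi.add_apply]; ring
  simp only [e]
  rw [integral_add ((hu.sub_fun (hE.memLp_poly hmu)).integrable_mul_fun (hE.memLp_poly hq))
    ((hv.sub_fun (hE.memLp_poly hmv)).integrable_mul_fun (hE.memLp_poly hq)),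
    integral_sub_l2proj_mul hE hu hq, integral_sub_l2proj_mul hE hv hq, add_zero]

theorem l2proj_smul (hE : IsCell E) (k : ℕ) (hv : MemLp v 2 (volume.restrict E)) (c : ℝ) :
    l2proj E k (c • v) = c • l2proj E k v := by
  refine l2proj_eq hE (hv.const_smul c) (smul_mem_polySpace c (l2proj_mem hE k hv)) fun q hq => ?_
  have e : ∀ x, ((c • v) x - (c • l2proj E k v) x) * q x =
      c * ((v x - l2proj E k v x) * q x) := fun x => by
    simp only [Pi.smul_apply, smul_eq_mul]; ring
  simp only [e]
  rw [integral_const_mul, integral_sub_l2proj_mul hE hv hq, mul_zero]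

theorem l2proj_sub (hE : IsCell E) (k : ℕ) (hu : MemLp u 2 (volume.restrict E))
    (hv : MemLp v 2 (volume.restrict E)) :
    l2proj E k (u - v) = l2proj E k u - l2proj E k v := by
  have h := l2proj_add hE k hu (hv.const_smul (-1 : ℝ))
  rw [l2proj_smul hE k hv] at h
  simpa [sub_eq_add_neg] using h

theorem l2proj_of_mem (hE : IsCell E) (hp : p ∈ polySpace k) : l2proj E k p = p :=
  l2proj_eq hE (hE.memLp_poly hp) hp fun q _ => by simp

/-- The projection is chosen from a predicate that sees `u` only through integrals. Functions that
agree almost everywhere yield the same predicate, hence the same choice. -/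
theorem l2proj_congr (k : ℕ) (h : u =ᵐ[volume.restrict E] v) : l2proj E k u = l2proj E k v := by
  have e : ∀ p q : R2 → ℝ, ∫ x in E, (u x - p x) * q x = ∫ x in E, (v x - p x) * q x :=
    fun p q => integral_congr_ae (h.mono fun x hx => by simp only [hx])
  have e' : (fun p : R2 → ℝ => p ∈ polySpace k ∧ ∀ q ∈ polySpace k,
      ∫ x in E, (u x - p x) * q x = 0) = fun p => p ∈ polySpace k ∧ ∀ q ∈ polySpace k,
      ∫ x in E, (v x - p x) * q x = 0 := by
    simp only [e]
  unfold l2proj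
  congr!

/-- Pythagoras: `v - Πv` is orthogonal to `Πv - q`. The best approximation and stability bounds
below arise by dropping one of the two terms. -/
theorem integral_sq_eq_l2proj (hE : IsCell E) (hv : MemLp v 2 (volume.restrict E))
    (hq : q ∈ polySpace k) :
    ∫ x in E, (v x - q x) ^ 2 = (∫ x in E, (v x - l2proj E k v x) ^ 2) +
      ∫ x in E, (l2proj E k v x - q x) ^ 2 := by
  have hm := l2proj_mem hE k hv
  have hd := sub_mem_polySpace hm hq
  have h1 := hv.sub_fun (hE.memLp_poly hm)
  have h2 := (hE.memLp_poly hm).sub_fun (hE.memLp_poly hq)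
  have h3 := integral_sub_l2proj_mul hE hv hd
  simp only [Pi.sub_apply] at h3
  have e : ∀ x, (v x - q x) ^ 2 = ((v x - l2proj E k v x) ^ 2 + (l2proj E k v x - q x) ^ 2) +
      2 * ((v x - l2proj E k v x) * (l2proj E k v x - q x)) := fun x => by
    ring
  simp only [e]
  have h4 : Integrable (fun x => (v x - l2proj E k v x) ^ 2 + (l2proj E k v x - q x) ^ 2)
    (volume.restrict E) := h1.integrable_sq.add h2.integrable_sq
  rw [integral_add h4 ((h1.integrable_mul_fun h2).const_mul 2),
    integral_add h1.integrable_sq h2.integrable_sq, integral_const_mul, h3, mul_zero, add_zero]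

theorem integral_sub_l2proj_sq_le (hE : IsCell E) (hv : MemLp v 2 (volume.restrict E))
    (hq : q ∈ polySpace k) :
    ∫ x in E, (v x - l2proj E k v x) ^ 2 ≤ ∫ x in E, (v x - q x) ^ 2 := by
  rw [integral_sq_eq_l2proj hE hv hq]
  exact le_add_of_nonneg_right (setIntegral_sq_nonneg E _)

theorem integral_l2proj_sq_le (hE : IsCell E) (k : ℕ) (hv : MemLp v 2 (volume.restrict E)) :
    ∫ x in E, l2proj E k v x ^ 2 ≤ ∫ x in E, v x ^ 2 := by
  have h := integral_sq_eq_l2proj hE hv (const_mem_polySpace k 0)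
  simp only [sub_zero] at h
  rw [h]
  exact le_add_of_nonneg_left (setIntegral_sq_nonneg E _)

theorem integral_l2proj_sub_sq_le (hE : IsCell E) (hv : MemLp v 2 (volume.restrict E))
    (hq : q ∈ polySpace k) :
    ∫ x in E, (l2proj E k v x - q x) ^ 2 ≤ ∫ x in E, (v x - q x) ^ 2 := by
  rw [integral_sq_eq_l2proj hE hv hq]
  exact le_add_of_nonneg_left (setIntegral_sq_nonneg E _)

/-! ### Inverse inequalities -/

theorem pderiv_comp_affine {p : R2 → ℝ} (hp : ContDiff ℝ ∞ p) (x y : R2) (r : ℝ) (d : Fin 2) :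
    pderiv d (fun y => p (x + r • y)) y = r * pderiv d p (x + r • y) := by
  have h1 : HasFDerivAt (fun y : R2 => x + r • y) (r • ContinuousLinearMap.id ℝ R2) y :=
    ((hasFDerivAt_id y).const_smul r).const_add x
  have h2 := ((hp.differentiable (by simp) (x + r • y)).hasFDerivAt).comp y h1
  unfold pderiv
  have h3 : fderiv ℝ (fun y => p (x + r • y)) y = _ := h2.fderiv
  rw [h3]
  simp

theorem integral_ball_comp_affine (f : R2 → ℝ) (x : R2) {r : ℝ} (hr : 0 < r) :
    ∫ y in Metric.ball (0 : R2) 1, f (x + r • y) = (r ^ 2)⁻¹ * ∫ y in Metric.ball x r, f y := by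
  rw [← integral_indicator Metric.isOpen_ball.measurableSet,
    ← integral_indicator Metric.isOpen_ball.measurableSet]
  have e : (Metric.ball (0 : R2) 1).indicator (fun y => f (x + r • y)) =
      fun y => (fun w => (Metric.ball x r).indicator f (x + w)) (r • y) := by
    funext y
    have : y ∈ Metric.ball (0 : R2) 1 ↔ x + r • y ∈ Metric.ball x r := by
      rw [Metric.mem_ball, Metric.mem_ball, dist_zero_right, dist_eq_norm, add_sub_cancel_left,
        norm_smul, Real.norm_of_nonneg hr.le]
      constructor <;> intro h <;> nlinarith
    by_cases h : y ∈ Metric.ball (0 : R2) 1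
    · rw [indicator_of_mem h]
      exact (indicator_of_mem (this.1 h) f).symm
    · rw [indicator_of_notMem h]
      exact (indicator_of_notMem (fun h' => h (this.2 h')) f).symm
  rw [e, Measure.integral_comp_smul, integral_add_left_eq_self]
  simp [abs_of_pos hr]

/-- After scaling to the unit ball, the `L²` norm there controls the coordinates of a polynomial in
a fixed basis, and thereby its values and derivatives on the ball of radius `R`. Taking `R > 1` lets
a ball inside an element control the polynomial on the whole element. -/
theorem exists_inverse_estimate (k : ℕ) (R : ℝ) : ∃ C > 0, ∀ p ∈ polySpace k, ∀ (x : R2), ∀ r > 0,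
    ∀ y ∈ Metric.closedBall x (R * r),
      p y ^ 2 ≤ C * ((r ^ 2)⁻¹ * ∫ z in Metric.ball x r, p z ^ 2) ∧
      ∀ d, r ^ 2 * pderiv d p y ^ 2 ≤ C * ((r ^ 2)⁻¹ * ∫ z in Metric.ball x r, p z ^ 2) := by
  have hB := isCell_ball (0 : R2) one_pos
  obtain ⟨n, ⟨b⟩⟩ : ∃ n, Nonempty (Module.Basis (Fin n) ℝ (polySub k)) :=
    ⟨_, ⟨Module.finBasis ℝ (polySub k)⟩⟩
  obtain ⟨C, hC, hcoord⟩ := exists_coord_sq_le b (polyForm hB k) (polyForm_pos hB)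
  have hsm : ∀ i, ContDiff ℝ ∞ (b i).1 := fun i => contDiff_of_mem_polySpace (mem_polySub.1 (b i).2)
  have hbd : ∃ K : ℝ, ∀ y ∈ Metric.closedBall (0 : R2) R,
      ∑ i, ((b i).1 y ^ 2 + ∑ d, pderiv d (b i).1 y ^ 2) ≤ K := by
    have hc : Continuous fun y => ∑ i, ((b i).1 y ^ 2 + ∑ d, pderiv d (b i).1 y ^ 2) :=
      continuous_finsetSum _ fun i _ => ((hsm i).continuous.pow 2).add
        (continuous_finsetSum _ fun d _ => (contDiff_pderiv (hsm i) d).continuous.pow 2)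
    obtain ⟨K, hK⟩ := (isCompact_closedBall (0 : R2) R).exists_bound_of_continuousOn hc.continuousOn
    exact ⟨K, fun y hy => (le_abs_self _).trans (hK y hy)⟩
  obtain ⟨K, hK⟩ := hbd
  have key : ∀ (p : polySub k) (w : Fin n → ℝ), ∑ i, w i ^ 2 ≤ K →
      (∑ i, b.repr p i * w i) ^ 2 ≤ (n + 1) * C * (|K| + 1) * polyForm hB k p p := by
    intro p w hw
    have hp0 : 0 ≤ polyForm hB k p p := by
      rw [polyForm_self]; exact integral_nonneg fun _ => sq_nonneg _
    have h1 : ∑ i, b.repr p i ^ 2 ≤ n * (C * polyForm hB k p p) := by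
      refine (Finset.sum_le_sum fun i _ => hcoord p i).trans_eq ?_
      rw [Finset.sum_const, Finset.card_univ, Fintype.card_fin, nsmul_eq_mul]
    calc (∑ i, b.repr p i * w i) ^ 2 ≤ (∑ i, b.repr p i ^ 2) * ∑ i, w i ^ 2 :=
          Finset.sum_mul_sq_le_sq_mul_sq _ _ _
      _ ≤ ((n + 1) * (C * polyForm hB k p p)) * (|K| + 1) := by
          refine mul_le_mul (h1.trans ?_) (hw.trans ?_) (Finset.sum_nonneg fun _ _ => sq_nonneg _)
            (by positivity)
          · gcongr; linarith
          · linarith [le_abs_self K]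
      _ = _ := by ring
  refine ⟨(n + 1) * C * (|K| + 1), by positivity, fun p hp x r hr y hy => ?_⟩
  set P : polySub k := ⟨fun w => p (x + r • w), mem_polySub.2 (comp_affine_mem_polySpace hp x r)⟩
  set w : R2 := r⁻¹ • (y - x)
  have hyw : x + r • w = y := by
    simp only [w]
    rw [smul_smul, mul_inv_cancel₀ hr.ne', one_smul, add_sub_cancel]
  have hw : w ∈ Metric.closedBall (0 : R2) R := by
    rw [mem_closedBall_zero_iff]
    simp only [w]
    rw [norm_smul, norm_inv, Real.norm_of_nonneg hr.le, inv_mul_le_iff₀ hr, ← dist_eq_norm,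
      mul_comm]
    exact hy
  have hform : polyForm hB k P P = (r ^ 2)⁻¹ * ∫ z in Metric.ball x r, p z ^ 2 := by
    rw [polyForm_self, ← integral_ball_comp_affine (fun z => p z ^ 2) x hr]
  have hP : (P : R2 → ℝ) = fun z => ∑ i, b.repr P i * (b i).1 z := by
    funext z
    have h := congrArg (fun p : polySub k => p.1 z) (b.sum_repr P)
    simp only [Submodule.coe_sum, Finset.sum_apply, Submodule.coe_smul, Pi.smul_apply,
      smul_eq_mul] at h
    exact h.symm
  have hterm : ∀ i, 0 ≤ (b i).1 w ^ 2 + ∑ d, pderiv d (b i).1 w ^ 2 := fun i => by positivity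
  rw [← hform]
  constructor
  · have h1 := key P (fun i => (b i).1 w) ((Finset.sum_le_sum fun i _ =>
      le_add_of_nonneg_right (Finset.sum_nonneg fun d _ => sq_nonneg _)).trans (hK w hw))
    have h2 := congrFun hP w
    rw [← h2] at h1
    have h3 : (P : R2 → ℝ) w = p y := by rw [← hyw]
    rwa [h3] at h1
  · intro d
    have h1 := key P (fun i => pderiv d (b i).1 w) ((Finset.sum_le_sum fun i _ =>
      (Finset.single_le_sum (f := fun d => pderiv d (b i).1 w ^ 2) (fun d _ => sq_nonneg _)
        (Finset.mem_univ d)).trans (le_add_of_nonneg_left (sq_nonneg _))).trans (hK w hw))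
    have h2 : pderiv d (P : R2 → ℝ) w = ∑ i, b.repr P i * pderiv d (b i).1 w := by
      rw [hP]
      unfold pderiv
      rw [fderiv_fun_sum fun i _ => ((hsm i).differentiable (by simp) w).const_mul _]
      simp only [_root_.sum_apply]
      refine Finset.sum_congr rfl fun i _ => ?_
      rw [fderiv_const_mul ((hsm i).differentiable (by simp) w)]
      rfl
    have h3 : pderiv d (P : R2 → ℝ) w = r * pderiv d p y := by
      rw [← hyw]
      exact pderiv_comp_affine (contDiff_of_mem_polySpace hp) x w r d
    rwa [← h2, h3, mul_pow] at h1

end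

/-! ### Estimates for polynomials on shape-regular elements -/

/-- A ball of radius `α h_E` fits into the element, and the concentric ball of radius `h_E` contains
it. The outer radius is written as a multiple of the inner one to match `exists_inverse_estimate`
with `R = α⁻¹`. -/
theorem Element.Regular.exists_ball {E : Element} {α : ℝ} (hE : E.Regular α) (hα : 0 < α) :
    ∃ z, Metric.ball z (α * E.diam) ⊆ E.carrier ∧
      E.carrier ⊆ Metric.closedBall z (α⁻¹ * (α * E.diam)) := by
  obtain ⟨⟨N, D, hED, hD⟩, -⟩ := hE
  obtain ⟨x, hx⟩ := E.isConnected.nonempty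
  rw [hED] at hx
  obtain ⟨j, -⟩ := mem_iUnion.1 hx
  obtain ⟨-, z, r, hr, hb, -⟩ := hD j
  have hsub : Metric.ball z (α * E.diam) ⊆ E.carrier := by
    rw [hED]
    exact (Metric.ball_subset_ball hr.le).trans (hb.trans (subset_iUnion D j))
  have hz : z ∈ E.carrier := hsub (Metric.mem_ball_self (mul_pos hα E.diam_pos))
  refine ⟨z, hsub, fun y hy => ?_⟩
  rw [← mul_assoc, inv_mul_cancel₀ hα.ne', one_mul]
  exact Metric.dist_le_diam_of_mem E.isBounded hy hz

theorem Element.exists_inverse_estimate {α : ℝ} (hα : 0 < α) (k : ℕ) : ∃ C > 0, ∀ E : Element,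
    E.Regular α → ∀ p ∈ polySpace k, ∀ y ∈ E.carrier,
      E.diam ^ 2 * p y ^ 2 ≤ C * ∫ x in E.carrier, p x ^ 2 ∧
      ∀ d, E.diam ^ 4 * pderiv d p y ^ 2 ≤ C * ∫ x in E.carrier, p x ^ 2 := by
  obtain ⟨C, hC, hinv⟩ := IsoVEM.exists_inverse_estimate k α⁻¹
  refine ⟨C * (α ^ 2)⁻¹ * (1 + (α ^ 2)⁻¹), by positivity, fun E hE p hp y hy => ?_⟩
  obtain ⟨z, hball, hsub⟩ := hE.exists_ball hα
  have hh := E.diam_pos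
  set h := E.diam
  have hr : 0 < α * h := mul_pos hα hh
  set I := ∫ x in E.carrier, p x ^ 2
  have hI : ∫ x in Metric.ball z (α * h), p x ^ 2 ≤ I :=
    setIntegral_mono_set (E.isCell.memLp_poly hp).integrable_sq
      (Filter.Eventually.of_forall fun _ => sq_nonneg _) hball.eventuallyLE
  have hI0 : 0 ≤ I := setIntegral_sq_nonneg _ _
  obtain ⟨h1, h2⟩ := hinv p hp z _ hr y (hsub hy)
  set B := ((α * h) ^ 2)⁻¹ * ∫ x in Metric.ball z (α * h), p x ^ 2
  have hB : h ^ 2 * B ≤ (α ^ 2)⁻¹ * I := by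
    simp only [B]
    rw [mul_pow, mul_inv]
    calc h ^ 2 * ((α ^ 2)⁻¹ * (h ^ 2)⁻¹ * ∫ x in Metric.ball z (α * h), p x ^ 2)
        = (α ^ 2)⁻¹ * ∫ x in Metric.ball z (α * h), p x ^ 2 := by field_simp
      _ ≤ _ := by gcongr
  have hpos : 0 ≤ (α ^ 2)⁻¹ * I := by positivity
  constructor
  · calc h ^ 2 * p y ^ 2 ≤ h ^ 2 * (C * B) := by gcongr
      _ = C * (h ^ 2 * B) := by ring
      _ ≤ C * ((α ^ 2)⁻¹ * I) := by gcongr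
      _ ≤ C * ((α ^ 2)⁻¹ * I) * (1 + (α ^ 2)⁻¹) :=
          le_mul_of_one_le_right (by positivity) (by simp; positivity)
      _ = _ := by ring
  · intro d
    have h3 : h ^ 2 * pderiv d p y ^ 2 ≤ (α ^ 2)⁻¹ * (C * B) := by
      have := h2 d
      rw [mul_pow] at this
      rw [le_inv_mul_iff₀ (by positivity)]
      linarith
    calc h ^ 4 * pderiv d p y ^ 2 = h ^ 2 * (h ^ 2 * pderiv d p y ^ 2) := by ring
      _ ≤ h ^ 2 * ((α ^ 2)⁻¹ * (C * B)) := by gcongr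
      _ = C * (α ^ 2)⁻¹ * (h ^ 2 * B) := by ring
      _ ≤ C * (α ^ 2)⁻¹ * ((α ^ 2)⁻¹ * I) := by gcongr
      _ ≤ C * (α ^ 2)⁻¹ * ((1 + (α ^ 2)⁻¹) * I) := by
          gcongr
          linarith
      _ = _ := by ring

theorem weakDeriv_of_contDiff {U : Set R2} (hU : IsOpen U) {f : R2 → ℝ} (hf : ContDiff ℝ ∞ f)
    (d : Fin 2) : weakDeriv U (unitIdx d) f =ᵐ[volume.restrict U] pderiv d f :=
  (hasWeakDeriv_of_contDiff U hf d).weakDeriv_ae hU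

theorem MemSobolev.sub {U : Set R2} {s : ℕ} {p : ℝ≥0∞} {f f' : R2 → ℝ}
    (h : MemSobolev U s p f) (h' : MemSobolev U s p f') : MemSobolev U s p (f - f') := by
  have := h.add (h'.smul (-1))
  simpa [sub_eq_add_neg] using this

theorem weakDeriv_sub_ae {U : Set R2} (hU : IsOpen U) {f f' : R2 → ℝ} (h : MemSobolev U 1 2 f)
    (h' : MemSobolev U 1 2 f') (d : Fin 2) :
    weakDeriv U (unitIdx d) (f - f') =ᵐ[volume.restrict U]
      weakDeriv U (unitIdx d) f - weakDeriv U (unitIdx d) f' :=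
  ((h.hasWeakDeriv (unitIdx_order d).le).sub
    (h'.hasWeakDeriv (unitIdx_order d).le)).weakDeriv_ae hU

theorem weakDeriv_add_ae {U : Set R2} (hU : IsOpen U) {f f' : R2 → ℝ} (h : MemSobolev U 1 2 f)
    (h' : MemSobolev U 1 2 f') (d : Fin 2) :
    weakDeriv U (unitIdx d) (f + f') =ᵐ[volume.restrict U]
      weakDeriv U (unitIdx d) f + weakDeriv U (unitIdx d) f' :=
  ((h.hasWeakDeriv (unitIdx_order d).le).add
    (h'.hasWeakDeriv (unitIdx_order d).le)).weakDeriv_ae hU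

theorem weakDeriv_smul_ae {U : Set R2} (hU : IsOpen U) {f : R2 → ℝ} (h : MemSobolev U 1 2 f)
    (c : ℝ) (d : Fin 2) :
    weakDeriv U (unitIdx d) (c • f) =ᵐ[volume.restrict U] c • weakDeriv U (unitIdx d) f :=
  ((h.hasWeakDeriv (unitIdx_order d).le).smul c).weakDeriv_ae hU

theorem weakDeriv_mono_ae {U V : Set R2} (hU : IsOpen U) (hUV : U ⊆ V) {α : ℕ × ℕ} {f : R2 → ℝ}
    (h : HasWeakDeriv V α f (weakDeriv V α f)) :
    weakDeriv U α f =ᵐ[volume.restrict U] weakDeriv V α f :=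
  (h.mono hUV).weakDeriv_ae hU

theorem IsCell.memSobolev_poly {E : Set R2} (hE : IsCell E) {k : ℕ} {p : R2 → ℝ}
    (hp : p ∈ polySpace k) : MemSobolev E 1 2 p :=
  memSobolev_of_contDiff hE.isOpen hE.isBounded (contDiff_of_mem_polySpace hp)

theorem sobolevSemi_poly_sq {E : Set R2} (hE : IsCell E) {k : ℕ} {p : R2 → ℝ}
    (hp : p ∈ polySpace k) :
    sobolevSemi E 1 p ^ 2 = ∑ d, ∫ x in E, pderiv d p x ^ 2 := by
  rw [sobolevSemi_one_sq]
  refine Finset.sum_congr rfl fun d _ => integral_congr_ae ?_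
  filter_upwards [weakDeriv_of_contDiff hE.isOpen (contDiff_of_mem_polySpace hp) d] with x hx
  rw [hx]

theorem Element.volume_real_le (E : Element) : volume.real E.carrier ≤ 4 * E.diam ^ 2 :=
  ENNReal.toReal_le_of_le_ofReal (by positivity) (volume_le_sq_diam E.isBounded)

/-- `Πu` and `Πu - c` have the same gradient. Since `Π` preserves constants, `‖Πu - c‖ ≤ ‖u - c‖ ≤ C
h_E |u|₁` by Poincaré, and the inverse estimate gives back the factor `h_E`. -/
theorem exists_l2proj_stable {α : ℝ} (hα : 0 < α) (k : ℕ) : ∃ C > 0, ∀ E : Element,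
    E.Regular α → ∀ u ∈ enlargedSpace E k,
      sobolevSemi E.carrier 1 (l2proj E.carrier k u) ^ 2 ≤ C * sobolevSemi E.carrier 1 u ^ 2 := by
  obtain ⟨C₁, hC₁, hpoin⟩ := exists_poincare hα k
  obtain ⟨C₂, hC₂, hinv⟩ := Element.exists_inverse_estimate hα k
  refine ⟨8 * (C₂ * C₁), by positivity, fun E hE u hu => ?_⟩
  obtain ⟨c, hc⟩ := hpoin E hE u hu
  have hcell := E.isCell
  have hu2 : MemLp u 2 (volume.restrict E.carrier) := hu.1.memLp E.isOpen
  have hm := l2proj_mem hcell k hu2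
  have hcm := const_mem_polySpace k c
  set p := l2proj E.carrier k u - fun _ => c with hp
  have hpm : p ∈ polySpace k := sub_mem_polySpace hm hcm
  have hpI : ∫ x in E.carrier, p x ^ 2 ≤ C₁ * E.diam ^ 2 * sobolevSemi E.carrier 1 u ^ 2 :=
    (integral_l2proj_sub_sq_le hcell hu2 hcm).trans hc
  have hpd : ∀ d x, pderiv d p x = pderiv d (l2proj E.carrier k u) x := by
    intro d x
    rw [hp]
    unfold pderiv
    rw [fderiv_sub ((contDiff_of_mem_polySpace hm).differentiable (by simp) x)
      (differentiableAt_const c)]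
    simp
  have hh := E.diam_pos
  have hbd : ∀ d, ∀ y ∈ E.carrier, pderiv d (l2proj E.carrier k u) y ^ 2 ≤
      C₂ * C₁ * (E.diam ^ 2)⁻¹ * sobolevSemi E.carrier 1 u ^ 2 := by
    intro d y hy
    have h1 := (hinv E hE p hpm y hy).2 d
    rw [hpd] at h1
    have h2 : E.diam ^ 4 * pderiv d (l2proj E.carrier k u) y ^ 2 ≤
        E.diam ^ 4 * (C₂ * C₁ * (E.diam ^ 2)⁻¹ * sobolevSemi E.carrier 1 u ^ 2) := by
      refine (h1.trans (mul_le_mul_of_nonneg_left hpI hC₂.le)).trans_eq ?_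
      field_simp
    exact le_of_mul_le_mul_left h2 (by positivity)
  have hterm : ∀ d, ∫ x in E.carrier, pderiv d (l2proj E.carrier k u) x ^ 2 ≤
      4 * (C₂ * C₁) * sobolevSemi E.carrier 1 u ^ 2 := by
    intro d
    have hint : IntegrableOn (fun x => pderiv d (l2proj E.carrier k u) x ^ 2) E.carrier :=
      (hcell.memLp_poly (pderiv_mem_polySpace hm d)).integrable_sq
    calc ∫ x in E.carrier, pderiv d (l2proj E.carrier k u) x ^ 2
        ≤ ∫ _x in E.carrier, C₂ * C₁ * (E.diam ^ 2)⁻¹ * sobolevSemi E.carrier 1 u ^ 2 :=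
          setIntegral_mono_on hint (integrableOn_const E.volume_lt_top.ne) E.isOpen.measurableSet
            (hbd d)
      _ = volume.real E.carrier * (C₂ * C₁ * (E.diam ^ 2)⁻¹ * sobolevSemi E.carrier 1 u ^ 2) := by
          rw [setIntegral_const, smul_eq_mul]
      _ ≤ 4 * E.diam ^ 2 * (C₂ * C₁ * (E.diam ^ 2)⁻¹ * sobolevSemi E.carrier 1 u ^ 2) :=
          mul_le_mul_of_nonneg_right E.volume_real_le (by positivity)
      _ = _ := by field_simp
  rw [sobolevSemi_poly_sq hcell hm]
  refine (Finset.sum_le_sum fun d _ => hterm d).trans_eq ?_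
  rw [Finset.sum_const, Finset.card_univ, Fintype.card_fin, nsmul_eq_mul]
  push_cast
  ring

/-! ### The projected gradient -/

theorem MemSobolev.memLp_weakGrad {U : Set R2} (hU : IsOpen U) {u : R2 → ℝ}
    (h : MemSobolev U 1 2 u) (d : Fin 2) :
    MemLp (fun x => weakGrad U u x d) 2 (volume.restrict U) := by
  simp only [weakGrad_apply]
  exact h.memLp_weakDeriv hU (unitIdx_order d).le

theorem projGrad_eq {E : Set R2} {k : ℕ} {u : R2 → ℝ} (x : R2) (d : Fin 2) :
    projGrad E k u x d = l2proj E (k - 1) (weakDeriv E (unitIdx d) u) x := by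
  simp only [projGrad, weakGrad_apply]

theorem MemSobolev.memLp_unit {U : Set R2} (hU : IsOpen U) {u : R2 → ℝ}
    (h : MemSobolev U 1 2 u) (d : Fin 2) :
    MemLp (weakDeriv U (unitIdx d) u) 2 (volume.restrict U) :=
  h.memLp_weakDeriv hU (unitIdx_order d).le

theorem projGrad_add {E : Set R2} (hE : IsCell E) (k : ℕ) {u v : R2 → ℝ}
    (hu : MemSobolev E 1 2 u) (hv : MemSobolev E 1 2 v) :
    projGrad E k (u + v) = projGrad E k u + projGrad E k v := by
  funext x d
  simp only [Pi.add_apply, projGrad_eq]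
  rw [l2proj_congr _ (weakDeriv_add_ae hE.isOpen hu hv d),
    l2proj_add hE _ (hu.memLp_unit hE.isOpen d) (hv.memLp_unit hE.isOpen d)]
  rfl

theorem projGrad_smul {E : Set R2} (hE : IsCell E) (k : ℕ) {u : R2 → ℝ}
    (hu : MemSobolev E 1 2 u) (c : ℝ) :
    projGrad E k (c • u) = c • projGrad E k u := by
  funext x d
  simp only [Pi.smul_apply, projGrad_eq]
  rw [l2proj_congr _ (weakDeriv_smul_ae hE.isOpen hu c d),
    l2proj_smul hE _ (hu.memLp_unit hE.isOpen d)]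
  rfl

theorem memLp_projGrad {E : Set R2} (hE : IsCell E) (k : ℕ) {u : R2 → ℝ}
    (hu : MemSobolev E 1 2 u) (d : Fin 2) :
    MemLp (fun x => projGrad E k u x d) 2 (volume.restrict E) := by
  simp only [projGrad_eq]
  exact hE.memLp_poly (l2proj_mem hE _ (hu.memLp_unit hE.isOpen d))

theorem sum_integral_projGrad_sq_le {E : Set R2} (hE : IsCell E) (k : ℕ) {u : R2 → ℝ}
    (hu : MemSobolev E 1 2 u) :
    ∑ d, ∫ x in E, projGrad E k u x d ^ 2 ≤ sobolevSemi E 1 u ^ 2 := by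
  rw [sobolevSemi_one_sq]
  simp only [projGrad_eq]
  exact Finset.sum_le_sum fun d _ => integral_l2proj_sq_le hE _ (hu.memLp_unit hE.isOpen d)

/-- The projected gradient misses no more of the gradient than `∇ Π⁰_k u` does. -/
theorem sobolevSemi_sq_le_projGrad {E : Set R2} (hE : IsCell E) (k : ℕ) {u : R2 → ℝ}
    (hu : MemSobolev E 1 2 u) :
    sobolevSemi E 1 u ^ 2 ≤ (∑ d, ∫ x in E, projGrad E k u x d ^ 2) +
      sobolevSemi E 1 (u - l2proj E k u) ^ 2 := by
  have hm := l2proj_mem hE k (hu.memLp hE.isOpen)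
  rw [sobolevSemi_one_sq, sobolevSemi_one_sq, ← Finset.sum_add_distrib]
  refine Finset.sum_le_sum fun d _ => ?_
  have hd := hu.memLp_unit hE.isOpen d
  have h1 := integral_sq_eq_l2proj hE hd (const_mem_polySpace (k - 1) 0)
  have h2 := integral_sub_l2proj_sq_le hE hd (pderiv_mem_polySpace hm d)
  have h3 : ∫ x in E, weakDeriv E (unitIdx d) (u - l2proj E k u) x ^ 2 =
      ∫ x in E, (weakDeriv E (unitIdx d) u x - pderiv d (l2proj E k u) x) ^ 2 := by
    refine integral_congr_ae ?_
    filter_upwards [weakDeriv_sub_ae hE.isOpen hu (hE.memSobolev_poly hm) d,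
      weakDeriv_of_contDiff hE.isOpen (contDiff_of_mem_polySpace hm) d] with x h1 h2
    rw [h1, Pi.sub_apply, h2]
  simp only [sub_zero] at h1
  simp only [projGrad_eq]
  rw [h3, h1]
  linarith

/-! ### The Jacobian of the reference map and its projection -/

theorem multiDeriv_add_unitIdx {φ : R2 → ℝ} (hφ : ContDiff ℝ ∞ φ) (d e : Fin 2) :
    multiDeriv (unitIdx d + unitIdx e) φ = pderiv d (pderiv e φ) := by
  fin_cases d <;> fin_cases e
  · rfl
  · rfl
  · exact pderiv_comm hφ 0 1
  · rfl

/-- Test the first-order identity with `∂_e φ` and compare it with the second-order identity for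
`φ`. -/
theorem HasWeakDeriv.of_second {U : Set R2} {f g g' : R2 → ℝ} {d e : Fin 2}
    (hg : HasWeakDeriv U (unitIdx d) f g) (hg' : HasWeakDeriv U (unitIdx d + unitIdx e) f g') :
    HasWeakDeriv U (unitIdx e) g g' := by
  refine ⟨hg.2.1, hg'.2.1, fun φ hφ => ?_⟩
  have h1 := hg.2.2 _ (hφ.pderiv e)
  have h2 := hg'.2.2 φ hφ
  rw [multiDeriv_unitIdx, unitIdx_order] at h1
  rw [multiDeriv_add_unitIdx hφ.1, Prod.fst_add, Prod.snd_add] at h2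
  rw [multiDeriv_unitIdx, unitIdx_order]
  have h3 : (unitIdx d).1 + (unitIdx e).1 + ((unitIdx d).2 + (unitIdx e).2) = 2 := by
    have := unitIdx_order d
    have := unitIdx_order e
    omega
  rw [h3] at h2
  linarith

theorem MemSobolev.of_top {U : Set R2} (hU : volume U < ⊤) {s t : ℕ} (hst : t ≤ s) {f : R2 → ℝ}
    (h : MemSobolev U s ⊤ f) : MemSobolev U t 2 f := by
  intro α hα
  obtain ⟨g, hg, hgp⟩ := h α (hα.trans hst)
  have : IsFiniteMeasure (volume.restrict U) := ⟨by simpa using hU⟩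
  exact ⟨g, hg, hgp.mono_exponent le_top⟩

theorem exists_ae_bound_of_memLp_top {U : Set R2} {f : R2 → ℝ}
    (h : MemLp f ⊤ (volume.restrict U)) : ∃ K, ∀ᵐ x ∂volume.restrict U, |f x| ≤ K := by
  have h1 := h.2
  rw [eLpNorm_exponent_top] at h1
  refine ⟨(eLpNormEssSup f (volume.restrict U)).toReal, ?_⟩
  filter_upwards [ae_le_eLpNormEssSup (f := f) (μ := volume.restrict U)] with x hx
  rw [← Real.norm_eq_abs, ← toReal_enorm]
  exact ENNReal.toReal_mono h1.ne hx

/-- A uniform bound for the second derivatives of a map in `W^{2,∞}`. -/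
theorem exists_second_bound {U : Set R2} (hU : IsOpen U) {s : ℕ} (hs : 2 ≤ s) {F : R2 → R2}
    (hF : ∀ c, MemSobolev U s ⊤ (comp F c)) : ∃ K > 0, ∀ c, ∀ β : ℕ × ℕ, β.1 + β.2 = 2 →
      ∀ᵐ x ∂volume.restrict U, |weakDeriv U β (comp F c) x| ≤ K := by
  have h : ∀ c, ∀ β : ℕ × ℕ, ∃ K : ℝ, β.1 + β.2 = 2 →
      ∀ᵐ x ∂volume.restrict U, |weakDeriv U β (comp F c) x| ≤ K := by
    intro c β
    by_cases hβ : β.1 + β.2 = 2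
    · obtain ⟨K, hK⟩ := exists_ae_bound_of_memLp_top
        ((hF c).memLp_weakDeriv hU (α := β) (hβ.trans_le hs))
      exact ⟨K, fun _ => hK⟩
    · exact ⟨0, fun h => absurd h hβ⟩
  choose K hK using h
  refine ⟨1 + ∑ c, ∑ β ∈ Finset.HasAntidiagonal.antidiagonal 2, |K c β|, by positivity,
    fun c β hβ => ?_⟩
  filter_upwards [hK c β hβ] with x hx
  have h1 : |K c β| ≤ ∑ β ∈ Finset.HasAntidiagonal.antidiagonal 2, |K c β| :=
    Finset.single_le_sum (f := fun β => |K c β|) (fun _ _ => abs_nonneg _)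
      (Finset.HasAntidiagonal.mem_antidiagonal.2 hβ)
  have h2 : ∑ β ∈ Finset.HasAntidiagonal.antidiagonal 2, |K c β| ≤
      ∑ c, ∑ β ∈ Finset.HasAntidiagonal.antidiagonal 2, |K c β| :=
    Finset.single_le_sum (f := fun c => ∑ β ∈ Finset.HasAntidiagonal.antidiagonal 2, |K c β|)
      (fun _ _ => by positivity) (Finset.mem_univ c)
  linarith [le_abs_self (K c β)]

/-- The oscillation over a shape-regular element of a function with bounded weak gradient. -/
theorem exists_osc_bound {α : ℝ} (hα : 0 < α) : ∃ C > 0, ∀ E : Element, E.Regular α →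
    ∀ f : R2 → ℝ, IntegrableOn f E.carrier → ∀ g : Fin 2 → R2 → ℝ,
      (∀ d, HasWeakDeriv E.carrier (unitIdx d) f (g d)) → ∀ K, 0 ≤ K →
      (∀ d, ∀ᵐ x ∂volume.restrict E.carrier, |g d x| ≤ K) →
      ∃ S : Set R2, (∀ᵐ x, x ∈ E.carrier → x ∈ S) ∧ ∀ x ∈ S ∩ E.carrier, ∀ y ∈ S ∩ E.carrier,
        |f x - f y| ≤ C * K * E.diam := by
  obtain ⟨ι, hι, hcov⟩ := exists_uniform_cover hα
  refine ⟨8 * Fintype.card ι + 1, by positivity, fun E hE f hf g hg K hK0 hK => ?_⟩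
  obtain ⟨D, z, hED, hD⟩ := hcov E hE
  obtain ⟨S, hS, hlip⟩ := exists_lipschitz_on_segments E.isOpen hf hg hK0 hK
  have hh := E.diam_pos
  -- `S` has full measure in the element, so it meets every nonempty open subset.
  have hmeet : ∀ O ⊆ E.carrier, IsOpen O → O.Nonempty → (O ∩ S).Nonempty := by
    intro O hO hOo hOne
    by_contra hemp
    rw [not_nonempty_iff_eq_empty] at hemp
    have h1 : O ⊆ {x | ¬ (x ∈ E.carrier → x ∈ S)} := fun x hx h => by
      have : x ∈ O ∩ S := ⟨hx, h (hO hx)⟩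
      rw [hemp] at this
      exact this
    exact absurd (measure_mono_null h1 hS) (hOo.measure_pos volume hOne).ne'
  have hloc : ∀ i, ∀ x ∈ S ∩ D i, ∀ y ∈ S ∩ D i, |f x - f y| ≤ 4 * K * E.diam := by
    intro i x hx y hy
    have hDE : D i ⊆ E.carrier := by rw [hED]; exact subset_iUnion D i
    have hball := (hD i).ball_subset ⟨x, hx.2⟩
    have hr : 0 < α * E.diam / 2 := by positivity
    -- Two points of a piece need not see each other, but both see the points of the ball. The
    -- detour runs through a point `w` of the ball that lies in `S`, where the Lipschitz bound is
    -- available.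
    obtain ⟨w, hwb, hwS⟩ := hmeet _ (hball.trans hDE) Metric.isOpen_ball
      (Metric.nonempty_ball.2 hr)
    have hseg : ∀ v ∈ S ∩ D i, |f w - f v| ≤ 2 * K * E.diam := by
      intro v hv
      refine (hlip w hwS v hv.1 ?_).trans ?_
      · exact (((hD i).2 w hwb).segment_subset hv.2).trans hDE
      · gcongr
        exact Metric.dist_le_diam_of_mem E.isBounded (hDE (hball hwb)) (hDE hv.2)
    have h1 := hseg x hx
    have h2 := hseg y hy
    rw [abs_sub_comm] at h1
    linarith [abs_sub_le (f x) (f w) (f y)]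
  refine ⟨S, hS, fun x hx y hy => ?_⟩
  refine (abs_sub_le_of_connected E.isConnected.isPreconnected (fun i => (hD i).1) hED hmeet
    (by positivity) hloc hx hy).trans ?_
  have : 0 ≤ K * E.diam := by positivity
  nlinarith

theorem unitIdx_add_order (d e : Fin 2) :
    (unitIdx d + unitIdx e).1 + (unitIdx d + unitIdx e).2 = 2 := by
  have := unitIdx_order d
  have := unitIdx_order e
  rw [Prod.fst_add, Prod.snd_add]
  omega

/-- The entries of `J` have the second derivatives of `F` as weak gradients, so `exists_osc_bound`
applies to each. As `J` is only determined almost everywhere, the predicate `p` allows `x₀` to be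
picked where the almost-everywhere bounds on `J` hold. -/
theorem exists_jac_near {α : ℝ} (hα : 0 < α) : ∃ C > 0, ∀ Ω : Set R2, IsOpen Ω →
    Bornology.IsBounded Ω → ∀ s, 2 ≤ s → ∀ F : R2 → R2,
    (∀ c, MemSobolev Ω s ⊤ (comp F c)) → ∀ K, 0 ≤ K →
    (∀ c, ∀ β : ℕ × ℕ, β.1 + β.2 = 2 →
      ∀ᵐ x ∂volume.restrict Ω, |weakDeriv Ω β (comp F c) x| ≤ K) →
    ∀ p : R2 → Prop, (∀ᵐ x ∂volume.restrict Ω, p x) → ∀ E : Element, E.Regular α →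
      E.carrier ⊆ Ω → ∃ x₀, p x₀ ∧ ∀ᵐ x ∂volume.restrict E.carrier, ∀ c d,
        |jac Ω F x c d - jac Ω F x₀ c d| ≤ C * K * E.diam := by
  obtain ⟨C, hC, hosc⟩ := exists_osc_bound hα
  refine ⟨C, hC, fun Ω hΩ hb s hs F hF K hK0 hK p hp E hE hEΩ => ?_⟩
  have hfin : ∀ c, MemSobolev Ω 2 2 (comp F c) := fun c => (hF c).of_top hb.measure_lt_top hs
  have h1 : ∀ c d, ∃ S : Set R2, (∀ᵐ x, x ∈ E.carrier → x ∈ S) ∧ ∀ x ∈ S ∩ E.carrier,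
      ∀ y ∈ S ∩ E.carrier, |jac Ω F x c d - jac Ω F y c d| ≤ C * K * E.diam := by
    intro c d
    have hlp : MemLp (weakDeriv Ω (unitIdx d) (comp F c)) 2 (volume.restrict E.carrier) :=
      ((hfin c).memLp_weakDeriv hΩ ((unitIdx_order d).le.trans one_le_two)).mono_measure
        (Measure.restrict_mono hEΩ le_rfl)
    have : IsFiniteMeasure (volume.restrict E.carrier) := ⟨by simpa using E.volume_lt_top⟩
    obtain ⟨S, hS, hS'⟩ := hosc E hE (weakDeriv Ω (unitIdx d) (comp F c))
      (hlp.integrable one_le_two)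
      (fun e => weakDeriv Ω (unitIdx d + unitIdx e) (comp F c))
      (fun e => (((hfin c).hasWeakDeriv ((unitIdx_order d).le.trans one_le_two)).of_second
        ((hfin c).hasWeakDeriv (unitIdx_add_order d e).le)).mono hEΩ) K hK0
      (fun e => ae_mono (Measure.restrict_mono hEΩ le_rfl) (hK c _ (unitIdx_add_order d e)))
    refine ⟨S, hS, fun x hx y hy => ?_⟩
    have := hS' x hx y hy
    simpa only [jac, Matrix.of_apply, weakGrad_apply] using this
  choose S hS hSb using h1
  have hall : ∀ᵐ x, x ∈ E.carrier → (∀ c d, x ∈ S c d) ∧ p x := by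
    have h2 : ∀ᵐ x, ∀ c d, x ∈ E.carrier → x ∈ S c d :=
      ae_all_iff.2 fun c => ae_all_iff.2 fun d => hS c d
    have h3 := (ae_restrict_iff' hΩ.measurableSet).1 hp
    filter_upwards [h2, h3] with x hx hx' hxE
    exact ⟨fun c d => hx c d hxE, hx' (hEΩ hxE)⟩
  obtain ⟨x₀, hx₀E, hx₀⟩ : ∃ x ∈ E.carrier, (∀ c d, x ∈ S c d) ∧ p x := by
    by_contra! hcon
    refine absurd (measure_mono_null (fun x hx h => ?_) hall)
      (E.isOpen.measure_pos volume E.isConnected.nonempty).ne'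
    exact hcon x hx (h hx).1 (h hx).2
  refine ⟨x₀, hx₀.2, ?_⟩
  rw [ae_restrict_iff' E.isOpen.measurableSet]
  filter_upwards [hall] with x hx hxE c d
  exact hSb c d x ⟨(hx hxE).1 c d, hxE⟩ x₀ ⟨hx₀.1 c d, hx₀E⟩

theorem integral_sq_le_of_ae_bound {E : Element} {f : R2 → ℝ} {B : ℝ}
    (h : ∀ᵐ x ∂volume.restrict E.carrier, |f x| ≤ B) :
    ∫ x in E.carrier, f x ^ 2 ≤ 4 * E.diam ^ 2 * B ^ 2 := by
  have h1 : ∫ x in E.carrier, f x ^ 2 ≤ ∫ _x in E.carrier, B ^ 2 := by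
    refine integral_mono_of_nonneg (Filter.Eventually.of_forall fun _ => sq_nonneg _)
      (integrableOn_const E.volume_lt_top.ne) ?_
    filter_upwards [h] with x hx
    rw [← sq_abs]
    exact pow_le_pow_left₀ (abs_nonneg _) hx 2
  rw [setIntegral_const, smul_eq_mul] at h1
  exact h1.trans (mul_le_mul_of_nonneg_right E.volume_real_le (sq_nonneg _))

theorem sobolevSemi_two_sq_le {E : Element} {f : R2 → ℝ} {K : ℝ}
    (hK : ∀ β : ℕ × ℕ, β.1 + β.2 = 2 →
      ∀ᵐ x ∂volume.restrict E.carrier, |weakDeriv E.carrier β f x| ≤ K) :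
    sobolevSemi E.carrier 2 f ^ 2 ≤ 12 * E.diam ^ 2 * K ^ 2 := by
  rw [sobolevSemi, Real.sq_sqrt (Finset.sum_nonneg fun _ _ => setIntegral_sq_nonneg _ _)]
  refine (Finset.sum_le_sum fun β hβ => integral_sq_le_of_ae_bound
    (hK β (Finset.HasAntidiagonal.mem_antidiagonal.1 hβ))).trans_eq ?_
  rw [Finset.sum_const, show (Finset.HasAntidiagonal.antidiagonal 2 : Finset (ℕ × ℕ)).card = 3 by
    decide, nsmul_eq_mul]
  push_cast
  ring

/-- First-order accuracy of `Fh` on one element. -/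
def AccurateOn (E : Element) (C : ℝ) (F Fh : R2 → R2) : Prop :=
  E.diam * √(∑ c, sobolevSemi E.carrier 1 (comp F c - comp Fh c) ^ 2) ≤
    C * E.diam ^ 2 * √(∑ c, sobolevSemi E.carrier 2 (comp F c) ^ 2)

theorem MapAccurate.accurateOn {Ω : Set R2} {T : Mesh Ω} {l : ℕ} (hl : 1 ≤ l) {C : ℝ}
    {F Fh : R2 → R2} (h : MapAccurate T l C F Fh) (i : Fin T.card) :
    AccurateOn (T.elem i) C F Fh :=
  (le_add_of_nonneg_left (Real.sqrt_nonneg _)).trans (h i 1 hl)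

/-- The constant matrix `J(x₀)` is reproduced by the projection, so `J_h - J(x₀)` is the projection
of `∇F_h - J(x₀)`. That difference is small in `L²` by the accuracy of `F_h` and the oscillation
bound for `J`; being a polynomial, its projection is then small pointwise. -/
theorem exists_jacProj_near {α : ℝ} (hα : 0 < α) (l : ℕ) (CF : ℝ) : ∃ C > 0, ∀ Ω : Set R2,
    IsOpen Ω → Bornology.IsBounded Ω → ∀ s, 2 ≤ s → ∀ F : R2 → R2,
    (∀ c, MemSobolev Ω s ⊤ (comp F c)) → ∀ K, 0 ≤ K →
    (∀ c, ∀ β : ℕ × ℕ, β.1 + β.2 = 2 →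
      ∀ᵐ x ∂volume.restrict Ω, |weakDeriv Ω β (comp F c) x| ≤ K) →
    ∀ p : R2 → Prop, (∀ᵐ x ∂volume.restrict Ω, p x) → ∀ E : Element, E.Regular α →
      E.carrier ⊆ Ω → ∀ Fh : R2 → R2, (∀ c, MemSobolev E.carrier 1 2 (comp Fh c)) →
      AccurateOn E CF F Fh → ∃ x₀, p x₀ ∧ ∀ x ∈ E.carrier, ∀ c d,
        |jacProj E.carrier l Fh x c d - jac Ω F x₀ c d| ≤ C * K * E.diam := by
  obtain ⟨C₁, hC₁, hnear⟩ := exists_jac_near hα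
  obtain ⟨C₂, hC₂, hinv⟩ := Element.exists_inverse_estimate hα (l - 1)
  set C₃ := C₂ * (2 * (24 * CF ^ 2) + 2 * (4 * C₁ ^ 2)) with hC₃
  have hC₃0 : 0 < C₃ := by positivity
  refine ⟨√C₃, Real.sqrt_pos.2 hC₃0, fun Ω hΩ hb s hs F hF K hK0 hK p hp E hE hEΩ Fh hFh hacc => ?_⟩
  obtain ⟨x₀, hx₀, hx₀n⟩ := hnear Ω hΩ hb s hs F hF K hK0 hK p hp E hE hEΩ
  refine ⟨x₀, hx₀, fun x hx c d => ?_⟩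
  have hh := E.diam_pos
  set h := E.diam
  have hfin : ∀ c, MemSobolev Ω 2 2 (comp F c) := fun c => (hF c).of_top hb.measure_lt_top hs
  have hFE : ∀ c, MemSobolev E.carrier 1 2 (comp F c) := fun c =>
    ((hF c).of_top hb.measure_lt_top (one_le_two.trans hs)).mono hEΩ
  have hle : volume.restrict E.carrier ≤ volume.restrict Ω := Measure.restrict_mono hEΩ le_rfl
  have hsemi2 : ∀ c, sobolevSemi E.carrier 2 (comp F c) ^ 2 ≤ 12 * h ^ 2 * K ^ 2 := fun c => by
    refine sobolevSemi_two_sq_le fun β hβ => ?_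
    filter_upwards [weakDeriv_mono_ae E.isOpen hEΩ ((hfin c).hasWeakDeriv hβ.le),
      ae_mono hle (hK c β hβ)] with y hy hy'
    rw [hy]
    exact hy'
  have herr : sobolevSemi E.carrier 1 (comp F c - comp Fh c) ^ 2 ≤ 24 * CF ^ 2 * K ^ 2 * h ^ 4 := by
    have h1 := pow_le_pow_left₀ (by positivity) hacc 2
    rw [mul_pow, Real.sq_sqrt (by positivity), mul_pow, Real.sq_sqrt (by positivity)] at h1
    have h2 : sobolevSemi E.carrier 1 (comp F c - comp Fh c) ^ 2 ≤
        ∑ c, sobolevSemi E.carrier 1 (comp F c - comp Fh c) ^ 2 :=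
      Finset.single_le_sum (f := fun c => sobolevSemi E.carrier 1 (comp F c - comp Fh c) ^ 2)
        (fun _ _ => sq_nonneg _) (Finset.mem_univ c)
    have h3 : ∑ c, sobolevSemi E.carrier 2 (comp F c) ^ 2 ≤ 24 * h ^ 2 * K ^ 2 := by
      refine (Finset.sum_le_sum fun c _ => hsemi2 c).trans_eq ?_
      rw [Finset.sum_const, Finset.card_univ, Fintype.card_fin, nsmul_eq_mul]
      push_cast
      ring
    have h4 : h ^ 2 * sobolevSemi E.carrier 1 (comp F c - comp Fh c) ^ 2 ≤
        h ^ 2 * (24 * CF ^ 2 * K ^ 2 * h ^ 4) := by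
      calc h ^ 2 * sobolevSemi E.carrier 1 (comp F c - comp Fh c) ^ 2
          ≤ h ^ 2 * ∑ c, sobolevSemi E.carrier 1 (comp F c - comp Fh c) ^ 2 := by gcongr
        _ ≤ (CF * h ^ 2) ^ 2 * ∑ c, sobolevSemi E.carrier 2 (comp F c) ^ 2 := h1
        _ ≤ (CF * h ^ 2) ^ 2 * (24 * h ^ 2 * K ^ 2) := by gcongr
        _ = _ := by ring
    exact le_of_mul_le_mul_left h4 (by positivity)
  set A := jac Ω F x₀ c d
  set w := weakDeriv E.carrier (unitIdx d) (comp Fh c) with hw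
  set f := weakDeriv E.carrier (unitIdx d) (comp F c) with hf
  have hwL : MemLp w 2 (volume.restrict E.carrier) := (hFh c).memLp_unit E.isOpen d
  have hfL : MemLp f 2 (volume.restrict E.carrier) := (hFE c).memLp_unit E.isOpen d
  have hAm := const_mem_polySpace (l - 1) A
  have hAL := E.isCell.memLp_poly hAm
  have h1 : ∫ y in E.carrier, (f y - w y) ^ 2 ≤ 24 * CF ^ 2 * K ^ 2 * h ^ 4 := by
    refine le_trans ?_ herr
    rw [sobolevSemi_one_sq]
    refine le_trans (le_of_eq ?_) (Finset.single_le_sum (f := fun d => ∫ y in E.carrier,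
      weakDeriv E.carrier (unitIdx d) (comp F c - comp Fh c) y ^ 2)
      (fun d _ => setIntegral_sq_nonneg _ _) (Finset.mem_univ d))
    refine integral_congr_ae ?_
    filter_upwards [weakDeriv_sub_ae E.isOpen (hFE c) (hFh c) d] with y hy
    rw [hy]
    rfl
  have h2 : ∫ y in E.carrier, (f y - A) ^ 2 ≤ 4 * h ^ 2 * (C₁ * K * h) ^ 2 := by
    refine integral_sq_le_of_ae_bound ?_
    filter_upwards [weakDeriv_mono_ae E.isOpen hEΩ ((hfin c).hasWeakDeriv
      ((unitIdx_order d).le.trans one_le_two)), hx₀n] with y hy hy'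
    have := hy' c d
    simp only [jac, Matrix.of_apply, weakGrad_apply] at this
    rw [hf, hy]
    simpa only [A, jac, Matrix.of_apply, weakGrad_apply] using this
  have h3 : ∫ y in E.carrier, (w y - A) ^ 2 ≤
      2 * (24 * CF ^ 2 * K ^ 2 * h ^ 4) + 2 * (4 * h ^ 2 * (C₁ * K * h) ^ 2) := by
    have i1 := (hfL.sub_fun hwL).integrable_sq
    have i2 := (hfL.sub_fun hAL).integrable_sq
    calc ∫ y in E.carrier, (w y - A) ^ 2
        ≤ ∫ y in E.carrier, (2 * (f y - w y) ^ 2 + 2 * (f y - A) ^ 2) :=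
          integral_mono ((hwL.sub_fun hAL).integrable_sq) ((i1.const_mul 2).add (i2.const_mul 2))
            fun y => by nlinarith [sq_nonneg ((f y - w y) + (f y - A))]
      _ = 2 * (∫ y in E.carrier, (f y - w y) ^ 2) + 2 * ∫ y in E.carrier, (f y - A) ^ 2 := by
          rw [integral_add (i1.const_mul 2) (i2.const_mul 2), integral_const_mul,
            integral_const_mul]
      _ ≤ _ := by gcongr
  have hm := l2proj_mem E.isCell (l - 1) hwL
  have h4 := (hinv E hE _ (sub_mem_polySpace hm hAm) x hx).1
  have h5 : ∫ y in E.carrier, (l2proj E.carrier (l - 1) w y - A) ^ 2 ≤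
      ∫ y in E.carrier, (w y - A) ^ 2 := integral_l2proj_sub_sq_le E.isCell hwL hAm
  -- The integral is of order `h ^ 4` and the inverse estimate costs `h ^ 2`; the square of `K * h`
  -- remains.
  have h6 : h ^ 2 * (l2proj E.carrier (l - 1) w x - A) ^ 2 ≤ h ^ 2 * (C₃ * (K * h) ^ 2) := by
    refine (h4.trans (mul_le_mul_of_nonneg_left (h5.trans h3) hC₂.le)).trans_eq ?_
    rw [hC₃]
    ring
  have h7 := Real.abs_le_sqrt (le_of_mul_le_mul_left h6 (by positivity))
  rw [Real.sqrt_mul hC₃0.le, Real.sqrt_sq (by positivity), ← mul_assoc] at h7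
  rwa [jacProj, Matrix.of_apply, projGrad_eq]

/-- The discrete Jacobian inherits the bounds of the exact one. -/
theorem exists_jacProj_bounds {α : ℝ} (hα : 0 < α) (l : ℕ) (CF : ℝ) {Ω : Set R2} (hΩ : IsOpen Ω)
    (hb : Bornology.IsBounded Ω) {s : ℕ} (hs : 2 ≤ s) {F : R2 → R2}
    (hF : ∀ c, MemSobolev Ω s ⊤ (comp F c)) {j₀ Λ : ℝ} (hj₀ : 0 < j₀)
    (hJ : ∀ᵐ x ∂volume.restrict Ω, j₀ ≤ (jac Ω F x).det ∧ ∀ d e, |jac Ω F x d e| ≤ Λ) :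
    ∃ h₀ > 0, ∀ E : Element, E.Regular α → E.carrier ⊆ Ω → E.diam ≤ h₀ →
      ∀ Fh : R2 → R2, (∀ c, MemSobolev E.carrier 1 2 (comp Fh c)) → AccurateOn E CF F Fh →
      ∀ x ∈ E.carrier, j₀ / 2 ≤ (jacProj E.carrier l Fh x).det ∧
        ∀ d e, |jacProj E.carrier l Fh x d e| ≤ Λ + 1 := by
  obtain ⟨C, hC, hnear⟩ := exists_jacProj_near hα l CF
  obtain ⟨K, hK0, hK⟩ := exists_second_bound hΩ hs hF
  -- An entrywise error `ε ≤ 1` changes each of the two products in the determinant by at most `ε *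
  -- (2 * |Λ| + 1)`, so the determinant loses at most `j₀ / 2`.
  set ε := min 1 (j₀ / (2 * (4 * |Λ| + 2))) with hε
  have hε0 : 0 < ε := by positivity
  refine ⟨ε / (C * K), by positivity, fun E hE hEΩ hd Fh hFh hacc x hx => ?_⟩
  obtain ⟨x₀, ⟨hdet, hA⟩, hx₀⟩ := hnear Ω hΩ hb s hs F hF K hK0.le hK _ hJ E hE hEΩ Fh hFh hacc
  rw [le_div_iff₀ (by positivity), mul_comm] at hd
  have hδ : ∀ c d, |jacProj E.carrier l Fh x c d - jac Ω F x₀ c d| ≤ ε := fun c d =>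
    (hx₀ x hx c d).trans hd
  have hε1 : ε ≤ 1 := min_le_left _ _
  have hεj : ε * (4 * |Λ| + 2) ≤ j₀ / 2 := by
    have : ε ≤ j₀ / (2 * (4 * |Λ| + 2)) := min_le_right _ _
    rw [le_div_iff₀ (by positivity)] at this
    linarith
  set B := jacProj E.carrier l Fh x
  set A := jac Ω F x₀
  constructor
  · rw [Matrix.det_fin_two] at hdet ⊢
    have hprod : ∀ c d c' d', |B c d * B c' d' - A c d * A c' d'| ≤ ε * (2 * |Λ| + 1) := by
      intro c d c' d'
      have e : B c d * B c' d' - A c d * A c' d' = (B c d - A c d) * (B c' d' - A c' d') +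
        (B c d - A c d) * A c' d' + A c d * (B c' d' - A c' d') := by ring
      rw [e]
      have b1 := hδ c d
      have b2 := hδ c' d'
      have a1 := (hA c d).trans (le_abs_self Λ)
      have a2 := (hA c' d').trans (le_abs_self Λ)
      calc |(B c d - A c d) * (B c' d' - A c' d') + (B c d - A c d) * A c' d' +
            A c d * (B c' d' - A c' d')|
          ≤ |B c d - A c d| * |B c' d' - A c' d'| + |B c d - A c d| * |A c' d'| +
            |A c d| * |B c' d' - A c' d'| := by
            rw [← abs_mul, ← abs_mul, ← abs_mul]
            exact (abs_add_le _ _).trans (by gcongr; exact abs_add_le _ _)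
        _ ≤ ε * 1 + ε * |Λ| + |Λ| * ε := by
            gcongr
            exact b2.trans hε1
        _ = _ := by ring
    have p1 := abs_le.1 (hprod 0 0 1 1)
    have p2 := abs_le.1 (hprod 0 1 1 0)
    linarith [p1.1, p2.2]
  · intro d e
    have h1 := hδ d e
    have h2 := hA d e
    have h3 : B d e = (B d e - A d e) + A d e := by ring
    rw [h3]
    exact (abs_add_le _ _).trans (by linarith)

section

/-! ### Bounds for the transformed bilinear form -/

/-- Bounds for the coefficients and the Jacobian at a point. -/
structure TameAt (D : Coeffs) (A : Matrix (Fin 2) (Fin 2) ℝ) (x : R2) (a₀ a₁ b₁ μ₁ j Λ : ℝ) :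
    Prop where
  le_a : a₀ ≤ D.a x
  a_le : D.a x ≤ a₁
  b_le : ∀ d, |D.b x d| ≤ b₁
  μ_nonneg : 0 ≤ D.μ x
  μ_le : D.μ x ≤ μ₁
  le_det : j ≤ A.det
  entry_le : ∀ d e, |A d e| ≤ Λ

/-- Measurability and bounds for the coefficients and the Jacobian on a set. -/
structure TameOn (E : Set R2) (D : Coeffs) (J : R2 → Matrix (Fin 2) (Fin 2) ℝ)
    (a₀ a₁ b₁ μ₁ j Λ : ℝ) : Prop where
  measurable_a : AEMeasurable D.a (volume.restrict E)
  measurable_b : ∀ d, AEMeasurable (fun x => D.b x d) (volume.restrict E)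
  measurable_μ : AEMeasurable D.μ (volume.restrict E)
  measurable_J : ∀ d e, AEMeasurable (fun x => J x d e) (volume.restrict E)
  tameAt : ∀ᵐ x ∂volume.restrict E, TameAt D (J x) x a₀ a₁ b₁ μ₁ j Λ

section pointwise

variable {D : Coeffs} {A : Matrix (Fin 2) (Fin 2) ℝ} {x : R2} {a₀ a₁ b₁ μ₁ j Λ : ℝ}

/-- In dimension two the entries of the adjugate are those of the matrix up to sign and order. -/
theorem TameAt.inv_le (h : TameAt D A x a₀ a₁ b₁ μ₁ j Λ) (hj : 0 < j) (d e : Fin 2) :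
    |A⁻¹ d e| ≤ Λ / j := by
  have hdet := h.le_det
  have hd : 0 < A.det := hj.trans_le hdet
  have hadj : |A.adjugate d e| ≤ Λ := by
    rw [Matrix.adjugate_fin_two]
    fin_cases d <;> fin_cases e <;> simp [h.entry_le]
  rw [Matrix.inv_def, Ring.inverse_eq_inv', Matrix.smul_apply, smul_eq_mul, abs_mul, abs_inv,
    abs_of_pos hd, div_eq_mul_inv, mul_comm]
  exact mul_le_mul hadj (inv_anti₀ hj hdet) (by positivity) ((abs_nonneg _).trans hadj)

theorem TameAt.Λ_nonneg (h : TameAt D A x a₀ a₁ b₁ μ₁ j Λ) : 0 ≤ Λ :=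
  (abs_nonneg _).trans (h.entry_le 0 0)

theorem TameAt.det_le (h : TameAt D A x a₀ a₁ b₁ μ₁ j Λ) : A.det ≤ 2 * Λ ^ 2 := by
  have h0 := h.Λ_nonneg
  have key : ∀ c d c' d', |A c d * A c' d'| ≤ Λ ^ 2 := fun c d c' d' => by
    rw [abs_mul, sq]
    exact mul_le_mul (h.entry_le _ _) (h.entry_le _ _) (abs_nonneg _) h0
  rw [Matrix.det_fin_two]
  linarith [(abs_le.1 (key 0 0 1 1)).2, (abs_le.1 (key 0 1 1 0)).1]

theorem TameAt.mulVec_le (h : TameAt D A x a₀ a₁ b₁ μ₁ j Λ) (hj : 0 < j) (g : Fin 2 → ℝ)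
    (i : Fin 2) : |(A⁻¹ᵀ *ᵥ g) i| ≤ Λ / j * (|g 0| + |g 1|) := by
  rw [Matrix.mulVec, dotProduct, Fin.sum_univ_two, Matrix.transpose_apply, Matrix.transpose_apply,
    mul_add]
  refine (abs_add_le _ _).trans (add_le_add ?_ ?_)
  · rw [abs_mul]; exact mul_le_mul_of_nonneg_right (h.inv_le hj 0 i) (abs_nonneg _)
  · rw [abs_mul]; exact mul_le_mul_of_nonneg_right (h.inv_le hj 1 i) (abs_nonneg _)

/-- Since `g = Aᵀ (A⁻ᵀ g)`, an upper bound for the entries of `A` is a lower bound for `A⁻ᵀ`. The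
summand `1` keeps the constant positive when it appears in a denominator. -/
theorem TameAt.le_mulVec (h : TameAt D A x a₀ a₁ b₁ μ₁ j Λ) (hj : 0 < j) (g : Fin 2 → ℝ) :
    ∑ d, g d ^ 2 ≤ (4 * Λ ^ 2 + 1) * ((A⁻¹ᵀ *ᵥ g) ⬝ᵥ (A⁻¹ᵀ *ᵥ g)) := by
  have hu : IsUnit A.det := (hj.trans_le h.le_det).ne'.isUnit
  have h1 : Aᵀ *ᵥ (A⁻¹ᵀ *ᵥ g) = g := by
    rw [Matrix.mulVec_mulVec, ← Matrix.transpose_mul, Matrix.nonsing_inv_mul _ hu,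
      Matrix.transpose_one, Matrix.one_mulVec]
  set w := A⁻¹ᵀ *ᵥ g
  have hent : ∀ d e, A d e ^ 2 ≤ Λ ^ 2 := fun d e => by
    rw [← sq_abs]
    exact pow_le_pow_left₀ (abs_nonneg _) (h.entry_le d e) 2
  have hw : 0 ≤ w 0 ^ 2 + w 1 ^ 2 := by positivity
  have hd : ∀ d, g d ^ 2 ≤ 2 * Λ ^ 2 * (w 0 ^ 2 + w 1 ^ 2) := by
    intro d
    have h2 : g d = A 0 d * w 0 + A 1 d * w 1 := by
      rw [← congrFun h1 d, Matrix.mulVec, dotProduct, Fin.sum_univ_two]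
      rfl
    calc g d ^ 2 = (A 0 d * w 0 + A 1 d * w 1) ^ 2 := by rw [h2]
      _ ≤ (A 0 d ^ 2 + A 1 d ^ 2) * (w 0 ^ 2 + w 1 ^ 2) := by
          nlinarith [sq_nonneg (A 0 d * w 1 - A 1 d * w 0)]
      _ ≤ (2 * Λ ^ 2) * (w 0 ^ 2 + w 1 ^ 2) := by
          gcongr
          linarith [hent 0 d, hent 1 d]
  rw [Fin.sum_univ_two, dotProduct, Fin.sum_univ_two]
  nlinarith [hd 0, hd 1]

/-- The constant bounding the three parts of the form. -/
def formBound (a₁ b₁ μ₁ j Λ : ℝ) : ℝ :=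
  4 * |a₁| * Λ ^ 2 * (Λ / j) ^ 2 + 4 * |b₁| * Λ ^ 2 * |Λ / j| + 2 * |μ₁| * Λ ^ 2

theorem formBound_nonneg (a₁ b₁ μ₁ j Λ : ℝ) : 0 ≤ formBound a₁ b₁ μ₁ j Λ := by
  unfold formBound
  positivity

theorem TameAt.diffusion_le (h : TameAt D A x a₀ a₁ b₁ μ₁ j Λ) (ha : 0 < a₀) (hj : 0 < j)
    (g g' : Fin 2 → ℝ) : |D.a x * ((A⁻¹ᵀ *ᵥ g) ⬝ᵥ (A⁻¹ᵀ *ᵥ g')) * A.det| ≤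
      4 * |a₁| * Λ ^ 2 * (Λ / j) ^ 2 * ((|g 0| + |g 1|) * (|g' 0| + |g' 1|)) := by
  have hdet := h.det_le
  have hd : 0 ≤ A.det := (hj.trans_le h.le_det).le
  have hρ : 0 ≤ Λ / j := div_nonneg h.Λ_nonneg hj.le
  have h1 := h.mulVec_le hj g
  have h2 := h.mulVec_le hj g'
  have h3 : |(A⁻¹ᵀ *ᵥ g) ⬝ᵥ (A⁻¹ᵀ *ᵥ g')| ≤
      2 * ((Λ / j * (|g 0| + |g 1|)) * (Λ / j * (|g' 0| + |g' 1|))) := by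
    rw [dotProduct, Fin.sum_univ_two, two_mul]
    refine (abs_add_le _ _).trans (add_le_add ?_ ?_)
    all_goals
      rw [abs_mul]
      exact mul_le_mul (h1 _) (h2 _) (abs_nonneg _) (by positivity)
  have ha' : |D.a x| ≤ |a₁| := abs_le_abs_of_nonneg (ha.le.trans h.le_a) h.a_le
  rw [abs_mul, abs_mul, abs_of_nonneg hd]
  calc |D.a x| * |(A⁻¹ᵀ *ᵥ g) ⬝ᵥ (A⁻¹ᵀ *ᵥ g')| * A.det
      ≤ |a₁| * (2 * ((Λ / j * (|g 0| + |g 1|)) * (Λ / j * (|g' 0| + |g' 1|)))) * (2 * Λ ^ 2) := by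
        gcongr
    _ = _ := by ring

theorem TameAt.convection_le (h : TameAt D A x a₀ a₁ b₁ μ₁ j Λ) (hj : 0 < j) (u v : ℝ)
    (g g' : Fin 2 → ℝ) :
    |(D.b x ⬝ᵥ (v • (A⁻¹ᵀ *ᵥ g) - u • (A⁻¹ᵀ *ᵥ g'))) * A.det| ≤
      4 * |b₁| * Λ ^ 2 * |Λ / j| * (|v| * (|g 0| + |g 1|) + |u| * (|g' 0| + |g' 1|)) := by
  have hdet := h.det_le
  have hd : 0 ≤ A.det := (hj.trans_le h.le_det).le
  have hρ : 0 ≤ Λ / j := div_nonneg h.Λ_nonneg hj.le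
  have h1 := h.mulVec_le hj g
  have h2 := h.mulVec_le hj g'
  have hterm : ∀ i, |D.b x i * (v * (A⁻¹ᵀ *ᵥ g) i - u * (A⁻¹ᵀ *ᵥ g') i)| ≤
      |b₁| * (Λ / j * (|v| * (|g 0| + |g 1|) + |u| * (|g' 0| + |g' 1|))) := by
    intro i
    rw [abs_mul]
    refine mul_le_mul ((h.b_le i).trans (le_abs_self _)) ?_ (abs_nonneg _) (abs_nonneg _)
    refine (abs_sub _ _).trans ?_
    rw [abs_mul, abs_mul]
    calc |v| * |(A⁻¹ᵀ *ᵥ g) i| + |u| * |(A⁻¹ᵀ *ᵥ g') i|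
        ≤ |v| * (Λ / j * (|g 0| + |g 1|)) + |u| * (Λ / j * (|g' 0| + |g' 1|)) := by
          gcongr
          exacts [h1 i, h2 i]
      _ = _ := by ring
  rw [abs_mul, abs_of_nonneg hd, dotProduct, Fin.sum_univ_two]
  simp only [Pi.sub_apply, Pi.smul_apply, smul_eq_mul]
  rw [abs_of_nonneg hρ]
  calc _ ≤ (|b₁| * (Λ / j * (|v| * (|g 0| + |g 1|) + |u| * (|g' 0| + |g' 1|))) +
        |b₁| * (Λ / j * (|v| * (|g 0| + |g 1|) + |u| * (|g' 0| + |g' 1|)))) * (2 * Λ ^ 2) :=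
        mul_le_mul ((abs_add_le _ _).trans (add_le_add (hterm 0) (hterm 1))) hdet hd
          (by positivity)
    _ = _ := by ring

theorem TameAt.reaction_le (h : TameAt D A x a₀ a₁ b₁ μ₁ j Λ) (hj : 0 < j) (u v : ℝ) :
    |D.μ x * u * v * A.det| ≤ 2 * |μ₁| * Λ ^ 2 * (|u| * |v|) := by
  have hdet := h.det_le
  have hd : 0 ≤ A.det := (hj.trans_le h.le_det).le
  have hμ : |D.μ x| ≤ |μ₁| := abs_le_abs_of_nonneg h.μ_nonneg h.μ_le
  rw [abs_mul, abs_mul, abs_mul, abs_of_nonneg hd]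
  calc |D.μ x| * |u| * |v| * A.det ≤ |μ₁| * |u| * |v| * (2 * Λ ^ 2) := by gcongr
    _ = _ := by ring

end pointwise

section form

variable {E : Set R2} {D : Coeffs} {J : R2 → Matrix (Fin 2) (Fin 2) ℝ} {a₀ a₁ b₁ μ₁ j Λ : ℝ}
  {u v w : R2 → ℝ} {gu gv gw : R2 → Fin 2 → ℝ}

/-- A square integrable function together with a square integrable vector field. -/
structure PairLp (E : Set R2) (u : R2 → ℝ) (gu : R2 → Fin 2 → ℝ) : Prop where
  fst : MemLp u 2 (volume.restrict E)
  snd : ∀ d, MemLp (fun x => gu x d) 2 (volume.restrict E)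

/-- The squared norm of such a pair. -/
def pairSq (E : Set R2) (u : R2 → ℝ) (gu : R2 → Fin 2 → ℝ) : ℝ :=
  (∫ x in E, u x ^ 2) + ∑ d, ∫ x in E, gu x d ^ 2

/-- The pointwise size of a pair. -/
def pairAbs (u : R2 → ℝ) (gu : R2 → Fin 2 → ℝ) (x : R2) : ℝ := |u x| + (|gu x 0| + |gu x 1|)

theorem PairLp.memLp_abs (hu : PairLp E u gu) : MemLp (pairAbs u gu) 2 (volume.restrict E) :=
  hu.fst.abs.add ((hu.snd 0).abs.add (hu.snd 1).abs)

theorem PairLp.integral_abs_sq_le (hu : PairLp E u gu) :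
    ∫ x in E, pairAbs u gu x ^ 2 ≤ 3 * pairSq E u gu := by
  have i0 := hu.fst.integrable_sq
  have i1 := (hu.snd 0).integrable_sq
  have i2 := (hu.snd 1).integrable_sq
  have i12 : Integrable (fun x => gu x 0 ^ 2 + gu x 1 ^ 2) (volume.restrict E) := i1.add i2
  rw [pairSq, Fin.sum_univ_two, ← integral_add i1 i2, ← integral_add i0 i12, ← integral_const_mul]
  refine integral_mono hu.memLp_abs.integrable_sq ((i0.add i12).const_mul 3) fun x => ?_
  simp only [pairAbs]
  rw [← sq_abs (u x), ← sq_abs (gu x 0), ← sq_abs (gu x 1)]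
  nlinarith [sq_nonneg (|u x| - |gu x 0|), sq_nonneg (|u x| - |gu x 1|),
    sq_nonneg (|gu x 0| - |gu x 1|)]

/-- The quadratic polynomial `t ↦ ∫ (f - t g)²` is nonnegative, so its discriminant is not positive.
-/
theorem integral_mul_le_sqrt {f g : R2 → ℝ} (hf : MemLp f 2 (volume.restrict E))
    (hg : MemLp g 2 (volume.restrict E)) :
    ∫ x in E, f x * g x ≤ √(∫ x in E, f x ^ 2) * √(∫ x in E, g x ^ 2) := by
  have i1 := hf.integrable_sq
  have i2 := hg.integrable_sq
  have i3 := hf.integrable_mul_fun hg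
  have hq : ∀ t : ℝ, 0 ≤ (∫ x in E, g x ^ 2) * (t * t) + (-2 * ∫ x in E, f x * g x) * t +
      ∫ x in E, f x ^ 2 := by
    intro t
    have h0 : 0 ≤ ∫ x in E, (f x - t * g x) ^ 2 := setIntegral_sq_nonneg E _
    have e : ∀ x, (f x - t * g x) ^ 2 =
        (t * t) * g x ^ 2 + (-2 * t) * (f x * g x) + f x ^ 2 := fun x => by ring
    simp only [e] at h0
    have i4 : Integrable (fun x => (t * t) * g x ^ 2 + (-2 * t) * (f x * g x))
      (volume.restrict E) := (i2.const_mul _).add (i3.const_mul _)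
    rw [integral_add i4 i1, integral_add (i2.const_mul _) (i3.const_mul _), integral_const_mul,
      integral_const_mul] at h0
    linarith
  have hdisc := discrim_le_zero hq
  rw [discrim] at hdisc
  rw [← Real.sqrt_mul (setIntegral_sq_nonneg E f)]
  exact Real.le_sqrt_of_sq_le (by nlinarith)

theorem pairAbs_nonneg (u : R2 → ℝ) (gu : R2 → Fin 2 → ℝ) (x : R2) : 0 ≤ pairAbs u gu x := by
  unfold pairAbs; positivity

theorem abs_le_pairAbs (u : R2 → ℝ) (gu : R2 → Fin 2 → ℝ) (x : R2) : |u x| ≤ pairAbs u gu x :=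
  le_add_of_nonneg_right (by positivity)

theorem grad_le_pairAbs (u : R2 → ℝ) (gu : R2 → Fin 2 → ℝ) (x : R2) :
    |gu x 0| + |gu x 1| ≤ pairAbs u gu x :=
  le_add_of_nonneg_left (abs_nonneg _)

theorem TameAt.le_pairAbs {x : R2} (h : TameAt D (J x) x a₀ a₁ b₁ μ₁ j Λ) (ha : 0 < a₀)
    (hj : 0 < j) (u v : R2 → ℝ) (gu gv : R2 → Fin 2 → ℝ) :
    |D.a x * (((J x)⁻¹ᵀ *ᵥ gu x) ⬝ᵥ ((J x)⁻¹ᵀ *ᵥ gv x)) * (J x).det| ≤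
      4 * |a₁| * Λ ^ 2 * (Λ / j) ^ 2 * (pairAbs u gu x * pairAbs v gv x) ∧
    |(D.b x ⬝ᵥ (v x • ((J x)⁻¹ᵀ *ᵥ gu x) - u x • ((J x)⁻¹ᵀ *ᵥ gv x))) * (J x).det| ≤
      4 * |b₁| * Λ ^ 2 * |Λ / j| * (pairAbs u gu x * pairAbs v gv x) ∧
    |D.μ x * u x * v x * (J x).det| ≤
      2 * |μ₁| * Λ ^ 2 * (pairAbs u gu x * pairAbs v gv x) := by
  have hu := pairAbs_nonneg u gu x
  refine ⟨(h.diffusion_le ha hj _ _).trans (mul_le_mul_of_nonneg_left ?_ (by positivity)),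
    (h.convection_le hj _ _ _ _).trans (mul_le_mul_of_nonneg_left ?_ (by positivity)),
    (h.reaction_le hj _ _).trans (mul_le_mul_of_nonneg_left ?_ (by positivity))⟩
  · exact mul_le_mul (grad_le_pairAbs u gu x) (grad_le_pairAbs v gv x) (by positivity) hu
  · simp only [pairAbs]
    have h1 := mul_nonneg (abs_nonneg (u x)) (abs_nonneg (v x))
    have h2 := mul_nonneg (add_nonneg (abs_nonneg (gu x 0)) (abs_nonneg (gu x 1)))
        (add_nonneg (abs_nonneg (gv x 0)) (abs_nonneg (gv x 1)))
    linarith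
  · exact mul_le_mul (abs_le_pairAbs u gu x) (abs_le_pairAbs v gv x) (abs_nonneg _) hu

/-- Exhibits the entries of the inverse as measurable expressions in the entries of the matrix. -/
theorem exists_inv_entry (d e : Fin 2) : ∃ (c : ℝ) (d' e' : Fin 2),
    ∀ A : Matrix (Fin 2) (Fin 2) ℝ, A⁻¹ d e = A.det⁻¹ * (c * A d' e') := by
  simp only [Matrix.inv_def, Ring.inverse_eq_inv', Matrix.smul_apply, smul_eq_mul,
      Matrix.adjugate_fin_two]
  fin_cases d <;> fin_cases e
  · exact ⟨1, 1, 1, fun A => by simp⟩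
  · exact ⟨-1, 0, 1, fun A => by simp⟩
  · exact ⟨-1, 1, 0, fun A => by simp⟩
  · exact ⟨1, 0, 0, fun A => by simp⟩

theorem TameOn.aemeasurable_det (h : TameOn E D J a₀ a₁ b₁ μ₁ j Λ) :
    AEMeasurable (fun x => (J x).det) (volume.restrict E) := by
  have hm := h.measurable_J
  simp only [Matrix.det_fin_two]
  exact ((hm 0 0).mul (hm 1 1)).sub ((hm 0 1).mul (hm 1 0))

theorem TameOn.aemeasurable_mulVec (h : TameOn E D J a₀ a₁ b₁ μ₁ j Λ) {g : R2 → Fin 2 → ℝ}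
    (hg : ∀ d, AEMeasurable (fun x => g x d) (volume.restrict E)) (i : Fin 2) :
    AEMeasurable (fun x => ((J x)⁻¹ᵀ *ᵥ g x) i) (volume.restrict E) := by
  have hinv : ∀ d e, AEMeasurable (fun x => (J x)⁻¹ d e) (volume.restrict E) := by
    intro d e
    obtain ⟨c, d', e', hc⟩ := exists_inv_entry d e
    simp only [hc]
    exact h.aemeasurable_det.inv.mul ((h.measurable_J d' e').const_mul c)
  simp only [Matrix.mulVec, dotProduct, Fin.sum_univ_two, Matrix.transpose_apply]
  exact ((hinv 0 i).mul (hg 0)).add ((hinv 1 i).mul (hg 1))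

theorem TameOn.integrable (h : TameOn E D J a₀ a₁ b₁ μ₁ j Λ) (ha : 0 < a₀) (hj : 0 < j)
    (hu : PairLp E u gu) (hv : PairLp E v gv) :
    IntegrableOn (fun x => D.a x * (((J x)⁻¹ᵀ *ᵥ gu x) ⬝ᵥ ((J x)⁻¹ᵀ *ᵥ gv x)) * (J x).det) E ∧
    IntegrableOn (fun x => (D.b x ⬝ᵥ (v x • ((J x)⁻¹ᵀ *ᵥ gu x) - u x • ((J x)⁻¹ᵀ *ᵥ gv x))) *
      (J x).det) E ∧
    IntegrableOn (fun x => D.μ x * u x * v x * (J x).det) E := by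
  have m2 := h.measurable_b
  have m5 := hu.fst.aemeasurable
  have m6 := hv.fst.aemeasurable
  have mgu := h.aemeasurable_mulVec fun d => (hu.snd d).aemeasurable
  have mgv := h.aemeasurable_mulVec fun d => (hv.snd d).aemeasurable
  have i0 : Integrable (fun x => pairAbs u gu x * pairAbs v gv x) (volume.restrict E) :=
    hu.memLp_abs.integrable_mul_fun hv.memLp_abs
  have hle := h.tameAt.mono fun x hx => hx.le_pairAbs ha hj u v gu gv
  refine ⟨(i0.const_mul _).mono' ?_ (hle.mono fun x hx => hx.1),
    (i0.const_mul _).mono' ?_ (hle.mono fun x hx => hx.2.1),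
    (i0.const_mul _).mono' ?_ (hle.mono fun x hx => hx.2.2)⟩
  · simp only [dotProduct, Fin.sum_univ_two]
    exact ((h.measurable_a.mul (((mgu 0).mul (mgv 0)).add ((mgu 1).mul (mgv 1)))).mul
      h.aemeasurable_det).aestronglyMeasurable
  · simp only [dotProduct, Fin.sum_univ_two, Pi.sub_apply, Pi.smul_apply, smul_eq_mul]
    exact ((((m2 0).mul ((m6.mul (mgu 0)).sub (m5.mul (mgv 0)))).add
      ((m2 1).mul ((m6.mul (mgu 1)).sub (m5.mul (mgv 1))))).mul
      h.aemeasurable_det).aestronglyMeasurable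
  · exact (((h.measurable_μ.mul m5).mul m6).mul h.aemeasurable_det).aestronglyMeasurable

theorem TameOn.abs_form_le (h : TameOn E D J a₀ a₁ b₁ μ₁ j Λ) (ha : 0 < a₀) (hj : 0 < j)
    (hu : PairLp E u gu) (hv : PairLp E v gv) :
    |transformedForm E D J u v gu gv| ≤
      3 * formBound a₁ b₁ μ₁ j Λ * (√(pairSq E u gu) * √(pairSq E v gv)) := by
  have i0 : Integrable (fun x => pairAbs u gu x * pairAbs v gv x) (volume.restrict E) :=
    hu.memLp_abs.integrable_mul_fun hv.memLp_abs
  set I := ∫ x in E, pairAbs u gu x * pairAbs v gv x with hI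
  have hI0 : 0 ≤ I := integral_nonneg fun x => by unfold pairAbs; positivity
  have hIle : I ≤ 3 * (√(pairSq E u gu) * √(pairSq E v gv)) := by
    refine (integral_mul_le_sqrt hu.memLp_abs hv.memLp_abs).trans ?_
    calc _ ≤ √(3 * pairSq E u gu) * √(3 * pairSq E v gv) :=
          mul_le_mul (Real.sqrt_le_sqrt hu.integral_abs_sq_le)
            (Real.sqrt_le_sqrt hv.integral_abs_sq_le) (Real.sqrt_nonneg _) (Real.sqrt_nonneg _)
      _ = (√3 * √3) * (√(pairSq E u gu) * √(pairSq E v gv)) := by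
          rw [Real.sqrt_mul (by norm_num), Real.sqrt_mul (by norm_num)]; ring
      _ = _ := by rw [Real.mul_self_sqrt (by norm_num)]
  have hle := h.tameAt.mono fun x hx => hx.le_pairAbs ha hj u v gu gv
  have hint : ∀ {f : R2 → ℝ} {C : ℝ},
      (∀ᵐ x ∂volume.restrict E, |f x| ≤ C * (pairAbs u gu x * pairAbs v gv x)) →
      |∫ x in E, f x| ≤ C * I := by
    intro f C hf
    rw [hI, ← integral_const_mul]
    exact norm_integral_le_of_norm_le (f := f) (i0.const_mul C) hf
  have b1 := hint (hle.mono fun x hx => hx.1)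
  have b2 := hint (hle.mono fun x hx => hx.2.1)
  have b3 := hint (hle.mono fun x hx => hx.2.2)
  calc |transformedForm E D J u v gu gv| ≤ formBound a₁ b₁ μ₁ j Λ * I := by
        rw [transformedForm, formBound, add_mul, add_mul]
        refine (abs_add_le _ _).trans (add_le_add ((abs_add_le _ _).trans (add_le_add b1 ?_)) b3)
        rw [abs_mul, abs_of_nonneg (by norm_num : (0 : ℝ) ≤ 1 / 2)]
        refine le_trans ?_ b2
        linarith [abs_nonneg (∫ x in E, (D.b x ⬝ᵥ (v x • ((J x)⁻¹ᵀ *ᵥ gu x) -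
          u x • ((J x)⁻¹ᵀ *ᵥ gv x))) * (J x).det)]
    _ ≤ formBound a₁ b₁ μ₁ j Λ * (3 * (√(pairSq E u gu) * √(pairSq E v gv))) :=
        mul_le_mul_of_nonneg_left hIle (formBound_nonneg _ _ _ _ _)
    _ = _ := by ring

/-- With equal arguments the convective integrand vanishes identically and the reaction is
nonnegative, so the diffusion alone gives the bound. -/
theorem TameOn.le_form (h : TameOn E D J a₀ a₁ b₁ μ₁ j Λ) (ha : 0 < a₀) (hj : 0 < j)
    (hv : PairLp E v gv) :
    a₀ * j / (4 * Λ ^ 2 + 1) * ∑ d, ∫ x in E, gv x d ^ 2 ≤ transformedForm E D J v v gv gv := by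
  have i1 := (h.integrable ha hj hv hv).1
  have h2 : ∫ x in E, (D.b x ⬝ᵥ (v x • ((J x)⁻¹ᵀ *ᵥ gv x) - v x • ((J x)⁻¹ᵀ *ᵥ gv x))) *
      (J x).det = 0 := by simp
  have h3 : 0 ≤ ∫ x in E, D.μ x * v x * v x * (J x).det := by
    refine integral_nonneg_of_ae ?_
    filter_upwards [h.tameAt] with x hx
    have := hx.μ_nonneg
    have := hj.le.trans hx.le_det
    rw [mul_assoc (D.μ x)]
    exact mul_nonneg (mul_nonneg hx.μ_nonneg (mul_self_nonneg _)) this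
  have h1 : a₀ * j / (4 * Λ ^ 2 + 1) * ∑ d, ∫ x in E, gv x d ^ 2 ≤
      ∫ x in E, D.a x * (((J x)⁻¹ᵀ *ᵥ gv x) ⬝ᵥ ((J x)⁻¹ᵀ *ᵥ gv x)) * (J x).det := by
    rw [← integral_finsetSum _ fun d _ => (hv.snd d).integrable_sq, ← integral_const_mul]
    refine integral_mono_ae
      ((integrable_finsetSum _ fun d _ => (hv.snd d).integrable_sq).const_mul _) i1 ?_
    filter_upwards [h.tameAt] with x hx
    have h4 := hx.le_mulVec hj (gv x)
    set W := ((J x)⁻¹ᵀ *ᵥ gv x) ⬝ᵥ ((J x)⁻¹ᵀ *ᵥ gv x)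
    have hW : 0 ≤ W := by
      simp only [W, dotProduct]
      exact Finset.sum_nonneg fun _ _ => mul_self_nonneg _
    have h5 := hx.le_a
    have h6 := hx.le_det
    calc a₀ * j / (4 * Λ ^ 2 + 1) * ∑ d, gv x d ^ 2
        ≤ a₀ * j / (4 * Λ ^ 2 + 1) * ((4 * Λ ^ 2 + 1) * W) := by gcongr
      _ = a₀ * W * j := by field_simp
      _ ≤ D.a x * W * (J x).det := by
          have := ha.le.trans h5
          gcongr
  rw [transformedForm, h2]
  linarith

theorem TameOn.form_add_left (h : TameOn E D J a₀ a₁ b₁ μ₁ j Λ) (ha : 0 < a₀) (hj : 0 < j)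
    (hu : PairLp E u gu) (hw : PairLp E w gw) (hv : PairLp E v gv) :
    transformedForm E D J (u + w) v (gu + gw) gv =
      transformedForm E D J u v gu gv + transformedForm E D J w v gw gv := by
  obtain ⟨i1, i2, i3⟩ := h.integrable ha hj hu hv
  obtain ⟨k1, k2, k3⟩ := h.integrable ha hj hw hv
  have e1 := integral_add i1 k1
  have e2 := integral_add i2 k2
  have e3 := integral_add i3 k3
  have f1 : ∀ x, D.a x * (((J x)⁻¹ᵀ *ᵥ (gu + gw) x) ⬝ᵥ ((J x)⁻¹ᵀ *ᵥ gv x)) * (J x).det =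
      D.a x * (((J x)⁻¹ᵀ *ᵥ gu x) ⬝ᵥ ((J x)⁻¹ᵀ *ᵥ gv x)) * (J x).det +
      D.a x * (((J x)⁻¹ᵀ *ᵥ gw x) ⬝ᵥ ((J x)⁻¹ᵀ *ᵥ gv x)) * (J x).det := fun x => by
    rw [Pi.add_apply, Matrix.mulVec_add, add_dotProduct]; ring
  have f2 : ∀ x, (D.b x ⬝ᵥ (v x • ((J x)⁻¹ᵀ *ᵥ (gu + gw) x) - (u + w) x • ((J x)⁻¹ᵀ *ᵥ gv x))) *
      (J x).det = (D.b x ⬝ᵥ (v x • ((J x)⁻¹ᵀ *ᵥ gu x) - u x • ((J x)⁻¹ᵀ *ᵥ gv x))) * (J x).det +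
      (D.b x ⬝ᵥ (v x • ((J x)⁻¹ᵀ *ᵥ gw x) - w x • ((J x)⁻¹ᵀ *ᵥ gv x))) * (J x).det := fun x => by
    simp only [Pi.add_apply, Matrix.mulVec_add, smul_add, add_smul, dotProduct_sub, dotProduct_add]
    ring
  have f3 : ∀ x, D.μ x * (u + w) x * v x * (J x).det = D.μ x * u x * v x * (J x).det +
      D.μ x * w x * v x * (J x).det := fun x => by rw [Pi.add_apply]; ring
  simp only [transformedForm, f1, f2, f3]
  rw [e1, e2, e3]
  ring

theorem form_smul_left (c : ℝ) :
    transformedForm E D J (c • u) v (c • gu) gv = c * transformedForm E D J u v gu gv := by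
  have f1 : ∀ x, D.a x * (((J x)⁻¹ᵀ *ᵥ (c • gu) x) ⬝ᵥ ((J x)⁻¹ᵀ *ᵥ gv x)) * (J x).det =
      c * (D.a x * (((J x)⁻¹ᵀ *ᵥ gu x) ⬝ᵥ ((J x)⁻¹ᵀ *ᵥ gv x)) * (J x).det) := fun x => by
    rw [Pi.smul_apply, Matrix.mulVec_smul, smul_dotProduct, smul_eq_mul]; ring
  have f2 : ∀ x, (D.b x ⬝ᵥ (v x • ((J x)⁻¹ᵀ *ᵥ (c • gu) x) - (c • u) x • ((J x)⁻¹ᵀ *ᵥ gv x))) *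
      (J x).det =
      c * ((D.b x ⬝ᵥ (v x • ((J x)⁻¹ᵀ *ᵥ gu x) - u x • ((J x)⁻¹ᵀ *ᵥ gv x))) * (J x).det) :=
    fun x => by
    simp only [Pi.smul_apply, Matrix.mulVec_smul, dotProduct_sub, dotProduct_smul, smul_eq_mul]
    ring
  have f3 : ∀ x, D.μ x * (c • u) x * v x * (J x).det = c * (D.μ x * u x * v x * (J x).det) :=
    fun x => by rw [Pi.smul_apply, smul_eq_mul]; ring
  simp only [transformedForm, f1, f2, f3, integral_const_mul]
  ring

/-- The coefficients of the adjoint form. -/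
def Coeffs.adjoint (D : Coeffs) : Coeffs := ⟨D.a, -D.b, D.μ⟩

/-- Exchanging the two arguments only changes the sign of the convection. Linearity in the second
argument is thus reduced to linearity in the first. -/
theorem form_adjoint :
    transformedForm E D.adjoint J u v gu gv = transformedForm E D J v u gv gu := by
  have f2 : ∀ x, (D.adjoint.b x ⬝ᵥ (v x • ((J x)⁻¹ᵀ *ᵥ gu x) - u x • ((J x)⁻¹ᵀ *ᵥ gv x))) =
      D.b x ⬝ᵥ (u x • ((J x)⁻¹ᵀ *ᵥ gv x) - v x • ((J x)⁻¹ᵀ *ᵥ gu x)) := fun x => by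
    simp only [Coeffs.adjoint, Pi.neg_apply, neg_dotProduct, dotProduct_sub]; ring
  have f3 : ∀ x, D.μ x * u x * v x * (J x).det = D.μ x * v x * u x * (J x).det :=
    fun x => by ring
  simp only [transformedForm, f2]
  simp only [Coeffs.adjoint, f3, dotProduct_comm ((_)⁻¹ᵀ *ᵥ gu _)]

theorem TameOn.adjoint (h : TameOn E D J a₀ a₁ b₁ μ₁ j Λ) :
    TameOn E D.adjoint J a₀ a₁ b₁ μ₁ j Λ where
  measurable_a := h.measurable_a
  measurable_b d := (h.measurable_b d).neg
  measurable_μ := h.measurable_μ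
  measurable_J := h.measurable_J
  tameAt := by
    filter_upwards [h.tameAt] with x hx
    exact ⟨hx.le_a, hx.a_le, fun d => by simpa [Coeffs.adjoint] using hx.b_le d, hx.μ_nonneg,
      hx.μ_le, hx.le_det, hx.entry_le⟩

theorem TameOn.form_add_right (h : TameOn E D J a₀ a₁ b₁ μ₁ j Λ) (ha : 0 < a₀) (hj : 0 < j)
    (hu : PairLp E u gu) (hw : PairLp E w gw) (hv : PairLp E v gv) :
    transformedForm E D J v (u + w) gv (gu + gw) =
      transformedForm E D J v u gv gu + transformedForm E D J v w gv gw := by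
  simp only [← form_adjoint (D := D) (u := _) (v := v)]
  exact h.adjoint.form_add_left ha hj hu hw hv

theorem form_smul_right (c : ℝ) :
    transformedForm E D J v (c • u) gv (c • gu) = c * transformedForm E D J v u gv gu := by
  rw [← form_adjoint (D := D) (v := v), ← form_adjoint (D := D) (u := u), form_smul_left]

end form

end

/-! ### The `H¹` norm -/

theorem h1norm_sq_eq_pairSq (U : Set R2) (v : R2 → ℝ) :
    h1norm U v ^ 2 = pairSq U v (weakGrad U v) := by
  simp only [h1norm_sq, l2norm_sq, sobolevSemi_one_sq, pairSq, weakGrad_apply]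

theorem h1norm_nonneg (U : Set R2) (v : R2 → ℝ) : 0 ≤ h1norm U v := Real.sqrt_nonneg _

theorem h1norm_eq_sqrt (U : Set R2) (v : R2 → ℝ) :
    h1norm U v = √(pairSq U v (weakGrad U v)) := by
  rw [← h1norm_sq_eq_pairSq, Real.sqrt_sq (h1norm_nonneg U v)]

theorem MemSobolev.pairLp {U : Set R2} (hU : IsOpen U) {v : R2 → ℝ} (h : MemSobolev U 1 2 v) :
    PairLp U v (weakGrad U v) :=
  ⟨h.memLp hU, h.memLp_weakGrad hU⟩

theorem integral_add_sq_le {U : Set R2} {f g w : R2 → ℝ} (hf : MemLp f 2 (volume.restrict U))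
    (hg : MemLp g 2 (volume.restrict U)) (hw : w =ᵐ[volume.restrict U] f + g) :
    ∫ x in U, w x ^ 2 ≤ 2 * (∫ x in U, f x ^ 2) + 2 * ∫ x in U, g x ^ 2 := by
  have i1 := hf.integrable_sq.const_mul 2
  have i2 := hg.integrable_sq.const_mul 2
  rw [← integral_const_mul, ← integral_const_mul, ← integral_add i1 i2]
  refine integral_mono_of_nonneg (Filter.Eventually.of_forall fun _ => sq_nonneg _)
    (i1.add i2) ?_
  filter_upwards [hw] with x hx
  rw [hx]
  simp only [Pi.add_apply]
  nlinarith [sq_nonneg (f x - g x)]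

theorem sobolevSemi_add_sq_le {U : Set R2} (hU : IsOpen U) {f g : R2 → ℝ}
    (hf : MemSobolev U 1 2 f) (hg : MemSobolev U 1 2 g) :
    sobolevSemi U 1 (f + g) ^ 2 ≤ 2 * sobolevSemi U 1 f ^ 2 + 2 * sobolevSemi U 1 g ^ 2 := by
  simp only [sobolevSemi_one_sq, Finset.mul_sum]
  rw [← Finset.sum_add_distrib]
  exact Finset.sum_le_sum fun d _ => integral_add_sq_le (hf.memLp_unit hU d) (hg.memLp_unit hU d)
    (weakDeriv_add_ae hU hf hg d)

theorem sobolevSemi_smul_sq {U : Set R2} (hU : IsOpen U) {f : R2 → ℝ}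
    (hf : MemSobolev U 1 2 f) (c : ℝ) :
    sobolevSemi U 1 (c • f) ^ 2 = c ^ 2 * sobolevSemi U 1 f ^ 2 := by
  simp only [sobolevSemi_one_sq, Finset.mul_sum]
  refine Finset.sum_congr rfl fun d _ => ?_
  rw [← integral_const_mul]
  refine integral_congr_ae ?_
  filter_upwards [weakDeriv_smul_ae hU hf c d] with x hx
  rw [hx, Pi.smul_apply, smul_eq_mul]
  ring

theorem sobolevSemi_sub_sq_le {U : Set R2} (hU : IsOpen U) {f g : R2 → ℝ}
    (hf : MemSobolev U 1 2 f) (hg : MemSobolev U 1 2 g) :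
    sobolevSemi U 1 (f - g) ^ 2 ≤ 2 * sobolevSemi U 1 f ^ 2 + 2 * sobolevSemi U 1 g ^ 2 := by
  have h := sobolevSemi_add_sq_le hU hf (hg.smul (-1))
  rw [sobolevSemi_smul_sq hU hg] at h
  have e : f + (-1 : ℝ) • g = f - g := by simp [sub_eq_add_neg]
  rw [e] at h
  linarith

theorem l2norm_add_sq_le {U : Set R2} {f g : R2 → ℝ} (hf : MemLp f 2 (volume.restrict U))
    (hg : MemLp g 2 (volume.restrict U)) :
    l2norm U (f + g) ^ 2 ≤ 2 * l2norm U f ^ 2 + 2 * l2norm U g ^ 2 := by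
  simp only [l2norm_sq]
  exact integral_add_sq_le hf hg Filter.EventuallyEq.rfl

theorem h1norm_add_sq_le {U : Set R2} (hU : IsOpen U) {f g : R2 → ℝ}
    (hf : MemSobolev U 1 2 f) (hg : MemSobolev U 1 2 g) :
    h1norm U (f + g) ^ 2 ≤ 2 * h1norm U f ^ 2 + 2 * h1norm U g ^ 2 := by
  simp only [h1norm_sq]
  linarith [l2norm_add_sq_le (hf.memLp hU) (hg.memLp hU), sobolevSemi_add_sq_le hU hf hg]

theorem h1norm_smul_sq {U : Set R2} (hU : IsOpen U) {f : R2 → ℝ} (hf : MemSobolev U 1 2 f)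
    (c : ℝ) : h1norm U (c • f) ^ 2 = c ^ 2 * h1norm U f ^ 2 := by
  have e : l2norm U (c • f) ^ 2 = c ^ 2 * l2norm U f ^ 2 := by
    simp only [l2norm_sq, Pi.smul_apply, smul_eq_mul, mul_pow]
    exact integral_const_mul _ _
  rw [h1norm_sq, h1norm_sq, sobolevSemi_smul_sq hU hf, e]
  ring

theorem IsTestFunction.memSobolev {U : Set R2} (hU : IsOpen U) (hb : Bornology.IsBounded U)
    {φ : R2 → ℝ} (h : IsTestFunction U φ) : MemSobolev U 1 2 φ :=
  memSobolev_of_contDiff hU hb h.1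

theorem MemH10.add {U : Set R2} (hU : IsOpen U) (hb : Bornology.IsBounded U) {f g : R2 → ℝ}
    (hf : MemH10 U f) (hg : MemH10 U g) : MemH10 U (f + g) := by
  refine ⟨hf.1.add hg.1, fun ε hε => ?_⟩
  obtain ⟨φ, hφ, h1⟩ := hf.2 (ε / 2) (by positivity)
  obtain ⟨ψ, hψ, h2⟩ := hg.2 (ε / 2) (by positivity)
  refine ⟨φ + ψ, ⟨hφ.1.add hψ.1, hφ.2.1.add hψ.2.1, (tsupport_add φ ψ).trans
    (union_subset hφ.2.2 hψ.2.2)⟩, ?_⟩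
  have e : (fun x => (f + g) x - (φ + ψ) x) = (f - φ) + (g - ψ) := by
    funext x; simp only [Pi.add_apply, Pi.sub_apply]; ring
  rw [e]
  have h3 := h1norm_add_sq_le hU (hf.1.sub (hφ.memSobolev hU hb)) (hg.1.sub (hψ.memSobolev hU hb))
  have h1' : h1norm U (f - φ) < ε / 2 := h1
  have h2' : h1norm U (g - ψ) < ε / 2 := h2
  have h4 := pow_lt_pow_left₀ h1' (h1norm_nonneg _ _) two_ne_zero
  have h5 := pow_lt_pow_left₀ h2' (h1norm_nonneg _ _) two_ne_zero
  refine lt_of_pow_lt_pow_left₀ 2 hε.le ?_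
  nlinarith

theorem MemH10.smul {U : Set R2} (hU : IsOpen U) (hb : Bornology.IsBounded U) {f : R2 → ℝ}
    (hf : MemH10 U f) (c : ℝ) : MemH10 U (c • f) := by
  refine ⟨hf.1.smul c, fun ε hε => ?_⟩
  obtain ⟨φ, hφ, h1⟩ := hf.2 (ε / (|c| + 1)) (by positivity)
  refine ⟨c • φ, ⟨contDiff_const.smul hφ.1, hφ.2.1.mono (Function.support_const_smul_subset c φ),
    (closure_mono (Function.support_const_smul_subset c φ)).trans hφ.2.2⟩, ?_⟩
  have e : (fun x => (c • f) x - (c • φ) x) = c • (f - φ) := by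
    funext x; simp only [Pi.smul_apply, Pi.sub_apply, smul_eq_mul]; ring
  rw [e]
  have h2 := h1norm_smul_sq hU (hf.1.sub (hφ.memSobolev hU hb)) c
  have h1' : h1norm U (f - φ) < ε / (|c| + 1) := h1
  rw [lt_div_iff₀ (by positivity)] at h1'
  have h0 := h1norm_nonneg U (f - φ)
  have h3 : h1norm U (c • (f - φ)) = |c| * h1norm U (f - φ) := by
    rw [← Real.sqrt_sq (h1norm_nonneg U (c • (f - φ))), h2, Real.sqrt_mul (sq_nonneg c),
      Real.sqrt_sq_eq_abs, Real.sqrt_sq h0]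
  rw [h3]
  nlinarith

/-- The Friedrichs inequality on a bounded domain. -/
theorem MemH10.l2norm_sq_le {U : Set R2} (hU : IsOpen U) (hb : Bornology.IsBounded U) {v : R2 → ℝ}
    (hv : MemH10 U v) : l2norm U v ^ 2 ≤ 8 * Metric.diam U ^ 2 * sobolevSemi U 1 v ^ 2 := by
  set h := Metric.diam U
  -- Friedrichs for a test function `φ` close to `v` gives `‖φ‖² ≤ 2h² |φ|₁²`. Passing from `v` to
  -- `φ` in the `L²` norm and back in the semi-norm costs a factor two each, hence `8`.
  have key : ∀ ε > 0, l2norm U v ^ 2 ≤ 8 * h ^ 2 * sobolevSemi U 1 v ^ 2 +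
      (2 + 8 * h ^ 2) * ε ^ 2 := by
    intro ε hε
    obtain ⟨φ, hφ, h1⟩ := hv.2 ε hε
    have hφS := hφ.memSobolev hU hb
    have h1' : h1norm U (v - φ) < ε := h1
    have h2 := pow_lt_pow_left₀ h1' (h1norm_nonneg _ _) two_ne_zero
    rw [h1norm_sq] at h2
    have hF := friedrichs_smooth hU (h := h) (fun x hx y hy => Metric.dist_le_diam_of_mem hb hx hy)
      hφ.1 le_rfl (fun x hx => by rw [hφ.eq_zero hx, abs_zero])
    have hg : ∫⁻ x in U, ENNReal.ofReal (gradSq φ x) = ENNReal.ofReal (sobolevSemi U 1 φ ^ 2) := by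
      rw [← hφS.lintegral_gradSq hU]
      refine lintegral_congr_ae ?_
      filter_upwards [weakDeriv_of_contDiff hU hφ.1 0, weakDeriv_of_contDiff hU hφ.1 1] with x h0 h1
      rw [gradSq, Fin.sum_univ_two, Fin.sum_univ_two, h0, h1]
    rw [hg, ← ofReal_integral_eq_lintegral_ofReal (hφS.memLp hU).integrable_sq
      (Filter.Eventually.of_forall fun _ => sq_nonneg _), ← ENNReal.ofReal_mul (by positivity)] at hF
    have h3 : ∫ x in U, φ x ^ 2 ≤ 2 * h ^ 2 * sobolevSemi U 1 φ ^ 2 := by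
      have : ENNReal.ofReal (∫ x in U, φ x ^ 2) ≤
          ENNReal.ofReal (2 * h ^ 2 * sobolevSemi U 1 φ ^ 2) := by simpa using hF
      exact (ENNReal.ofReal_le_ofReal_iff (by positivity)).1 this
    rw [← l2norm_sq] at h3
    have e1 : v = (v - φ) + φ := (sub_add_cancel v φ).symm
    have e2 : φ = v - (v - φ) := (sub_sub_cancel v φ).symm
    have h4 := l2norm_add_sq_le ((hv.1.sub hφS).memLp hU) (hφS.memLp hU)
    rw [← e1] at h4
    have h5 := sobolevSemi_sub_sq_le hU hv.1 (hv.1.sub hφS)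
    rw [← e2] at h5
    have h6 := sq_nonneg (l2norm U (v - φ))
    have h7 := sq_nonneg (sobolevSemi U 1 (v - φ))
    have h8 : h ^ 2 * sobolevSemi U 1 φ ^ 2 ≤
        h ^ 2 * (2 * sobolevSemi U 1 v ^ 2 + 2 * ε ^ 2) := by
      gcongr
      linarith
    nlinarith
  refine le_of_forall_pos_le_add fun κ hκ => ?_
  refine (key (√(κ / (2 + 8 * h ^ 2))) (Real.sqrt_pos.2 (by positivity))).trans ?_
  rw [Real.sq_sqrt (by positivity), mul_div_cancel₀ _ (by positivity)]

/-! ### Sums over the elements of a mesh -/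

theorem volume_segment (a b : R2) : volume (segment ℝ a b) = 0 := by
  have hne : affineSpan ℝ {a, b} ≠ (⊤ : AffineSubspace ℝ R2) := by
    intro h
    have h1 := (collinear_iff_finrank_le_one (k := ℝ) (s := {a, b})).1 (collinear_pair ℝ a b)
    rw [← direction_affineSpan, h, AffineSubspace.direction_top, finrank_top,
      finrank_euclideanSpace_fin] at h1
    omega
  refine measure_mono_null ?_ (Measure.addHaar_affineSubspace volume _ hne)
  rw [← convexHull_pair]
  exact convexHull_subset_affineSpan _

theorem Element.volume_frontier (E : Element) : volume (frontier E.carrier) = 0 := by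
  rw [E.frontier_eq, Polygon.boundary]
  refine measure_iUnion_null fun i => ?_
  refine measure_mono_null ?_ (volume_segment (E.poly i) (E.poly (finRotate _ i)))
  rw [segment_eq_image_lineMap]
  rfl

/-- The closures of the elements cover the domain, and the frontiers are finite unions of segments,
which are null sets. -/
theorem Mesh.ae_eq {Ω : Set R2} (T : Mesh Ω) :
    (⋃ i, (T.elem i).carrier : Set R2) =ᵐ[volume] Ω := by
  have hsub : (⋃ i, (T.elem i).carrier : Set R2) ⊆ Ω := iUnion_subset T.subset
  refine Filter.EventuallyLE.antisymm hsub.eventuallyLE ?_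
  have h0 : volume (⋃ i, frontier (T.elem i).carrier) = 0 :=
    measure_iUnion_null fun i => (T.elem i).volume_frontier
  refine ae_le_set.2 (measure_mono_null (fun x hx => ?_) h0)
  have h1 := subset_closure (s := Ω) hx.1
  rw [T.cover] at h1
  obtain ⟨i, hi⟩ := mem_iUnion.1 h1
  refine mem_iUnion.2 ⟨i, hi, fun hint => hx.2 ?_⟩
  exact mem_iUnion.2 ⟨i, interior_subset hint⟩

theorem Mesh.setIntegral_eq {Ω : Set R2} (T : Mesh Ω) {f : R2 → ℝ} (hf : IntegrableOn f Ω) :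
    ∫ x in Ω, f x = ∑ i, ∫ x in (T.elem i).carrier, f x := by
  rw [← setIntegral_congr_set T.ae_eq]
  exact integral_iUnion_fintype (fun i => (T.elem i).isOpen.measurableSet)
    (fun i j h => T.disjoint i j h) fun i => hf.mono_set (T.subset i)

theorem Mesh.sum_l2norm_sq {Ω : Set R2} (T : Mesh Ω) {f : R2 → ℝ}
    (hf : MemLp f 2 (volume.restrict Ω)) :
    ∑ i, l2norm (T.elem i).carrier f ^ 2 = l2norm Ω f ^ 2 := by
  simp only [l2norm_sq]
  exact (T.setIntegral_eq hf.integrable_sq).symm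

theorem Mesh.sum_sobolevSemi_sq {Ω : Set R2} (hΩ : IsOpen Ω) (T : Mesh Ω) {f : R2 → ℝ}
    (hf : MemSobolev Ω 1 2 f) :
    ∑ i, sobolevSemi (T.elem i).carrier 1 f ^ 2 = sobolevSemi Ω 1 f ^ 2 := by
  simp only [sobolevSemi_one_sq]
  rw [Finset.sum_comm]
  refine Finset.sum_congr rfl fun d _ => ?_
  rw [T.setIntegral_eq (hf.memLp_unit hΩ d).integrable_sq]
  refine Finset.sum_congr rfl fun i _ => integral_congr_ae ?_
  filter_upwards [weakDeriv_mono_ae (T.elem i).isOpen (T.subset i)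
    (hf.hasWeakDeriv (unitIdx_order d).le)] with x hx
  rw [hx]

theorem Mesh.sum_h1norm_sq {Ω : Set R2} (hΩ : IsOpen Ω) (T : Mesh Ω) {f : R2 → ℝ}
    (hf : MemSobolev Ω 1 2 f) :
    ∑ i, h1norm (T.elem i).carrier f ^ 2 = h1norm Ω f ^ 2 := by
  simp only [h1norm_sq, Finset.sum_add_distrib]
  rw [T.sum_l2norm_sq (hf.memLp hΩ), T.sum_sobolevSemi_sq hΩ hf]

theorem Mesh.diam_le_size {Ω : Set R2} (T : Mesh Ω) (i : Fin T.card) :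
    (T.elem i).diam ≤ T.size :=
  le_ciSup (f := fun i => (T.elem i).diam) (Set.finite_range _).bddAbove i

theorem Mesh.ShapeRegular.regular {Ω : Set R2} {T : Mesh Ω} {α : ℝ} (h : T.ShapeRegular α)
    (i : Fin T.card) : (T.elem i).Regular α := h i

section

/-! ### Linear structure of the virtual element spaces -/

section local_spaces

variable {E : Element} {k : ℕ} {P : (R2 → ℝ) →ₗ[ℝ] (R2 → ℝ)} {u v p : R2 → ℝ}

theorem IsTestFunction.integrableOn_mul_laplacian {U : Set R2} {φ f : R2 → ℝ}
    (hφ : IsTestFunction U φ) (hf : LocallyIntegrableOn f U) :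
    IntegrableOn (fun x => f x * (IsoVEM.pderiv 0 (IsoVEM.pderiv 0 φ) x +
      IsoVEM.pderiv 1 (IsoVEM.pderiv 1 φ) x)) U := by
  simp only [mul_add]
  exact (((hφ.pderiv 0).pderiv 0).integrableOn_mul hf).add
    (((hφ.pderiv 1).pderiv 1).integrableOn_mul hf)

theorem MemSobolev.locallyIntegrableOn {U : Set R2} (h : MemSobolev U 1 2 u) :
    LocallyIntegrableOn u U := (h.hasWeakDeriv (unitIdx_order 0).le).1

theorem add_mem_enlargedSpace (hu : u ∈ enlargedSpace E k) (hv : v ∈ enlargedSpace E k) :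
    u + v ∈ enlargedSpace E k := by
  obtain ⟨hu1, hu2, ⟨p, hp, hup⟩, hu4⟩ := hu
  obtain ⟨hv1, hv2, ⟨q, hq, hvq⟩, hv4⟩ := hv
  refine ⟨hu1.add hv1, hu2.add hv2, ⟨p + q, add_mem_polySpace hp hq, fun φ hφ => ?_⟩, fun j => ?_⟩
  · have hloc : ∀ {p : R2 → ℝ}, p ∈ polySpace k → IntegrableOn (fun x => p x * φ x) E.carrier :=
      fun {p} hp => hφ.integrableOn_mul
        ((contDiff_of_mem_polySpace hp).continuous.locallyIntegrable.locallyIntegrableOn _)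
    simp only [Pi.add_apply, add_mul]
    rw [integral_add (hφ.integrableOn_mul_laplacian hu1.locallyIntegrableOn)
      (hφ.integrableOn_mul_laplacian hv1.locallyIntegrableOn), hup φ hφ, hvq φ hφ,
      integral_add (hloc hp) (hloc hq)]
  · obtain ⟨r, hr, hur⟩ := hu4 j
    obtain ⟨s, hs, hvs⟩ := hv4 j
    refine ⟨r + s, (Polynomial.natDegree_add_le _ _).trans (max_le hr hs), fun t ht => ?_⟩
    rw [Pi.add_apply, hur t ht, hvs t ht, Polynomial.eval_add]

theorem smul_mem_enlargedSpace (c : ℝ) (hu : u ∈ enlargedSpace E k) :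
    c • u ∈ enlargedSpace E k := by
  obtain ⟨hu1, hu2, ⟨p, hp, hup⟩, hu4⟩ := hu
  refine ⟨hu1.smul c, hu2.const_smul c, ⟨c • p, smul_mem_polySpace c hp, fun φ hφ => ?_⟩,
    fun j => ?_⟩
  · simp only [Pi.smul_apply, smul_eq_mul, mul_assoc, integral_const_mul]
    rw [hup φ hφ]
  · obtain ⟨r, hr, hur⟩ := hu4 j
    refine ⟨Polynomial.C c * r, (Polynomial.natDegree_C_mul_le _ _).trans hr, fun t ht => ?_⟩
    rw [Pi.smul_apply, hur t ht, Polynomial.eval_mul, Polynomial.eval_C, smul_eq_mul]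

/-- Classical integration by parts identifies the distributional Laplacian with the classical one, a
polynomial of no larger degree; on an edge the polynomial is composed with an affine
parametrisation. -/
theorem poly_mem_enlargedSpace (hp : p ∈ polySpace k) : p ∈ enlargedSpace E k := by
  have hsm := contDiff_of_mem_polySpace hp
  refine ⟨E.isCell.memSobolev_poly hp, hsm.continuous.continuousOn,
    ⟨pderiv 0 (pderiv 0 p) + pderiv 1 (pderiv 1 p), ?_, fun φ hφ => ?_⟩, fun j => ?_⟩
  · exact add_mem_polySpace
      (polySpace_mono (by omega) (pderiv_mem_polySpace (pderiv_mem_polySpace hp 0) 0))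
      (polySpace_mono (by omega) (pderiv_mem_polySpace (pderiv_mem_polySpace hp 1) 1))
  · have hloc : ∀ {f : R2 → ℝ}, ContDiff ℝ ∞ f → LocallyIntegrableOn f E.carrier :=
      fun hf => hf.continuous.locallyIntegrable.locallyIntegrableOn _
    have hd := fun d => contDiff_pderiv hsm d
    have h2 : ∀ d, ∫ x in E.carrier, p x * pderiv d (pderiv d φ) x =
        ∫ x in E.carrier, pderiv d (pderiv d p) x * φ x := fun d => by
      rw [integral_mul_pderiv hsm (hφ.pderiv d) d, integral_mul_pderiv (hd d) hφ d, neg_neg]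
    simp only [Pi.add_apply, mul_add, add_mul]
    rw [integral_add (((hφ.pderiv 0).pderiv 0).integrableOn_mul (hloc hsm))
      (((hφ.pderiv 1).pderiv 1).integrableOn_mul (hloc hsm)), h2, h2,
      integral_add (hφ.integrableOn_mul (hloc (contDiff_pderiv (hd 0) 0)))
        (hφ.integrableOn_mul (hloc (contDiff_pderiv (hd 1) 1)))]
  · obtain ⟨q, hq, rfl⟩ := exists_evalPoly hp
    refine ⟨MvPolynomial.aeval (fun d => Polynomial.C (E.poly j d) +
      Polynomial.C ((E.poly (finRotate _ j) - E.poly j) d) * Polynomial.X) q, ?_, fun t _ => ?_⟩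
    · refine (MvPolynomial.aeval_natDegree_le q hq _ (n := 1) fun d => ?_).trans_eq (mul_one k)
      refine (Polynomial.natDegree_add_le _ _).trans (max_le (by simp) ?_)
      exact (Polynomial.natDegree_C_mul_le _ _).trans Polynomial.natDegree_X_le
    · rw [edgePath_eq, evalPoly_apply, MvPolynomial.aeval_def, MvPolynomial.eval₂_eq',
        MvPolynomial.eval_eq', Polynomial.eval_finsetSum]
      refine Finset.sum_congr rfl fun s _ => ?_
      simp [mul_comm]

theorem mem_enlargedSpace_memLp (hv : v ∈ enlargedSpace E k) :
    MemLp v 2 (volume.restrict E.carrier) := hv.1.memLp E.isOpen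

theorem continuous_scaledMonomial (E : Element) (β : ℕ × ℕ) : Continuous (scaledMonomial E β) := by
  unfold scaledMonomial
  fun_prop

theorem integrable_localSpace (hP : IsAuxProj E k P) (hv : v ∈ enlargedSpace E k) (β : ℕ × ℕ) :
    Integrable (fun x => (P v x - v x) * scaledMonomial E β x) (volume.restrict E.carrier) :=
  ((E.isCell.memLp_poly (hP.range v hv)).sub_fun (mem_enlargedSpace_memLp hv)).integrable_mul_fun
    (memLp_of_continuous E.isBounded (continuous_scaledMonomial E β) 2)

theorem add_mem_localSpace (hP : IsAuxProj E k P) (hu : u ∈ localSpace E k P)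
    (hv : v ∈ localSpace E k P) : u + v ∈ localSpace E k P := by
  refine ⟨add_mem_enlargedSpace hu.1 hv.1, fun β h1 h2 => ?_⟩
  have e : ∀ x, (P (u + v) x - (u + v) x) * scaledMonomial E β x =
      (P u x - u x) * scaledMonomial E β x + (P v x - v x) * scaledMonomial E β x := fun x => by
    simp only [map_add, Pi.add_apply]; ring
  simp only [e]
  rw [integral_add (integrable_localSpace hP hu.1 β) (integrable_localSpace hP hv.1 β),
    hu.2 β h1 h2, hv.2 β h1 h2, add_zero]

theorem smul_mem_localSpace (c : ℝ) (hu : u ∈ localSpace E k P) : c • u ∈ localSpace E k P := by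
  refine ⟨smul_mem_enlargedSpace c hu.1, fun β h1 h2 => ?_⟩
  have e : ∀ x, (P (c • u) x - (c • u) x) * scaledMonomial E β x =
      c * ((P u x - u x) * scaledMonomial E β x) := fun x => by
    simp only [map_smul, Pi.smul_apply, smul_eq_mul]; ring
  simp only [e, integral_const_mul]
  rw [hu.2 β h1 h2, mul_zero]

theorem sub_mem_localSpace (hP : IsAuxProj E k P) (hu : u ∈ localSpace E k P)
    (hv : v ∈ localSpace E k P) : u - v ∈ localSpace E k P := by
  have := add_mem_localSpace hP hu (smul_mem_localSpace (-1) hv)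
  simpa [sub_eq_add_neg] using this

theorem poly_mem_localSpace (hP : IsAuxProj E k P) (hp : p ∈ polySpace k) :
    p ∈ localSpace E k P :=
  ⟨poly_mem_enlargedSpace hp, fun β _ _ => by simp [hP.reproduces p hp]⟩

theorem mem_localSpace_memLp (hv : v ∈ localSpace E k P) :
    MemLp v 2 (volume.restrict E.carrier) := mem_enlargedSpace_memLp hv.1

theorem sub_l2proj_mem_localSpace (hP : IsAuxProj E k P) (hv : v ∈ localSpace E k P) :
    v - l2proj E.carrier k v ∈ localSpace E k P :=
  sub_mem_localSpace hP hv
    (poly_mem_localSpace hP (l2proj_mem E.isCell k (mem_localSpace_memLp hv)))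

theorem l2proj_sub_l2proj {E : Set R2} (hE : IsCell E) (k : ℕ)
    (hv : MemLp v 2 (volume.restrict E)) : l2proj E k (v - l2proj E k v) = 0 := by
  have hm := l2proj_mem hE k hv
  rw [l2proj_sub hE k hv (hE.memLp_poly hm), l2proj_of_mem hE hm, sub_self]

end local_spaces

section global_spaces

variable {Ω : Set R2} {T : Mesh Ω} {k : ℕ} {P : Fin T.card → (R2 → ℝ) →ₗ[ℝ] (R2 → ℝ)}
  {u v : R2 → ℝ}

/-- `vemSpaceZero` as a subspace. -/
def vemSub (hΩ : IsPolygonalDomain Ω) (T : Mesh Ω) (k : ℕ)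
    {P : Fin T.card → (R2 → ℝ) →ₗ[ℝ] (R2 → ℝ)} (hP : ∀ i, IsAuxProj (T.elem i) k (P i)) :
    Submodule ℝ (R2 → ℝ) where
  carrier := vemSpaceZero T k P
  add_mem' hu hv := ⟨⟨hu.1.1.add hv.1.1, fun i => add_mem_localSpace (hP i) (hu.1.2 i) (hv.1.2 i)⟩,
    hu.2.add hΩ.isOpen hΩ.isBounded hv.2⟩
  zero_mem' := by
    have h0 : (0 : R2 → ℝ) ∈ polySpace k := const_mem_polySpace k 0
    have hS : MemSobolev Ω 1 2 (0 : R2 → ℝ) :=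
      memSobolev_of_contDiff hΩ.isOpen hΩ.isBounded contDiff_const
    refine ⟨⟨hS, fun i => poly_mem_localSpace (hP i) h0⟩, hS, fun ε hε => ?_⟩
    refine ⟨0, ⟨contDiff_const, HasCompactSupport.zero, by simp⟩, ?_⟩
    have h := h1norm_smul_sq hΩ.isOpen hS 0
    have e : (fun x => (0 : R2 → ℝ) x - (0 : R2 → ℝ) x) = (0 : ℝ) • (0 : R2 → ℝ) := by
      funext x; simp
    rw [e]
    rw [zero_pow two_ne_zero, zero_mul] at h
    rw [pow_eq_zero_iff two_ne_zero |>.1 h]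
    exact hε
  smul_mem' c _ hu := ⟨⟨hu.1.1.smul c, fun i => smul_mem_localSpace c (hu.1.2 i)⟩,
    hu.2.smul hΩ.isOpen hΩ.isBounded c⟩

end global_spaces

end

section

/-! ### Estimates for the discrete form on one element -/

/-- The contribution of one element to the discrete form. -/
def localForm (k l : ℕ) (Fh : R2 → R2) (D : Coeffs) (S : LinearMap.BilinForm ℝ (R2 → ℝ))
    (E : Set R2) (u v : R2 → ℝ) : ℝ :=
  discreteLocal k l Fh D E u v + S (u - l2proj E k u) (v - l2proj E k v)

/-- The hypotheses on one element under which the local estimates hold. -/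
structure LocalData (Ω : Set R2) (F Fh : R2 → R2) (k l : ℕ) (D : Coeffs) (E : Element)
    (P : (R2 → ℝ) →ₗ[ℝ] (R2 → ℝ)) (S : LinearMap.BilinForm ℝ (R2 → ℝ))
    (a₀ a₁ b₁ μ₁ j Λ cS CS K : ℝ) : Prop where
  a₀_pos : 0 < a₀
  j_pos : 0 < j
  cS_pos : 0 < cS
  K_pos : 0 < K
  proj : IsAuxProj E k P
  tame : TameOn E.carrier D (jac Ω F) a₀ a₁ b₁ μ₁ j Λ
  discrete_tame : TameOn E.carrier D (jacProj E.carrier l Fh) a₀ a₁ b₁ μ₁ j Λ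
  stab : IsStabilisation E k P (exactLocal Ω F D E.carrier) cS CS S
  stable : ∀ u ∈ enlargedSpace E k,
    sobolevSemi E.carrier 1 (l2proj E.carrier k u) ^ 2 ≤ K * sobolevSemi E.carrier 1 u ^ 2

variable {Ω : Set R2} {F Fh : R2 → R2} {k l : ℕ} {D : Coeffs} {E : Element}
  {P : (R2 → ℝ) →ₗ[ℝ] (R2 → ℝ)} {S : LinearMap.BilinForm ℝ (R2 → ℝ)}
  {a₀ a₁ b₁ μ₁ j Λ cS CS K : ℝ} {u v w : R2 → ℝ}

theorem pairLp_discrete (hv : v ∈ localSpace E k P) :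
    PairLp E.carrier (l2proj E.carrier k v) (projGrad E.carrier k v) :=
  ⟨E.isCell.memLp_poly (l2proj_mem E.isCell k (mem_localSpace_memLp hv)),
    memLp_projGrad E.isCell k hv.1.1⟩

theorem pairSq_discrete_le (hv : v ∈ localSpace E k P) :
    pairSq E.carrier (l2proj E.carrier k v) (projGrad E.carrier k v) ≤
      h1norm E.carrier v ^ 2 := by
  rw [h1norm_sq, l2norm_sq]
  exact add_le_add (integral_l2proj_sq_le E.isCell k (mem_localSpace_memLp hv))
    (sum_integral_projGrad_sq_le E.isCell k hv.1.1)

theorem sqrt_pairSq_discrete_le (hv : v ∈ localSpace E k P) :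
    √(pairSq E.carrier (l2proj E.carrier k v) (projGrad E.carrier k v)) ≤ h1norm E.carrier v :=
  Real.sqrt_le_iff.2 ⟨h1norm_nonneg _ _, pairSq_discrete_le hv⟩

namespace LocalData

theorem abs_discreteLocal_le
    (h : LocalData Ω F Fh k l D E P S a₀ a₁ b₁ μ₁ j Λ cS CS K)
    (hu : u ∈ localSpace E k P) (hv : v ∈ localSpace E k P) :
    |discreteLocal k l Fh D E.carrier u v| ≤
      3 * formBound a₁ b₁ μ₁ j Λ * (h1norm E.carrier u * h1norm E.carrier v) := by
  refine (h.discrete_tame.abs_form_le h.a₀_pos h.j_pos (pairLp_discrete hu)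
    (pairLp_discrete hv)).trans ?_
  have := formBound_nonneg a₁ b₁ μ₁ j Λ
  exact mul_le_mul_of_nonneg_left (mul_le_mul (sqrt_pairSq_discrete_le hu)
    (sqrt_pairSq_discrete_le hv) (Real.sqrt_nonneg _) (h1norm_nonneg _ _)) (by positivity)

theorem exactLocal_le
    (h : LocalData Ω F Fh k l D E P S a₀ a₁ b₁ μ₁ j Λ cS CS K)
    (hv : MemSobolev E.carrier 1 2 v) :
    |exactLocal Ω F D E.carrier v v| ≤ 3 * formBound a₁ b₁ μ₁ j Λ * h1norm E.carrier v ^ 2 := by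
  have hp := hv.pairLp E.isOpen
  refine (h.tame.abs_form_le h.a₀_pos h.j_pos hp hp).trans_eq ?_
  rw [← h1norm_eq_sqrt, sq]

theorem le_exactLocal
    (h : LocalData Ω F Fh k l D E P S a₀ a₁ b₁ μ₁ j Λ cS CS K)
    (hv : MemSobolev E.carrier 1 2 v) :
    a₀ * j / (4 * Λ ^ 2 + 1) * sobolevSemi E.carrier 1 v ^ 2 ≤ exactLocal Ω F D E.carrier v v := by
  have h1 := h.tame.le_form h.a₀_pos h.j_pos (hv.pairLp E.isOpen)
  simp only [weakGrad_apply] at h1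
  rw [sobolevSemi_one_sq]
  exact h1

theorem le_stab
    (h : LocalData Ω F Fh k l D E P S a₀ a₁ b₁ μ₁ j Λ cS CS K)
    (hv : v ∈ localSpace E k P) (h0 : l2proj E.carrier k v = 0) :
    cS * (a₀ * j / (4 * Λ ^ 2 + 1)) * sobolevSemi E.carrier 1 v ^ 2 ≤ S v v := by
  refine le_trans ?_ (h.stab.lower v hv h0)
  rw [mul_assoc]
  exact mul_le_mul_of_nonneg_left (h.le_exactLocal hv.1.1) h.cS_pos.le

theorem stab_nonneg
    (h : LocalData Ω F Fh k l D E P S a₀ a₁ b₁ μ₁ j Λ cS CS K)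
    (hv : v ∈ localSpace E k P) (h0 : l2proj E.carrier k v = 0) : 0 ≤ S v v := by
  have := h.a₀_pos
  have := h.j_pos
  have := h.cS_pos
  exact le_trans (by positivity) (h.le_stab hv h0)

theorem mem_sub
    (h : LocalData Ω F Fh k l D E P S a₀ a₁ b₁ μ₁ j Λ cS CS K)
    (hv : v ∈ localSpace E k P) : v - l2proj E.carrier k v ∈ localSpace E k P :=
  sub_l2proj_mem_localSpace h.proj hv

theorem l2proj_sub_eq (hv : v ∈ localSpace E k P) :
    l2proj E.carrier k (v - l2proj E.carrier k v) = 0 :=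
  l2proj_sub_l2proj E.isCell k (mem_localSpace_memLp hv)

/-- The `L²` part is best approximation compared with zero; the semi-norm uses the stability of the
projection. -/
theorem h1norm_sub_sq_le
    (h : LocalData Ω F Fh k l D E P S a₀ a₁ b₁ μ₁ j Λ cS CS K)
    (hv : v ∈ localSpace E k P) :
    h1norm E.carrier (v - l2proj E.carrier k v) ^ 2 ≤ (2 + 2 * K) * h1norm E.carrier v ^ 2 := by
  have hv2 := mem_localSpace_memLp hv
  have hm := l2proj_mem E.isCell k hv2
  have h1 := sobolevSemi_sub_sq_le E.isOpen hv.1.1 (E.isCell.memSobolev_poly hm)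
  have h2 := h.stable v hv.1
  have h3 : l2norm E.carrier (v - l2proj E.carrier k v) ^ 2 ≤ l2norm E.carrier v ^ 2 := by
    have := integral_sub_l2proj_sq_le E.isCell hv2 (const_mem_polySpace k 0)
    simp only [sub_zero] at this
    simpa only [l2norm_sq, Pi.sub_apply] using this
  rw [h1norm_sq, h1norm_sq]
  have h4 := h.K_pos
  nlinarith [sq_nonneg (l2norm E.carrier v), mul_nonneg h4.le (sq_nonneg (l2norm E.carrier v))]

theorem stab_le
    (h : LocalData Ω F Fh k l D E P S a₀ a₁ b₁ μ₁ j Λ cS CS K)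
    (hv : v ∈ localSpace E k P) :
    S (v - l2proj E.carrier k v) (v - l2proj E.carrier k v) ≤
      |CS| * (3 * formBound a₁ b₁ μ₁ j Λ * (2 + 2 * K)) * h1norm E.carrier v ^ 2 := by
  have hm := h.mem_sub hv
  have := formBound_nonneg a₁ b₁ μ₁ j Λ
  calc S (v - l2proj E.carrier k v) (v - l2proj E.carrier k v)
      ≤ CS * exactLocal Ω F D E.carrier _ _ := h.stab.upper _ hm (l2proj_sub_eq hv)
    _ ≤ |CS| * |exactLocal Ω F D E.carrier (v - l2proj E.carrier k v) (v - l2proj E.carrier k v)| :=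
        by rw [← abs_mul]; exact le_abs_self _
    _ ≤ |CS| * (3 * formBound a₁ b₁ μ₁ j Λ * h1norm E.carrier (v - l2proj E.carrier k v) ^ 2) := by
        gcongr
        exact h.exactLocal_le hm.1.1
    _ ≤ |CS| * (3 * formBound a₁ b₁ μ₁ j Λ * ((2 + 2 * K) * h1norm E.carrier v ^ 2)) := by
        gcongr
        exact h.h1norm_sub_sq_le hv
    _ = _ := by ring

/-- Cauchy-Schwarz for `S`, from the discriminant of `t ↦ S (u' + t v') (u' + t v')`. The sum `u' +
t v'` still has zero projection, so it is in the range where `S` is known to be nonnegative;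
symmetry merges the two mixed terms. -/
theorem abs_stab_le
    (h : LocalData Ω F Fh k l D E P S a₀ a₁ b₁ μ₁ j Λ cS CS K)
    (hsymm : ∀ u ∈ localSpace E k P, ∀ v ∈ localSpace E k P, S u v = S v u)
    (hu : u ∈ localSpace E k P) (hv : v ∈ localSpace E k P) :
    |S (u - l2proj E.carrier k u) (v - l2proj E.carrier k v)| ≤
      |CS| * (3 * formBound a₁ b₁ μ₁ j Λ * (2 + 2 * K)) *
        (h1norm E.carrier u * h1norm E.carrier v) := by
  set C := |CS| * (3 * formBound a₁ b₁ μ₁ j Λ * (2 + 2 * K)) with hC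
  have hC0 : 0 ≤ C := by
    have := formBound_nonneg a₁ b₁ μ₁ j Λ
    have := h.K_pos
    positivity
  set u' := u - l2proj E.carrier k u
  set v' := v - l2proj E.carrier k v
  have hu' := h.mem_sub hu
  have hv' := h.mem_sub hv
  have hq : ∀ t : ℝ, 0 ≤ S v' v' * (t * t) + 2 * S u' v' * t + S u' u' := by
    intro t
    have hmem : u' + t • v' ∈ localSpace E k P :=
      add_mem_localSpace h.proj hu' (smul_mem_localSpace t hv')
    have h0 : l2proj E.carrier k (u' + t • v') = 0 := by
      rw [l2proj_add E.isCell k (mem_localSpace_memLp hu')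
        ((mem_localSpace_memLp hv').const_smul t), l2proj_smul E.isCell k
        (mem_localSpace_memLp hv'), l2proj_sub_eq hu, l2proj_sub_eq hv]
      simp
    have h1 := h.stab_nonneg hmem h0
    simp only [map_add, map_smul, LinearMap.add_apply, LinearMap.smul_apply, smul_eq_mul] at h1
    rw [hsymm v' hv' u' hu'] at h1
    linarith
  have hdisc := discrim_le_zero hq
  rw [discrim] at hdisc
  have h1 := h.stab_le hu
  have h2 := h.stab_le hv
  have h3 := h.stab_nonneg hu' (l2proj_sub_eq hu)
  have h4 : S u' v' ^ 2 ≤ (C * (h1norm E.carrier u * h1norm E.carrier v)) ^ 2 := by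
    calc S u' v' ^ 2 ≤ S u' u' * S v' v' := by nlinarith
      _ ≤ (C * h1norm E.carrier u ^ 2) * (C * h1norm E.carrier v ^ 2) :=
          mul_le_mul h1 h2 (h.stab_nonneg hv' (l2proj_sub_eq hv)) (by positivity)
      _ = _ := by ring
  have := h1norm_nonneg E.carrier u
  have := h1norm_nonneg E.carrier v
  exact abs_le_of_sq_le_sq h4 (by positivity)

theorem abs_localForm_le
    (h : LocalData Ω F Fh k l D E P S a₀ a₁ b₁ μ₁ j Λ cS CS K)
    (hsymm : ∀ u ∈ localSpace E k P, ∀ v ∈ localSpace E k P, S u v = S v u)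
    (hu : u ∈ localSpace E k P) (hv : v ∈ localSpace E k P) :
    |localForm k l Fh D S E.carrier u v| ≤
      3 * formBound a₁ b₁ μ₁ j Λ * (1 + |CS| * (2 + 2 * K)) *
        (h1norm E.carrier u * h1norm E.carrier v) := by
  refine (abs_add_le _ _).trans ((add_le_add (h.abs_discreteLocal_le hu hv)
    (h.abs_stab_le hsymm hu hv)).trans_eq ?_)
  ring

theorem localForm_self_le
    (h : LocalData Ω F Fh k l D E P S a₀ a₁ b₁ μ₁ j Λ cS CS K)
    (hv : v ∈ localSpace E k P) :
    localForm k l Fh D S E.carrier v v ≤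
      3 * formBound a₁ b₁ μ₁ j Λ * (1 + |CS| * (2 + 2 * K)) * h1norm E.carrier v ^ 2 := by
  refine (add_le_add ((le_abs_self _).trans (h.abs_discreteLocal_le hv hv))
    (h.stab_le hv)).trans_eq ?_
  ring

/-- The projected part of the form controls the projected gradient, the stabilisation controls the
semi-norm of `v - Πv`, and `sobolevSemi_sq_le_projGrad` combines the two. -/
theorem le_localForm
    (h : LocalData Ω F Fh k l D E P S a₀ a₁ b₁ μ₁ j Λ cS CS K)
    (hv : v ∈ localSpace E k P) :
    min 1 cS * (a₀ * j / (4 * Λ ^ 2 + 1)) * sobolevSemi E.carrier 1 v ^ 2 ≤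
      localForm k l Fh D S E.carrier v v := by
  have h1 := h.discrete_tame.le_form h.a₀_pos h.j_pos (pairLp_discrete hv)
  have h2 := h.le_stab (h.mem_sub hv) (l2proj_sub_eq hv)
  have h3 := sobolevSemi_sq_le_projGrad E.isCell k hv.1.1
  have hc : 0 ≤ a₀ * j / (4 * Λ ^ 2 + 1) := by
    have := h.a₀_pos
    have := h.j_pos
    positivity
  set c := a₀ * j / (4 * Λ ^ 2 + 1)
  have h4 : 0 ≤ ∑ d, ∫ x in E.carrier, projGrad E.carrier k v x d ^ 2 :=
    Finset.sum_nonneg fun d _ => setIntegral_sq_nonneg _ fun x => projGrad E.carrier k v x d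
  have h5 := sq_nonneg (sobolevSemi E.carrier 1 (v - l2proj E.carrier k v))
  have hm0 : 0 ≤ min 1 cS := le_min zero_le_one h.cS_pos.le
  calc min 1 cS * c * sobolevSemi E.carrier 1 v ^ 2
      ≤ min 1 cS * c * ((∑ d, ∫ x in E.carrier, projGrad E.carrier k v x d ^ 2) +
        sobolevSemi E.carrier 1 (v - l2proj E.carrier k v) ^ 2) := by gcongr
    _ = min 1 cS * (c * ∑ d, ∫ x in E.carrier, projGrad E.carrier k v x d ^ 2) +
        min 1 cS * c * sobolevSemi E.carrier 1 (v - l2proj E.carrier k v) ^ 2 := by ring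
    _ ≤ 1 * (c * ∑ d, ∫ x in E.carrier, projGrad E.carrier k v x d ^ 2) +
        cS * c * sobolevSemi E.carrier 1 (v - l2proj E.carrier k v) ^ 2 := by
        gcongr
        · exact min_le_left _ _
        · exact min_le_right _ _
    _ ≤ _ := by
        rw [one_mul]
        exact add_le_add h1 h2

theorem localForm_add_left
    (h : LocalData Ω F Fh k l D E P S a₀ a₁ b₁ μ₁ j Λ cS CS K)
    (hu : u ∈ localSpace E k P) (hw : w ∈ localSpace E k P)
    (hv : v ∈ localSpace E k P) : localForm k l Fh D S E.carrier (u + w) v =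
      localForm k l Fh D S E.carrier u v + localForm k l Fh D S E.carrier w v := by
  simp only [localForm, discreteLocal]
  rw [l2proj_add E.isCell k (mem_localSpace_memLp hu) (mem_localSpace_memLp hw),
    projGrad_add E.isCell k hu.1.1 hw.1.1, h.discrete_tame.form_add_left h.a₀_pos h.j_pos
    (pairLp_discrete hu) (pairLp_discrete hw) (pairLp_discrete hv), add_sub_add_comm, map_add,
    LinearMap.add_apply]
  ring

theorem localForm_add_right
    (h : LocalData Ω F Fh k l D E P S a₀ a₁ b₁ μ₁ j Λ cS CS K)
    (hu : u ∈ localSpace E k P) (hw : w ∈ localSpace E k P)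
    (hv : v ∈ localSpace E k P) : localForm k l Fh D S E.carrier v (u + w) =
      localForm k l Fh D S E.carrier v u + localForm k l Fh D S E.carrier v w := by
  simp only [localForm, discreteLocal]
  rw [l2proj_add E.isCell k (mem_localSpace_memLp hu) (mem_localSpace_memLp hw),
    projGrad_add E.isCell k hu.1.1 hw.1.1, h.discrete_tame.form_add_right h.a₀_pos h.j_pos
    (pairLp_discrete hu) (pairLp_discrete hw) (pairLp_discrete hv), add_sub_add_comm, map_add]
  ring

theorem localForm_smul_left (c : ℝ) (hu : u ∈ localSpace E k P) :
    localForm k l Fh D S E.carrier (c • u) v = c * localForm k l Fh D S E.carrier u v := by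
  simp only [localForm, discreteLocal]
  rw [l2proj_smul E.isCell k (mem_localSpace_memLp hu), projGrad_smul E.isCell k hu.1.1,
    form_smul_left, ← smul_sub, map_smul, LinearMap.smul_apply, smul_eq_mul]
  ring

theorem localForm_smul_right (c : ℝ) (hu : u ∈ localSpace E k P) :
    localForm k l Fh D S E.carrier v (c • u) = c * localForm k l Fh D S E.carrier v u := by
  simp only [localForm, discreteLocal]
  rw [l2proj_smul E.isCell k (mem_localSpace_memLp hu), projGrad_smul E.isCell k hu.1.1,
    form_smul_right, ← smul_sub, map_smul, smul_eq_mul]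
  ring

/-! ### The load on one element -/

theorem integrable_load (h : LocalData Ω F Fh k l D E P S a₀ a₁ b₁ μ₁ j Λ cS CS K)
    {f : R2 → ℝ} (hf : MemLp f 2 (volume.restrict E.carrier)) (hv : v ∈ localSpace E k P) :
    Integrable (fun x => f x * l2proj E.carrier k v x * (jacProj E.carrier l Fh x).det)
      (volume.restrict E.carrier) ∧
    |∫ x in E.carrier, f x * l2proj E.carrier k v x * (jacProj E.carrier l Fh x).det| ≤
      2 * Λ ^ 2 * (l2norm E.carrier f * h1norm E.carrier v) := by
  have hp := (pairLp_discrete hv).fst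
  have hi := hf.abs.integrable_mul_fun hp.abs
  have hbd : ∀ᵐ x ∂volume.restrict E.carrier,
      ‖f x * l2proj E.carrier k v x * (jacProj E.carrier l Fh x).det‖ ≤
        2 * Λ ^ 2 * (|f x| * |l2proj E.carrier k v x|) := by
    filter_upwards [h.discrete_tame.tameAt] with x hx
    rw [norm_mul, norm_mul, Real.norm_eq_abs, Real.norm_eq_abs,
      Real.norm_of_nonneg (h.j_pos.le.trans hx.le_det), mul_comm (2 * Λ ^ 2)]
    exact mul_le_mul_of_nonneg_left hx.det_le (by positivity)
  refine ⟨(hi.const_mul _).mono' ((hf.aemeasurable.mul hp.aemeasurable).mul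
    h.discrete_tame.aemeasurable_det).aestronglyMeasurable hbd, ?_⟩
  refine (norm_integral_le_of_norm_le (hi.const_mul _) hbd).trans ?_
  rw [integral_const_mul]
  refine mul_le_mul_of_nonneg_left ?_ (by positivity)
  refine (integral_mul_le_sqrt hf.abs hp.abs).trans ?_
  simp only [Pi.abs_apply, sq_abs]
  refine mul_le_mul_of_nonneg_left ?_ (Real.sqrt_nonneg _)
  refine Real.sqrt_le_iff.2 ⟨h1norm_nonneg _ _, le_trans ?_ (pairSq_discrete_le hv)⟩
  exact le_add_of_nonneg_right (Finset.sum_nonneg fun d _ =>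
    setIntegral_sq_nonneg _ fun x => projGrad E.carrier k v x d)

end LocalData

end

section

/-! ### Positive definite forms modulo a kernel of finite codimension -/

section quotient

variable {V : Type*} [AddCommGroup V] [Module ℝ V]

/-- The form induced on the quotient by a subspace contained in both kernels. -/
def quotForm (B : LinearMap.BilinForm ℝ V) (N : Submodule ℝ V)
    (hN : ∀ v ∈ N, ∀ u, B u v = 0 ∧ B v u = 0) : LinearMap.BilinForm ℝ (V ⧸ N) :=
  N.liftQ (N.liftQ B.flip fun v hv => LinearMap.ext fun u => (hN v hv u).1).flip fun v hv =>
    LinearMap.ext fun x => by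
      obtain ⟨u, rfl⟩ := N.mkQ_surjective x
      exact (hN v hv u).2

variable {B : LinearMap.BilinForm ℝ V} {N : Submodule ℝ V}

theorem quotForm_mkQ (hN : ∀ v ∈ N, ∀ u, B u v = 0 ∧ B v u = 0) (u v : V) :
    quotForm B N hN (N.mkQ u) (N.mkQ v) = B u v := rfl

theorem quotForm_pos (hN : ∀ v ∈ N, ∀ u, B u v = 0 ∧ B v u = 0) (hB : ∀ v, v ∉ N → 0 < B v v)
    (x : V ⧸ N) (hx : x ≠ 0) : 0 < quotForm B N hN x x := by
  obtain ⟨v, rfl⟩ := N.mkQ_surjective x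
  rw [quotForm_mkQ]
  exact hB v fun h => hx (by simpa using h)

/-- Coordinates in a basis of the quotient are bounded by the square root of the diagonal, and the
form is a finite combination of products of coordinates. This replaces Cauchy-Schwarz for
nonsymmetric forms; the price is a constant depending on `B`. -/
theorem exists_bound_of_posDef [Module.Finite ℝ (V ⧸ N)]
    (hN : ∀ v ∈ N, ∀ u, B u v = 0 ∧ B v u = 0) (hB : ∀ v, v ∉ N → 0 < B v v) :
    ∃ C, 0 ≤ C ∧ ∀ u v, |B u v| ≤ C * (√(B u u) * √(B v v)) := by
  set b := Module.finBasis ℝ (V ⧸ N)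
  set Q := quotForm B N hN
  obtain ⟨C, hC, hcoord⟩ := exists_coord_sq_le b Q (quotForm_pos hN hB)
  refine ⟨∑ i, ∑ j, C * |Q (b i) (b j)|, by positivity, fun u v => ?_⟩
  have hco : ∀ w i, |b.repr (N.mkQ w) i| ≤ √C * √(B w w) := fun w i => by
    rw [← Real.sqrt_mul hC.le]
    exact Real.abs_le_sqrt (hcoord (N.mkQ w) i)
  have e : B u v = ∑ i, ∑ j, b.repr (N.mkQ u) i * (b.repr (N.mkQ v) j * Q (b i) (b j)) := by
    rw [← quotForm_mkQ hN u v]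
    conv_lhs => rw [← b.sum_repr (N.mkQ u), ← b.sum_repr (N.mkQ v)]
    simp only [map_sum, map_smul, LinearMap.sum_apply, LinearMap.smul_apply, smul_eq_mul,
      Finset.mul_sum]
    rw [Finset.sum_comm]
    exact Finset.sum_congr rfl fun i _ => Finset.sum_congr rfl fun j _ => mul_left_comm _ _ _
  rw [e, Finset.sum_mul]
  refine (Finset.abs_sum_le_sum_abs _ _).trans (Finset.sum_le_sum fun i _ => ?_)
  rw [Finset.sum_mul]
  refine (Finset.abs_sum_le_sum_abs _ _).trans (Finset.sum_le_sum fun j _ => ?_)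
  rw [abs_mul, abs_mul]
  calc |b.repr (N.mkQ u) i| * (|b.repr (N.mkQ v) j| * |Q (b i) (b j)|)
      ≤ (√C * √(B u u)) * ((√C * √(B v v)) * |Q (b i) (b j)|) := by
        gcongr
        exacts [hco u i, hco v j]
    _ = (√C * √C) * |Q (b i) (b j)| * (√(B u u) * √(B v v)) := by ring
    _ = _ := by rw [Real.mul_self_sqrt hC.le]

/-- A positive definite form on a finite-dimensional space maps injectively to the dual, hence onto
it; `f` descends to the quotient because it vanishes on `N`. -/
theorem exists_solution_of_posDef [Module.Finite ℝ (V ⧸ N)]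
    (hN : ∀ v ∈ N, ∀ u, B u v = 0 ∧ B v u = 0) (hB : ∀ v, v ∉ N → 0 < B v v) (f : V →ₗ[ℝ] ℝ)
    (hf : ∀ v ∈ N, f v = 0) : ∃ u, ∀ v, B u v = f v := by
  have hinj : Function.Injective (quotForm B N hN) := by
    rw [← LinearMap.ker_eq_bot, LinearMap.ker_eq_bot']
    intro x hx
    by_contra hne
    have := quotForm_pos hN hB x hne
    rw [hx] at this
    simp at this
  have hsurj : Function.Surjective (quotForm B N hN) :=
    (LinearMap.injective_iff_surjective_of_finrank_eq_finrank
      (Subspace.dual_finrank_eq (K := ℝ) (V := V ⧸ N)).symm).1 hinj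
  obtain ⟨x, hx⟩ := hsurj (N.liftQ f fun v hv => hf v hv)
  obtain ⟨u, rfl⟩ := N.mkQ_surjective x
  exact ⟨u, fun v => LinearMap.congr_fun hx (N.mkQ v)⟩

theorem finite_quotient_of_ker_le {W : Type*} [AddCommGroup W] [Module ℝ W] [Module.Finite ℝ W]
    (Φ : V →ₗ[ℝ] W) (h : LinearMap.ker Φ ≤ N) : Module.Finite ℝ (V ⧸ N) := by
  have : Module.Finite ℝ (V ⧸ LinearMap.ker Φ) :=
    Module.Finite.equiv Φ.quotKerEquivRange.symm
  exact Module.Finite.of_surjective (Submodule.factor h) (Submodule.factor_surjective h)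

end quotient

/-! ### Finite dimension of the virtual element space -/

section finite

/-- Restrictions to `[0, 1]` of real polynomials of degree at most `k`. -/
def edgeSub (k : ℕ) : Submodule ℝ (Icc (0 : ℝ) 1 → ℝ) :=
  (Polynomial.degreeLE ℝ k).map
    ({ toFun := fun q t => q.eval t.1
       map_add' := fun p q => by funext t; simp
       map_smul' := fun c q => by funext t; simp } :
      Polynomial ℝ →ₗ[ℝ] (Icc (0 : ℝ) 1 → ℝ))

instance (k : ℕ) : Module.Finite ℝ (edgeSub k) := by
  unfold edgeSub
  have : Module.Finite ℝ (Polynomial.degreeLE ℝ k) := by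
    rw [Polynomial.degreeLE_eq_span_X_pow]
    exact Module.Finite.span_finset ℝ _
  infer_instance

/-- The test functions on `U`. -/
def TestFun (U : Set R2) : Type := {φ : R2 → ℝ // IsTestFunction U φ}

/-- The functionals on test functions represented by polynomials of degree at most `k`. -/
def momentSub (E : Element) (k : ℕ) : Submodule ℝ (TestFun E.carrier → ℝ) :=
  LinearMap.range
    ({ toFun := fun p φ => ∫ x in E.carrier, p.1 x * φ.1 x
       map_add' := fun p q => by
        funext φ
        have hi : ∀ p : polySub k, IntegrableOn (fun x => p.1 x * φ.1 x) E.carrier := fun p =>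
          φ.2.integrableOn_mul ((contDiff_of_mem_polySpace
            (mem_polySub.1 p.2)).continuous.locallyIntegrable.locallyIntegrableOn _)
        simp only [Submodule.coe_add, Pi.add_apply, add_mul]
        exact integral_add (hi p) (hi q)
       map_smul' := fun c p => by
        funext φ
        simp only [Submodule.coe_smul, Pi.smul_apply, smul_eq_mul, mul_assoc, RingHom.id_apply]
        exact integral_const_mul _ _ } : polySub k →ₗ[ℝ] (TestFun E.carrier → ℝ))

instance (E : Element) (k : ℕ) : Module.Finite ℝ (momentSub E k) := by
  unfold momentSub
  infer_instance

variable {Ω : Set R2} {T : Mesh Ω} {k : ℕ} {P : Fin T.card → (R2 → ℝ) →ₗ[ℝ] (R2 → ℝ)}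

/-- The traces on the edges. -/
def edgeTrace (hΩ : IsPolygonalDomain Ω) (hP : ∀ i, IsAuxProj (T.elem i) k (P i))
    (i : Fin T.card) (j : Fin ((T.elem i).n + 3)) : vemSub hΩ T k hP →ₗ[ℝ] edgeSub k where
  toFun v := ⟨fun t => v.1 ((T.elem i).poly.edgePath ℝ j t.1), by
    obtain ⟨q, hq, h⟩ := (v.2.1.2 i).1.2.2.2 j
    exact Submodule.mem_map.2 ⟨q, Polynomial.mem_degreeLE.2
      (Polynomial.degree_le_of_natDegree_le hq), funext fun t => (h t.1 t.2).symm⟩⟩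
  map_add' u v := rfl
  map_smul' c u := rfl

/-- The distributional Laplacians on the elements. -/
def elementLaplacian (hΩ : IsPolygonalDomain Ω) (hP : ∀ i, IsAuxProj (T.elem i) k (P i))
    (i : Fin T.card) : vemSub hΩ T k hP →ₗ[ℝ] momentSub (T.elem i) k where
  toFun v := ⟨fun φ => ∫ x in (T.elem i).carrier,
      v.1 x * (pderiv 0 (pderiv 0 φ.1) x + pderiv 1 (pderiv 1 φ.1) x), by
    obtain ⟨p, hp, h⟩ := (v.2.1.2 i).1.2.2.1
    exact ⟨⟨p, mem_polySub.2 hp⟩, funext fun φ => (h φ.1 φ.2).symm⟩⟩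
  map_add' u v := Subtype.ext <| funext fun φ => by
    simp only [Submodule.coe_add, Pi.add_apply, add_mul]
    exact integral_add (φ.2.integrableOn_mul_laplacian (u.2.1.2 i).1.1.locallyIntegrableOn)
      (φ.2.integrableOn_mul_laplacian (v.2.1.2 i).1.1.locallyIntegrableOn)
  map_smul' c u := Subtype.ext <| funext fun φ => by
    simp only [Submodule.coe_smul, Pi.smul_apply, smul_eq_mul, mul_assoc, RingHom.id_apply]
    exact integral_const_mul _ _

/-- The functions of `vemSub` that vanish on the closure of the domain. -/
def nullSub (hΩ : IsPolygonalDomain Ω) (hP : ∀ i, IsAuxProj (T.elem i) k (P i)) :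
    Submodule ℝ (vemSub hΩ T k hP) where
  carrier := {v | EqOn v.1 0 (closure Ω)}
  add_mem' hu hv x hx := by simp [hu hx, hv hx]
  zero_mem' x _ := rfl
  smul_mem' c u hu x hx := by simp [hu hx]

theorem mem_nullSub {hΩ : IsPolygonalDomain Ω} {hP : ∀ i, IsAuxProj (T.elem i) k (P i)}
    {v : vemSub hΩ T k hP} : v ∈ nullSub hΩ hP ↔ EqOn v.1 0 (closure Ω) := Iff.rfl

theorem mem_nullSub_of_ae (hΩ : IsPolygonalDomain Ω) (hP : ∀ i, IsAuxProj (T.elem i) k (P i))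
    {v : vemSub hΩ T k hP} (h : ∀ i, ∀ x ∈ (T.elem i).carrier, v.1 x = 0) :
    v ∈ nullSub hΩ hP := by
  intro x hx
  rw [T.cover] at hx
  obtain ⟨i, hi⟩ := mem_iUnion.1 hx
  exact EqOn.of_subset_closure (fun y hy => h i y hy) (v.2.1.2 i).1.2.1 continuousOn_const
    subset_closure le_rfl hi

/-- Edge traces and element Laplacians take values in finite-dimensional spaces. If they all vanish,
then on each element the function is weakly harmonic, continuous up to the boundary and zero there,
hence zero. -/
instance finite_quotient (hΩ : IsPolygonalDomain Ω) (hP : ∀ i, IsAuxProj (T.elem i) k (P i)) :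
    Module.Finite ℝ (vemSub hΩ T k hP ⧸ nullSub hΩ hP) := by
  refine finite_quotient_of_ker_le (LinearMap.pi fun i =>
    (LinearMap.pi (edgeTrace hΩ hP i)).prod (elementLaplacian hΩ hP i)) fun v hv => ?_
  refine mem_nullSub_of_ae hΩ hP fun i => ?_
  have hi := congrFun (LinearMap.mem_ker.1 hv) i
  have h1 : ∀ j, edgeTrace hΩ hP i j v = 0 := fun j => congrFun (congrArg Prod.fst hi) j
  have h2 : elementLaplacian hΩ hP i v = 0 := congrArg Prod.snd hi
  refine eq_zero_of_weaklyHarmonic (T.elem i).isOpen (T.elem i).isBounded (v.2.1.2 i).1.2.1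
    (fun x hx => ?_) fun φ hφ => ?_
  · obtain ⟨j, t, ht, rfl⟩ := (T.elem i).exists_edgePath hx
    exact congrFun (congrArg Subtype.val (h1 j)) ⟨t, ht⟩
  · exact congrFun (congrArg Subtype.val h2) ⟨φ, hφ⟩

end finite

end

section

/-! ### Global estimates -/

theorem Element.edgePath_zero (E : Element) (i : Fin (E.n + 3)) :
    E.poly.edgePath ℝ i (0 : ℝ) = E.poly i := by
  simp [Polygon.edgePath]

theorem dofsVanish_of_eqOn {E : Element} (k : ℕ) {v : R2 → ℝ}
    (h : EqOn v 0 (closure E.carrier)) : DofsVanish E k v := by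
  have hp : ∀ j, ∀ t ∈ Icc (0 : ℝ) 1, v (E.poly.edgePath ℝ j t) = 0 := fun j t ht =>
    h (frontier_subset_closure (E.edgePath_mem_frontier j ht))
  refine ⟨fun j => ?_, fun j q _ => ?_, fun q _ => ?_⟩
  · rw [← E.edgePath_zero j]
    exact hp j 0 ⟨le_rfl, zero_le_one⟩
  · rw [intervalIntegral.integral_congr (g := fun _ => 0), intervalIntegral.integral_zero]
    intro t ht
    rw [uIcc_of_le zero_le_one] at ht
    simp [hp j t ht]
  · rw [setIntegral_congr_fun (g := fun _ => 0) E.isOpen.measurableSet, integral_zero]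
    intro x hx
    simp [h (subset_closure hx)]

theorem weakDeriv_ae_zero {U : Set R2} (hU : IsOpen U) {v : R2 → ℝ}
    (hl : LocallyIntegrableOn v U) (h : EqOn v 0 U) (α : ℕ × ℕ) :
    weakDeriv U α v =ᵐ[volume.restrict U] 0 := by
  have h0 : LocallyIntegrableOn (0 : R2 → ℝ) U :=
    (continuous_const (y := (0 : ℝ))).locallyIntegrable.locallyIntegrableOn U
  have hw : HasWeakDeriv U α v 0 := ⟨hl, h0, fun φ _ => by
    rw [setIntegral_congr_fun (g := fun _ => 0) hU.measurableSet fun x hx => by simp [h hx]]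
    simp⟩
  exact hw.weakDeriv_ae hU

theorem h1norm_eq_zero_of_eqOn {U : Set R2} (hU : IsOpen U) {v : R2 → ℝ}
    (hl : LocallyIntegrableOn v U) (h : EqOn v 0 U) : h1norm U v = 0 := by
  have h1 : ∫ x in U, v x ^ 2 = 0 := by
    rw [setIntegral_congr_fun (g := fun _ => 0) hU.measurableSet fun x hx => by simp [h hx]]
    simp
  have h2 : ∀ d, ∫ x in U, weakDeriv U (unitIdx d) v x ^ 2 = 0 := fun d => by
    rw [integral_congr_ae (g := fun _ => 0) ((weakDeriv_ae_zero hU hl h (unitIdx d)).mono fun x hx => by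
      simp [hx])]
    simp
  have : h1norm U v ^ 2 = 0 := by
    rw [h1norm_sq, l2norm_sq, sobolevSemi_one_sq, h1]
    simp [h2]
  exact pow_eq_zero_iff two_ne_zero |>.1 this

theorem MemSobolev.ae_eq_zero {U : Set R2} (hU : IsOpen U) {v : R2 → ℝ}
    (hv : MemSobolev U 1 2 v) (h : h1norm U v = 0) : v =ᵐ[volume.restrict U] 0 := by
  have h1 : h1norm U v ^ 2 = 0 := by rw [h, zero_pow two_ne_zero]
  rw [h1norm_sq, l2norm_sq] at h1
  have h2 : ∫ x in U, v x ^ 2 = 0 :=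
    le_antisymm (by nlinarith [sq_nonneg (sobolevSemi U 1 v)]) (setIntegral_sq_nonneg U v)
  rw [integral_eq_zero_iff_of_nonneg (fun x => sq_nonneg _) (hv.memLp hU).integrable_sq] at h2
  exact h2.mono fun x hx => by simpa using hx

namespace LocalData

variable {Ω : Set R2} {F Fh : R2 → R2} {k l : ℕ} {D : Coeffs} {E : Element}
  {P : (R2 → ℝ) →ₗ[ℝ] (R2 → ℝ)} {S : LinearMap.BilinForm ℝ (R2 → ℝ)}
  {a₀ a₁ b₁ μ₁ j Λ cS CS K : ℝ} {u v f : R2 → ℝ}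

theorem h1norm_eq_zero (hv : v ∈ localSpace E k P) (h0 : EqOn v 0 (closure E.carrier)) :
    h1norm E.carrier v = 0 :=
  h1norm_eq_zero_of_eqOn E.isOpen hv.1.1.locallyIntegrableOn (h0.mono subset_closure)

theorem l2proj_eq_zero (k : ℕ) (h0 : EqOn v 0 (closure E.carrier)) :
    l2proj E.carrier k v = 0 := by
  rw [l2proj_congr (v := 0) k (ae_restrict_of_forall_mem E.isOpen.measurableSet
    fun x hx => h0 (subset_closure hx))]
  exact l2proj_of_mem E.isCell (const_mem_polySpace k 0)

/-- The projected part is bounded by the `H¹` norms, so it vanishes. A function that is zero on the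
closed element may be nonzero elsewhere as an argument of `S`; `S` ignores this because it depends
on the degrees of freedom only. -/
theorem localForm_eq_zero (h : LocalData Ω F Fh k l D E P S a₀ a₁ b₁ μ₁ j Λ cS CS K)
    (hu : u ∈ localSpace E k P) (hv : v ∈ localSpace E k P)
    (h0 : EqOn v 0 (closure E.carrier)) :
    localForm k l Fh D S E.carrier u v = 0 ∧ localForm k l Fh D S E.carrier v u = 0 := by
  have hS := h.stab.computable v hv (u - l2proj E.carrier k u) (h.mem_sub hu)
    (dofsVanish_of_eqOn k h0)
  have h1 := h.abs_discreteLocal_le hu hv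
  have h2 := h.abs_discreteLocal_le hv hu
  rw [h1norm_eq_zero hv h0, mul_zero, mul_zero] at h1
  rw [h1norm_eq_zero hv h0, zero_mul, mul_zero] at h2
  simp only [localForm, abs_nonpos_iff.1 h1, abs_nonpos_iff.1 h2, l2proj_eq_zero k h0, sub_zero,
    hS.1, hS.2, add_zero, and_self]

theorem load_eq_zero (h : LocalData Ω F Fh k l D E P S a₀ a₁ b₁ μ₁ j Λ cS CS K)
    (hf : MemLp f 2 (volume.restrict E.carrier)) (hv : v ∈ localSpace E k P)
    (h0 : EqOn v 0 (closure E.carrier)) :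
    ∫ x in E.carrier, f x * l2proj E.carrier k v x * (jacProj E.carrier l Fh x).det = 0 := by
  have h1 := (h.integrable_load hf hv).2
  rw [h1norm_eq_zero hv h0, mul_zero, mul_zero] at h1
  exact abs_nonpos_iff.1 h1

end LocalData

section global_forms

variable {Ω : Set R2} {F Fh : R2 → R2} {k l : ℕ} {D : Coeffs} {T : Mesh Ω}
  {P : Fin T.card → (R2 → ℝ) →ₗ[ℝ] (R2 → ℝ)} {S : Fin T.card → LinearMap.BilinForm ℝ (R2 → ℝ)}
  {a₀ a₁ b₁ μ₁ j Λ cS CS K : ℝ} {u v f : R2 → ℝ}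

theorem sum_mul_le_of_sum_sq_eq {ι : Type*} [Fintype ι] {p q : ι → ℝ} {a b : ℝ}
    (ha : 0 ≤ a) (hb : 0 ≤ b) (hp : ∑ i, p i ^ 2 = a ^ 2) (hq : ∑ i, q i ^ 2 = b ^ 2) :
    ∑ i, p i * q i ≤ a * b := by
  refine (Real.sum_mul_le_sqrt_mul_sqrt _ _ _).trans_eq ?_
  rw [hp, hq, Real.sqrt_sq ha, Real.sqrt_sq hb]

theorem abs_discreteForm_le (hΩ : IsPolygonalDomain Ω) (hK : 0 < K)
    (h : ∀ i, LocalData Ω F Fh k l D (T.elem i) (P i) (S i) a₀ a₁ b₁ μ₁ j Λ cS CS K)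
    (hsymm : ∀ i, ∀ u ∈ localSpace (T.elem i) k (P i), ∀ v ∈ localSpace (T.elem i) k (P i),
      S i u v = S i v u) (hu : u ∈ vemSpace T k P) (hv : v ∈ vemSpace T k P) :
    |discreteForm T k l Fh D S u v| ≤
      3 * formBound a₁ b₁ μ₁ j Λ * (1 + |CS| * (2 + 2 * K)) * (h1norm Ω u * h1norm Ω v) := by
  refine (Finset.abs_sum_le_sum_abs _ _).trans ((Finset.sum_le_sum fun i _ =>
    (h i).abs_localForm_le (hsymm i) (hu.2 i) (hv.2 i)).trans ?_)
  rw [← Finset.mul_sum]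
  have := formBound_nonneg a₁ b₁ μ₁ j Λ
  exact mul_le_mul_of_nonneg_left (sum_mul_le_of_sum_sq_eq (h1norm_nonneg _ _)
    (h1norm_nonneg _ _) (T.sum_h1norm_sq hΩ.isOpen hu.1) (T.sum_h1norm_sq hΩ.isOpen hv.1))
    (by positivity)

theorem discreteForm_self_le (hΩ : IsPolygonalDomain Ω)
    (h : ∀ i, LocalData Ω F Fh k l D (T.elem i) (P i) (S i) a₀ a₁ b₁ μ₁ j Λ cS CS K)
    (hv : v ∈ vemSpace T k P) :
    discreteForm T k l Fh D S v v ≤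
      3 * formBound a₁ b₁ μ₁ j Λ * (1 + |CS| * (2 + 2 * K)) * h1norm Ω v ^ 2 := by
  refine (Finset.sum_le_sum fun i _ => (h i).localForm_self_le (hv.2 i)).trans_eq ?_
  rw [← Finset.mul_sum, T.sum_h1norm_sq hΩ.isOpen hv.1]

/-- The elementwise lower bounds add up to the semi-norm on `Ω`, and Friedrichs' inequality bounds
the full norm squared by `8 * diam² + 1` times the semi-norm squared. -/
theorem le_discreteForm (hΩ : IsPolygonalDomain Ω) (ha₀ : 0 < a₀) (hj : 0 < j) (hcS : 0 < cS)
    (h : ∀ i, LocalData Ω F Fh k l D (T.elem i) (P i) (S i) a₀ a₁ b₁ μ₁ j Λ cS CS K)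
    (hv : v ∈ vemSpaceZero T k P) :
    min 1 cS * (a₀ * j / (4 * Λ ^ 2 + 1)) / (8 * Metric.diam Ω ^ 2 + 1) * h1norm Ω v ^ 2 ≤
      discreteForm T k l Fh D S v v := by
  have h1 : min 1 cS * (a₀ * j / (4 * Λ ^ 2 + 1)) * sobolevSemi Ω 1 v ^ 2 ≤
      discreteForm T k l Fh D S v v := by
    rw [← T.sum_sobolevSemi_sq hΩ.isOpen hv.1.1, Finset.mul_sum]
    exact Finset.sum_le_sum fun i _ => (h i).le_localForm (hv.1.2 i)
  refine le_trans ?_ h1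
  have h2 := hv.2.l2norm_sq_le hΩ.isOpen hΩ.isBounded
  have hm0 : 0 < min 1 cS := lt_min zero_lt_one hcS
  rw [div_mul_eq_mul_div, div_le_iff₀ (by positivity), h1norm_sq, mul_assoc _ (_ ^ 2)]
  refine mul_le_mul_of_nonneg_left ?_ (by positivity)
  linarith

theorem abs_discreteLoad_le (hΩ : IsPolygonalDomain Ω)
    (h : ∀ i, LocalData Ω F Fh k l D (T.elem i) (P i) (S i) a₀ a₁ b₁ μ₁ j Λ cS CS K)
    (hf : MemLp f 2 (volume.restrict Ω)) (hv : v ∈ vemSpace T k P) :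
    |discreteLoad T k l Fh f v| ≤ 2 * Λ ^ 2 * (l2norm Ω f * h1norm Ω v) := by
  refine (Finset.abs_sum_le_sum_abs _ _).trans ((Finset.sum_le_sum fun i _ =>
    ((h i).integrable_load (hf.mono_measure (Measure.restrict_mono (T.subset i) le_rfl))
      (hv.2 i)).2).trans ?_)
  rw [← Finset.mul_sum]
  exact mul_le_mul_of_nonneg_left (sum_mul_le_of_sum_sq_eq (Real.sqrt_nonneg _)
    (h1norm_nonneg _ _) (T.sum_l2norm_sq hf) (T.sum_h1norm_sq hΩ.isOpen hv.1)) (by positivity)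

/-- The discrete form as a bilinear form. -/
def globalForm (hΩ : IsPolygonalDomain Ω)
    (h : ∀ i, LocalData Ω F Fh k l D (T.elem i) (P i) (S i) a₀ a₁ b₁ μ₁ j Λ cS CS K) :
    LinearMap.BilinForm ℝ (vemSub hΩ T k fun i => (h i).proj) :=
  LinearMap.mk₂ ℝ (fun u v => ∑ i, localForm k l Fh D (S i) (T.elem i).carrier u.1 v.1)
    (fun u w v => by
      rw [← Finset.sum_add_distrib]
      exact Finset.sum_congr rfl fun i _ =>
        (h i).localForm_add_left (u.2.1.2 i) (w.2.1.2 i) (v.2.1.2 i))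
    (fun c u v => by
      rw [smul_eq_mul, Finset.mul_sum]
      exact Finset.sum_congr rfl fun i _ => LocalData.localForm_smul_left c (u.2.1.2 i))
    (fun v u w => by
      rw [← Finset.sum_add_distrib]
      exact Finset.sum_congr rfl fun i _ =>
        (h i).localForm_add_right (u.2.1.2 i) (w.2.1.2 i) (v.2.1.2 i))
    (fun c v u => by
      rw [smul_eq_mul, Finset.mul_sum]
      exact Finset.sum_congr rfl fun i _ => LocalData.localForm_smul_right c (u.2.1.2 i))

/-- The discrete load as a linear functional. -/
def globalLoad (hΩ : IsPolygonalDomain Ω)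
    (h : ∀ i, LocalData Ω F Fh k l D (T.elem i) (P i) (S i) a₀ a₁ b₁ μ₁ j Λ cS CS K)
    (hf : MemLp f 2 (volume.restrict Ω)) : (vemSub hΩ T k fun i => (h i).proj) →ₗ[ℝ] ℝ where
  toFun v := discreteLoad T k l Fh f v.1
  map_add' u v := by
    simp only [discreteLoad]
    rw [← Finset.sum_add_distrib]
    refine Finset.sum_congr rfl fun i _ => ?_
    have hfi := hf.mono_measure (Measure.restrict_mono (T.subset i) le_rfl)
    rw [← integral_add ((h i).integrable_load hfi (u.2.1.2 i)).1
      ((h i).integrable_load hfi (v.2.1.2 i)).1, Submodule.coe_add,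
      l2proj_add (T.elem i).isCell k (mem_localSpace_memLp (u.2.1.2 i))
        (mem_localSpace_memLp (v.2.1.2 i))]
    refine integral_congr_ae (.of_forall fun x => ?_)
    simp only [Pi.add_apply]
    ring
  map_smul' c v := by
    simp only [discreteLoad, RingHom.id_apply, smul_eq_mul]
    rw [Finset.mul_sum]
    refine Finset.sum_congr rfl fun i _ => ?_
    rw [← integral_const_mul, Submodule.coe_smul,
      l2proj_smul (T.elem i).isCell k (mem_localSpace_memLp (v.2.1.2 i))]
    refine integral_congr_ae (.of_forall fun x => ?_)
    simp only [Pi.smul_apply, smul_eq_mul]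
    ring

theorem Mesh.eqOn_closure {i : Fin T.card} (h0 : EqOn v 0 (closure Ω)) :
    EqOn v 0 (closure (T.elem i).carrier) :=
  h0.mono (closure_mono (T.subset i))

theorem globalForm_null (hΩ : IsPolygonalDomain Ω)
    (h : ∀ i, LocalData Ω F Fh k l D (T.elem i) (P i) (S i) a₀ a₁ b₁ μ₁ j Λ cS CS K) :
    ∀ v ∈ nullSub hΩ fun i => (h i).proj, ∀ u,
      globalForm hΩ h u v = 0 ∧ globalForm hΩ h v u = 0 := by
  intro v hv u
  have := fun i => (h i).localForm_eq_zero (u.2.1.2 i) (v.2.1.2 i) (Mesh.eqOn_closure hv)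
  simp only [globalForm, LinearMap.mk₂_apply]
  exact ⟨Finset.sum_eq_zero fun i _ => (this i).1, Finset.sum_eq_zero fun i _ => (this i).2⟩

theorem globalLoad_null (hΩ : IsPolygonalDomain Ω)
    (h : ∀ i, LocalData Ω F Fh k l D (T.elem i) (P i) (S i) a₀ a₁ b₁ μ₁ j Λ cS CS K)
    (hf : MemLp f 2 (volume.restrict Ω)) :
    ∀ v ∈ nullSub hΩ fun i => (h i).proj, globalLoad hΩ h hf v = 0 := by
  intro v hv
  change discreteLoad T k l Fh f v.1 = 0
  exact Finset.sum_eq_zero fun i _ => (h i).load_eq_zero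
    (hf.mono_measure (Measure.restrict_mono (T.subset i) le_rfl)) (v.2.1.2 i)
    (Mesh.eqOn_closure hv)

/-- By coercivity the form can fail to be positive only if the `H¹` norm is zero. Then the function
vanishes almost everywhere, and by continuity at every point of each element. -/
theorem globalForm_pos (hΩ : IsPolygonalDomain Ω) (ha₀ : 0 < a₀) (hj : 0 < j) (hcS : 0 < cS)
    (h : ∀ i, LocalData Ω F Fh k l D (T.elem i) (P i) (S i) a₀ a₁ b₁ μ₁ j Λ cS CS K) :
    ∀ v, v ∉ nullSub hΩ (fun i => (h i).proj) → 0 < globalForm hΩ h v v := by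
  intro v hv
  have hm0 : 0 < min 1 cS := lt_min zero_lt_one hcS
  refine lt_of_lt_of_le ?_ (le_discreteForm hΩ ha₀ hj hcS h v.2)
  have hne : h1norm Ω v.1 ≠ 0 := fun h0 => hv <| by
    have hae := v.2.1.1.ae_eq_zero hΩ.isOpen h0
    refine mem_nullSub_of_ae hΩ _ fun i => ?_
    exact Measure.eqOn_open_of_ae_eq (ae_restrict_of_ae_restrict_of_subset (T.subset i) hae)
      (T.elem i).isOpen ((v.2.1.2 i).1.2.1.mono subset_closure) continuousOn_const
  have := (h1norm_nonneg Ω v.1).lt_of_ne' hne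
  positivity

/-- The diagonal of the form has a uniform bound even if the stabilisation is not symmetric; only
the passage from the diagonal to pairs uses a constant that depends on the discrete form. -/
theorem exists_discreteForm_bound (hΩ : IsPolygonalDomain Ω) (ha₀ : 0 < a₀) (hj : 0 < j)
    (hcS : 0 < cS)
    (h : ∀ i, LocalData Ω F Fh k l D (T.elem i) (P i) (S i) a₀ a₁ b₁ μ₁ j Λ cS CS K) :
    ∃ M, ∀ u ∈ vemSpaceZero T k P, ∀ v ∈ vemSpaceZero T k P,
      |discreteForm T k l Fh D S u v| ≤ M * h1norm Ω u * h1norm Ω v := by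
  obtain ⟨C, hC, hbd⟩ := exists_bound_of_posDef (globalForm_null hΩ h)
    (globalForm_pos hΩ ha₀ hj hcS h)
  set C' := 3 * formBound a₁ b₁ μ₁ j Λ * (1 + |CS| * (2 + 2 * K))
  have hs : ∀ v ∈ vemSpaceZero T k P, √(discreteForm T k l Fh D S v v) ≤ √C' * h1norm Ω v :=
    fun v hv => by
      refine (Real.sqrt_le_sqrt (discreteForm_self_le hΩ h hv.1)).trans_eq ?_
      rw [Real.sqrt_mul' _ (sq_nonneg _), Real.sqrt_sq (h1norm_nonneg Ω v)]
  refine ⟨C * (√C' * √C'), fun u hu v hv => (hbd ⟨u, hu⟩ ⟨v, hv⟩).trans ?_⟩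
  have := h1norm_nonneg Ω u
  calc C * (√(discreteForm T k l Fh D S u u) * √(discreteForm T k l Fh D S v v))
      ≤ C * ((√C' * h1norm Ω u) * (√C' * h1norm Ω v)) := by
        gcongr
        exacts [hs u hu, hs v hv]
    _ = _ := by ring

theorem exists_unique_solution (hΩ : IsPolygonalDomain Ω) (ha₀ : 0 < a₀) (hj : 0 < j)
    (hcS : 0 < cS)
    (h : ∀ i, LocalData Ω F Fh k l D (T.elem i) (P i) (S i) a₀ a₁ b₁ μ₁ j Λ cS CS K)
    (hf : MemLp f 2 (volume.restrict Ω)) :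
    ∃ u ∈ vemSpaceZero T k P,
      (∀ v ∈ vemSpaceZero T k P,
        discreteForm T k l Fh D S u v = discreteLoad T k l Fh f v) ∧
      ∀ u' ∈ vemSpaceZero T k P,
        (∀ v ∈ vemSpaceZero T k P,
          discreteForm T k l Fh D S u' v = discreteLoad T k l Fh f v) →
        EqOn u' u (closure Ω) := by
  obtain ⟨u, hu⟩ := exists_solution_of_posDef (globalForm_null hΩ h)
    (globalForm_pos hΩ ha₀ hj hcS h) (globalLoad hΩ h hf) (globalLoad_null hΩ h hf)
  refine ⟨u.1, u.2, fun v hv => hu ⟨v, hv⟩, fun u' hu' hsol => ?_⟩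
  by_contra hne
  -- Uniqueness: the difference of two solutions is tested against itself. Values outside the closed
  -- domain are invisible, so agreement is obtained on the closure only.
  set w : vemSub hΩ T k fun i => (h i).proj := ⟨u', hu'⟩
  have hd : w - u ∉ nullSub hΩ fun i => (h i).proj := fun hmem =>
    hne fun x hx => sub_eq_zero.1 (mem_nullSub.1 hmem hx)
  have hpos := globalForm_pos hΩ ha₀ hj hcS h (w - u) hd
  have e : globalForm hΩ h w (w - u) = globalForm hΩ h u (w - u) :=
    (hsol _ (w - u).2).trans (hu _).symm
  rw [map_sub (globalForm hΩ h) w u, LinearMap.sub_apply, e, sub_self] at hpos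
  exact lt_irrefl _ hpos

end global_forms

end

section

/-! ### Verification of the local hypotheses -/

section verification

variable {Ω : Set R2} {D : Coeffs} {E : Element} {J : R2 → Matrix (Fin 2) (Fin 2) ℝ}
  {a₀ a₁ b₁ μ₀ μ₁ j Λ : ℝ}

theorem Coeffs.Admissible.tameOn (h : D.Admissible Ω a₀ a₁ b₁ μ₀ μ₁) (hμ₀ : 0 ≤ μ₀)
    {U : Set R2} (hU : U ⊆ Ω) (hm : ∀ d e, AEMeasurable (fun x => J x d e) (volume.restrict U))
    (hJ : ∀ᵐ x ∂volume.restrict U, j ≤ (J x).det ∧ ∀ d e, |J x d e| ≤ Λ) :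
    TameOn U D J a₀ a₁ b₁ μ₁ j Λ where
  measurable_a := h.measurable_a.aemeasurable.mono_measure (Measure.restrict_mono hU le_rfl)
  measurable_b d := (h.measurable_b d).aemeasurable.mono_measure (Measure.restrict_mono hU le_rfl)
  measurable_μ := h.measurable_μ.aemeasurable.mono_measure (Measure.restrict_mono hU le_rfl)
  measurable_J := hm
  tameAt := by
    filter_upwards [ae_restrict_of_ae_restrict_of_subset hU h.bound_a,
      ae_restrict_of_ae_restrict_of_subset hU h.bound_b,
      ae_restrict_of_ae_restrict_of_subset hU h.bound_μ, hJ] with x ha hb hμ hx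
    exact ⟨ha.1, ha.2, hb, hμ₀.trans hμ.1, hμ.2, hx.1, hx.2⟩

theorem aemeasurable_jac (hΩ : IsOpen Ω) {F : R2 → R2} (hF : ∀ c, MemSobolev Ω 1 2 (comp F c))
    {U : Set R2} (hU : U ⊆ Ω) (d e : Fin 2) :
    AEMeasurable (fun x => jac Ω F x d e) (volume.restrict U) :=
  ((hF d).memLp_weakGrad hΩ e).aemeasurable.mono_measure (Measure.restrict_mono hU le_rfl)

theorem aemeasurable_jacProj (E : Element) (l : ℕ) {Fh : R2 → R2}
    (hF : ∀ c, MemSobolev E.carrier 1 2 (comp Fh c)) (d e : Fin 2) :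
    AEMeasurable (fun x => jacProj E.carrier l Fh x d e) (volume.restrict E.carrier) :=
  (memLp_projGrad E.isCell l (hF d) e).aemeasurable

end verification

end

end IsoVEM

end

/-! ### The well-posedness theorem -/

open IsoVEM in
theorem mainTheorem3
    (Ω : Set R2) (hΩ : IsPolygonalDomain Ω)
    (k l m : ℕ) (hk : 1 ≤ k) (hl : 1 ≤ l) (hlm : l ≤ m)
    (α CF cS CS a₀ a₁ b₁ μ₀ μ₁ j₀ Λ : ℝ)
    (hα : 0 < α) (hcS : 0 < cS) (ha₀ : 0 < a₀) (hμ₀ : 0 ≤ μ₀) (hj₀ : 0 < j₀) :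
    ∃ M > 0, ∃ c > 0, ∀ F : R2 → R2,
      IsBiLipschitzOn Ω F →
      (∀ d, MemSobolev Ω (m + 1) ⊤ (comp F d)) →
      (∀ᵐ x ∂volume.restrict Ω, j₀ ≤ (jac Ω F x).det ∧ ∀ d e, |jac Ω F x d e| ≤ Λ) →
      ∃ h₀ > 0, ∀ D : Coeffs, D.Admissible Ω a₀ a₁ b₁ μ₀ μ₁ →
        ∀ T : Mesh Ω, T.ShapeRegular α → T.size ≤ h₀ →
        ∀ (P Q : Fin T.card → (R2 → ℝ) →ₗ[ℝ] (R2 → ℝ)),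
          (∀ i, IsAuxProj (T.elem i) k (P i)) → (∀ i, IsAuxProj (T.elem i) l (Q i)) →
        ∀ Fh : R2 → R2, (∀ d, comp Fh d ∈ vemSpace T l Q) → MapAccurate T l CF F Fh →
        ∀ S : Fin T.card → LinearMap.BilinForm ℝ (R2 → ℝ),
          (∀ i, IsStabilisation (T.elem i) k (P i)
            (exactLocal Ω F D (T.elem i).carrier) cS CS (S i)) →
          -- continuity of the bilinear form
          (∃ M', ∀ u ∈ vemSpaceZero T k P, ∀ v ∈ vemSpaceZero T k P,
            |discreteForm T k l Fh D S u v| ≤ M' * h1norm Ω u * h1norm Ω v) ∧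
          -- continuity with the uniform constant, for symmetric stabilisations
          ((∀ i, ∀ u ∈ localSpace (T.elem i) k (P i), ∀ v ∈ localSpace (T.elem i) k (P i),
              S i u v = S i v u) →
            ∀ u ∈ vemSpaceZero T k P, ∀ v ∈ vemSpaceZero T k P,
              |discreteForm T k l Fh D S u v| ≤ M * h1norm Ω u * h1norm Ω v) ∧
          -- coercivity
          (∀ v ∈ vemSpaceZero T k P, c * h1norm Ω v ^ 2 ≤ discreteForm T k l Fh D S v v) ∧
          -- continuity of the load and unique solvability
          ∀ f : R2 → ℝ, MemLp f 2 (volume.restrict Ω) →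
            (∀ v ∈ vemSpaceZero T k P,
              |discreteLoad T k l Fh f v| ≤ M * l2norm Ω f * h1norm Ω v) ∧
            ∃ u ∈ vemSpaceZero T k P,
              (∀ v ∈ vemSpaceZero T k P,
                discreteForm T k l Fh D S u v = discreteLoad T k l Fh f v) ∧
              ∀ u' ∈ vemSpaceZero T k P,
                (∀ v ∈ vemSpaceZero T k P,
                  discreteForm T k l Fh D S u' v = discreteLoad T k l Fh f v) →
                EqOn u' u (closure Ω) := by
  obtain ⟨K, hK, hstable⟩ := exists_l2proj_stable hα k
  -- The bounds `j₀ / 2` and `Λ + 1` hold for the exact and the discrete Jacobian alike, so one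
  -- constant serves the stabilisation, compared with the exact form, and the projected part. `M` is
  -- the maximum of the constants for the form and for the load, and of `1` for positivity.
  set M₁ := 3 * formBound a₁ b₁ μ₁ (j₀ / 2) (Λ + 1) * (1 + |CS| * (2 + 2 * K))
  set c := min 1 cS * (a₀ * (j₀ / 2) / (4 * (Λ + 1) ^ 2 + 1)) / (8 * Metric.diam Ω ^ 2 + 1)
  have hj : 0 < j₀ / 2 := half_pos hj₀
  have hm0 : 0 < min 1 cS := lt_min zero_lt_one hcS
  refine ⟨max 1 (max M₁ (2 * (Λ + 1) ^ 2)), lt_max_of_lt_left one_pos, c, by positivity,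
    fun F _ hF hJ => ?_⟩
  -- `1 ≤ l ≤ m` gives the two bounded derivatives of `F` needed here. The threshold is fixed before
  -- the coefficients, the mesh and the discrete data are introduced.
  obtain ⟨h₀, hh₀, hjac⟩ := exists_jacProj_bounds hα l CF hΩ.isOpen hΩ.isBounded
    (by omega : 2 ≤ m + 1) hF hj₀ hJ
  refine ⟨h₀, hh₀, fun D hD T hT hsize P Q hP hQ Fh hFh hacc S hS => ?_⟩
  have hF1 : ∀ d, MemSobolev Ω 1 2 (comp F d) := fun d =>
    (hF d).of_top hΩ.isBounded.measure_lt_top (by omega)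
  have hFh1 : ∀ i d, MemSobolev (T.elem i).carrier 1 2 (comp Fh d) := fun i d =>
    ((hFh d).2 i).1.1
  have h : ∀ i, LocalData Ω F Fh k l D (T.elem i) (P i) (S i) a₀ a₁ b₁ μ₁ (j₀ / 2) (Λ + 1)
      cS CS K := fun i =>
    { a₀_pos := ha₀
      j_pos := hj
      cS_pos := hcS
      K_pos := hK
      proj := hP i
      tame := hD.tameOn hμ₀ (T.subset i) (aemeasurable_jac hΩ.isOpen hF1 (T.subset i)) <| by
        filter_upwards [ae_restrict_of_ae_restrict_of_subset (T.subset i) hJ] with x hx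
        exact ⟨(half_le_self hj₀.le).trans hx.1, fun d e => (hx.2 d e).trans (by linarith)⟩
      discrete_tame := hD.tameOn hμ₀ (T.subset i) (aemeasurable_jacProj _ l (hFh1 i))
        (ae_restrict_of_forall_mem (T.elem i).isOpen.measurableSet
          (hjac (T.elem i) (hT.regular i) (T.subset i) ((T.diam_le_size i).trans hsize) Fh
            (hFh1 i) (hacc.accurateOn hl i)))
      stab := hS i
      stable := hstable (T.elem i) (hT.regular i) }
  refine ⟨exists_discreteForm_bound hΩ ha₀ hj hcS h, fun hsymm u hu v hv => ?_,
    fun v hv => le_discreteForm hΩ ha₀ hj hcS h hv, fun f hf =>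
    ⟨fun v hv => ?_, exists_unique_solution hΩ ha₀ hj hcS h hf⟩⟩
  · refine (abs_discreteForm_le hΩ hK h hsymm hu.1 hv.1).trans ?_
    rw [mul_assoc (max _ _)]
    exact mul_le_mul_of_nonneg_right ((le_max_left _ _).trans (le_max_right _ _))
      (mul_nonneg (h1norm_nonneg _ _) (h1norm_nonneg _ _))
  · refine (abs_discreteLoad_le hΩ h hf hv.1).trans ?_
    rw [mul_assoc (max _ _)]
    exact mul_le_mul_of_nonneg_right ((le_max_right _ _).trans (le_max_right _ _))
      (mul_nonneg (Real.sqrt_nonneg _) (h1norm_nonneg _ _))
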